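/- **Setting.** Let $\mathcal S,\mathcal A$ be finite, $|\mathcal S|\ge 2$, with transition kernel $\mathsf P(s'|s,a)$ and cost $c(s,a)$. Policies are maps $\pi:\mathcal S\to\Delta_{|\mathcal A|}$, and for every policy the induced state chain $P_\pi$ is assumed irreducible and aperiodic, with stationary distribution $\nu^\pi$. Fix $\Gamma\in(0,1)$ with $\min_s\nu^\pi(s)\ge 1-\Gamma$ for all $\pi$, and let $t_{\rm mix}=\max_\pi\min\{t\ge1:\max_{q\in\Delta}\|(P_\pi^{t})^\top q-\nu^\pi\|_1\le\frac12\}$. The regularizer $h^\pi(s)$ is a closed convex function of $\pi(\cdot|s)$ satisfying, for some $\omega>0$, $h^\pi(s)-h^{\pi'}(s)-\langle\nabla h^{\pi'}(s,\cdot),\pi(\cdot|s)-\pi'(\cdot|s)\rangle\ge\omega\,{\rm KL}(\pi(\cdot|s)\,\|\,\pi'(\cdot|s))$ for all $\pi$ and all $\pi'>0$, with a subgradient $\nabla h^{\pi'}$; assume $|c(s,a)+h^\pi(s)|\le\bar c$. Put $c^\pi(s)=\sum_a\pi(a|s)c(s,a)$, $\rho(\pi)=\langle\nu^\pi,c^\pi+h^\pi\rangle$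 and $\bar Q^\pi(s,a)=\mathbb E_\pi[\sum_{t\ge0}(c(s_t,a_t)+h^\pi(s_t)-\rho(\pi))\mid s_0=s,a_0=a]$. Let $\pi^*$ minimize $\rho$, and let $D(\pi,\pi^*)=\mathbb E_{s\sim\nu^{\pi^*}}{\rm KL}(\pi^*(\cdot|s)\,\|\,\pi(\cdot|s))$. **Features and exploration.** Let $\Psi\in\mathbb R^{|\mathcal S||\mathcal A|\times d}$, $d\ge1$, have rows $\psi(s,a)^\top$ with $\|\psi(s,a)\|_2\le1$. Let $P^\pi$ be the state-action transition matrix, $D^\pi={\rm diag}(\nu^\pi(s)\pi(a|s))$, $1-\beta_\pi=\inf\{x^\top D^\pi(I-P^\pi)x: x\in{\rm span}\,\Psi,\ \|x\|_{D^\pi}=1\}$ and $b_\pi=\min\{1-\beta_\pi,\frac12\}$. Assume $1/b_\pi\le C_\beta t_{\rm mix}$ for all $\pi$, for a constant $C_\beta$. For each $\pi$ fix an exploration level $\underline\pi\in(0,1)$, put $\mathcal A_s=\{a:\pi(a|s)>\underline\pi/2\}$ and $m=|\mathcal A|-\min_s|\mathcal A_s|$, and assume $\underline\pi\, m\,(8+b_\pi\min_s\nu^\pi(s))\le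 b_\pi\min_s\nu^\pi(s)$. The perturbed policy $\widetilde\pi$ is $\underline\pi$ off $\mathcal A_s$ and $\pi(a|s)\frac{1-(|\mathcal A|-|\mathcal A_s|)\underline\pi}{\sum_{a'\in\mathcal A_s}\pi(a'|s)}$ on $\mathcal A_s$. Let $\widetilde D^\pi={\rm diag}(\nu^\pi(s)\widetilde\pi(a|s))$, $\mu_\pi=\lambda_{\min}(\Psi^\top\widetilde D^\pi\Psi)$, $\alpha=1-m\underline\pi$ and $\widetilde b_\pi=\min\{\frac{27\alpha b_\pi}{32},\frac{1-\alpha b_\pi}{8}\}$. Assume $\mu_\pi\ge\bar\mu>0$ and $\lambda_{\min}(\widetilde D^\pi)\ge\delta>0$ for all $\pi$. Let $\theta^*_\pi$ be the solution of $\Psi^\top\widetilde D^\pi\Psi\theta=\Psi^\top\widetilde D^\pi P^\pi\Psi\theta+\Psi^\top\widetilde D^\pi(c+h^\pi-\rho(\pi)\mathbf 1)$ and $\epsilon_{\rm approx}=\max_\pi\min_{b\in\mathbb R}\|\Psi\theta^*_\pi+b\mathbf 1-\bar Q^\pi\|_\infty$. **Critic (EVRTD).** For a policy $\pi$, all data come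 from one trajectory. The critic has parameters $\eta,T,N,N',\tau,\tau'$ and starts at $\theta^0\in\mathbb R^d$. An epoch with center $\widetilde\theta$ averages $c(s,a)+h^\pi(s)$ over $N'$ pairs, each the last of $\tau'+1$ successive ones, to get $\widetilde\rho$. A sample with skipping length $k$ is obtained by running $\pi$ for $k$ steps to a state $s$ and drawing $a\sim\widetilde\pi(\cdot|s)$, $s'\sim\mathsf P(\cdot|s,a)$, $a'\sim\pi(\cdot|s')$; write $\widetilde g(\theta,\widetilde\rho)=(\langle\psi(s,a)-\psi(s',a'),\theta\rangle-c(s,a)-h^\pi(s)+\widetilde\rho)\psi(s,a)$. The epoch averages $\widetilde g(\widetilde\theta,\widetilde\rho)$ over $N$ samples with skipping length $\tau'$ to get $\widehat g$. Starting at $\theta_1=\widetilde\theta$, it then iterates $\theta_{t+1}=\theta_t-\eta(\widetilde g(\theta_t,\widetilde\rho)-\widetilde g(\widetilde\theta,\widetilde\rho)+\widehat g)$ with a new sample of skipping length $\tau$ for each $t=1,\dots,T$, and outputs $\frac1T\sum_{t\le T}\theta_t$, the next center. **Actor (SPMD).** From $\pi_0$ uniform, for $k=0,\dots,K$ let $\theta_k$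 be the critic's output for $\pi_k$, put $\mathcal Q_k=\Psi\theta_k$ and $\pi_{k+1}(\cdot|s)=\arg\min_{p\in\Delta_{|\mathcal A|}}\{\lambda[\langle\mathcal Q_k(s,\cdot),p\rangle+h^p(s)]+{\rm KL}(p\,\|\,\pi_k(\cdot|s))\}$. The output is $\widehat\pi=\pi_{K+1}$. Let $\sigma>0$ be such that $\mathbb E[\min_b\|\mathcal Q_k+b\mathbf 1-\bar Q^{\pi_k}\|_\infty^2\mid\text{past}]\le\sigma^2$ for $0\le k\le K$. The stepsize is $$\lambda=\min\Big\{\frac{1-\Gamma}{\omega\Gamma},\frac{q\log K}{\omega K}\Big\},\qquad q=2\Big(1+\log\max\Big\{1,\frac{2\Gamma(1-\Gamma)\omega^2D(\pi_0,\pi^*)+2\Gamma(1-\Gamma)\omega(\rho(\pi_0)-\rho(\pi^*))}{\sigma^2}\Big\}\Big).$$ **Statement.** There are $C>0$ and $p\in\mathbb N$, depending only on $C_\beta$, such that for every instance as above and every $\epsilon>0$, with $$L=\log\Big(3+\tfrac1\epsilon+\omega+\tfrac1\omega+\bar c+\tfrac1{1-\Gamma}+t_{\rm mix}+\tfrac1{\bar\mu}+\tfrac1\delta+\|\theta^0\|_2^2\Big),$$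 and $L_\sigma$ defined in the same way with $\sigma+\frac1\sigma$ added inside the logarithm, the following holds. There are critic parameters, the same for all policies, satisfying for all $\pi$ $$0<\eta\le\frac{\widetilde b_\pi}{845},\quad T\ge\frac{64}{\mu_\pi\widetilde b_\pi\eta},\quad N\ge\frac{1160}{\mu_\pi\widetilde b_\pi^2},\quad N'\ge\frac{1}{\mu_\pi\widetilde b_\pi^2},\quad \tau,\tau'\ge t_{\rm mix}\log\tfrac1\epsilon,$$ and a number $n$ of epochs with $\log\frac1\epsilon\le n\le CL^p$, such that: 1. For every policy and every past, the critic's error satisfies $$\mathbb E\min_b\|\mathcal Q+b\mathbf 1-\bar Q^{\pi}\|_\infty^2\le2\epsilon_{\rm approx}^2+C\max_{\pi'}\frac{\|\theta^*_{\pi'}\|_2^2+2^{-n}\|\theta^0\|_2^2}{\lambda_{\min}(\widetilde D^{\pi'})};$$ in particular, if $\theta^0=0$, one can take $\sigma^2\le2\epsilon_{\rm approx}^2+O\big(\max_\pi\|\theta_\pi^*\|_2^2/\lambda_{\min}(\widetilde D^\pi)\big)$. 2. For every $\sigma>0$ there is $K_0\ge2$ such that $K_0+1$ SPMD iterations number at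 most $$C\,\frac{1+\sigma^2/(\omega^2\epsilon)}{1-\Gamma}\,L_\sigma^p$$ and use in total at most $$C\,\frac{(1+\sigma^2/(\omega^2\epsilon))\,t_{\rm mix}^3}{(1-\Gamma)\bar\mu}\,L_\sigma^p$$ state-action transition samples; if $\epsilon\le\sigma^2/\omega^2$, these are $\widetilde O\big(\frac{\sigma^2}{\omega^2(1-\Gamma)\epsilon}\big)$ iterations and $\widetilde O\big(\frac{\sigma^2t_{\rm mix}^3}{\omega^2(1-\Gamma)\bar\mu\epsilon}\big)$ samples. For every $K\ge K_0$ such that $\sigma$ is a bound as above for the run with $K$ and its stepsize $\lambda$, the output satisfies $$\mathbb E[D(\widehat\pi,\pi^*)]\le C\,\frac{\epsilon_{\rm approx}}{\omega\Gamma}+\epsilon .$$ -/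

import Mathlib

open scoped Matrix

noncomputable section

/-! ### Finite probability -/

/-- The probability mass function with the weights of a point of the simplex. -/
def pmfOf {ι : Type} [Fintype ι] (p : stdSimplex ℝ ι) : PMF ι :=
  PMF.ofFintype (fun i => ENNReal.ofReal (p.1 i)) (by
    rw [← ENNReal.ofReal_sum_of_nonneg (fun i _ => p.2.1 i), p.2.2, ENNReal.ofReal_one])

/-- Expectation under a probability mass function. All laws below have finite support, so that
the sum is finite. -/
def pmfE {α : Type} (p : PMF α) (f : α → ℝ) : ℝ := ∑' x, (p x).toReal * f x

/-- Kullback-Leibler divergence `∑ a, p a log (p a / p' a)` of `p` from `p'`; it is only used for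
`p'` with full support. -/
def kl {ι : Type} [Fintype ι] (p p' : ι → ℝ) : ℝ := ∑ i, p i * Real.log (p i / p' i)

/-- `min_b ‖x + b 1‖_∞` (functions on a finite type carry the sup norm). -/
def supNormModConst {ι : Type} [Fintype ι] (x : ι → ℝ) : ℝ := ⨅ b : ℝ, ‖fun i => x i + b‖

/-- Smallest eigenvalue; only used for real symmetric matrices. -/
def lambdaMin {ι : Type} [Fintype ι] [DecidableEq ι] (B : Matrix ι ι ℝ) : ℝ :=
  sInf (spectrum ℝ B)

/-- A closed convex function on the simplex of modulus `ω` relative to the Kullback-Leibler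
divergence: at each `p'` with full support there is a subgradient `g` with
`f p - (f p' + ⟨g, p - p'⟩) ≥ ω KL(p, p')` for all `p`. -/
def IsKLStronglyConvex {ι : Type} [Fintype ι] (ω : ℝ) (f : (ι → ℝ) → ℝ) : Prop :=
  ConvexOn ℝ (stdSimplex ℝ ι) f ∧ LowerSemicontinuousOn f (stdSimplex ℝ ι) ∧
  ∀ p' ∈ stdSimplex ℝ ι, (∀ i, 0 < p' i) →
    ∃ g : ι → ℝ, ∀ p ∈ stdSimplex ℝ ι, ω * kl p p' ≤ f p - (f p' + g ⬝ᵥ (p - p'))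

/-- The quantity whose logarithm appears in the bounds that hold up to logarithmic factors; `tm` is
the mixing time, `dmin` a lower bound of the weights, `n0` the squared norm of the initial point. -/
def problemSize (ε ω Γ cbar tm mubar dmin n0 : ℝ) : ℝ :=
  3 + 1 / ε + ω + 1 / ω + cbar + 1 / (1 - Γ) + tm + 1 / mubar + 1 / dmin + n0

/-! ### Average-reward Markov decision processes -/

/-- A regularized average-reward MDP with finite state space `S` and action space `A`:
transition kernel `P s a`, cost `c s a`, and the regularizer `h s p`, the value `h^π(s)` for
`p = π(·|s)`. -/
structure AMDP (S A : Type) [Fintype S] [Fintype A] where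
  P : S → A → stdSimplex ℝ S
  c : S → A → ℝ
  h : S → (A → ℝ) → ℝ

/-- Randomized stationary policies. -/
abbrev Policy (S A : Type) [Fintype A] := S → stdSimplex ℝ A

/-- Current state-action pair of the trajectory, and the number of transitions sampled so far. -/
abbrev Traj (S A : Type) := (S × A) × ℕ

/-- Parameters of the critic: stepsize, number of epochs, inner iterations per epoch, batch sizes
`N`, `N'` and skipping lengths `τ`, `τ'`. -/
structure CriticParams where
  eta : ℝ
  epochs : ℕ
  T : ℕ
  N : ℕ
  N' : ℕ
  tau : ℕ
  tau' : ℕ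

/-- The actions of probability larger than `u / 2`. -/
def bigActions {A : Type} [Fintype A] (u : ℝ) (p : stdSimplex ℝ A) : Finset A :=
  open Classical in Finset.univ.filter fun a => u / 2 < p.1 a

/-- Weights of the perturbed distribution: `u` off the set of `bigActions`, the others rescaled. -/
def perturbWeights {A : Type} [Fintype A] (u : ℝ) (p : stdSimplex ℝ A) : A → ℝ :=
  open Classical in fun a =>
    if a ∈ bigActions u p then
      p.1 a * ((1 - ((Fintype.card A : ℝ) - (bigActions u p).card) * u) /
        ∑ a' ∈ bigActions u p, p.1 a')
    else u

/-- The perturbed policy. Its weights lie in the simplex whenever `u` is as small as is required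
below; otherwise the policy is (by convention) left unchanged. -/
def perturb {S A : Type} [Fintype A] (u : ℝ) (π : Policy S A) : Policy S A :=
  open Classical in fun s =>
    if hw : perturbWeights u (π s) ∈ stdSimplex ℝ A then ⟨perturbWeights u (π s), hw⟩ else π s

/-- `|A| - min_s |A_s|`, where `A_s` is the set of `bigActions` of `π(·|s)`. -/
def numMissing {S A : Type} [Fintype A] (u : ℝ) (π : Policy S A) : ℝ :=
  (Fintype.card A : ℝ) - ⨅ s, ((bigActions u (π s)).card : ℝ)

/-- The policy that chooses actions uniformly. -/
def uniformPolicy (S A : Type) [Fintype A] [Nonempty A] : Policy S A := fun _ =>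
  ⟨fun _ => (Fintype.card A : ℝ)⁻¹, fun _ => by positivity, by
    simp [Finset.sum_const, Finset.card_univ]⟩

namespace AMDP

variable {S A : Type} [Fintype S] [Fintype A] (M : AMDP S A)

/-! #### Policies, stationary distributions, value functions -/

/-- The state transition matrix `P_π`. -/
def stateMat (π : Policy S A) : Matrix S S ℝ :=
  fun s s' => ∑ a, (π s).1 a * (M.P s a).1 s'

/-- The state-action transition matrix `P^π`. -/
def pairMat (π : Policy S A) : Matrix (S × A) (S × A) ℝ :=
  fun z z' => (M.P z.1 z.2).1 z'.1 * (π z'.1).1 z'.2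

/-- The chain induced by any policy is irreducible and aperiodic. -/
def Ergodic [DecidableEq S] : Prop :=
  ∀ π : Policy S A,
    (∀ s s', ∃ t : ℕ, 0 < (M.stateMat π ^ t) s s') ∧
    ∀ (s : S) (k : ℕ), (∀ t : ℕ, 1 ≤ t → 0 < (M.stateMat π ^ t) s s → k ∣ t) → k = 1

/-- The stationary distribution `ν^π` of the states (unique under ergodicity). -/
def stat (π : Policy S A) : S → ℝ :=
  Classical.epsilon fun ν => ν ∈ stdSimplex ℝ S ∧ ν ᵥ* M.stateMat π = ν

/-- Cost of a state-action pair including regularization, `c(s,a) + h^π(s)`. -/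
def cost (π : Policy S A) (z : S × A) : ℝ := M.c z.1 z.2 + M.h z.1 (π z.1).1

/-- The long-run average cost `ρ^π = ⟨ν^π, c^π + h^π⟩`. -/
def rho (π : Policy S A) : ℝ :=
  ∑ s, M.stat π s * (∑ a, (π s).1 a * M.c s a + M.h s (π s).1)

/-- The basic differential Q-function
`E_π [∑_t (c(s_t,a_t) + h^π(s_t) - ρ^π) | s_0 = s, a_0 = a]`. -/
def basicQ [DecidableEq S] [DecidableEq A] (π : Policy S A) : S × A → ℝ :=
  fun z => ∑' t : ℕ, ((M.pairMat π ^ t) *ᵥ fun y => M.cost π y - M.rho π) z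

/-- The policy is optimal: it minimizes the average cost. -/
def IsOptimal (π : Policy S A) : Prop := ∀ π' : Policy S A, M.rho π ≤ M.rho π'

/-- Mixing time of a policy: the least `t ≥ 1` at which the chain is within `1/2` of the stationary
distribution in the `ℓ₁` norm, whatever the initial distribution. -/
def mixTime [DecidableEq S] (π : Policy S A) : ℕ :=
  sInf {t | 1 ≤ t ∧ ∀ q ∈ stdSimplex ℝ S,
    ∑ s, |(q ᵥ* (M.stateMat π ^ t)) s - M.stat π s| ≤ 1 / 2}

/-- The mixing time `t_mix`, the maximum over all policies. -/
def tmix [DecidableEq S] : ℕ := ⨆ π : Policy S A, M.mixTime π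

/-- The distance `D(π, π') = E_{s ∼ ν} KL(π'(·|s), π(·|s))` with `ν = ν^{π'}`; it is used with
`π'` an optimal policy. -/
def dist (π π' : Policy S A) : ℝ := ∑ s, M.stat π' s * kl (π' s).1 (π s).1

/-! #### Linear function approximation -/

variable {d : ℕ} (Ψ : Matrix (S × A) (Fin d) ℝ)

/-- The diagonal matrix with entries `ν^π(s) π'(a|s)`: it is `D^π` for `π' = π`, and the perturbed
matrix for `π'` the perturbed policy. -/
def weightMat [DecidableEq S] [DecidableEq A] (π π' : Policy S A) : Matrix (S × A) (S × A) ℝ :=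
  Matrix.diagonal fun z => M.stat π z.1 * (π' z.1).1 z.2

/-- `min {1 - β, 1/2}` where `1 - β = inf {xᵀ D (I - P) x : x ∈ span Ψ, ‖x‖_D = 1}` for
`D = D^π`, `P = P^π` (the infimum over the empty set is infinite). -/
def betaGap [DecidableEq S] [DecidableEq A] (π : Policy S A) : ℝ :=
  sSup {b | b ≤ 1 / 2 ∧ ∀ θ : Fin d → ℝ,
    b * ((Ψ *ᵥ θ) ⬝ᵥ (M.weightMat π π *ᵥ (Ψ *ᵥ θ))) ≤
      (Ψ *ᵥ θ) ⬝ᵥ ((M.weightMat π π * (1 - M.pairMat π)) *ᵥ (Ψ *ᵥ θ))}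

/-- The requirement on the exploration level `u` of the policy `π`: `0 < u < 1` and
`u ≤ b ν_min / ((|A| - min_s |A_s|) (8 + b ν_min))`, void if `|A| = min_s |A_s|`. -/
def GoodLevel [DecidableEq S] [DecidableEq A] (π : Policy S A) (u : ℝ) : Prop :=
  0 < u ∧ u < 1 ∧
  u * (numMissing u π * (8 + M.betaGap Ψ π * ⨅ s, M.stat π s)) ≤
    M.betaGap Ψ π * ⨅ s, M.stat π s

/-- `min {27 α b / 32, (1 - α b) / 8}` with `α = 1 - (|A| - min_s |A_s|) u`. -/
def betaGapPert [DecidableEq S] [DecidableEq A] (π : Policy S A) (u : ℝ) : ℝ :=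
  min (27 * (1 - numMissing u π * u) * M.betaGap Ψ π / 32)
    ((1 - (1 - numMissing u π * u) * M.betaGap Ψ π) / 8)

/-- `λ_min` of the perturbed weight matrix. -/
def lamD [DecidableEq S] [DecidableEq A] (π : Policy S A) (u : ℝ) : ℝ :=
  lambdaMin (M.weightMat π (perturb u π))

/-- `μ`, the smallest eigenvalue of the Gram matrix of the features in the perturbed weights. -/
def mu [DecidableEq S] [DecidableEq A] (π : Policy S A) (u : ℝ) : ℝ :=
  lambdaMin (Ψᵀ * M.weightMat π (perturb u π) * Ψ)

/-- The solution `θ*_π` of the projected Bellman equation in the perturbed weights (unique when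
`μ` and the monotonicity constant are positive). -/
def thetaStar [DecidableEq S] [DecidableEq A] (π : Policy S A) (u : ℝ) : Fin d → ℝ :=
  Classical.epsilon fun θ =>
    (Ψᵀ * M.weightMat π (perturb u π) * Ψ) *ᵥ θ =
      (Ψᵀ * M.weightMat π (perturb u π) * M.pairMat π * Ψ) *ᵥ θ +
        (Ψᵀ * M.weightMat π (perturb u π)) *ᵥ (fun z => M.cost π z - M.rho π)

/-- `ε_approx = max_π min_b ‖Ψ θ*_π + b 1 - Q^π‖_∞`; `u π` is the exploration level used for `π`. -/
def epsApprox [DecidableEq S] [DecidableEq A] (u : Policy S A → ℝ) : ℝ :=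
  ⨆ π : Policy S A, supNormModConst (Ψ *ᵥ M.thetaStar Ψ π (u π) - M.basicQ π)

/-! #### The critic: exploratory variance-reduced temporal differences -/

/-- One transition of the state-action chain: `s' ∼ P(·|s,a)`, then `a' ∼ π(·|s')`. -/
def transition (π : Policy S A) (z : S × A) : PMF (S × A) :=
  (pmfOf (M.P z.1 z.2)).bind fun s' => (pmfOf (π s')).map fun a' => (s', a')

/-- Run the trajectory induced by `π` for `k` steps. -/
def run (π : Policy S A) : ℕ → Traj S A → PMF (Traj S A)
  | 0, x => PMF.pure x
  | k + 1, x => (M.transition π x.1).bind fun z => run π k (z, x.2 + 1)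

/-- Run for `k` steps to a state `s`, then draw `a ∼ π'(·|s)`, `s' ∼ P(·|s,a)`, `a' ∼ π(·|s')`. The
sample is `((s,a),(s',a'))`, and the trajectory goes on from `(s',a')`. -/
def sampleTuple (π π' : Policy S A) (k : ℕ) (x : Traj S A) :
    PMF (((S × A) × (S × A)) × Traj S A) :=
  (M.run π k x).bind fun y =>
    (pmfOf (π' y.1.1)).bind fun a =>
      (M.transition π (y.1.1, a)).map fun z => (((y.1.1, a), z), (z, y.2 + 1))

/-- The stochastic operator `(⟨ψ(s,a) - ψ(s',a'), θ⟩ - c(s,a) + ρ) ψ(s,a)`. -/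
def gTilde (π : Policy S A) (θ : Fin d → ℝ) (r : ℝ) (ξ : (S × A) × (S × A)) : Fin d → ℝ :=
  ((Ψ ξ.1 - Ψ ξ.2) ⬝ᵥ θ - M.cost π ξ.1 + r) • Ψ ξ.1

/-- Add to `acc` the costs of `n` state-action samples, each the last one of `k + 1` successive
ones. -/
def sumCosts (π : Policy S A) (k : ℕ) : ℕ → ℝ → Traj S A → PMF (ℝ × Traj S A)
  | 0, acc, x => PMF.pure (acc, x)
  | n + 1, acc, x => (M.run π (k + 1) x).bind fun y => sumCosts π k n (acc + M.cost π y.1) y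

/-- Add to `acc` the stochastic operator at `(θ, r)` for `n` samples with skipping length `k`. -/
def sumOps (π π' : Policy S A) (k : ℕ) (θ : Fin d → ℝ) (r : ℝ) :
    ℕ → (Fin d → ℝ) → Traj S A → PMF ((Fin d → ℝ) × Traj S A)
  | 0, acc, x => PMF.pure (acc, x)
  | n + 1, acc, x => (M.sampleTuple π π' k x).bind fun y =>
      sumOps π π' k θ r n (acc + M.gTilde Ψ π θ r y.1) y.2

/-- The inner loop: `n` further variance-reduced steps from the iterate `θ`; the iterates are summed
in `acc`. Here `θc`, `r`, `gh` are the center, the estimate of the average cost, and the averaged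
operator at the center. -/
def innerLoop (π π' : Policy S A) (k : ℕ) (η : ℝ) (θc : Fin d → ℝ) (r : ℝ) (gh : Fin d → ℝ) :
    ℕ → (Fin d → ℝ) → (Fin d → ℝ) → Traj S A → PMF ((Fin d → ℝ) × Traj S A)
  | 0, _, acc, x => PMF.pure (acc, x)
  | n + 1, θ, acc, x => (M.sampleTuple π π' k x).bind fun y =>
      innerLoop π π' k η θc r gh n
        (θ - η • (M.gTilde Ψ π θ r y.1 - M.gTilde Ψ π θc r y.1 + gh)) (acc + θ) y.2

/-- One epoch from the center `θc`; the output is the average of the `T` inner iterates. -/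
def epoch (π π' : Policy S A) (prm : CriticParams) (θc : Fin d → ℝ) (x : Traj S A) :
    PMF ((Fin d → ℝ) × Traj S A) :=
  (M.sumCosts π prm.tau' prm.N' 0 x).bind fun y =>
    (M.sumOps Ψ π π' prm.tau' θc (y.1 / prm.N') prm.N 0 y.2).bind fun w =>
      (M.innerLoop Ψ π π' prm.tau prm.eta θc (y.1 / prm.N') ((prm.N : ℝ)⁻¹ • w.1)
        prm.T θc 0 w.2).map fun v => ((prm.T : ℝ)⁻¹ • v.1, v.2)

/-- `n` epochs. -/
def epochs (π π' : Policy S A) (prm : CriticParams) :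
    ℕ → (Fin d → ℝ) → Traj S A → PMF ((Fin d → ℝ) × Traj S A)
  | 0, θ, x => PMF.pure (θ, x)
  | n + 1, θ, x => (M.epoch Ψ π π' prm θ x).bind fun y => epochs π π' prm n y.1 y.2

/-- The EVRTD critic for the policy `π` with exploration level `u`, started at `θ0`. -/
def critic (u : ℝ) (prm : CriticParams) (θ0 : Fin d → ℝ) (π : Policy S A) (x : Traj S A) :
    PMF ((Fin d → ℝ) × Traj S A) :=
  M.epochs Ψ π (perturb u π) prm prm.epochs θ0 x

/-- The error `E min_b ‖Ψ θ + b 1 - Q^π‖_∞²` of the critic's output `θ`. -/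
def criticError [DecidableEq S] [DecidableEq A] (u : ℝ) (prm : CriticParams) (θ0 : Fin d → ℝ)
    (π : Policy S A) (x : Traj S A) : ℝ :=
  pmfE (M.critic Ψ u prm θ0 π x) fun y => supNormModConst (Ψ *ᵥ y.1 - M.basicQ π) ^ 2

/-! #### The actor: stochastic policy mirror descent -/

/-- The mirror descent update: in each state a minimizer over the simplex of
`l (⟨Q(s,·), p⟩ + h^p(s)) + KL(p, π(·|s))`. -/
def mirrorStep (l : ℝ) (Q : S × A → ℝ) (π : Policy S A) : Policy S A := fun s =>
  @Classical.epsilon (stdSimplex ℝ A) ⟨π s⟩ fun p => ∀ q : stdSimplex ℝ A,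
    l * (∑ a, Q (s, a) * p.1 a + M.h s p.1) + kl p.1 (π s).1 ≤
      l * (∑ a, Q (s, a) * q.1 a + M.h s q.1) + kl q.1 (π s).1

/-- Joint law of the policy `π_k` and the trajectory after `k` iterations of SPMD with the EVRTD
critic, started at the uniform policy and the pair `z0`. -/
def spmd [Nonempty A] (u : Policy S A → ℝ) (prm : CriticParams) (θ0 : Fin d → ℝ) (l : ℝ)
    (z0 : S × A) : ℕ → PMF (Policy S A × Traj S A)
  | 0 => PMF.pure (uniformPolicy S A, (z0, 0))
  | k + 1 => (spmd u prm θ0 l z0 k).bind fun y =>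
      (M.critic Ψ (u y.1) prm θ0 y.1 y.2).map fun w => (M.mirrorStep l (Ψ *ᵥ w.1) y.1, w.2)

/-- The stepsize `min {(1-Γ)/(ωΓ), q log K / (ωK)}`, where `q = 2 (1 + log max {1, X/σ²})` and
`X = 2Γ(1-Γ)ω² D(π₀,π*) + 2Γ(1-Γ)ω (ρ(π₀) - ρ(π*))`. -/
def stepsize [Nonempty A] (Γ ω σ : ℝ) (πs : Policy S A) (K : ℕ) : ℝ :=
  min ((1 - Γ) / (ω * Γ))
    (2 * (1 + Real.log (max 1
      ((2 * Γ * (1 - Γ) * ω ^ 2 * M.dist (uniformPolicy S A) πs +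
        2 * Γ * (1 - Γ) * ω * (M.rho (uniformPolicy S A) - M.rho πs)) / σ ^ 2))) *
      Real.log K / (ω * K))

end AMDP

end

/-! The critic is first analysed as if its samples were independent and stationary. The actor is a
mirror descent that feels the bias of the critic at first order in the stepsize, but its variance
only at second order.

From the trajectory to independent samples. Every stationary weight is at least 1 - Γ, so the ℓ₁
distance 2·2^(-j) reached after j mixing times is a relative error δ = 2·2^(-j)/(1-Γ)
(`ratio_bounds`). Relative errors multiply under composition (`Dom.bind`), so a critic that uses m
samples has a law between (1-δ)^m and (1+δ)^m times that of the same program fed with independent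
samples (`critic_dom`); a logarithmic j makes this negligible. Expectations are positive linear
functionals `Ex`, so that no measurability question arises.

The critic with independent samples. A random vector is measured by the L^(2q) norms of all its
linear functionals, with q of the order of the logarithm of the problem size. The sup norm over
state-action pairs is then a maximum of at most 9^q functionals and costs a factor 3, and the
dimension of the features never enters. Tested against (I - ηAᵀ)^j v, the inner iterates form a
martingale, and the quadratic forms of these directions sum to at most |v|²/(ηβ) by telescoping;
tested against v A⁻¹, the batch noise carries the factor 1/(β²μ). So an epoch takes an error W to (W
+ G)/100 (`epoch_bd`), whereas the mean error shrinks by 1/100 with no noise term at all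
(`epoch_bias`). The noise level G is controlled by ε_approx and ‖θ*‖ and not by the cost bound times
the mixing time: the Bellman equation reads c - ρ = Q - PQ, and Q agrees with Ψθ* up to a constant
and ε_approx (`abs_cost_sub_le_approx`). Exploration preserves half of the monotonicity constant
(`perturbed_monotone`).

The actor. The three-point inequality of the proximal step is averaged over the stationary law of
the optimal policy and combined with the performance difference formula. What remains is the
decrease of the proximal objective in each state; it is nonnegative, so the optimal stationary law
may be replaced by Γ/(1-Γ) times that of the new policy, where the formula applies again. The
potential (1+λω) D + Γ/(1-Γ) λ (ρ - ρ*) therefore contracts by the factor 1+λω, up to Γ/(1-Γ) λ²σ² +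
2λ(ε_approx + bias) (`mirror_step`, `potential_step`). After summing the geometric series, the
stepsize makes the initial and the variance contributions at most ε/4 each (`stepsize_bounds`), the
bias contributes ε/2, and 2 ε_approx/ω is left.

Counting. With β of order 1/t_mix, an epoch needs about t_mix²/μ̄ samples at distance about t_mix
from each other, up to logarithms, and the number of epochs is logarithmic (`exists_criticParams`).
-/

noncomputable section

/-! ### Expectation functionals -/

/-- An expectation functional: a linear, monotone functional on real functions that preserves
constants. -/
structure Ex (α : Type) where
  toFun : (α → ℝ) → ℝ
  add' : ∀ f g : α → ℝ, toFun (fun x => f x + g x) = toFun f + toFun g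
  smul' : ∀ (c : ℝ) (f : α → ℝ), toFun (fun x => c * f x) = c * toFun f
  mono' : ∀ f g : α → ℝ, (∀ x, f x ≤ g x) → toFun f ≤ toFun g
  one' : toFun (fun _ => 1) = 1

namespace Ex

instance {α : Type} : CoeFun (Ex α) (fun _ => (α → ℝ) → ℝ) := ⟨Ex.toFun⟩

variable {α β γ : Type}

theorem add (E : Ex α) (f g : α → ℝ) : E (fun x => f x + g x) = E f + E g := E.add' f g

theorem smul (E : Ex α) (c : ℝ) (f : α → ℝ) : E (fun x => c * f x) = c * E f := E.smul' c f

theorem mono (E : Ex α) {f g : α → ℝ} (h : ∀ x, f x ≤ g x) : E f ≤ E g := E.mono' f g h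

theorem const (E : Ex α) (c : ℝ) : E (fun _ => c) = c := by
  have := E.smul c (fun _ => 1)
  simpa [E.one'] using this

theorem sub (E : Ex α) (f g : α → ℝ) : E (fun x => f x - g x) = E f - E g := by
  have h := E.add f (fun x => -1 * g x)
  rw [E.smul] at h
  simp only [neg_mul, one_mul, ← sub_eq_add_neg] at h
  exact h

theorem nonneg (E : Ex α) {f : α → ℝ} (h : ∀ x, 0 ≤ f x) : 0 ≤ E f := by
  have := E.mono (f := fun _ => 0) (g := f) h
  rwa [E.const] at this

theorem sum (E : Ex α) {ι : Type} (s : Finset ι) (f : ι → α → ℝ) :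
    E (fun x => ∑ i ∈ s, f i x) = ∑ i ∈ s, E (f i) := by
  classical
  induction s using Finset.induction_on with
  | empty => simpa using E.const 0
  | insert a s ha ih =>
    simp only [Finset.sum_insert ha]
    rw [E.add, ih]

theorem abs_apply_le (E : Ex α) (f : α → ℝ) : |E f| ≤ E (fun x => |f x|) := by
  rw [abs_le]
  constructor
  · have := E.mono (f := fun x => -1 * |f x|) (g := f)
      (fun x => by have := neg_abs_le (f x); linarith)
    rw [E.smul] at this
    linarith
  · exact E.mono fun x => le_abs_self _

/-- The expectation of a constant. -/
def pure (x : α) : Ex α where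
  toFun f := f x
  add' _ _ := rfl
  smul' _ _ := rfl
  mono' _ _ h := h x
  one' := rfl

/-- Composition of expectations. -/
def bind (E : Ex α) (K : α → Ex β) : Ex β where
  toFun f := E fun x => K x f
  add' f g := by simp only [Ex.add]
  smul' c f := by simp only [Ex.smul]
  mono' f g h := E.mono fun x => (K x).mono h
  one' := by simp only [Ex.const]

/-- Image of an expectation. -/
def map (φ : α → β) (E : Ex α) : Ex β where
  toFun f := E fun x => f (φ x)
  add' _ _ := E.add _ _
  smul' _ _ := E.smul _ _
  mono' _ _ h := E.mono fun _ => h _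
  one' := E.const 1

@[simp] theorem pure_apply (x : α) (f : α → ℝ) : pure x f = f x := rfl

@[simp] theorem bind_apply (E : Ex α) (K : α → Ex β) (f : β → ℝ) :
    E.bind K f = E fun x => K x f := rfl

@[simp] theorem map_apply (φ : α → β) (E : Ex α) (f : β → ℝ) :
    E.map φ f = E fun x => f (φ x) := rfl

/-- Expectation with respect to a point of the simplex. -/
def ofSimplex {ι : Type} [Fintype ι] (w : stdSimplex ℝ ι) : Ex ι where
  toFun f := ∑ i, w.1 i * f i
  add' f g := by simp only [mul_add, Finset.sum_add_distrib]
  smul' c f := by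
    rw [Finset.mul_sum]
    exact Finset.sum_congr rfl fun i _ => by ring
  mono' f g h := Finset.sum_le_sum fun i _ => mul_le_mul_of_nonneg_left (h i) (w.2.1 i)
  one' := by simpa using w.2.2

theorem ofSimplex_apply {ι : Type} [Fintype ι] (w : stdSimplex ℝ ι) (f : ι → ℝ) :
    ofSimplex w f = ∑ i, w.1 i * f i := rfl

end Ex

/-! ### Probability mass functions of finite support -/

theorem pmfE_eq_sum {α : Type} (p : PMF α) (hp : p.support.Finite) (f : α → ℝ) :
    pmfE p f = ∑ x ∈ hp.toFinset, (p x).toReal * f x := by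
  rw [pmfE]
  apply tsum_eq_sum
  intro x hx
  have : p x = 0 := by
    by_contra h
    exact hx (by simpa [PMF.mem_support_iff] using h)
  simp [this]

theorem PMF.sum_toReal_support {α : Type} (p : PMF α) (hp : p.support.Finite) :
    ∑ x ∈ hp.toFinset, (p x).toReal = 1 := by
  rw [← ENNReal.toReal_sum (fun x _ => p.apply_ne_top x)]
  have : ∑ x ∈ hp.toFinset, p x = 1 := by
    rw [← p.tsum_coe]
    symm
    apply tsum_eq_sum
    intro x hx
    by_contra h
    exact hx (by simpa [PMF.mem_support_iff] using h)
  rw [this]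
  simp

/-- The expectation functional of a law of finite support. -/
def Ex.ofPMF {α : Type} (p : PMF α) (hp : p.support.Finite) : Ex α where
  toFun f := pmfE p f
  add' f g := by
    simp only [pmfE_eq_sum p hp, mul_add, Finset.sum_add_distrib]
  smul' c f := by
    simp only [pmfE_eq_sum p hp]
    rw [Finset.mul_sum]
    exact Finset.sum_congr rfl fun i _ => by ring
  mono' f g h := by
    simp only [pmfE_eq_sum p hp]
    exact Finset.sum_le_sum fun i _ => mul_le_mul_of_nonneg_left (h i) ENNReal.toReal_nonneg
  one' := by
    simp only [pmfE_eq_sum p hp, mul_one]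
    exact p.sum_toReal_support hp

/-- The restriction to the support matters for the actor, whose one-step estimates hold only for
policies that can be reached. -/
theorem pmfE_mono_support {α : Type} (p : PMF α) (hp : p.support.Finite) {f g : α → ℝ}
    (h : ∀ x ∈ p.support, f x ≤ g x) : pmfE p f ≤ pmfE p g := by
  simp only [pmfE_eq_sum p hp]
  refine Finset.sum_le_sum fun i hi => mul_le_mul_of_nonneg_left (h i ?_) ENNReal.toReal_nonneg
  simpa using hi

theorem pmfE_pure {α : Type} (x : α) (f : α → ℝ) : pmfE (PMF.pure x) f = f x := by
  rw [pmfE, tsum_eq_single x]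
  · simp
  · intro y hy
    simp [PMF.pure_apply, hy]

theorem finite_support_bind {α β : Type} {p : PMF α} {k : α → PMF β} (hp : p.support.Finite)
    (hk : ∀ x, (k x).support.Finite) : (p.bind k).support.Finite := by
  rw [PMF.support_bind]
  exact hp.biUnion fun x _ => hk x

theorem finite_support_map {α β : Type} {p : PMF α} (φ : α → β) (hp : p.support.Finite) :
    (p.map φ).support.Finite := by
  rw [PMF.support_map]
  exact hp.image _

theorem finite_support_pure {α : Type} (x : α) : (PMF.pure x).support.Finite := by
  rw [PMF.support_pure]
  exact Set.finite_singleton x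

theorem pmfE_bind {α β : Type} {p : PMF α} {k : α → PMF β} (hp : p.support.Finite)
    (hk : ∀ x, (k x).support.Finite) (f : β → ℝ) :
    pmfE (p.bind k) f = pmfE p fun x => pmfE (k x) f := by
  classical
  set s : Finset β := (finite_support_bind hp hk).toFinset with hs
  rw [pmfE_eq_sum _ (finite_support_bind hp hk), pmfE_eq_sum p hp]
  have h1 : ∀ x ∈ hp.toFinset, pmfE (k x) f = ∑ y ∈ s, (k x y).toReal * f y := by
    intro x hx
    rw [pmfE]
    apply tsum_eq_sum
    intro y hy
    have : k x y = 0 := by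
      by_contra h
      apply hy
      simp only [hs, Set.Finite.mem_toFinset, PMF.mem_support_bind_iff]
      exact ⟨x, by simpa using hx, (PMF.mem_support_iff _ _).2 h⟩
    simp [this]
  have h3 : ∑ x ∈ hp.toFinset, (p x).toReal * pmfE (k x) f =
      ∑ x ∈ hp.toFinset, ∑ y ∈ s, (p x).toReal * ((k x y).toReal * f y) :=
    Finset.sum_congr rfl fun x hx => by rw [h1 x hx, Finset.mul_sum]
  rw [h3, Finset.sum_comm]
  refine Finset.sum_congr rfl fun y _ => ?_
  have h2 : ((p.bind k) y).toReal = ∑ x ∈ hp.toFinset, (p x).toReal * (k x y).toReal := by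
    rw [PMF.bind_apply, tsum_eq_sum (s := hp.toFinset)]
    · rw [ENNReal.toReal_sum]
      · simp only [ENNReal.toReal_mul]
      · intro x _
        exact ENNReal.mul_ne_top (p.apply_ne_top x) ((k x).apply_ne_top y)
    · intro x hx
      have : p x = 0 := by
        by_contra h
        exact hx (by simpa [PMF.mem_support_iff] using h)
      simp [this]
  rw [h2, Finset.sum_mul]
  exact Finset.sum_congr rfl fun x _ => by ring

theorem pmfE_map {α β : Type} {p : PMF α} (φ : α → β) (hp : p.support.Finite) (f : β → ℝ) :
    pmfE (p.map φ) f = pmfE p fun x => f (φ x) := by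
  have : p.map φ = p.bind fun x => PMF.pure (φ x) := rfl
  rw [this, pmfE_bind hp fun x => finite_support_pure _]
  simp only [pmfE_pure]

theorem pmfE_pmfOf {ι : Type} [Fintype ι] (w : stdSimplex ℝ ι) (f : ι → ℝ) :
    pmfE (pmfOf w) f = ∑ i, w.1 i * f i := by
  rw [pmfE, tsum_fintype]
  refine Finset.sum_congr rfl fun i _ => ?_
  have : pmfOf w i = ENNReal.ofReal (w.1 i) := rfl
  rw [this, ENNReal.toReal_ofReal (w.2.1 i)]

theorem finite_support_of_finite {ι : Type} [Finite ι] (p : PMF ι) : p.support.Finite :=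
  Set.toFinite _

/-! ### Comparison of laws -/

/-- The law `p` of a pair is comparable, up to the factors `lo` and `hi`, to the expectation `E` in
what concerns the first component. -/
structure Dom {X R : Type} (lo hi : ℝ) (p : PMF (X × R)) (E : Ex X) : Prop where
  fin : p.support.Finite
  le : ∀ f : X → ℝ, (∀ x, 0 ≤ f x) → pmfE p (fun y => f y.1) ≤ hi * E f
  ge : ∀ f : X → ℝ, (∀ x, 0 ≤ f x) → lo * E f ≤ pmfE p (fun y => f y.1)

namespace Dom

variable {X Y R : Type} {lo hi lo' hi' : ℝ}

theorem pure (x : X) (r : R) : Dom 1 1 (PMF.pure (x, r)) (Ex.pure x) where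
  fin := finite_support_pure _
  le f _ := by simp [pmfE_pure]
  ge f _ := by simp [pmfE_pure]

/-- The kernel `k` may use the whole trajectory, but its comparison `K` sees only the first
component: this is how the memory of the trajectory is dropped. The inner bound is again a
nonnegative test function, so the factors multiply. -/
theorem bind {R' : Type} {p : PMF (X × R)} {E : Ex X} {k : X × R → PMF (Y × R')} {K : X → Ex Y}
    (h : Dom lo hi p E) (hlo : 0 ≤ lo') (hhi : 0 ≤ hi')
    (hk : ∀ y, Dom lo' hi' (k y) (K y.1)) : Dom (lo * lo') (hi * hi') (p.bind k) (E.bind K) where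
  fin := finite_support_bind h.fin fun y => (hk y).fin
  le f hf := by
    rw [pmfE_bind h.fin fun y => (hk y).fin]
    calc pmfE p (fun y => pmfE (k y) fun z => f z.1)
        ≤ pmfE p (fun y => hi' * K y.1 f) :=
          pmfE_mono_support p h.fin fun y _ => (hk y).le f hf
      _ ≤ hi * E (fun x => hi' * K x f) :=
          h.le (fun x => hi' * K x f) fun x => mul_nonneg hhi ((K x).nonneg hf)
      _ = hi * hi' * (E.bind K) f := by rw [Ex.smul, Ex.bind_apply, mul_assoc]
  ge f hf := by
    rw [pmfE_bind h.fin fun y => (hk y).fin]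
    calc lo * lo' * (E.bind K) f = lo * E (fun x => lo' * K x f) := by
          rw [Ex.smul, Ex.bind_apply, mul_assoc]
      _ ≤ pmfE p (fun y => lo' * K y.1 f) :=
          h.ge (fun x => lo' * K x f) fun x => mul_nonneg hlo ((K x).nonneg hf)
      _ ≤ pmfE p (fun y => pmfE (k y) fun z => f z.1) :=
          pmfE_mono_support p h.fin fun y _ => (hk y).ge f hf

theorem map {p : PMF (X × R)} {E : Ex X} (φ : X → Y) (h : Dom lo hi p E) :
    Dom lo hi (p.map fun v => (φ v.1, v.2)) (E.map φ) where
  fin := finite_support_map _ h.fin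
  le f hf := by
    rw [pmfE_map _ h.fin]
    exact h.le (fun x => f (φ x)) fun x => hf _
  ge f hf := by
    rw [pmfE_map _ h.fin]
    exact h.ge (fun x => f (φ x)) fun x => hf _

/-- Apply the two one-sided comparisons to the positive and to the negative part of `f`. -/
theorem abs_sub_le {p : PMF (X × R)} {E : Ex X} {δ : ℝ} (h : Dom (1 - δ) (1 + δ) p E)
    (f : X → ℝ) : |pmfE p (fun y => f y.1) - E f| ≤ δ * E (fun x => |f x|) := by
  have e1 : pmfE p (fun y => f y.1)
      = pmfE p (fun y => max (f y.1) 0) - pmfE p (fun y => max (-f y.1) 0) := by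
    have := (Ex.ofPMF p h.fin).sub (fun y => max (f y.1) 0) (fun y => max (-f y.1) 0)
    simp only [max_zero_sub_eq_self] at this
    exact this
  have e2 : E f = E (fun x => max (f x) 0) - E (fun x => max (-f x) 0) := by
    rw [← E.sub]
    simp only [max_zero_sub_eq_self]
  have e3 : E (fun x => |f x|) = E (fun x => max (f x) 0) + E (fun x => max (-f x) 0) := by
    rw [← E.add]
    simp only [max_zero_add_max_neg_zero_eq_abs_self]
  have a1 := h.le (fun x => max (f x) 0) fun x => le_max_right _ _
  have a2 := h.ge (fun x => max (f x) 0) fun x => le_max_right _ _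
  have a3 := h.le (fun x => max (-f x) 0) fun x => le_max_right _ _
  have a4 := h.ge (fun x => max (-f x) 0) fun x => le_max_right _ _
  rw [abs_le]
  have e4 : δ * E (fun x => |f x|) =
      δ * E (fun x => max (f x) 0) + δ * E (fun x => max (-f x) 0) := by rw [e3]; ring
  constructor <;> linarith

end Dom

/-! ### Moments of even order -/

/-- Young's inequality for natural exponents. -/
theorem succ_mul_mul_pow_le {u v : ℝ} (hu : 0 ≤ u) (hv : 0 ≤ v) (k : ℕ) :
    (k + 1) * (u * v ^ k) ≤ u ^ (k + 1) + k * v ^ (k + 1) := by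
  induction k with
  | zero => simp
  | succ k ih =>
    have h1 := mul_le_mul_of_nonneg_right ih hv
    -- The rearrangement inequality is what the induction hypothesis multiplied by `v` lacks.
    have h2 : 0 ≤ (u ^ (k + 1) - v ^ (k + 1)) * (u - v) := by
      rcases le_total u v with h | h
      · exact mul_nonneg_of_nonpos_of_nonpos
          (sub_nonpos.2 (pow_le_pow_left₀ hu h _)) (sub_nonpos.2 h)
      · exact mul_nonneg (sub_nonneg.2 (pow_le_pow_left₀ hv h _)) (sub_nonneg.2 h)
    push_cast
    ring_nf at h1 h2 ⊢
    linarith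

/-- Second order Taylor expansion of a power. -/
theorem abs_add_pow_sub_le (a b : ℝ) (n : ℕ) :
    |(a + b) ^ (n + 2) - a ^ (n + 2) - (n + 2) * a ^ (n + 1) * b|
      ≤ (n + 2) * (n + 1) / 2 * b ^ 2 * (|a| + |b|) ^ n := by
  induction n with
  | zero =>
    have : (a + b) ^ (0 + 2) - a ^ (0 + 2) - ((0 : ℕ) + 2) * a ^ (0 + 1) * b = b ^ 2 := by
      push_cast; ring
    rw [this, abs_of_nonneg (sq_nonneg b)]
    simp
  | succ n ih =>
    -- The remainder of order n+1 is (a+b) times the remainder of order n, plus one explicit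
    -- quadratic term.
    have e : (a + b) ^ (n + 1 + 2) - a ^ (n + 1 + 2) - ((n + 1 : ℕ) + 2) * a ^ (n + 1 + 1) * b =
        (a + b) * ((a + b) ^ (n + 2) - a ^ (n + 2) - (n + 2) * a ^ (n + 1) * b) +
          (n + 2) * a ^ (n + 1) * b ^ 2 := by
      push_cast; ring
    rw [e]
    have h1 : |(a + b) * ((a + b) ^ (n + 2) - a ^ (n + 2) - (n + 2) * a ^ (n + 1) * b)| ≤
        (|a| + |b|) * ((n + 2) * (n + 1) / 2 * b ^ 2 * (|a| + |b|) ^ n) := by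
      rw [abs_mul]
      exact mul_le_mul (abs_add_le a b) ih (abs_nonneg _) (by positivity)
    have h2 : |(n + 2) * a ^ (n + 1) * b ^ 2| ≤ (n + 2) * (|a| + |b|) ^ (n + 1) * b ^ 2 := by
      rw [abs_mul, abs_mul, abs_of_nonneg (sq_nonneg b), abs_pow,
        abs_of_nonneg (by positivity : (0 : ℝ) ≤ n + 2)]
      gcongr
      linarith [abs_nonneg b]
    refine (abs_add_le _ _).trans ((add_le_add h1 h2).trans (le_of_eq ?_))
    push_cast
    ring

namespace Ex

variable {α β Ξ Ω X : Type}

/-- The `L^{2q}` norm of `f` is at most `C`. -/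
def Bd (E : Ex α) (q : ℕ) (f : α → ℝ) (C : ℝ) : Prop :=
  0 ≤ C ∧ E (fun x => f x ^ (2 * q)) ≤ C ^ (2 * q)

theorem Bd.mono {E : Ex α} {q : ℕ} {f : α → ℝ} {C D : ℝ} (h : E.Bd q f C) (hCD : C ≤ D) :
    E.Bd q f D :=
  ⟨h.1.trans hCD, h.2.trans (pow_le_pow_left₀ h.1 hCD _)⟩

theorem Bd.of_abs_le {E : Ex α} {q : ℕ} {f g : α → ℝ} {C : ℝ} (h : E.Bd q g C)
    (hfg : ∀ x, |f x| ≤ |g x|) : E.Bd q f C := by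
  refine ⟨h.1, (E.mono fun x => ?_).trans h.2⟩
  rw [pow_mul, pow_mul]
  exact pow_le_pow_left₀ (sq_nonneg _) (sq_le_sq.2 (hfg x)) _

theorem Bd.congr {E : Ex α} {q : ℕ} {f g : α → ℝ} {C : ℝ} (h : E.Bd q g C)
    (hfg : ∀ x, f x = g x) : E.Bd q f C :=
  h.of_abs_le fun x => by rw [hfg x]

theorem Bd.const (E : Ex α) (q : ℕ) {c C : ℝ} (h : |c| ≤ C) : E.Bd q (fun _ => c) C := by
  refine ⟨(abs_nonneg c).trans h, ?_⟩
  rw [E.const]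
  calc c ^ (2 * q) = |c| ^ (2 * q) := by rw [pow_mul, pow_mul, sq_abs]
    _ ≤ C ^ (2 * q) := pow_le_pow_left₀ (abs_nonneg c) h _

theorem Bd.smul {E : Ex α} {q : ℕ} {f : α → ℝ} {C : ℝ} (h : E.Bd q f C) (c : ℝ) :
    E.Bd q (fun x => c * f x) (|c| * C) := by
  refine ⟨mul_nonneg (abs_nonneg c) h.1, ?_⟩
  simp only [mul_pow]
  rw [E.smul]
  have : |c| ^ (2 * q) = c ^ (2 * q) := by rw [pow_mul, pow_mul, sq_abs]
  rw [this]
  refine mul_le_mul_of_nonneg_left h.2 ?_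
  rw [pow_mul]
  exact pow_nonneg (sq_nonneg c) q

theorem Bd.neg {E : Ex α} {q : ℕ} {f : α → ℝ} {C : ℝ} (h : E.Bd q f C) :
    E.Bd q (fun x => - f x) C :=
  h.of_abs_le fun x => by rw [abs_neg]

/-- `Bd` allows a zero bound, whereas the convexity and Young arguments divide by the bounds. They
are run with bounds enlarged by `e`, and then `e` tends to 0. -/
theorem le_of_forall_pos_le_of_continuous {a : ℝ} {g : ℝ → ℝ} (hg : Continuous g)
    (h : ∀ e : ℝ, 0 < e → a ≤ g e) : a ≤ g 0 := by
  have ht : Filter.Tendsto g (nhdsWithin 0 (Set.Ioi 0)) (nhds (g 0)) :=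
    (hg.tendsto 0).mono_left nhdsWithin_le_nhds
  exact ge_of_tendsto ht (by filter_upwards [self_mem_nhdsWithin] with e he using h e he)

/-- Minkowski's inequality. -/
theorem Bd.add {E : Ex α} {q : ℕ} {f g : α → ℝ} {C D : ℝ} (hf : E.Bd q f C) (hg : E.Bd q g D) :
    E.Bd q (fun x => f x + g x) (C + D) := by
  refine ⟨add_nonneg hf.1 hg.1, ?_⟩
  have key : ∀ C D : ℝ, 0 < C → 0 < D → E.Bd q f C → E.Bd q g D →
      E (fun x => (f x + g x) ^ (2 * q)) ≤ (C + D) ^ (2 * q) := by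
    intro C D hC hD hf hg
    -- Convexity is used at the points f/C and g/D with the weights C/(C+D) and D/(C+D).
    have hconv : ConvexOn ℝ Set.univ (fun x : ℝ => x ^ (2 * q)) := (even_two_mul q).convexOn_pow
    have hp : ∀ x, (f x + g x) ^ (2 * q) ≤
        (C + D) ^ (2 * q) * (C / (C + D) / C ^ (2 * q)) * f x ^ (2 * q) +
        (C + D) ^ (2 * q) * (D / (C + D) / D ^ (2 * q)) * g x ^ (2 * q) := by
      intro x
      have h := hconv.2 (Set.mem_univ (f x / C)) (Set.mem_univ (g x / D))
        (by positivity : 0 ≤ C / (C + D)) (by positivity : 0 ≤ D / (C + D)) (by field_simp)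
      simp only [smul_eq_mul] at h
      have e : f x + g x = (C + D) * (C / (C + D) * (f x / C) + D / (C + D) * (g x / D)) := by
        field_simp
      rw [e, mul_pow]
      refine (mul_le_mul_of_nonneg_left h (by positivity)).trans (le_of_eq ?_)
      rw [div_pow, div_pow]
      field_simp
    refine (E.mono hp).trans ?_
    rw [E.add, E.smul, E.smul]
    have h1 : (C + D) ^ (2 * q) * (C / (C + D) / C ^ (2 * q)) * E (fun x => f x ^ (2 * q)) ≤
        (C + D) ^ (2 * q) * (C / (C + D) / C ^ (2 * q)) * C ^ (2 * q) :=
      mul_le_mul_of_nonneg_left hf.2 (by positivity)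
    have h2 : (C + D) ^ (2 * q) * (D / (C + D) / D ^ (2 * q)) * E (fun x => g x ^ (2 * q)) ≤
        (C + D) ^ (2 * q) * (D / (C + D) / D ^ (2 * q)) * D ^ (2 * q) :=
      mul_le_mul_of_nonneg_left hg.2 (by positivity)
    refine (add_le_add h1 h2).trans (le_of_eq ?_)
    field_simp
  have := le_of_forall_pos_le_of_continuous
    (g := fun e => ((C + e) + (D + e)) ^ (2 * q)) (by fun_prop) fun e he =>
      key (C + e) (D + e) (by linarith [hf.1]) (by linarith [hg.1])
        (hf.mono (by linarith)) (hg.mono (by linarith))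
  simpa using this

theorem Bd.sub {E : Ex α} {q : ℕ} {f g : α → ℝ} {C D : ℝ} (hf : E.Bd q f C) (hg : E.Bd q g D) :
    E.Bd q (fun x => f x - g x) (C + D) :=
  (hf.add hg.neg).congr fun x => by ring

theorem Bd.abs {E : Ex α} {q : ℕ} {f : α → ℝ} {C : ℝ} (hf : E.Bd q f C) :
    E.Bd q (fun x => |f x|) C :=
  hf.of_abs_le fun x => by rw [abs_abs]

/-- A maximum of `n ≤ 9 ^ q` functions. -/
theorem Bd.sup {ι : Type} [Fintype ι] {E : Ex α} {q : ℕ} {f : ι → α → ℝ} {C : ℝ} {g : α → ℝ}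
    (hC : 0 ≤ C) (hι : (Fintype.card ι : ℝ) ≤ 9 ^ q) (hf : ∀ i, E.Bd q (f i) C)
    (hg : ∀ x, ∃ i, |g x| ≤ |f i x|) : E.Bd q g (3 * C) := by
  refine ⟨by positivity, ?_⟩
  -- The power of the maximum is at most the sum of the powers, and n^(1/(2q)) ≤ 3.
  have h1 : ∀ x, g x ^ (2 * q) ≤ ∑ i, f i x ^ (2 * q) := by
    intro x
    obtain ⟨i, hi⟩ := hg x
    have hn : ∀ j, 0 ≤ f j x ^ (2 * q) := fun j => by
      rw [pow_mul]; exact pow_nonneg (sq_nonneg _) q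
    refine le_trans ?_ (Finset.single_le_sum (fun j _ => hn j) (Finset.mem_univ i))
    rw [pow_mul, pow_mul]
    exact pow_le_pow_left₀ (sq_nonneg _) (sq_le_sq.2 hi) _
  refine (E.mono h1).trans ?_
  rw [E.sum]
  calc ∑ i, E (fun x => f i x ^ (2 * q)) ≤ ∑ _i : ι, C ^ (2 * q) :=
        Finset.sum_le_sum fun i _ => (hf i).2
    _ = Fintype.card ι * C ^ (2 * q) := by simp
    _ ≤ 9 ^ q * C ^ (2 * q) := by gcongr
    _ = (3 * C) ^ (2 * q) := by
      rw [mul_pow, pow_mul 3 2 q]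
      norm_num

/-- Hölder's inequality with exponents k+1 and (k+1)/k, obtained by integrating Young's inequality
for (m/M)² and (c/K)². -/
theorem Bd.sq_mul_pow_le {E : Ex α} {k : ℕ} {m c : α → ℝ} {M K : ℝ} (hm : E.Bd (k + 1) m M)
    (hc : E.Bd (k + 1) c K) (hM : 0 < M) (hK : 0 < K) :
    E (fun x => m x ^ 2 * c x ^ (2 * k)) ≤ M ^ 2 * K ^ (2 * k) := by
  have hp : ∀ x, m x ^ 2 * c x ^ (2 * k) ≤
      M ^ 2 * K ^ (2 * k) / (k + 1) / M ^ (2 * (k + 1)) * m x ^ (2 * (k + 1)) +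
        M ^ 2 * K ^ (2 * k) / (k + 1) * k / K ^ (2 * (k + 1)) * c x ^ (2 * (k + 1)) := by
    intro x
    have h := succ_mul_mul_pow_le (sq_nonneg (m x / M)) (sq_nonneg (c x / K)) k
    have h' := mul_le_mul_of_nonneg_left h
      (by positivity : 0 ≤ M ^ 2 * K ^ (2 * k) / ((k : ℝ) + 1))
    simp only [← pow_mul] at h'
    calc m x ^ 2 * c x ^ (2 * k) = M ^ 2 * K ^ (2 * k) / (k + 1) *
          ((k + 1) * ((m x / M) ^ 2 * (c x / K) ^ (2 * k))) := by
          rw [div_pow, div_pow]; field_simp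
      _ ≤ _ := h'
      _ = _ := by rw [div_pow, div_pow]; field_simp
  refine (E.mono hp).trans ?_
  rw [E.add, E.smul, E.smul]
  have h1 := mul_le_mul_of_nonneg_left hm.2
    (by positivity : 0 ≤ M ^ 2 * K ^ (2 * k) / ((k : ℝ) + 1) / M ^ (2 * (k + 1)))
  have h2 := mul_le_mul_of_nonneg_left hc.2
    (by positivity : 0 ≤ M ^ 2 * K ^ (2 * k) / ((k : ℝ) + 1) * k / K ^ (2 * (k + 1)))
  refine (add_le_add h1 h2).trans (le_of_eq ?_)
  field_simp
  ring

/-- Hölder against the constant function 1. -/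
theorem Bd.sq_le {E : Ex α} {q : ℕ} {f : α → ℝ} {C : ℝ} (hf : E.Bd q f C) (hq : 1 ≤ q) :
    E (fun x => f x ^ 2) ≤ C ^ 2 := by
  obtain ⟨k, rfl⟩ : ∃ k, q = k + 1 := ⟨q - 1, by omega⟩
  have := le_of_forall_pos_le_of_continuous (g := fun e => (C + e) ^ 2) (by fun_prop)
    fun e he => by
      have h1 := (hf.mono (by linarith : C ≤ C + e)).sq_mul_pow_le (K := 1)
        (Bd.const E (k + 1) (c := 1) (by simp)) (by linarith [hf.1]) one_pos
      simpa using h1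
  simpa using this

/-- The variance of |f| is nonnegative, so the first moment is controlled by the second. -/
theorem Bd.abs_expect_le {E : Ex α} {q : ℕ} {f : α → ℝ} {C : ℝ} (hf : E.Bd q f C) (hq : 1 ≤ q) :
    E (fun x => |f x|) ≤ C := by
  have h1 := hf.sq_le hq
  have h2 : 0 ≤ E (fun x => (|f x| - E (fun x => |f x|)) ^ 2) := E.nonneg fun x => sq_nonneg _
  set μ := E (fun x => |f x|) with hμ
  have h3 : E (fun x => (|f x| - μ) ^ 2) = E (fun x => f x ^ 2) - μ ^ 2 := by
    have : (fun x => (|f x| - μ) ^ 2) = fun x => (f x ^ 2 - (2 * μ) * |f x|) + μ ^ 2 := by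
      funext x
      rw [sub_sq, sq_abs]; ring
    rw [this, E.add, E.sub, E.smul, E.const, ← hμ]
    ring
  have h4 : μ ^ 2 ≤ C ^ 2 := by linarith
  exact le_of_sq_le_sq h4 hf.1
where
  le_of_sq_le_sq {a b : ℝ} (h : a ^ 2 ≤ b ^ 2) (hb : 0 ≤ b) : a ≤ b :=
    (le_abs_self a).trans (abs_le_of_sq_le_sq h hb)

theorem variance_le (w : Ex Ξ) (f : Ξ → ℝ) :
    w (fun ξ => (f ξ - w f) ^ 2) ≤ w (fun ξ => f ξ ^ 2) := by
  have : (fun ξ => (f ξ - w f) ^ 2) = fun ξ => (f ξ ^ 2 - (2 * w f) * f ξ) + (w f) ^ 2 := by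
    funext ξ; ring
  rw [this, w.add, w.sub, w.smul, w.const]
  nlinarith [sq_nonneg (w f)]

/-- One step of a martingale: the moment of order `2q` after adding a centered increment. -/
theorem Bd.add_centered {E : Ex α} {w : Ex Ξ} {q : ℕ} (hq : 1 ≤ q) {a m : α → ℝ}
    {f : α → Ξ → ℝ} {B s y M : ℝ} (hB : 0 ≤ B) (hs : 0 ≤ s) (hM : 0 < M) (hy : 0 < y)
    (hm0 : ∀ x, 0 ≤ m x) (hf : ∀ x ξ, |f x ξ| ≤ B * m x)
    (hv : ∀ x, w (fun ξ => f x ξ ^ 2) ≤ s * m x ^ 2) (ha : E.Bd q a y) (hm : E.Bd q m M)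
    (hBy : 4 * q * B * M ≤ y) :
    E (fun x => w fun ξ => (a x + (f x ξ - w (f x))) ^ (2 * q)) ≤
      y ^ (2 * q) + 6 * q ^ 2 * s * M ^ 2 * y ^ (2 * (q - 1)) := by
  obtain ⟨k, rfl⟩ : ∃ k, q = k + 1 := ⟨q - 1, by omega⟩
  simp only [Nat.add_sub_cancel]
  have hmean : ∀ x, |w (f x)| ≤ B * m x := fun x =>
    (w.abs_apply_le _).trans (((w.mono fun ξ => hf x ξ)).trans (le_of_eq (w.const _)))
  have hp : ∀ x, w (fun ξ => (a x + (f x ξ - w (f x))) ^ (2 * (k + 1))) ≤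
      a x ^ (2 * (k + 1)) + (2 * (k + 1) ^ 2 * s) *
        (m x ^ 2 * (|a x| + 2 * B * m x) ^ (2 * k)) := by
    intro x
    -- Second order Taylor expansion at `a x`. The linear term disappears after averaging over ξ
    -- because the increment is centered, and the quadratic one sees only the variance.
    have h1 : ∀ ξ, (a x + (f x ξ - w (f x))) ^ (2 * (k + 1)) ≤
        (a x ^ (2 * (k + 1)) + (2 * (k + 1)) * a x ^ (2 * k + 1) * (f x ξ - w (f x))) +
        (2 * (k + 1) ^ 2 * (|a x| + 2 * B * m x) ^ (2 * k)) * (f x ξ - w (f x)) ^ 2 := by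
      intro ξ
      have t2 := (le_abs_self _).trans (abs_add_pow_sub_le (a x) (f x ξ - w (f x)) (2 * k))
      have hb : |f x ξ - w (f x)| ≤ 2 * B * m x := by
        refine (abs_sub _ _).trans ?_
        linarith [hf x ξ, hmean x]
      have t3 : (((2 * k : ℕ) : ℝ) + 2) * ((2 * k : ℕ) + 1) / 2 * (f x ξ - w (f x)) ^ 2 *
          (|a x| + |f x ξ - w (f x)|) ^ (2 * k) ≤
          (2 * (k + 1) ^ 2 * (|a x| + 2 * B * m x) ^ (2 * k)) * (f x ξ - w (f x)) ^ 2 := by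
        have c1 : (((2 * k : ℕ) : ℝ) + 2) * ((2 * k : ℕ) + 1) / 2 ≤ 2 * (k + 1) ^ 2 := by
          push_cast; nlinarith [(Nat.cast_nonneg k : (0 : ℝ) ≤ k)]
        have c2 : (|a x| + |f x ξ - w (f x)|) ^ (2 * k) ≤ (|a x| + 2 * B * m x) ^ (2 * k) := by
          gcongr
        calc _ ≤ 2 * (k + 1 : ℝ) ^ 2 * (f x ξ - w (f x)) ^ 2 *
              (|a x| + 2 * B * m x) ^ (2 * k) := by gcongr
          _ = _ := by ring
      have e : 2 * (k + 1) = 2 * k + 2 := by ring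
      rw [e]
      have t4 := le_trans t2 t3
      push_cast at t4 ⊢
      linarith
    refine (w.mono h1).trans ?_
    rw [w.add, w.add, w.const, w.smul, w.smul, w.sub, w.const, sub_self, mul_zero, add_zero]
    have h2 := (w.variance_le (f x)).trans (hv x)
    have h0 := hm0 x
    have h3 : 0 ≤ 2 * ((k : ℝ) + 1) ^ 2 * (|a x| + 2 * B * m x) ^ (2 * k) := by positivity
    have h4 := mul_le_mul_of_nonneg_left h2 h3
    refine add_le_add le_rfl (h4.trans (le_of_eq ?_))
    ring
  refine (E.mono hp).trans ?_
  rw [E.add, E.smul]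
  have hc : E.Bd (k + 1) (fun x => |a x| + 2 * B * m x) (y + 2 * B * M) := by
    have h1 := ha.abs.add (hm.smul (2 * B))
    rwa [abs_of_nonneg (by positivity : 0 ≤ 2 * B)] at h1
  have h5 := hm.sq_mul_pow_le hc hM (by positivity)
  -- The hypothesis 4qBM ≤ y gives 2BM ≤ y/(2(k+1)), so the ratio is at most (1 + 1/(2(k+1)))^(2k) ≤
  -- e < 3. This 3 times the 2 of the Taylor term is the 6 of the conclusion.
  have h6 : (y + 2 * B * M) ^ (2 * k) ≤ 3 * y ^ (2 * k) := by
    have hk : (0 : ℝ) < 2 * (k + 1) := by positivity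
    have e1 : y + 2 * B * M ≤ y * Real.exp (1 / (2 * (k + 1))) := by
      have e2 : 1 / (2 * ((k : ℝ) + 1)) + 1 ≤ Real.exp (1 / (2 * (k + 1))) :=
        Real.add_one_le_exp _
      have e3 : 2 * B * M ≤ y * (1 / (2 * (k + 1))) := by
        rw [mul_one_div, le_div_iff₀ hk]
        push_cast at hBy
        linarith
      nlinarith
    calc (y + 2 * B * M) ^ (2 * k) ≤ (y * Real.exp (1 / (2 * (k + 1)))) ^ (2 * k) := by gcongr
      _ = y ^ (2 * k) * Real.exp (((2 * k : ℕ) : ℝ) * (1 / (2 * (k + 1)))) := by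
        rw [mul_pow, ← Real.exp_nat_mul]
      _ ≤ y ^ (2 * k) * Real.exp 1 := by
        gcongr
        push_cast
        rw [mul_one_div, div_le_one hk]
        linarith
      _ ≤ y ^ (2 * k) * 3 := by
        gcongr
        exact Real.exp_one_lt_three.le
      _ = _ := by ring
  have h7 : M ^ 2 * (y + 2 * B * M) ^ (2 * k) ≤ M ^ 2 * (3 * y ^ (2 * k)) := by gcongr
  have h8 := mul_le_mul_of_nonneg_left (h5.trans h7)
    (by positivity : 0 ≤ 2 * ((k : ℝ) + 1) ^ 2 * s)
  refine (add_le_add ha.2 h8).trans (le_of_eq ?_)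
  push_cast
  ring

/-! ### Iterated sampling -/

/-- Iterate `n` times a random update with fresh samples from `w`. -/
def loop (w : Ex Ξ) (step : X → Ξ → X) : ℕ → X → Ex X
  | 0, x => pure x
  | n + 1, x => w.bind fun ξ => loop w step n (step x ξ)

/-- Joint law of a random parameter and of the state after `n` updates. -/
def chain (E : Ex Ω) (w : Ex Ξ) (step : Ω → X → Ξ → X) (i : Ω → X) : ℕ → Ex (Ω × X)
  | 0 => E.map fun ω => (ω, i ω)
  | n + 1 => (chain E w step i n).bind fun p => w.map fun ξ => (p.1, step p.1 p.2 ξ)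

/-- The recursion consumes the first sample first, like the program; martingale arguments must
integrate the last one out. -/
theorem loop_succ (w : Ex Ξ) (step : X → Ξ → X) (n : ℕ) (x : X) (f : X → ℝ) :
    loop w step (n + 1) x f = loop w step n x fun y => w fun ξ => f (step y ξ) := by
  induction n generalizing x with
  | zero => rfl
  | succ n ih =>
    rw [loop, bind_apply]
    simp only [ih]
    rfl

theorem chain_apply (E : Ex Ω) (w : Ex Ξ) (step : Ω → X → Ξ → X) (i : Ω → X) (n : ℕ)
    (f : Ω × X → ℝ) :
    chain E w step i n f = E fun ω => loop w (step ω) n (i ω) fun x => f (ω, x) := by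
  induction n generalizing f with
  | zero => rfl
  | succ n ih =>
    rw [chain, bind_apply, ih]
    simp only [loop_succ]
    rfl

theorem chain_fst (E : Ex Ω) (w : Ex Ξ) (step : Ω → X → Ξ → X) (i : Ω → X) (n : ℕ)
    (f : Ω → ℝ) : chain E w step i n (fun p => f p.1) = E f := by
  rw [chain_apply]
  simp only [Ex.const]

theorem Bd.chain_fst {E : Ex Ω} {q : ℕ} {f : Ω → ℝ} {C : ℝ} (h : E.Bd q f C) (w : Ex Ξ)
    (step : Ω → X → Ξ → X) (i : Ω → X) (n : ℕ) :
    (chain E w step i n).Bd q (fun p => f p.1) C :=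
  ⟨h.1, by rw [Ex.chain_fst E w step i n fun ω => f ω ^ (2 * q)]; exact h.2⟩

/-- Moment bound for a martingale along iterated sampling. -/
theorem Bd.chain_martingale {E : Ex Ω} {w : Ex Ξ} {step : Ω → X → Ξ → X} {i : Ω → X} {q : ℕ}
    (hq : 1 ≤ q) {t : ℕ} {Y m : ℕ → Ω × X → ℝ} {f : ℕ → Ω × X → Ξ → ℝ} {s : ℕ → ℝ}
    {B M y₀ R : ℝ} (hB : 0 ≤ B) (hs : ∀ j, 0 ≤ s j)
    (hY : ∀ j < t, ∀ p ξ, Y (j + 1) (p.1, step p.1 p.2 ξ) = Y j p + (f j p ξ - w (f j p)))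
    (hm0 : ∀ j p, 0 ≤ m j p) (hf : ∀ j < t, ∀ p ξ, |f j p ξ| ≤ B * m j p)
    (hv : ∀ j < t, ∀ p, w (fun ξ => f j p ξ ^ 2) ≤ s j * m j p ^ 2)
    (hM0 : 0 ≤ M) (hM : ∀ j < t, (chain E w step i j).Bd q (m j) M)
    (hY0 : (chain E w step i 0).Bd q (Y 0) y₀) (hR : 0 ≤ R)
    (hle : y₀ ^ 2 + (4 * q * B * M) ^ 2 + 6 * q * M ^ 2 * ∑ j ∈ Finset.range t, s j ≤ R ^ 2) :
    (chain E w step i t).Bd q (Y t) R := by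
  -- For positive M and y₀ the induction carries the bound F^q, where F is the partial right-hand
  -- side; its square root is the norm bound at that time.
  have key : ∀ (M y₀ : ℝ), 0 < M → 0 < y₀ → (∀ j < t, (chain E w step i j).Bd q (m j) M) →
      (chain E w step i 0).Bd q (Y 0) y₀ → ∀ n ≤ t,
      chain E w step i n (fun p => Y n p ^ (2 * q)) ≤
        (y₀ ^ 2 + (4 * q * B * M) ^ 2 + 6 * q * M ^ 2 * ∑ j ∈ Finset.range n, s j) ^ q := by
    intro M y₀ hM0 hy0 hM hY0 n hn
    induction n with
    | zero =>
      refine hY0.2.trans ?_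
      rw [pow_mul]
      gcongr
      simp
      positivity
    | succ n ih =>
      have ih' := ih (by omega)
      set F := y₀ ^ 2 + (4 * q * B * M) ^ 2 + 6 * q * M ^ 2 * ∑ j ∈ Finset.range n, s j with hF
      have hS : 0 ≤ ∑ j ∈ Finset.range n, s j := Finset.sum_nonneg fun j _ => hs j
      have hFpos : 0 < F := by positivity
      set y := Real.sqrt F with hydef
      have hypos : 0 < y := Real.sqrt_pos.2 hFpos
      have hysq : y ^ 2 = F := Real.sq_sqrt hFpos.le
      have ha : (chain E w step i n).Bd q (Y n) y :=
        ⟨hypos.le, by rw [pow_mul y, hysq]; exact ih'⟩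
      -- The summand (4qBM)² is kept in F from the start precisely to ensure this at every step.
      have hBy : 4 * q * B * M ≤ y := by
        apply Real.le_sqrt_of_sq_le
        have h1 : 0 ≤ 6 * q * M ^ 2 * ∑ j ∈ Finset.range n, s j := by positivity
        nlinarith [sq_nonneg y₀]
      have h1 := Bd.add_centered (E := chain E w step i n) (w := w) hq hB (hs n) hM0 hypos
        (hm0 n) (hf n (by omega)) (hv n (by omega)) ha (hM n (by omega)) hBy
      have e1 : chain E w step i (n + 1) (fun p => Y (n + 1) p ^ (2 * q)) =
          chain E w step i n
            (fun p => w fun ξ => (Y n p + (f n p ξ - w (f n p))) ^ (2 * q)) := by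
        simp only [chain, bind_apply, map_apply]
        congr 1
        funext p
        congr 1
        funext ξ
        rw [hY n (by omega)]
      rw [e1]
      refine h1.trans ?_
      rw [pow_mul y, pow_mul y, hysq, Finset.sum_range_succ, mul_add, ← add_assoc, ← hF]
      have hx : 0 ≤ 6 * q * M ^ 2 * s n := by have := hs n; positivity
      -- Bernoulli: F^q + q x F^(q-1) ≤ (F + x)^q. The increment thus adds up inside the power, like
      -- a variance.
      have h2 := one_add_mul_le_pow (a := 6 * q * M ^ 2 * s n / F)
        (by have : 0 ≤ 6 * q * M ^ 2 * s n / F := by positivity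
            linarith) q
      have h3 := mul_le_mul_of_nonneg_left h2 (by positivity : 0 ≤ F ^ q)
      have e2 : F * (1 + 6 * q * M ^ 2 * s n / F) = F + 6 * q * M ^ 2 * s n := by
        field_simp
      rw [← mul_pow, e2] at h3
      refine le_trans (le_of_eq ?_) h3
      obtain ⟨k, rfl⟩ : ∃ k, q = k + 1 := ⟨q - 1, by omega⟩
      simp only [Nat.add_sub_cancel]
      field_simp
      ring
  refine ⟨hR, ?_⟩
  have hlim := le_of_forall_pos_le_of_continuous
    (g := fun e => ((y₀ + e) ^ 2 + (4 * q * B * (M + e)) ^ 2 +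
      6 * q * (M + e) ^ 2 * ∑ j ∈ Finset.range t, s j) ^ q) (by fun_prop) fun e he =>
      key (M + e) (y₀ + e) (by linarith) (by linarith [hY0.1])
        (fun j hj => (hM j hj).mono (by linarith)) (hY0.mono (by linarith)) t le_rfl
  simp only [add_zero] at hlim
  refine hlim.trans ?_
  rw [pow_mul R]
  refine pow_le_pow_left₀ ?_ hle q
  have : 0 ≤ ∑ j ∈ Finset.range t, s j := Finset.sum_nonneg fun j _ => hs j
  positivity

/-- The mean needs no moment assumption: the fresh sample centers each increment. -/
theorem chain_martingale_mean {E : Ex Ω} {w : Ex Ξ} {step : Ω → X → Ξ → X} {i : Ω → X}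
    {Y : ℕ → Ω × X → ℝ} {f : ℕ → Ω × X → Ξ → ℝ} {t : ℕ}
    (hY : ∀ j < t, ∀ p ξ, Y (j + 1) (p.1, step p.1 p.2 ξ) = Y j p + (f j p ξ - w (f j p))) :
    chain E w step i t (Y t) = E fun ω => Y 0 (ω, i ω) := by
  have key : ∀ n ≤ t, chain E w step i n (Y n) = E fun ω => Y 0 (ω, i ω) := by
    intro n hn
    induction n with
    | zero => rfl
    | succ n ih =>
      rw [← ih (by omega)]
      simp only [chain, bind_apply, map_apply]
      congr 1
      funext p
      have : (fun ξ => Y (n + 1) (p.1, step p.1 p.2 ξ)) =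
          fun ξ => Y n p + (f n p ξ - w (f n p)) := by
        funext ξ
        exact hY n (by omega) p ξ
      rw [this, w.add, w.sub, w.const, w.const, sub_self, add_zero]
  exact key t le_rfl

/-- A function whose value after an update does not depend on the sample. -/
theorem Bd.chain_succ {E : Ex Ω} {w : Ex Ξ} {step : Ω → X → Ξ → X} {i : Ω → X} {q n : ℕ}
    {f g : Ω × X → ℝ} {C : ℝ} (h : (chain E w step i n).Bd q g C)
    (hfg : ∀ p ξ, f (p.1, step p.1 p.2 ξ) = g p) : (chain E w step i (n + 1)).Bd q f C := by
  refine ⟨h.1, ?_⟩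
  simp only [chain, bind_apply, map_apply, hfg, w.const]
  exact h.2

theorem chain_succ_apply {E : Ex Ω} {w : Ex Ξ} {step : Ω → X → Ξ → X} {i : Ω → X} {n : ℕ}
    {f g : Ω × X → ℝ} (hfg : ∀ p ξ, f (p.1, step p.1 p.2 ξ) = g p) :
    chain E w step i (n + 1) f = chain E w step i n g := by
  simp only [chain, bind_apply, map_apply, hfg, w.const]

end Ex

/-! ### Weak moment bounds of random vectors -/

theorem dotProduct_sq_le {d : ℕ} (v x : Fin d → ℝ) : (v ⬝ᵥ x) ^ 2 ≤ (v ⬝ᵥ v) * (x ⬝ᵥ x) := by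
  have := Finset.sum_mul_sq_le_sq_mul_sq Finset.univ v x
  simpa [dotProduct, sq] using this

theorem dotProduct_self_nonneg_real {d : ℕ} (v : Fin d → ℝ) : 0 ≤ v ⬝ᵥ v :=
  Finset.sum_nonneg fun i _ => mul_self_nonneg (v i)

theorem abs_dotProduct_le {d : ℕ} {v x : Fin d → ℝ} {a b : ℝ} (ha : 0 ≤ a) (hb : 0 ≤ b)
    (hv : v ⬝ᵥ v ≤ a ^ 2) (hx : x ⬝ᵥ x ≤ b ^ 2) : |v ⬝ᵥ x| ≤ a * b := by
  apply abs_le_of_sq_le_sq _ (by positivity)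
  rw [mul_pow]
  exact (dotProduct_sq_le v x).trans
    (mul_le_mul hv hx (dotProduct_self_nonneg_real x) (sq_nonneg a))

theorem exists_norm_le_abs {Z : Type} [Fintype Z] [Nonempty Z] (f : Z → ℝ) :
    ∃ z, ‖f‖ ≤ |f z| := by
  obtain ⟨z, hz⟩ := Finite.exists_max fun z => |f z|
  exact ⟨z, (pi_norm_le_iff_of_nonneg (abs_nonneg _)).2 fun i => hz i⟩

namespace Ex

variable {Ω Ξ X : Type} {d : ℕ}

/-- All linear functionals of a random vector have `L^{2q}` norm at most `C` times their norm. -/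
def WBd (E : Ex Ω) (q : ℕ) (f : Ω → Fin d → ℝ) (C : ℝ) : Prop :=
  ∀ (v : Fin d → ℝ) (b : ℝ), 0 ≤ b → v ⬝ᵥ v ≤ b ^ 2 → E.Bd q (fun ω => v ⬝ᵥ f ω) (b * C)

/-- All linear functionals of a random vector have expectation at most `C` times their norm. -/
def LBd (E : Ex Ω) (f : Ω → Fin d → ℝ) (C : ℝ) : Prop :=
  ∀ (v : Fin d → ℝ) (b : ℝ), 0 ≤ b → v ⬝ᵥ v ≤ b ^ 2 → |E (fun ω => v ⬝ᵥ f ω)| ≤ b * C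

theorem WBd.nonneg {E : Ex Ω} {q : ℕ} {f : Ω → Fin d → ℝ} {C : ℝ} (h : E.WBd q f C) : 0 ≤ C := by
  simpa using (h 0 1 zero_le_one (by simp)).1

theorem WBd.mono {E : Ex Ω} {q : ℕ} {f : Ω → Fin d → ℝ} {C D : ℝ} (h : E.WBd q f C)
    (hCD : C ≤ D) : E.WBd q f D :=
  fun v b hb hv => (h v b hb hv).mono (mul_le_mul_of_nonneg_left hCD hb)

theorem WBd.sub {E : Ex Ω} {q : ℕ} {f g : Ω → Fin d → ℝ} {C D : ℝ} (hf : E.WBd q f C)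
    (hg : E.WBd q g D) : E.WBd q (fun ω => f ω - g ω) (C + D) := fun v b hb hv => by
  rw [mul_add]
  exact ((hf v b hb hv).sub (hg v b hb hv)).congr fun x => dotProduct_sub _ _ _

theorem WBd.congr {E : Ex Ω} {q : ℕ} {f g : Ω → Fin d → ℝ} {C : ℝ} (hf : E.WBd q f C)
    (h : ∀ ω, g ω = f ω) : E.WBd q g C := by
  have : g = f := funext h
  rwa [this]

theorem WBd.chain_fst {E : Ex Ω} {q : ℕ} {f : Ω → Fin d → ℝ} {C : ℝ} (h : E.WBd q f C)
    (w : Ex Ξ) (step : Ω → X → Ξ → X) (i : Ω → X) (n : ℕ) :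
    (chain E w step i n).WBd q (fun p => f p.1) C :=
  fun v b hb hv => (h v b hb hv).chain_fst w step i n

theorem WBd.const (E : Ex Ω) (q : ℕ) {x : Fin d → ℝ} {C : ℝ} (hC : 0 ≤ C) (hx : x ⬝ᵥ x ≤ C ^ 2) :
    E.WBd q (fun _ => x) C :=
  fun _ _ hb hv => Bd.const E q (abs_dotProduct_le hb hC hv hx)

/-- The rows of Ψ are test vectors of norm at most 1, and there are at most 9^q of them. The
dimension `d` plays no role. -/
theorem WBd.norm_mulVec {Z : Type} [Fintype Z] [Nonempty Z] {Ψ : Matrix Z (Fin d) ℝ}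
    (hΨ : ∀ z, Ψ z ⬝ᵥ Ψ z ≤ 1) {q : ℕ} (hZ : (Fintype.card Z : ℝ) ≤ 9 ^ q) {E : Ex Ω}
    {f : Ω → Fin d → ℝ} {C : ℝ} (hf : E.WBd q f C) : E.Bd q (fun ω => ‖Ψ *ᵥ f ω‖) (3 * C) := by
  refine Bd.sup (f := fun z ω => Ψ z ⬝ᵥ f ω) hf.nonneg hZ (fun z => ?_) fun ω => ?_
  · simpa using hf (Ψ z) 1 zero_le_one (by simpa using hΨ z)
  · obtain ⟨z, hz⟩ := exists_norm_le_abs (Ψ *ᵥ f ω)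
    exact ⟨z, by rw [abs_norm]; exact hz⟩

end Ex

/-! ### Temporal differences with independent samples -/

section TD

variable {Z : Type} {d : ℕ}

/-- The stochastic operator of temporal differences. -/
def tdOp (Ψ : Matrix Z (Fin d) ℝ) (cost : Z → ℝ) (θ : Fin d → ℝ) (r : ℝ) (ξ : Z × Z) : Fin d → ℝ :=
  ((Ψ ξ.1 - Ψ ξ.2) ⬝ᵥ θ - cost ξ.1 + r) • Ψ ξ.1

/-- A temporal difference problem with independent samples: pairs `wp`, costs `wc`, solution `θs`,
average cost `ρ`, a bound `G` of the residuals. -/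
structure TDProblem (Z : Type) (d : ℕ) where
  Ψ : Matrix Z (Fin d) ℝ
  cost : Z → ℝ
  wp : Ex (Z × Z)
  wc : Ex Z
  ρ : ℝ
  θs : Fin d → ℝ
  G : ℝ
  β : ℝ
  μ : ℝ
  β_pos : 0 < β
  μ_pos : 0 < μ
  β_le : β ≤ 1
  μ_le : μ ≤ 1
  norm_le : ∀ z, Ψ z ⬝ᵥ Ψ z ≤ 1
  monotone : ∀ x, β * wp (fun ξ => (Ψ ξ.1 ⬝ᵥ x) ^ 2) ≤
    wp fun ξ => (Ψ ξ.1 ⬝ᵥ x) * ((Ψ ξ.1 - Ψ ξ.2) ⬝ᵥ x)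
  posdef : ∀ x : Fin d → ℝ, μ * (x ⬝ᵥ x) ≤ wp fun ξ => (Ψ ξ.1 ⬝ᵥ x) ^ 2
  fixed : ∀ x, wp (fun ξ => (Ψ ξ.1 ⬝ᵥ x) * ((Ψ ξ.1 - Ψ ξ.2) ⬝ᵥ θs - cost ξ.1 + ρ)) = 0
  residual : ∀ ξ : Z × Z, |(Ψ ξ.1 - Ψ ξ.2) ⬝ᵥ θs - cost ξ.1 + ρ| ≤ G
  cost_mean : wc cost = ρ
  cost_le : ∀ z, |cost z - ρ| ≤ G

namespace TDProblem

variable (D : TDProblem Z d)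

/-- The expected operator. -/
def A : Matrix (Fin d) (Fin d) ℝ :=
  fun i j => D.wp fun ξ => D.Ψ ξ.1 i * (D.Ψ ξ.1 - D.Ψ ξ.2) j

/-- The quadratic form of the Gram matrix of the features. -/
def gram (x : Fin d → ℝ) : ℝ := D.wp fun ξ => (D.Ψ ξ.1 ⬝ᵥ x) ^ 2

/-- The expected feature vector. -/
def meanFeature : Fin d → ℝ := fun i => D.wp fun ξ => D.Ψ ξ.1 i

theorem G_nonneg [Nonempty Z] : 0 ≤ D.G :=
  (abs_nonneg _).trans (D.cost_le (Classical.arbitrary Z))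

theorem dot_A (v x : Fin d → ℝ) :
    v ⬝ᵥ (D.A *ᵥ x) = D.wp fun ξ => (D.Ψ ξ.1 ⬝ᵥ v) * ((D.Ψ ξ.1 - D.Ψ ξ.2) ⬝ᵥ x) := by
  simp only [dotProduct, Matrix.mulVec, A, Finset.sum_mul_sum]
  rw [D.wp.sum]
  refine Finset.sum_congr rfl fun i _ => ?_
  rw [D.wp.sum, Finset.mul_sum]
  refine Finset.sum_congr rfl fun j _ => ?_
  have e := D.wp.smul (v i * x j) fun ξ => D.Ψ ξ.1 i * (D.Ψ ξ.1 - D.Ψ ξ.2) j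
  calc _ = v i * x j * D.wp (fun ξ => D.Ψ ξ.1 i * (D.Ψ ξ.1 - D.Ψ ξ.2) j) := by ring
    _ = _ := by
      rw [← e]
      congr 1
      funext ξ
      ring

theorem dot_meanFeature (v : Fin d → ℝ) :
    v ⬝ᵥ D.meanFeature = D.wp fun ξ => D.Ψ ξ.1 ⬝ᵥ v := by
  simp only [dotProduct, meanFeature]
  rw [D.wp.sum]
  refine Finset.sum_congr rfl fun i _ => ?_
  rw [← D.wp.smul]
  congr 1
  funext ξ
  ring

theorem gram_nonneg (x : Fin d → ℝ) : 0 ≤ D.gram x := D.wp.nonneg fun _ => sq_nonneg _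

theorem gram_le_dot (x : Fin d → ℝ) : D.β * D.gram x ≤ x ⬝ᵥ (D.A *ᵥ x) := by
  rw [D.dot_A]
  exact D.monotone x

/-- A vector x in the kernel satisfies 0 = ⟨x, Ax⟩ ≥ βμ|x|². -/
theorem isUnit_det_A : IsUnit D.A.det := by
  rw [← Matrix.isUnit_iff_isUnit_det, ← Matrix.mulVec_injective_iff_isUnit]
  rw [← Matrix.coe_mulVecLin, ← LinearMap.ker_eq_bot, LinearMap.ker_eq_bot']
  intro x hx
  have h1 := D.gram_le_dot x
  have h2 : D.A *ᵥ x = 0 := hx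
  rw [h2, dotProduct_zero] at h1
  have h3 := D.posdef x
  have h4 : x ⬝ᵥ x ≤ 0 := by
    have := D.β_pos
    have := D.μ_pos
    have h5 : D.gram x ≤ 0 := by
      by_contra h
      push Not at h
      nlinarith
    have h6 : D.μ * (x ⬝ᵥ x) ≤ D.gram x := h3
    by_contra h
    push Not at h
    nlinarith
  exact dotProduct_self_eq_zero.1 (le_antisymm h4 (dotProduct_self_nonneg_real x))

/-- The test vector `u` with `⟨u, A x⟩ = ⟨v, x⟩`. -/
def dual (v : Fin d → ℝ) : Fin d → ℝ := v ᵥ* D.A⁻¹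

theorem dual_dot (v x : Fin d → ℝ) : D.dual v ⬝ᵥ x = v ⬝ᵥ (D.A⁻¹ *ᵥ x) := by
  rw [dual, Matrix.dotProduct_mulVec]

theorem dual_dot_A (v x : Fin d → ℝ) : D.dual v ⬝ᵥ (D.A *ᵥ x) = v ⬝ᵥ x := by
  rw [dual_dot, Matrix.mulVec_mulVec, Matrix.nonsing_inv_mul _ D.isUnit_det_A, Matrix.one_mulVec]

theorem A_mulVec_inv (x : Fin d → ℝ) : D.A *ᵥ (D.A⁻¹ *ᵥ x) = x := by
  rw [Matrix.mulVec_mulVec, Matrix.mul_nonsing_inv _ D.isUnit_det_A, Matrix.one_mulVec]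

/-- For u the dual vector of v, β gram(u) ≤ ⟨u, Au⟩ = ⟨v, u⟩ ≤ b|u| ≤ b (gram(u)/μ)^(1/2). The
variance of the batch noise therefore costs only one power of 1/μ; the Euclidean norm of u, which
costs two, enters only through the bound on single increments. -/
theorem gram_dual_le {v : Fin d → ℝ} {b : ℝ} (hv : v ⬝ᵥ v ≤ b ^ 2) :
    D.gram (D.dual v) ≤ b ^ 2 / (D.β ^ 2 * D.μ) := by
  have h1 := D.gram_le_dot (D.dual v)
  rw [dual_dot_A] at h1
  have h2 : D.μ * (D.dual v ⬝ᵥ D.dual v) ≤ D.gram (D.dual v) := D.posdef _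
  have h3 := dotProduct_sq_le v (D.dual v)
  have hg := D.gram_nonneg (D.dual v)
  have hβ := D.β_pos
  have hμ := D.μ_pos
  set s := D.gram (D.dual v)
  set n := D.dual v ⬝ᵥ D.dual v
  have hn : 0 ≤ n := dotProduct_self_nonneg_real _
  rw [le_div_iff₀ (by positivity)]
  rcases hg.eq_or_lt with h0 | h0
  · rw [← h0, zero_mul]; positivity
  have h4 : (D.β * s) ^ 2 ≤ b ^ 2 * n := by
    have h5 : (D.β * s) ^ 2 ≤ (v ⬝ᵥ D.dual v) ^ 2 := pow_le_pow_left₀ (by positivity) h1 2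
    nlinarith
  have h6 : D.μ * (D.β * s) ^ 2 ≤ b ^ 2 * s := by nlinarith [sq_nonneg b]
  have h7 : s * (s * (D.β ^ 2 * D.μ)) ≤ s * b ^ 2 := by nlinarith
  exact le_of_mul_le_mul_left h7 h0

theorem dual_dot_self_le {v : Fin d → ℝ} {b : ℝ} (hv : v ⬝ᵥ v ≤ b ^ 2) :
    D.dual v ⬝ᵥ D.dual v ≤ (b / (D.β * D.μ)) ^ 2 := by
  have h1 := D.gram_dual_le hv
  have h2 : D.μ * (D.dual v ⬝ᵥ D.dual v) ≤ D.gram (D.dual v) := D.posdef _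
  have hβ := D.β_pos
  have hμ := D.μ_pos
  have h3 : D.dual v ⬝ᵥ D.dual v ≤ b ^ 2 / (D.β ^ 2 * D.μ) / D.μ := by
    rw [le_div_iff₀ hμ]; linarith
  refine h3.trans (le_of_eq ?_)
  field_simp

theorem abs_dot_le_norm [Fintype Z] (z : Z) (x : Fin d → ℝ) : |D.Ψ z ⬝ᵥ x| ≤ ‖D.Ψ *ᵥ x‖ :=
  norm_le_pi_norm (D.Ψ *ᵥ x) z

theorem abs_diff_dot_le_norm [Fintype Z] (ξ : Z × Z) (x : Fin d → ℝ) :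
    |(D.Ψ ξ.1 - D.Ψ ξ.2) ⬝ᵥ x| ≤ 2 * ‖D.Ψ *ᵥ x‖ := by
  rw [sub_dotProduct]
  refine (abs_sub _ _).trans ?_
  linarith [D.abs_dot_le_norm ξ.1 x, D.abs_dot_le_norm ξ.2 x]

theorem diff_dot_sq_le (ξ : Z × Z) (x : Fin d → ℝ) :
    ((D.Ψ ξ.1 - D.Ψ ξ.2) ⬝ᵥ x) ^ 2 ≤ 4 * (x ⬝ᵥ x) := by
  rw [sub_dotProduct]
  have h1 := dotProduct_sq_le (D.Ψ ξ.1) x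
  have h2 := dotProduct_sq_le (D.Ψ ξ.2) x
  have h3 := mul_le_mul_of_nonneg_right (D.norm_le ξ.1) (dotProduct_self_nonneg_real x)
  have h4 := mul_le_mul_of_nonneg_right (D.norm_le ξ.2) (dotProduct_self_nonneg_real x)
  nlinarith [sq_nonneg (D.Ψ ξ.1 ⬝ᵥ x + D.Ψ ξ.2 ⬝ᵥ x)]

/-- The iterates `(I - η Aᵀ)^j v`. -/
def test (η : ℝ) (v : Fin d → ℝ) : ℕ → Fin d → ℝ
  | 0 => v
  | j + 1 => test η v j - η • (D.Aᵀ *ᵥ test η v j)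

theorem test_succ_dot (η : ℝ) (v x : Fin d → ℝ) (j : ℕ) :
    D.test η v (j + 1) ⬝ᵥ x = D.test η v j ⬝ᵥ (x - η • (D.A *ᵥ x)) := by
  rw [test, sub_dotProduct, dotProduct_sub, smul_dotProduct, dotProduct_smul,
    Matrix.mulVec_transpose, Matrix.dotProduct_mulVec]

/-- Expand the square. With y = Aᵀx, testing y against itself gives |y|² = ⟨x, Ay⟩ ≤ 2 gram(x) +
|y|²/2, hence |y|² ≤ 4 gram(x), and 4η ≤ β lets the quadratic term eat only half of the gain 2ηβ
gram(x). -/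
theorem test_succ_self_le {η : ℝ} (h0 : 0 ≤ η) (hη : 4 * η ≤ D.β) (v : Fin d → ℝ) (j : ℕ) :
    D.test η v (j + 1) ⬝ᵥ D.test η v (j + 1) ≤
      D.test η v j ⬝ᵥ D.test η v j - η * D.β * D.gram (D.test η v j) := by
  set x := D.test η v j with hx
  set y := D.Aᵀ *ᵥ x with hy
  have e1 : D.test η v (j + 1) ⬝ᵥ D.test η v (j + 1) =
      x ⬝ᵥ x - 2 * η * (x ⬝ᵥ (D.A *ᵥ x)) + η ^ 2 * (y ⬝ᵥ y) := by
    have e2 : x ⬝ᵥ (D.A *ᵥ x) = y ⬝ᵥ x := by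
      rw [hy, Matrix.mulVec_transpose, Matrix.dotProduct_mulVec]
    rw [test, ← hx, ← hy, e2]
    simp only [sub_dotProduct, dotProduct_sub, smul_dotProduct, dotProduct_smul, smul_eq_mul]
    rw [dotProduct_comm x y]
    ring
  have h1 := D.gram_le_dot x
  have h2 : y ⬝ᵥ y ≤ 4 * D.gram x := by
    have e0 : x ᵥ* D.A = y := by rw [hy, Matrix.mulVec_transpose]
    have e3 : y ⬝ᵥ y = x ⬝ᵥ (D.A *ᵥ y) := by
      rw [Matrix.dotProduct_mulVec x D.A y, e0]
    have h3 : x ⬝ᵥ (D.A *ᵥ y) ≤ 2 * D.gram x + (y ⬝ᵥ y) / 2 := by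
      rw [D.dot_A, gram]
      have h4 : ∀ ξ : Z × Z, (D.Ψ ξ.1 ⬝ᵥ x) * ((D.Ψ ξ.1 - D.Ψ ξ.2) ⬝ᵥ y) ≤
          2 * (D.Ψ ξ.1 ⬝ᵥ x) ^ 2 + (y ⬝ᵥ y) / 2 := by
        intro ξ
        nlinarith [D.diff_dot_sq_le ξ y,
          sq_nonneg (4 * (D.Ψ ξ.1 ⬝ᵥ x) - ((D.Ψ ξ.1 - D.Ψ ξ.2) ⬝ᵥ y))]
      refine (D.wp.mono h4).trans (le_of_eq ?_)
      rw [D.wp.add, D.wp.smul, D.wp.const]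
    linarith
  have hg := D.gram_nonneg x
  rw [e1]
  have h5 : η ^ 2 * (y ⬝ᵥ y) ≤ η * D.β * D.gram x := by
    calc η ^ 2 * (y ⬝ᵥ y) ≤ η ^ 2 * (4 * D.gram x) := by gcongr
      _ = η * (4 * η) * D.gram x := by ring
      _ ≤ η * D.β * D.gram x := by gcongr
  nlinarith [mul_le_mul_of_nonneg_left h1 h0]

/-- The contraction factor of the expected update. -/
def rate (η : ℝ) : ℝ := 1 - η * D.β * D.μ / 2

theorem rate_bounds {η : ℝ} (h0 : 0 ≤ η) (hη : 4 * η ≤ D.β) : 0 ≤ D.rate η ∧ D.rate η ≤ 1 := by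
  have hβ := D.β_pos
  have hμ := D.μ_pos
  have h1 : η * D.β * D.μ ≤ 1 * 1 * 1 := by
    gcongr
    · linarith [D.β_le]
    · exact D.β_le
    · exact D.μ_le
  have h2 : 0 ≤ η * D.β * D.μ := by positivity
  unfold rate
  constructor <;> linarith

theorem test_self_le {η : ℝ} (h0 : 0 ≤ η) (hη : 4 * η ≤ D.β) {v : Fin d → ℝ} {b : ℝ}
    (hv : v ⬝ᵥ v ≤ b ^ 2) (j : ℕ) :
    D.test η v j ⬝ᵥ D.test η v j ≤ (b * D.rate η ^ j) ^ 2 := by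
  induction j with
  | zero => simpa [test] using hv
  | succ j ih =>
    have h1 := D.test_succ_self_le h0 hη v j
    have h2 : D.μ * (D.test η v j ⬝ᵥ D.test η v j) ≤ D.gram (D.test η v j) := D.posdef _
    have hβ := D.β_pos
    have h3 := mul_le_mul_of_nonneg_left h2 (by positivity : 0 ≤ η * D.β)
    have h4 : D.test η v (j + 1) ⬝ᵥ D.test η v (j + 1) ≤
        D.rate η ^ 2 * (D.test η v j ⬝ᵥ D.test η v j) := by
      have h5 := dotProduct_self_nonneg_real (D.test η v j)
      have h6 : 1 - η * D.β * D.μ ≤ D.rate η ^ 2 := by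
        unfold rate
        nlinarith [sq_nonneg (η * D.β * D.μ / 2)]
      nlinarith
    refine h4.trans ((mul_le_mul_of_nonneg_left ih (sq_nonneg _)).trans (le_of_eq ?_))
    ring

/-- Telescoping of the previous decrease. The noise accumulated in a fixed direction is thus bounded
independently of the number of inner steps. -/
theorem sum_gram_test_le {η : ℝ} (h0 : 0 ≤ η) (hη : 4 * η ≤ D.β) {v : Fin d → ℝ} {b : ℝ}
    (hv : v ⬝ᵥ v ≤ b ^ 2) (t : ℕ) :
    η * D.β * ∑ j ∈ Finset.range t, D.gram (D.test η v j) ≤ b ^ 2 := by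
  have key : η * D.β * ∑ j ∈ Finset.range t, D.gram (D.test η v j) ≤
      v ⬝ᵥ v - D.test η v t ⬝ᵥ D.test η v t := by
    induction t with
    | zero => simp [test]
    | succ t ih =>
      rw [Finset.sum_range_succ, mul_add]
      linarith [D.test_succ_self_le h0 hη v t]
  linarith [dotProduct_self_nonneg_real (D.test η v t)]

end TDProblem

end TD

namespace TDProblem

variable {Z : Type} {d : ℕ} (D : TDProblem Z d) {Ω : Type}

/-! #### The inner loop -/

/-- One variance-reduced step; the second component sums the iterates. -/
def innerStep (η : ℝ) (θc : Fin d → ℝ) (r : ℝ) (gh : Fin d → ℝ)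
    (p : (Fin d → ℝ) × (Fin d → ℝ)) (ξ : Z × Z) : (Fin d → ℝ) × (Fin d → ℝ) :=
  (p.1 - η • (tdOp D.Ψ D.cost p.1 r ξ - tdOp D.Ψ D.cost θc r ξ + gh), p.2 + p.1)

theorem tdOp_sub (θ θc : Fin d → ℝ) (r : ℝ) (ξ : Z × Z) :
    tdOp D.Ψ D.cost θ r ξ - tdOp D.Ψ D.cost θc r ξ =
      ((D.Ψ ξ.1 - D.Ψ ξ.2) ⬝ᵥ (θ - θc)) • D.Ψ ξ.1 := by
  rw [tdOp, tdOp, ← sub_smul, dotProduct_sub]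
  congr 1
  ring

section Inner

variable (E : Ex Ω) (η : ℝ) (θc : Ω → Fin d → ℝ) (r : Ω → ℝ) (gh : Ω → Fin d → ℝ)

/-- Law of the iterates of the inner loop. -/
def innerChain (t : ℕ) : Ex (Ω × ((Fin d → ℝ) × (Fin d → ℝ))) :=
  Ex.chain E D.wp (fun ω => D.innerStep η (θc ω) (r ω) (gh ω)) (fun ω => (θc ω, 0)) t

theorem innerChain_fst (t : ℕ) (f : Ω → ℝ) :
    D.innerChain E η θc r gh t (fun p => f p.1) = E f :=
  Ex.chain_fst E D.wp _ _ t f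

/-- Deviation of an iterate from the fixed point of the expected inner update. -/
def dev (p : Ω × ((Fin d → ℝ) × (Fin d → ℝ))) : Fin d → ℝ :=
  p.2.1 - θc p.1 + D.A⁻¹ *ᵥ gh p.1

/-- Noise of the inner update in the direction `v`. -/
def innerNoise (v : Fin d → ℝ) (p : Ω × ((Fin d → ℝ) × (Fin d → ℝ))) (ξ : Z × Z) : ℝ :=
  -η * ((D.Ψ ξ.1 ⬝ᵥ v) * ((D.Ψ ξ.1 - D.Ψ ξ.2) ⬝ᵥ (p.2.1 - θc p.1)))

/-- The deviation obeys dev' = (I - ηA) dev + noise. Moving I - ηA onto the test vector shows that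
the test vector of index t - j paired with the deviation at time j is a martingale in j. -/
theorem test_dot_dev (v : Fin d → ℝ) (n : ℕ) (p : Ω × ((Fin d → ℝ) × (Fin d → ℝ)))
    (ξ : Z × Z) :
    D.test η v n ⬝ᵥ D.dev θc gh (p.1, D.innerStep η (θc p.1) (r p.1) (gh p.1) p.2 ξ) =
      D.test η v (n + 1) ⬝ᵥ D.dev θc gh p + (D.innerNoise η θc (D.test η v n) p ξ -
        D.wp (D.innerNoise η θc (D.test η v n) p)) := by
  have e1 : D.wp (D.innerNoise η θc (D.test η v n) p) =
      -η * (D.test η v n ⬝ᵥ (D.A *ᵥ (p.2.1 - θc p.1))) := by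
    rw [D.dot_A, ← D.wp.smul]
    rfl
  have e2 : D.A *ᵥ D.dev θc gh p = D.A *ᵥ (p.2.1 - θc p.1) + gh p.1 := by
    rw [dev, Matrix.mulVec_add, A_mulVec_inv]
  rw [e1, D.test_succ_dot, e2]
  simp only [dev, innerStep, innerNoise, tdOp_sub]
  rw [dotProduct_comm (D.Ψ ξ.1)]
  simp only [dotProduct_sub, dotProduct_add, dotProduct_smul, smul_eq_mul]
  ring

/-- Compare the two ends of the martingale. At time 0 the iterate is the center, so only A⁻¹ĝ is
left of the deviation. -/
theorem innerChain_mean (v : Fin d → ℝ) (t : ℕ) :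
    D.innerChain E η θc r gh t (fun p => v ⬝ᵥ D.dev θc gh p) =
      E fun ω => D.test η v t ⬝ᵥ (D.A⁻¹ *ᵥ gh ω) := by
  have h := Ex.chain_martingale_mean (E := E) (w := D.wp)
    (step := fun ω => D.innerStep η (θc ω) (r ω) (gh ω)) (i := fun ω => (θc ω, 0)) (t := t)
    (Y := fun j p => D.test η v (t - j) ⬝ᵥ D.dev θc gh p)
    (f := fun j p => D.innerNoise η θc (D.test η v (t - (j + 1))) p) (by
      intro j hj p ξ
      have := D.test_dot_dev η θc r gh v (t - (j + 1)) p ξ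
      rwa [show t - (j + 1) + 1 = t - j by omega] at this)
  simp only [Nat.sub_self, Nat.sub_zero] at h
  refine Eq.trans ?_ (h.trans ?_)
  · rfl
  · congr 1
    funext ω
    simp [dev]

theorem innerChain_sum_step (v : Fin d → ℝ) (t : ℕ) (p : Ω × ((Fin d → ℝ) × (Fin d → ℝ)))
    (ξ : Z × Z) :
    v ⬝ᵥ ((D.innerStep η (θc p.1) (r p.1) (gh p.1) p.2 ξ).2 -
        ((t + 1 : ℕ) : ℝ) • (θc p.1 - D.A⁻¹ *ᵥ gh p.1)) =
      v ⬝ᵥ (p.2.2 - (t : ℝ) • (θc p.1 - D.A⁻¹ *ᵥ gh p.1)) + v ⬝ᵥ D.dev θc gh p := by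
  rw [← dotProduct_add]
  congr 1
  simp only [innerStep, dev]
  push_cast
  module

theorem innerChain_sum_mean (v : Fin d → ℝ) (t : ℕ) :
    D.innerChain E η θc r gh t
        (fun p => v ⬝ᵥ (p.2.2 - (t : ℝ) • (θc p.1 - D.A⁻¹ *ᵥ gh p.1))) =
      ∑ j ∈ Finset.range t, E fun ω => D.test η v j ⬝ᵥ (D.A⁻¹ *ᵥ gh ω) := by
  induction t with
  | zero =>
    simp only [innerChain, Ex.chain, Ex.map_apply, Finset.range_zero, Finset.sum_empty]
    simpa using E.const 0
  | succ t ih =>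
    rw [Finset.sum_range_succ, ← ih, ← D.innerChain_mean E η θc r gh v t, ← Ex.add]
    exact Ex.chain_succ_apply fun p ξ => D.innerChain_sum_step η θc r gh v t p ξ

variable {E η θc r gh}

theorem innerChain_fst_wbd {q : ℕ} {f : Ω → Fin d → ℝ} {C : ℝ} (h : E.WBd q f C) (t : ℕ) :
    (D.innerChain E η θc r gh t).WBd q (fun p => f p.1) C :=
  h.chain_fst D.wp _ _ t

/-- The noise is multiplicative: at time j it has the size of the sup norm of Ψ(θ_j - θ_c), which is
controlled by the bounds already proved for earlier times. Hence the strong induction; `rate^t` is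
the transient of the initial deviation, and κ the stationary fluctuation, small because η is. -/
theorem innerChain_dev_bd [Fintype Z] [Nonempty Z] {q : ℕ} (hq : 1 ≤ q)
    (hZ : (Fintype.card Z : ℝ) ≤ 9 ^ q) {κ W : ℝ} (hκ0 : 0 ≤ κ) (hκ1 : κ ≤ 1) (h0 : 0 < η)
    (hη : 4 * η ≤ D.β) (hηq : 81 * (64 * q ^ 2 * η ^ 2 + 24 * q * η / D.β) ≤ κ ^ 2)
    (hh : E.WBd q (fun ω => D.A⁻¹ *ᵥ gh ω) W) (t : ℕ) :
    (D.innerChain E η θc r gh t).WBd q (D.dev θc gh) ((D.rate η ^ t + κ) * W) := by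
  have hW := hh.nonneg
  obtain ⟨hr0, hr1⟩ := D.rate_bounds h0.le hη
  have hβ := D.β_pos
  induction t using Nat.strong_induction_on with
  | _ t ih =>
  intro v b hb hv
  -- Here θ_j - θ_c is the deviation, at most (1 + κ)W ≤ 2W, minus A⁻¹ĝ, at most W; the sup norm
  -- costs the factor 3, which makes 9W and later the constant 81.
  have hM : ∀ j < t, (D.innerChain E η θc r gh j).Bd q
      (fun p => ‖D.Ψ *ᵥ (p.2.1 - θc p.1)‖) (9 * W) := by
    intro j hj
    have h1 : (D.innerChain E η θc r gh j).WBd q (D.dev θc gh) (2 * W) :=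
      (ih j hj).mono (by
        have := pow_le_one₀ (n := j) hr0 hr1
        nlinarith)
    have h2 := h1.sub (hh.chain_fst D.wp
      (fun ω => D.innerStep η (θc ω) (r ω) (gh ω)) (fun ω => (θc ω, 0)) j)
    have h3 := (h2.congr (g := fun p => p.2.1 - θc p.1)
      fun p => by simp [dev]).norm_mulVec D.norm_le hZ
    exact h3.mono (by linarith)
  have h := Ex.Bd.chain_martingale (E := E) (w := D.wp) (q := q)
    (step := fun ω => D.innerStep η (θc ω) (r ω) (gh ω)) (i := fun ω => (θc ω, 0)) (t := t)
    (Y := fun j p => D.test η v (t - j) ⬝ᵥ D.dev θc gh p)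
    (f := fun j p => D.innerNoise η θc (D.test η v (t - (j + 1))) p)
    (m := fun _ p => ‖D.Ψ *ᵥ (p.2.1 - θc p.1)‖)
    (s := fun j => 4 * η ^ 2 * D.gram (D.test η v (t - (j + 1))))
    (B := 2 * η * b) (M := 9 * W) (y₀ := b * D.rate η ^ t * W) (R := b * ((D.rate η ^ t + κ) * W))
    hq (by positivity) (fun j => by have := D.gram_nonneg (D.test η v (t - (j + 1))); positivity)
    (by
      intro j hj p ξ
      have := D.test_dot_dev η θc r gh v (t - (j + 1)) p ξ
      rwa [show t - (j + 1) + 1 = t - j by omega] at this)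
    (fun j p => norm_nonneg _)
    (by
      intro j hj p ξ
      have h1 := D.test_self_le h0.le hη hv (t - (j + 1))
      have h2 := abs_dotProduct_le (by positivity) zero_le_one h1 (by simpa using D.norm_le ξ.1)
      have h3 : b * D.rate η ^ (t - (j + 1)) ≤ b * 1 := by
        gcongr; exact pow_le_one₀ hr0 hr1
      rw [dotProduct_comm] at h2
      have h4 := D.abs_diff_dot_le_norm ξ (p.2.1 - θc p.1)
      rw [innerNoise, abs_mul, abs_mul, abs_neg, abs_of_pos h0]
      calc η * (|D.Ψ ξ.1 ⬝ᵥ D.test η v (t - (j + 1))| *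
            |(D.Ψ ξ.1 - D.Ψ ξ.2) ⬝ᵥ (p.2.1 - θc p.1)|)
          ≤ η * (b * (2 * ‖D.Ψ *ᵥ (p.2.1 - θc p.1)‖)) := by
            gcongr
            linarith
        _ = _ := by ring)
    (by
      intro j hj p
      have h1 : ∀ ξ, D.innerNoise η θc (D.test η v (t - (j + 1))) p ξ ^ 2 ≤
          (4 * η ^ 2 * ‖D.Ψ *ᵥ (p.2.1 - θc p.1)‖ ^ 2) *
            (D.Ψ ξ.1 ⬝ᵥ D.test η v (t - (j + 1))) ^ 2 := by
        intro ξ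
        have h4 := D.abs_diff_dot_le_norm ξ (p.2.1 - θc p.1)
        have h5 := pow_le_pow_left₀ (abs_nonneg _) h4 2
        rw [sq_abs] at h5
        rw [innerNoise]
        calc _ = η ^ 2 * (D.Ψ ξ.1 ⬝ᵥ D.test η v (t - (j + 1))) ^ 2 *
              ((D.Ψ ξ.1 - D.Ψ ξ.2) ⬝ᵥ (p.2.1 - θc p.1)) ^ 2 := by ring
          _ ≤ η ^ 2 * (D.Ψ ξ.1 ⬝ᵥ D.test η v (t - (j + 1))) ^ 2 *
              (2 * ‖D.Ψ *ᵥ (p.2.1 - θc p.1)‖) ^ 2 := by gcongr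
          _ = _ := by ring
      refine (D.wp.mono h1).trans (le_of_eq ?_)
      rw [D.wp.smul, gram]
      ring)
    (by positivity) hM
    (by
      have h1 := D.test_self_le h0.le hη hv t
      have h2 := hh (D.test η v t) (b * D.rate η ^ t) (by positivity) h1
      refine ⟨h2.1, ?_⟩
      refine le_trans (le_of_eq ?_) h2.2
      simp [Ex.chain, dev])
    (by positivity)
    (by
      have hS : ∑ j ∈ Finset.range t, 4 * η ^ 2 * D.gram (D.test η v (t - (j + 1))) ≤
          4 * η / D.β * b ^ 2 := by
        have e : ∑ j ∈ Finset.range t, 4 * η ^ 2 * D.gram (D.test η v (t - (j + 1))) =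
            4 * η / D.β * (η * D.β * ∑ j ∈ Finset.range t, D.gram (D.test η v j)) := by
          rw [← Finset.mul_sum]
          -- The martingale runs through the test vectors backwards, so the sum is reversed before
          -- telescoping.
          have : ∑ j ∈ Finset.range t, D.gram (D.test η v (t - (j + 1))) =
              ∑ j ∈ Finset.range t, D.gram (D.test η v j) := by
            rw [← Finset.sum_range_reflect (fun j => D.gram (D.test η v j)) t]
            refine Finset.sum_congr rfl fun j _ => ?_
            rw [show t - (j + 1) = t - 1 - j by omega]
          rw [this]
          field_simp
        rw [e]
        have := D.sum_gram_test_le h0.le hη hv t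
        gcongr
      have hq0 : (0 : ℝ) ≤ q := Nat.cast_nonneg q
      have h1 : 6 * q * (9 * W) ^ 2 *
          ∑ j ∈ Finset.range t, 4 * η ^ 2 * D.gram (D.test η v (t - (j + 1))) ≤
          6 * q * (9 * W) ^ 2 * (4 * η / D.β * b ^ 2) := by gcongr
      have h2 := mul_le_mul_of_nonneg_right hηq (by positivity : 0 ≤ b ^ 2 * W ^ 2)
      have h3 : 0 ≤ D.rate η ^ t := by positivity
      calc _ ≤ (b * D.rate η ^ t * W) ^ 2 + ((4 * q * (2 * η * b) * (9 * W)) ^ 2 +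
            6 * q * (9 * W) ^ 2 * (4 * η / D.β * b ^ 2)) := by linarith
        _ = (b * D.rate η ^ t * W) ^ 2 +
            81 * (64 * q ^ 2 * η ^ 2 + 24 * q * η / D.β) * (b ^ 2 * W ^ 2) := by ring
        _ ≤ (b * D.rate η ^ t * W) ^ 2 + κ ^ 2 * (b ^ 2 * W ^ 2) := by linarith
        _ ≤ (b * ((D.rate η ^ t + κ) * W)) ^ 2 := by
          have : 0 ≤ b ^ 2 * W ^ 2 * (D.rate η ^ t * κ) := by positivity
          nlinarith)
  simp only [Nat.sub_self] at h
  exact h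

theorem sum_rate_le (h0 : 0 < η) (hη : 4 * η ≤ D.β) (t : ℕ) :
    ∑ j ∈ Finset.range t, D.rate η ^ j ≤ 2 / (η * D.β * D.μ) := by
  have hβ := D.β_pos
  have hμ := D.μ_pos
  have hx : 0 < η * D.β * D.μ := by positivity
  have h1 := mul_neg_geom_sum (D.rate η) t
  have h2 : 1 - D.rate η = η * D.β * D.μ / 2 := by unfold rate; ring
  have h3 := pow_nonneg (D.rate_bounds h0.le hη).1 t
  rw [h2] at h1
  rw [le_div_iff₀ hx]
  linarith

/-- Minkowski's inequality over the iterates. Their correlation is not exploited, which suffices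
because each stationary fluctuation is already small. -/
theorem innerChain_sum_bd [Fintype Z] [Nonempty Z] {q : ℕ} (hq : 1 ≤ q)
    (hZ : (Fintype.card Z : ℝ) ≤ 9 ^ q) {κ W : ℝ} (hκ0 : 0 ≤ κ) (hκ1 : κ ≤ 1) (h0 : 0 < η)
    (hη : 4 * η ≤ D.β) (hηq : 81 * (64 * q ^ 2 * η ^ 2 + 24 * q * η / D.β) ≤ κ ^ 2)
    (hh : E.WBd q (fun ω => D.A⁻¹ *ᵥ gh ω) W) (t : ℕ) :
    (D.innerChain E η θc r gh t).WBd q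
      (fun p => p.2.2 - (t : ℝ) • (θc p.1 - D.A⁻¹ *ᵥ gh p.1))
      (∑ j ∈ Finset.range t, (D.rate η ^ j + κ) * W) := by
  induction t with
  | zero =>
    intro v b hb hv
    refine ⟨by simp, ?_⟩
    simp only [innerChain, Ex.chain, Ex.map_apply]
    simp only [Finset.range_zero, Finset.sum_empty, Nat.cast_zero, zero_smul, sub_zero,
      dotProduct_zero, mul_zero]
    rw [E.const]
  | succ t ih =>
    intro v b hb hv
    rw [Finset.sum_range_succ, mul_add]
    exact ((ih v b hb hv).add (D.innerChain_dev_bd hq hZ hκ0 hκ1 h0 hη hηq hh t v b hb hv)).chain_succ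
      fun p ξ => D.innerChain_sum_step η θc r gh v t p ξ

end Inner

end TDProblem

namespace TDProblem

variable {Z : Type} {d : ℕ} (D : TDProblem Z d) {Ω : Type}

/-! #### The averaged operator at the center -/

/-- Add the operator at a new sample. -/
def opStep (θc : Fin d → ℝ) (r : ℝ) (acc : Fin d → ℝ) (ξ : Z × Z) : Fin d → ℝ :=
  acc + tdOp D.Ψ D.cost θc r ξ

section Ops

variable (E : Ex Ω) (θc : Ω → Fin d → ℝ) (r : Ω → ℝ)

/-- Law of the sums of operators at the center. -/
def opChain (n : ℕ) : Ex (Ω × (Fin d → ℝ)) :=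
  Ex.chain E D.wp (fun ω => D.opStep (θc ω) (r ω)) (fun _ => 0) n

theorem opChain_fst (n : ℕ) (f : Ω → ℝ) : D.opChain E θc r n (fun p => f p.1) = E f :=
  Ex.chain_fst E D.wp _ _ n f

theorem dot_tdOp (u θ : Fin d → ℝ) (r : ℝ) (ξ : Z × Z) :
    u ⬝ᵥ tdOp D.Ψ D.cost θ r ξ = (D.Ψ ξ.1 ⬝ᵥ u) * (((D.Ψ ξ.1 - D.Ψ ξ.2) ⬝ᵥ (θ - D.θs)) +
      ((D.Ψ ξ.1 - D.Ψ ξ.2) ⬝ᵥ D.θs - D.cost ξ.1 + D.ρ) + (r - D.ρ)) := by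
  rw [tdOp, dotProduct_smul, smul_eq_mul, dotProduct_comm u, dotProduct_sub _ θ]
  ring

/-- The residual at the solution has zero mean against every feature, so an error of the average
cost enters only through the mean feature. -/
theorem wp_dot_tdOp (u θ : Fin d → ℝ) (r : ℝ) :
    D.wp (fun ξ => u ⬝ᵥ tdOp D.Ψ D.cost θ r ξ) =
      u ⬝ᵥ (D.A *ᵥ (θ - D.θs)) + (r - D.ρ) * (u ⬝ᵥ D.meanFeature) := by
  have e : (fun ξ => u ⬝ᵥ tdOp D.Ψ D.cost θ r ξ) = fun ξ =>
      ((D.Ψ ξ.1 ⬝ᵥ u) * ((D.Ψ ξ.1 - D.Ψ ξ.2) ⬝ᵥ (θ - D.θs)) +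
        (D.Ψ ξ.1 ⬝ᵥ u) * ((D.Ψ ξ.1 - D.Ψ ξ.2) ⬝ᵥ D.θs - D.cost ξ.1 + D.ρ)) +
      (r - D.ρ) * (D.Ψ ξ.1 ⬝ᵥ u) := by
    funext ξ
    rw [dot_tdOp]
    ring
  rw [e, D.wp.add, D.wp.add, D.dot_A, D.dot_meanFeature, D.fixed, ← D.wp.smul, add_zero]

theorem opChain_step (u : Fin d → ℝ) (c : ℝ) (j : ℕ) (p : Ω × (Fin d → ℝ)) (ξ : Z × Z) :
    c * (u ⬝ᵥ D.opStep (θc p.1) (r p.1) p.2 ξ) - ((j + 1 : ℕ) : ℝ) * c *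
        (u ⬝ᵥ (D.A *ᵥ (θc p.1 - D.θs)) + (r p.1 - D.ρ) * (u ⬝ᵥ D.meanFeature)) =
      (c * (u ⬝ᵥ p.2) - (j : ℝ) * c *
        (u ⬝ᵥ (D.A *ᵥ (θc p.1 - D.θs)) + (r p.1 - D.ρ) * (u ⬝ᵥ D.meanFeature))) +
      (c * (u ⬝ᵥ tdOp D.Ψ D.cost (θc p.1) (r p.1) ξ) -
        D.wp (fun ξ => c * (u ⬝ᵥ tdOp D.Ψ D.cost (θc p.1) (r p.1) ξ))) := by
  rw [D.wp.smul, D.wp_dot_tdOp, opStep, dotProduct_add]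
  push_cast
  ring

theorem opChain_mean (u : Fin d → ℝ) {n : ℕ} (hn : n ≠ 0) :
    D.opChain E θc r n (fun p => u ⬝ᵥ ((n : ℝ)⁻¹ • p.2) -
        (u ⬝ᵥ (D.A *ᵥ (θc p.1 - D.θs)) + (r p.1 - D.ρ) * (u ⬝ᵥ D.meanFeature))) = 0 := by
  have hn' : (n : ℝ) ≠ 0 := Nat.cast_ne_zero.2 hn
  have h := Ex.chain_martingale_mean (E := E) (w := D.wp)
    (step := fun ω => D.opStep (θc ω) (r ω)) (i := fun _ => 0) (t := n)
    (Y := fun j p => (n : ℝ)⁻¹ * (u ⬝ᵥ p.2) - (j : ℝ) * (n : ℝ)⁻¹ *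
        (u ⬝ᵥ (D.A *ᵥ (θc p.1 - D.θs)) + (r p.1 - D.ρ) * (u ⬝ᵥ D.meanFeature)))
    (f := fun _ p ξ => (n : ℝ)⁻¹ * (u ⬝ᵥ tdOp D.Ψ D.cost (θc p.1) (r p.1) ξ))
    (fun j _ p ξ => D.opChain_step θc r u (n : ℝ)⁻¹ j p ξ)
  simp only [mul_inv_cancel₀ hn', one_mul, Nat.cast_zero, zero_mul, dotProduct_zero, mul_zero,
    sub_zero, E.const] at h
  simp only [dotProduct_smul, smul_eq_mul]
  exact h

variable {E θc r}

theorem opChain_fst_bd {q : ℕ} {f : Ω → ℝ} {C : ℝ} (h : E.Bd q f C) (n : ℕ) :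
    (D.opChain E θc r n).Bd q (fun p => f p.1) C :=
  h.chain_fst D.wp _ _ n

theorem opChain_fst_wbd {q : ℕ} {f : Ω → Fin d → ℝ} {C : ℝ} (h : E.WBd q f C) (n : ℕ) :
    (D.opChain E θc r n).WBd q (fun p => f p.1) C :=
  h.chain_fst D.wp _ _ n

/-- A martingale whose increments scale with 2‖Ψ(θ_c - θ*)‖ + G + |r - ρ|. The last two terms have
norm at most G each and the sup norm costs a factor 3, which gives 6W + 2G. -/
theorem opChain_bd [Fintype Z] [Nonempty Z] {q : ℕ} (hq : 1 ≤ q)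
    (hZ : (Fintype.card Z : ℝ) ≤ 9 ^ q) {W : ℝ} (hθ : E.WBd q (fun ω => θc ω - D.θs) W)
    (hr : E.Bd q (fun ω => r ω - D.ρ) D.G) {u : Fin d → ℝ} {su bu R : ℝ}
    (hsu : D.gram u ≤ su) (hbu0 : 0 ≤ bu) (hbu : u ⬝ᵥ u ≤ bu ^ 2) {n : ℕ} (hn : n ≠ 0)
    (hR0 : 0 ≤ R)
    (hR : (6 * W + 2 * D.G) ^ 2 * ((4 * q * bu / n) ^ 2 + 6 * q * su / n) ≤ R ^ 2) :
    (D.opChain E θc r n).Bd q (fun p => u ⬝ᵥ ((n : ℝ)⁻¹ • p.2) -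
      (u ⬝ᵥ (D.A *ᵥ (θc p.1 - D.θs)) + (r p.1 - D.ρ) * (u ⬝ᵥ D.meanFeature))) R := by
  have hn' : (n : ℝ) ≠ 0 := Nat.cast_ne_zero.2 hn
  have hn0 : (0 : ℝ) < n := by positivity
  have hsu0 : 0 ≤ su := (D.gram_nonneg u).trans hsu
  have hG := D.G_nonneg
  have hW := hθ.nonneg
  set m : Ω × (Fin d → ℝ) → ℝ := fun p =>
    2 * ‖D.Ψ *ᵥ (θc p.1 - D.θs)‖ + D.G + |r p.1 - D.ρ| with hm
  have hm0 : ∀ p, 0 ≤ m p := fun p => by simp only [hm]; positivity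
  have hf : ∀ p : Ω × (Fin d → ℝ), ∀ ξ : Z × Z, |(D.Ψ ξ.1 - D.Ψ ξ.2) ⬝ᵥ (θc p.1 - D.θs) +
      ((D.Ψ ξ.1 - D.Ψ ξ.2) ⬝ᵥ D.θs - D.cost ξ.1 + D.ρ) + (r p.1 - D.ρ)| ≤ m p := by
    intro p ξ
    refine (abs_add_three _ _ _).trans ?_
    have h1 := D.abs_diff_dot_le_norm ξ (θc p.1 - D.θs)
    have h2 := D.residual ξ
    simp only [hm]
    linarith
  have h := Ex.Bd.chain_martingale (E := E) (w := D.wp) (q := q)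
    (step := fun ω => D.opStep (θc ω) (r ω)) (i := fun _ => 0) (t := n)
    (Y := fun j p => (n : ℝ)⁻¹ * (u ⬝ᵥ p.2) - (j : ℝ) * (n : ℝ)⁻¹ *
        (u ⬝ᵥ (D.A *ᵥ (θc p.1 - D.θs)) + (r p.1 - D.ρ) * (u ⬝ᵥ D.meanFeature)))
    (f := fun _ p ξ => (n : ℝ)⁻¹ * (u ⬝ᵥ tdOp D.Ψ D.cost (θc p.1) (r p.1) ξ))
    (m := fun _ => m) (s := fun _ => (n : ℝ)⁻¹ ^ 2 * su) (B := (n : ℝ)⁻¹ * bu)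
    (M := 6 * W + 2 * D.G) (y₀ := 0) (R := R) hq (by positivity) (fun _ => by positivity)
    (fun j _ p ξ => D.opChain_step θc r u (n : ℝ)⁻¹ j p ξ) (fun _ => hm0)
    (by
      intro j _ p ξ
      have h2 := abs_dotProduct_le zero_le_one hbu0 (by simpa using D.norm_le ξ.1) hbu
      rw [D.dot_tdOp, abs_mul, abs_mul, abs_of_pos (by positivity : 0 < (n : ℝ)⁻¹), mul_assoc]
      have := hf p ξ
      have := hm0 p
      gcongr
      linarith)
    (by
      intro j _ p
      have h1 : ∀ ξ, ((n : ℝ)⁻¹ * (u ⬝ᵥ tdOp D.Ψ D.cost (θc p.1) (r p.1) ξ)) ^ 2 ≤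
          ((n : ℝ)⁻¹ ^ 2 * m p ^ 2) * (D.Ψ ξ.1 ⬝ᵥ u) ^ 2 := by
        intro ξ
        have h5 := pow_le_pow_left₀ (abs_nonneg _) (hf p ξ) 2
        rw [sq_abs] at h5
        rw [D.dot_tdOp, mul_pow, mul_pow]
        calc _ ≤ (n : ℝ)⁻¹ ^ 2 * ((D.Ψ ξ.1 ⬝ᵥ u) ^ 2 * m p ^ 2) := by gcongr
          _ = _ := by ring
      refine (D.wp.mono h1).trans ?_
      rw [D.wp.smul]
      calc (n : ℝ)⁻¹ ^ 2 * m p ^ 2 * D.gram u ≤ (n : ℝ)⁻¹ ^ 2 * m p ^ 2 * su := by gcongr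
        _ = _ := by ring)
    (by positivity)
    (by
      intro j _
      have h1 := (((hθ.norm_mulVec D.norm_le hZ).smul 2).add
        (Ex.Bd.const E q (abs_of_nonneg hG).le)).add hr.abs
      refine (h1.chain_fst D.wp (fun ω => D.opStep (θc ω) (r ω)) (fun _ => 0) j).mono ?_
      rw [abs_two]
      linarith)
    (by
      have := Ex.Bd.const (Ex.chain E D.wp (fun ω => D.opStep (θc ω) (r ω)) (fun _ => 0) 0) q
        (c := 0) (C := 0) (by simp)
      refine ⟨le_rfl, le_trans (le_of_eq ?_) this.2⟩
      simp [Ex.chain])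
    hR0
    (by
      refine le_trans (le_of_eq ?_) hR
      simp only [Finset.sum_const, Finset.card_range, nsmul_eq_mul]
      field_simp
      ring)
  refine h.congr fun p => ?_
  rw [dotProduct_smul, smul_eq_mul, mul_inv_cancel₀ hn', one_mul]

end Ops

/-! #### The estimate of the average cost -/

/-- Add a new cost. -/
def costStep (acc : ℝ) (z : Z) : ℝ := acc + D.cost z

section Costs

variable (E : Ex Ω)

/-- Law of the sums of costs. -/
def costChain (n : ℕ) : Ex (Ω × ℝ) :=
  Ex.chain E D.wc (fun _ => D.costStep) (fun _ => 0) n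

theorem costChain_step (c : ℝ) (j : ℕ) (p : Ω × ℝ) (z : Z) :
    D.costStep p.2 z * c - ((j + 1 : ℕ) : ℝ) * c * D.ρ = (p.2 * c - (j : ℝ) * c * D.ρ) +
      (c * (D.cost z - D.ρ) - D.wc fun z => c * (D.cost z - D.ρ)) := by
  rw [D.wc.smul, D.wc.sub, D.wc.const, D.cost_mean, costStep]
  push_cast
  ring

theorem costChain_mean {n : ℕ} (hn : n ≠ 0) :
    D.costChain E n (fun p => p.2 / n - D.ρ) = 0 := by
  have hn' : (n : ℝ) ≠ 0 := Nat.cast_ne_zero.2 hn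
  have h := Ex.chain_martingale_mean (E := E) (w := D.wc) (step := fun _ => D.costStep)
    (i := fun _ => 0) (t := n) (Y := fun j p => p.2 * (n : ℝ)⁻¹ - (j : ℝ) * (n : ℝ)⁻¹ * D.ρ)
    (f := fun _ _ z => (n : ℝ)⁻¹ * (D.cost z - D.ρ))
    (fun j _ p ξ => D.costChain_step (n : ℝ)⁻¹ j p ξ)
  simp only [mul_inv_cancel₀ hn', one_mul, Nat.cast_zero, zero_mul, sub_zero, E.const] at h
  exact h

theorem costChain_bd [Nonempty Z] {q : ℕ} (hq : 1 ≤ q) {n : ℕ} (hn : n ≠ 0) {R : ℝ} (hR0 : 0 ≤ R)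
    (hR : D.G ^ 2 * ((4 * q / n) ^ 2 + 6 * q / n) ≤ R ^ 2) :
    (D.costChain E n).Bd q (fun p => p.2 / n - D.ρ) R := by
  have hn' : (n : ℝ) ≠ 0 := Nat.cast_ne_zero.2 hn
  have hn0 : (0 : ℝ) < n := by positivity
  have hG := D.G_nonneg
  have h := Ex.Bd.chain_martingale (E := E) (w := D.wc) (q := q) (step := fun _ => D.costStep)
    (i := fun _ => 0) (t := n) (Y := fun j p => p.2 * (n : ℝ)⁻¹ - (j : ℝ) * (n : ℝ)⁻¹ * D.ρ)
    (f := fun _ _ z => (n : ℝ)⁻¹ * (D.cost z - D.ρ)) (m := fun _ _ => D.G)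
    (s := fun _ => (n : ℝ)⁻¹ ^ 2) (B := (n : ℝ)⁻¹) (M := D.G) (y₀ := 0) (R := R) hq
    (by positivity) (fun _ => by positivity) (fun j _ p ξ => D.costChain_step (n : ℝ)⁻¹ j p ξ)
    (fun _ _ => hG)
    (by
      intro j _ p z
      rw [abs_mul, abs_of_pos (by positivity : 0 < (n : ℝ)⁻¹)]
      gcongr
      exact D.cost_le z)
    (by
      intro j _ p
      refine (D.wc.mono (g := fun _ => (n : ℝ)⁻¹ ^ 2 * D.G ^ 2) fun z => ?_).trans (le_of_eq ?_)
      · rw [mul_pow]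
        have h5 := pow_le_pow_left₀ (abs_nonneg _) (D.cost_le z) 2
        rw [sq_abs] at h5
        gcongr
      · rw [D.wc.const])
    hG (fun _ _ => Ex.Bd.const _ q (abs_of_nonneg hG).le)
    (by
      have := Ex.Bd.const (Ex.chain E D.wc (fun _ => D.costStep) (fun _ => 0) 0) q
        (c := 0) (C := 0) (by simp)
      refine ⟨le_rfl, le_trans (le_of_eq ?_) this.2⟩
      simp [Ex.chain])
    hR0
    (by
      refine le_trans (le_of_eq ?_) hR
      simp only [Finset.sum_const, Finset.card_range, nsmul_eq_mul]
      field_simp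
      ring)
  refine h.congr fun p => ?_
  rw [mul_inv_cancel₀ hn', one_mul, div_eq_mul_inv]

end Costs

/-! #### One epoch -/

/-- Law of the output of an epoch with independent samples, from the center `θc`. -/
def epochEx (η : ℝ) (n' n T : ℕ) (θc : Fin d → ℝ) : Ex (Fin d → ℝ) :=
  (Ex.loop D.wc D.costStep n' 0).bind fun a =>
    (Ex.loop D.wp (D.opStep θc (a / n')) n 0).bind fun g =>
      (Ex.loop D.wp (D.innerStep η θc (a / n') ((n : ℝ)⁻¹ • g)) T (θc, 0)).map
        fun v => (T : ℝ)⁻¹ • v.2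

/-- Joint law of the quantities of an epoch whose center has law `E`. -/
def epochChain (E : Ex (Fin d → ℝ)) (η : ℝ) (n' n T : ℕ) :
    Ex ((((Fin d → ℝ) × ℝ) × (Fin d → ℝ)) × ((Fin d → ℝ) × (Fin d → ℝ))) :=
  D.innerChain (D.opChain (D.costChain E n') (fun ω => ω.1) (fun ω => ω.2 / n') n) η
    (fun ω => ω.1.1) (fun ω => ω.1.2 / n') (fun ω => (n : ℝ)⁻¹ • ω.2) T

/-- The program nests its random choices and forgets intermediate quantities; the chain on the right
retains the center, the cost estimate, the batch and the iterates, so that all of them can occur in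
one expectation. -/
theorem bind_epochEx_apply (E : Ex (Fin d → ℝ)) (η : ℝ) (n' n T : ℕ) (f : (Fin d → ℝ) → ℝ) :
    E.bind (D.epochEx η n' n T) f = D.epochChain E η n' n T fun p => f ((T : ℝ)⁻¹ • p.2.2) := by
  rw [epochChain, innerChain, Ex.chain_apply, opChain, Ex.chain_apply, costChain, Ex.chain_apply]
  rfl

/-- With x the center and h = A⁻¹ĝ, the fixed point of the expected inner update is x - h. The
output error splits into the error of this point and the mean deviation from it. -/
theorem dot_output_eq {T : ℕ} (hT : T ≠ 0) (v θ x h acc : Fin d → ℝ) :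
    v ⬝ᵥ ((T : ℝ)⁻¹ • acc - θ) =
      v ⬝ᵥ (x - θ - h) + (T : ℝ)⁻¹ * (v ⬝ᵥ (acc - (T : ℝ) • (x - h))) := by
  have hT' : (T : ℝ) ≠ 0 := Nat.cast_ne_zero.2 hT
  rw [← smul_eq_mul, ← dotProduct_smul, ← dotProduct_add]
  congr 1
  rw [smul_sub, smul_smul, inv_mul_cancel₀ hT', one_smul]
  abel

/-- Testing against the dual vector cancels θ_c - θ* exactly. What remains is the batch noise and
the error of the cost estimate, which is the effect of variance reduction. -/
theorem dot_center_eq (v θc g : Fin d → ℝ) (r : ℝ) :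
    v ⬝ᵥ (θc - D.θs - D.A⁻¹ *ᵥ g) = -(D.dual v ⬝ᵥ g -
      (D.dual v ⬝ᵥ (D.A *ᵥ (θc - D.θs)) + (r - D.ρ) * (D.dual v ⬝ᵥ D.meanFeature))) -
      (D.dual v ⬝ᵥ D.meanFeature) * (r - D.ρ) := by
  rw [dual_dot_A, D.dual_dot v g, dotProduct_sub v (θc - D.θs)]
  ring

/-- Error of the expected output of an epoch. -/
theorem epoch_bias {E : Ex (Fin d → ℝ)} {η : ℝ} {n' n T : ℕ} (h0 : 0 < η) (hη : 4 * η ≤ D.β)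
    (hn' : n' ≠ 0) (hn : n ≠ 0) (hT : T ≠ 0) {W κ : ℝ} (hW0 : 0 ≤ W)
    (hW : E.LBd (fun θ => θ - D.θs) W) (hκ : 2 / (η * D.β * D.μ) ≤ κ * T) :
    (E.bind (D.epochEx η n' n T)).LBd (fun θ => θ - D.θs) (κ * W) := by
  intro v b hb hv
  rw [D.bind_epochEx_apply]
  set E1 := D.costChain E n' with hE1
  set E2 := D.opChain E1 (fun ω => ω.1) (fun ω => ω.2 / n') n with hE2
  have hδ : E1 (fun ω => ω.2 / n' - D.ρ) = 0 := D.costChain_mean E hn'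
  -- Both noises have mean zero, so the fixed point of the inner update is an unbiased estimate of
  -- the solution.
  have hx : ∀ v : Fin d → ℝ,
      E2 (fun ω => v ⬝ᵥ (ω.1.1 - D.θs - D.A⁻¹ *ᵥ ((n : ℝ)⁻¹ • ω.2))) = 0 := by
    intro v
    have h1 := D.opChain_mean E1 (fun ω => ω.1) (fun ω => ω.2 / n') (D.dual v) hn
    have h2 : E2 (fun ω => ω.1.2 / n' - D.ρ) = 0 := by
      rw [← hδ]
      exact D.opChain_fst E1 _ _ n fun ω => ω.2 / n' - D.ρ
    have e : (fun ω : ((Fin d → ℝ) × ℝ) × (Fin d → ℝ) =>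
        v ⬝ᵥ (ω.1.1 - D.θs - D.A⁻¹ *ᵥ ((n : ℝ)⁻¹ • ω.2))) = fun ω =>
        (-1) * (D.dual v ⬝ᵥ ((n : ℝ)⁻¹ • ω.2) - (D.dual v ⬝ᵥ (D.A *ᵥ (ω.1.1 - D.θs)) +
          (ω.1.2 / n' - D.ρ) * (D.dual v ⬝ᵥ D.meanFeature))) -
        (D.dual v ⬝ᵥ D.meanFeature) * (ω.1.2 / n' - D.ρ) := by
      funext ω
      rw [D.dot_center_eq v ω.1.1 ((n : ℝ)⁻¹ • ω.2) (ω.1.2 / n')]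
      ring
    rw [e, E2.sub, E2.smul, E2.smul, h2]
    have h1' : E2 (fun ω => D.dual v ⬝ᵥ ((n : ℝ)⁻¹ • ω.2) -
      (D.dual v ⬝ᵥ (D.A *ᵥ (ω.1.1 - D.θs)) +
          (ω.1.2 / n' - D.ρ) * (D.dual v ⬝ᵥ D.meanFeature))) = 0 := h1
    rw [h1']
    ring
  -- Equivalently, A⁻¹ĝ has the same mean as the error of the center.
  have hE : ∀ v : Fin d → ℝ, E2 (fun ω => v ⬝ᵥ (D.A⁻¹ *ᵥ ((n : ℝ)⁻¹ • ω.2))) =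
      E fun θ => v ⬝ᵥ (θ - D.θs) := by
    intro v
    have h1 := hx v
    have e : (fun ω : ((Fin d → ℝ) × ℝ) × (Fin d → ℝ) =>
        v ⬝ᵥ (ω.1.1 - D.θs - D.A⁻¹ *ᵥ ((n : ℝ)⁻¹ • ω.2))) = fun ω =>
        v ⬝ᵥ (ω.1.1 - D.θs) - v ⬝ᵥ (D.A⁻¹ *ᵥ ((n : ℝ)⁻¹ • ω.2)) := by
      funext ω
      rw [dotProduct_sub]
    rw [e, E2.sub] at h1
    have h2 : E2 (fun ω => v ⬝ᵥ (ω.1.1 - D.θs)) = E fun θ => v ⬝ᵥ (θ - D.θs) := by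
      rw [hE2, opChain, Ex.chain_fst _ _ _ _ _ (fun ω : (Fin d → ℝ) × ℝ => v ⬝ᵥ (ω.1 - D.θs)),
        hE1, costChain, Ex.chain_fst _ _ _ _ _ (fun θ : Fin d → ℝ => v ⬝ᵥ (θ - D.θs))]
    linarith
  have e1 := D.innerChain_sum_mean E2 η (fun ω => ω.1.1) (fun ω => ω.1.2 / n')
    (fun ω => (n : ℝ)⁻¹ • ω.2) v T
  -- The mean output error is the average over j of (I - ηA)^j applied to the mean initial error,
  -- and the geometric sum of the rates is at most 2/(ηβμ).
  have e2 : D.epochChain E η n' n T (fun p => v ⬝ᵥ ((T : ℝ)⁻¹ • p.2.2 - D.θs)) =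
      (T : ℝ)⁻¹ * ∑ j ∈ Finset.range T, E fun θ => D.test η v j ⬝ᵥ (θ - D.θs) := by
    have e : (fun p : (((Fin d → ℝ) × ℝ) × (Fin d → ℝ)) × ((Fin d → ℝ) × (Fin d → ℝ)) =>
        v ⬝ᵥ ((T : ℝ)⁻¹ • p.2.2 - D.θs)) = fun p =>
        v ⬝ᵥ (p.1.1.1 - D.θs - D.A⁻¹ *ᵥ ((n : ℝ)⁻¹ • p.1.2)) + (T : ℝ)⁻¹ *
          (v ⬝ᵥ (p.2.2 - (T : ℝ) • (p.1.1.1 - D.A⁻¹ *ᵥ ((n : ℝ)⁻¹ • p.1.2)))) := by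
      funext p
      exact dot_output_eq hT _ _ _ _ _
    rw [e, Ex.add, Ex.smul]
    have h3 : D.epochChain E η n' n T
        (fun p => v ⬝ᵥ (p.1.1.1 - D.θs - D.A⁻¹ *ᵥ ((n : ℝ)⁻¹ • p.1.2))) = 0 := by
      rw [← hx v]
      exact D.innerChain_fst E2 η _ _ _ T
        fun ω => v ⬝ᵥ (ω.1.1 - D.θs - D.A⁻¹ *ᵥ ((n : ℝ)⁻¹ • ω.2))
    rw [h3, zero_add]
    congr 1
    refine e1.trans (Finset.sum_congr rfl fun j _ => ?_)
    exact hE _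
  rw [e2, abs_mul]
  have hT0 : (0 : ℝ) < T := by positivity
  rw [abs_of_pos (by positivity : (0 : ℝ) < (T : ℝ)⁻¹)]
  have h4 : |∑ j ∈ Finset.range T, E fun θ => D.test η v j ⬝ᵥ (θ - D.θs)| ≤
      ∑ j ∈ Finset.range T, (b * D.rate η ^ j) * W := by
    refine (Finset.abs_sum_le_sum_abs _ _).trans (Finset.sum_le_sum fun j _ => ?_)
    have := (D.rate_bounds h0.le hη).1
    exact hW _ _ (by positivity) (D.test_self_le h0.le hη hv j)
  rw [← Finset.sum_mul, ← Finset.mul_sum] at h4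
  have h5 := (D.sum_rate_le h0 hη T).trans hκ
  calc (T : ℝ)⁻¹ * |∑ j ∈ Finset.range T, E fun θ => D.test η v j ⬝ᵥ (θ - D.θs)|
      ≤ (T : ℝ)⁻¹ * (b * (κ * T) * W) := by
        refine mul_le_mul_of_nonneg_left (h4.trans ?_) (by positivity)
        gcongr
    _ = b * (κ * W) := by field_simp

/-- Error of the fixed point of the expected inner update. -/
theorem epoch_center_bd [Fintype Z] [Nonempty Z] {q : ℕ} (hq : 1 ≤ q)
    (hZ : (Fintype.card Z : ℝ) ≤ 9 ^ q) {E : Ex (Fin d → ℝ)} {n' n : ℕ}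
    (hn' : 200000000 * q / (D.β ^ 2 * D.μ) ≤ n') (hn : 200000000 * q / (D.β ^ 2 * D.μ) ≤ n)
    {W : ℝ} (hW : E.WBd q (fun θ => θ - D.θs) W) :
    (D.opChain (D.costChain E n') (fun ω => ω.1) (fun ω => ω.2 / n') n).WBd q
      (fun ω => ω.1.1 - D.θs - D.A⁻¹ *ᵥ ((n : ℝ)⁻¹ • ω.2)) ((W + D.G) / 400) := by
  have hβ := D.β_pos
  have hμ := D.μ_pos
  have hG := D.G_nonneg
  have hW0 := hW.nonneg
  have hq1 : (1 : ℝ) ≤ q := by exact_mod_cast hq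
  have hx : 0 < D.β ^ 2 * D.μ := by positivity
  have hx1 : D.β ^ 2 * D.μ ≤ 1 := by
    have := D.β_le
    have := D.μ_le
    calc D.β ^ 2 * D.μ ≤ 1 ^ 2 * 1 := by gcongr
      _ = 1 := by norm_num
  have hnpos : ∀ k : ℕ, 200000000 * q / (D.β ^ 2 * D.μ) ≤ k → 200000000 * (q : ℝ) ≤ k := by
    intro k hk
    refine le_trans ?_ hk
    rw [le_div_iff₀ hx]
    nlinarith
  have hnR := hnpos n hn
  have hnR' := hnpos n' hn'
  have hn0 : (0 : ℝ) < n := by linarith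
  have hn0' : (0 : ℝ) < n' := by linarith
  have hne : n ≠ 0 := by rintro rfl; simp at hn0
  have hne' : n' ≠ 0 := by rintro rfl; simp at hn0'
  set E1 := D.costChain E n' with hE1
  have hδ : ∀ R : ℝ, 0 ≤ R → D.G ^ 2 * (7 * q / n') ≤ R ^ 2 →
      E1.Bd q (fun ω => ω.2 / n' - D.ρ) R := by
    intro R hR0 hR
    refine D.costChain_bd E hq hne' hR0 (le_trans ?_ hR)
    gcongr
    have h1 : (q : ℝ) / n' ≤ 1 / 200000000 := by
      rw [div_le_div_iff₀ hn0' (by norm_num)]; linarith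
    have h2 : 0 ≤ (q : ℝ) / n' := by positivity
    have e1 : (4 * (q : ℝ) / n') ^ 2 + 6 * q / n' = 16 * (q / n') ^ 2 + 6 * (q / n') := by ring
    have e2 : 7 * (q : ℝ) / n' = 7 * (q / n') := by ring
    rw [e1, e2]
    nlinarith
  -- A crude bound of the cost estimate, enough for the size of the increments in the batch. The
  -- sharp one is used below for the direct contribution.
  have hδG : E1.Bd q (fun ω => ω.2 / n' - D.ρ) D.G := hδ D.G hG (by
    have h1 : 7 * (q : ℝ) / n' ≤ 1 := by
      rw [div_le_one hn0']; linarith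
    nlinarith [sq_nonneg D.G])
  have hW1 : E1.WBd q (fun ω => ω.1 - D.θs) W := hW.chain_fst D.wc _ _ n'
  intro v b hb hv
  have hgram := D.gram_dual_le hv
  have hself := D.dual_dot_self_le hv
  have h1 := D.opChain_bd (E := E1) (θc := fun ω => ω.1) (r := fun ω => ω.2 / n') hq hZ hW1 hδG
    (u := D.dual v) (R := b * ((6 * W + 2 * D.G) / 4000)) hgram (by positivity) hself hne
    (by positivity) (by
      -- With k = 1/(2·10⁸) one has 16k² + 6k ≤ 1/4000², which fixes the constant of the batch
      -- sizes.
      have hk : q / (D.β ^ 2 * D.μ) / n ≤ 1 / 200000000 := by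
        rw [div_le_div_iff₀ hn0 (by norm_num)]
        have := hn
        rw [mul_div_assoc] at this
        linarith
      have hk' : q / (D.β * D.μ) / n ≤ 1 / 200000000 := by
        refine le_trans ?_ hk
        gcongr
        have := D.β_le
        nlinarith [mul_pos hβ hμ]
      have hk0 : 0 ≤ q / (D.β * D.μ) / n := by positivity
      have e : (4 * q * (b / (D.β * D.μ)) / n) ^ 2 + 6 * q * (b ^ 2 / (D.β ^ 2 * D.μ)) / n =
          b ^ 2 * (16 * (q / (D.β * D.μ) / n) ^ 2 + 6 * (q / (D.β ^ 2 * D.μ) / n)) := by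
        ring
      rw [e]
      have hle : 16 * (q / (D.β * D.μ) / n) ^ 2 + 6 * (q / (D.β ^ 2 * D.μ) / n) ≤
          (1 / 4000) ^ 2 := by nlinarith
      calc _ ≤ (6 * W + 2 * D.G) ^ 2 * (b ^ 2 * (1 / 4000) ^ 2) := by gcongr
        _ = _ := by ring)
  have h2 : E1.Bd q (fun ω => (D.dual v ⬝ᵥ D.meanFeature) * (ω.2 / n' - D.ρ))
      (b * (D.G / 4000)) := by
    -- The square of a mean is at most the mean of the square, so the mean feature is controlled by
    -- the same quadratic form as the noise.
    have hmf : |D.dual v ⬝ᵥ D.meanFeature| ^ 2 ≤ b ^ 2 / (D.β ^ 2 * D.μ) := by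
      refine le_trans ?_ hgram
      rw [D.dot_meanFeature, gram, sq_abs]
      have hh := D.wp.variance_le fun ξ => D.Ψ ξ.1 ⬝ᵥ D.dual v
      have h3 : 0 ≤ D.wp fun ξ => ((D.Ψ ξ.1 ⬝ᵥ D.dual v) -
          D.wp fun ξ => D.Ψ ξ.1 ⬝ᵥ D.dual v) ^ 2 := D.wp.nonneg fun _ => sq_nonneg _
      have e : D.wp (fun ξ => ((D.Ψ ξ.1 ⬝ᵥ D.dual v) -
          D.wp fun ξ => D.Ψ ξ.1 ⬝ᵥ D.dual v) ^ 2) = D.wp (fun ξ => (D.Ψ ξ.1 ⬝ᵥ D.dual v) ^ 2) -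
          (D.wp fun ξ => D.Ψ ξ.1 ⬝ᵥ D.dual v) ^ 2 := by
        have : (fun ξ => ((D.Ψ ξ.1 ⬝ᵥ D.dual v) -
            D.wp fun ξ => D.Ψ ξ.1 ⬝ᵥ D.dual v) ^ 2) = fun ξ : Z × Z =>
            ((D.Ψ ξ.1 ⬝ᵥ D.dual v) ^ 2 - (2 * D.wp fun ξ => D.Ψ ξ.1 ⬝ᵥ D.dual v) *
            (D.Ψ ξ.1 ⬝ᵥ D.dual v)) + (D.wp fun ξ => D.Ψ ξ.1 ⬝ᵥ D.dual v) ^ 2 := by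
          funext ξ; ring
        rw [this, D.wp.add, D.wp.sub, D.wp.smul, D.wp.const]
        ring
      linarith
    set c := |D.dual v ⬝ᵥ D.meanFeature| with hc
    have hc0 : 0 ≤ c := abs_nonneg _
    set R := D.G * Real.sqrt (7 * q / n') with hRdef
    have hRb := hδ R (by positivity) (by
      rw [hRdef, mul_pow, Real.sq_sqrt (by positivity)])
    refine (hRb.smul (D.dual v ⬝ᵥ D.meanFeature)).mono ?_
    apply le_of_sq_le_sq _ (by positivity)
    rw [← hc, hRdef, mul_pow, mul_pow, Real.sq_sqrt (by positivity)]
    have hk : q / (D.β ^ 2 * D.μ) / n' ≤ 1 / 200000000 := by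
      rw [div_le_div_iff₀ hn0' (by norm_num)]
      have := hn'
      rw [mul_div_assoc] at this
      linarith
    calc c ^ 2 * (D.G ^ 2 * (7 * q / n')) ≤
          b ^ 2 / (D.β ^ 2 * D.μ) * (D.G ^ 2 * (7 * q / n')) := by gcongr
      _ = 7 * b ^ 2 * D.G ^ 2 * (q / (D.β ^ 2 * D.μ) / n') := by field_simp
      _ ≤ 7 * b ^ 2 * D.G ^ 2 * (1 / 200000000) := by gcongr
      _ ≤ (b * (D.G / 4000)) ^ 2 := by
        have : 0 ≤ b ^ 2 * D.G ^ 2 := by positivity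
        nlinarith
  have h3 := h1.neg.sub (D.opChain_fst_bd h2 n)
  refine Ex.Bd.mono (h3.congr fun ω => ?_) ?_
  · exact D.dot_center_eq v ω.1.1 ((n : ℝ)⁻¹ • ω.2) (ω.1.2 / n')
  · have : b * (W + D.G) / 400 - (b * ((6 * W + 2 * D.G) / 4000) + b * (D.G / 4000)) =
      b * ((4 * W + 7 * D.G) / 4000) := by ring
    have h5 : 0 ≤ b * ((4 * W + 7 * D.G) / 4000) := by positivity
    linarith

/-- The factor 1/400 consists of 1/800 for the transient, since 2/(ηβμ) ≤ T/800, and of the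
fluctuation κ = 1/800. -/
theorem innerChain_output_bd [Fintype Z] [Nonempty Z] {q : ℕ} (hq : 1 ≤ q)
    (hZ : (Fintype.card Z : ℝ) ≤ 9 ^ q) {E : Ex Ω} {η : ℝ} {T : ℕ} {θc gh : Ω → Fin d → ℝ}
    {r : Ω → ℝ} (h0 : 0 < η) (hη : 4 * η ≤ D.β)
    (hηq : 81 * (64 * q ^ 2 * η ^ 2 + 24 * q * η / D.β) ≤ (1 / 800) ^ 2)
    (hT : 1600 / (η * D.β * D.μ) ≤ T) {C W : ℝ}
    (hcenter : E.WBd q (fun ω => θc ω - D.θs - D.A⁻¹ *ᵥ gh ω) C)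
    (hh : E.WBd q (fun ω => D.A⁻¹ *ᵥ gh ω) W) :
    (D.innerChain E η θc r gh T).WBd q (fun p => (T : ℝ)⁻¹ • p.2.2 - D.θs) (C + W / 400) := by
  have hβ := D.β_pos
  have hμ := D.μ_pos
  have hW0 := hh.nonneg
  have hT0 : (0 : ℝ) < T := lt_of_lt_of_le (by positivity) hT
  have hTne : T ≠ 0 := by rintro rfl; simp at hT0
  intro v b hb hv
  have h1 := D.innerChain_sum_bd (θc := θc) (r := r) hq hZ (κ := 1 / 800) (by norm_num)
    (by norm_num) h0 hη hηq hh T v b hb hv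
  have h2 := D.innerChain_fst_wbd (η := η) (θc := θc) (r := r) (gh := gh) hcenter T v b hb hv
  have h3 := h2.add (h1.smul (T : ℝ)⁻¹)
  refine Ex.Bd.mono (h3.congr fun p => dot_output_eq hTne _ _ _ _ _) ?_
  rw [abs_of_pos (by positivity : (0 : ℝ) < (T : ℝ)⁻¹), mul_add]
  have h8 : ∑ j ∈ Finset.range T, (D.rate η ^ j + 1 / 800) * W ≤ T * (W / 400) := by
    rw [← Finset.sum_mul, Finset.sum_add_distrib]
    simp only [Finset.sum_const, Finset.card_range, nsmul_eq_mul]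
    have h9 := D.sum_rate_le h0 hη T
    have h10 : 2 / (η * D.β * D.μ) ≤ T / 800 := by
      have e : 2 / (η * D.β * D.μ) = 1600 / (η * D.β * D.μ) / 800 := by ring
      rw [e]
      gcongr
    have h11 : ∑ j ∈ Finset.range T, D.rate η ^ j + T * (1 / 800) ≤ T / 400 := by linarith
    calc _ ≤ T / 400 * W := by gcongr
      _ = _ := by ring
  have h12 : (T : ℝ)⁻¹ * (b * ∑ j ∈ Finset.range T, (D.rate η ^ j + 1 / 800) * W) ≤
      b * (W / 400) := by
    calc _ ≤ (T : ℝ)⁻¹ * (b * (T * (W / 400))) := by gcongr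
      _ = _ := by field_simp
  linarith

/-- Error of the output of an epoch. -/
theorem epoch_bd [Fintype Z] [Nonempty Z] {q : ℕ} (hq : 1 ≤ q)
    (hZ : (Fintype.card Z : ℝ) ≤ 9 ^ q) {E : Ex (Fin d → ℝ)} {η : ℝ} {n' n T : ℕ} (h0 : 0 < η)
    (hη : 4 * η ≤ D.β)
    (hηq : 81 * (64 * q ^ 2 * η ^ 2 + 24 * q * η / D.β) ≤ (1 / 800) ^ 2)
    (hn' : 200000000 * q / (D.β ^ 2 * D.μ) ≤ n') (hn : 200000000 * q / (D.β ^ 2 * D.μ) ≤ n)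
    (hT : 1600 / (η * D.β * D.μ) ≤ T) {W : ℝ} (hW : E.WBd q (fun θ => θ - D.θs) W) :
    (E.bind (D.epochEx η n' n T)).WBd q (fun θ => θ - D.θs) ((W + D.G) / 100) := by
  have hβ := D.β_pos
  have hμ := D.μ_pos
  have hG := D.G_nonneg
  have hW0 := hW.nonneg
  have hcenter := D.epoch_center_bd hq hZ hn' hn hW
  have hW2 : (D.opChain (D.costChain E n') (fun ω => ω.1) (fun ω => ω.2 / n') n).WBd q
      (fun ω => ω.1.1 - D.θs) W :=
    D.opChain_fst_wbd (hW.chain_fst D.wc _ _ n') n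
  set E2 := D.opChain (D.costChain E n') (fun ω => ω.1) (fun ω => ω.2 / n') n with hE2
  -- Write A⁻¹ĝ as the error of the center minus the error of the fixed point.
  have hh : E2.WBd q (fun ω => D.A⁻¹ *ᵥ ((n : ℝ)⁻¹ • ω.2)) (W + (W + D.G) / 400) := by
    exact (hW2.sub hcenter).congr fun ω => by abel
  have hout := (D.innerChain_output_bd (θc := fun ω => ω.1.1) (r := fun ω => ω.1.2 / n') hq hZ h0
    hη hηq hT hcenter hh).mono (D := (W + D.G) / 100) (by linarith)
  intro v b hb hv
  refine ⟨(hout v b hb hv).1, ?_⟩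
  rw [D.bind_epochEx_apply]
  exact (hout v b hb hv).2

/-- Law of the critic's output with independent samples after `k` epochs. -/
def epochsEx (η : ℝ) (n' n T : ℕ) : ℕ → (Fin d → ℝ) → Ex (Fin d → ℝ)
  | 0, θ => Ex.pure θ
  | k + 1, θ => (D.epochEx η n' n T θ).bind (epochsEx η n' n T k)

theorem bind_epochsEx_succ (E : Ex (Fin d → ℝ)) (η : ℝ) (n' n T k : ℕ) :
    E.bind (D.epochsEx η n' n T (k + 1)) =
      (E.bind (D.epochEx η n' n T)).bind (D.epochsEx η n' n T k) := rfl

/-- G/99 is the fixed point of the map W ↦ (W + G)/100 of one epoch; the excess over it is divided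
by 100. -/
theorem bind_epochsEx_bd [Fintype Z] [Nonempty Z] {q : ℕ} (hq : 1 ≤ q)
    (hZ : (Fintype.card Z : ℝ) ≤ 9 ^ q) {η : ℝ} {n' n T : ℕ} (h0 : 0 < η) (hη : 4 * η ≤ D.β)
    (hηq : 81 * (64 * q ^ 2 * η ^ 2 + 24 * q * η / D.β) ≤ (1 / 800) ^ 2)
    (hn' : 200000000 * q / (D.β ^ 2 * D.μ) ≤ n') (hn : 200000000 * q / (D.β ^ 2 * D.μ) ≤ n)
    (hT : 1600 / (η * D.β * D.μ) ≤ T) (k : ℕ) {E : Ex (Fin d → ℝ)} {W : ℝ} (hW0 : 0 ≤ W)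
    (hW : E.WBd q (fun θ => θ - D.θs) (W + D.G / 99)) :
    (E.bind (D.epochsEx η n' n T k)).WBd q (fun θ => θ - D.θs) ((1 / 100) ^ k * W + D.G / 99) := by
  induction k generalizing E W with
  | zero =>
    rw [pow_zero, one_mul]
    exact hW
  | succ k ih =>
    rw [bind_epochsEx_succ]
    have h1 := D.epoch_bd hq hZ h0 hη hηq hn' hn hT hW
    have h2 := ih (W := W / 100) (by positivity) (h1.mono (by linarith))
    refine h2.mono (le_of_eq ?_)
    ring

theorem epochsEx_bd [Fintype Z] [Nonempty Z] {q : ℕ} (hq : 1 ≤ q)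
    (hZ : (Fintype.card Z : ℝ) ≤ 9 ^ q) {η : ℝ} {n' n T : ℕ} (h0 : 0 < η) (hη : 4 * η ≤ D.β)
    (hηq : 81 * (64 * q ^ 2 * η ^ 2 + 24 * q * η / D.β) ≤ (1 / 800) ^ 2)
    (hn' : 200000000 * q / (D.β ^ 2 * D.μ) ≤ n') (hn : 200000000 * q / (D.β ^ 2 * D.μ) ≤ n)
    (hT : 1600 / (η * D.β * D.μ) ≤ T) (k : ℕ) {θ0 : Fin d → ℝ} {W : ℝ} (hW0 : 0 ≤ W)
    (hW : (θ0 - D.θs) ⬝ᵥ (θ0 - D.θs) ≤ W ^ 2) :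
    (D.epochsEx η n' n T k θ0).WBd q (fun θ => θ - D.θs) ((1 / 100) ^ k * W + D.G / 99) := by
  have hG := D.G_nonneg
  have h1 : (Ex.pure θ0).WBd q (fun θ => θ - D.θs) (W + D.G / 99) := by
    have := (Ex.WBd.const (Ex.pure θ0) q hW0 hW).mono (by linarith : W ≤ W + D.G / 99)
    exact this
  exact D.bind_epochsEx_bd hq hZ h0 hη hηq hn' hn hT k hW0 h1

/-- In contrast to the moment bound there is no floor: the noise does not contribute to the mean. -/
theorem bind_epochsEx_bias {η : ℝ} {n' n T : ℕ} (h0 : 0 < η) (hη : 4 * η ≤ D.β)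
    (hn' : n' ≠ 0) (hn : n ≠ 0) (hT : T ≠ 0) (hT2 : 1600 / (η * D.β * D.μ) ≤ T) (k : ℕ)
    {E : Ex (Fin d → ℝ)} {W : ℝ} (hW0 : 0 ≤ W) (hW : E.LBd (fun θ => θ - D.θs) W) :
    (E.bind (D.epochsEx η n' n T k)).LBd (fun θ => θ - D.θs) ((1 / 100) ^ k * W) := by
  induction k generalizing E W with
  | zero =>
    rw [pow_zero, one_mul]
    exact hW
  | succ k ih =>
    rw [bind_epochsEx_succ]
    have hT0 : (0 : ℝ) ≤ T := Nat.cast_nonneg T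
    have h1 := D.epoch_bias h0 hη hn' hn hT hW0 hW (κ := 1 / 100) (by
      have e : 2 / (η * D.β * D.μ) = 1600 / (η * D.β * D.μ) / 800 := by ring
      rw [e]
      linarith)
    have h2 := ih (W := 1 / 100 * W) (by positivity) h1
    intro v b hb hv
    refine (h2 v b hb hv).trans (le_of_eq ?_)
    ring

theorem epochsEx_bias {η : ℝ} {n' n T : ℕ} (h0 : 0 < η) (hη : 4 * η ≤ D.β)
    (hn' : n' ≠ 0) (hn : n ≠ 0) (hT : T ≠ 0) (hT2 : 1600 / (η * D.β * D.μ) ≤ T) (k : ℕ)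
    {θ0 : Fin d → ℝ} {W : ℝ} (hW0 : 0 ≤ W) (hW : (θ0 - D.θs) ⬝ᵥ (θ0 - D.θs) ≤ W ^ 2) :
    (D.epochsEx η n' n T k θ0).LBd (fun θ => θ - D.θs) ((1 / 100) ^ k * W) :=
  D.bind_epochsEx_bias h0 hη hn' hn hT hT2 k (E := Ex.pure θ0) hW0
    fun _ _ hb hv => abs_dotProduct_le hb hW0 hv hW

end TDProblem

/-! ### Finite Markov chains -/

/-- The `ℓ₁` norm. -/
def l1 {S : Type} [Fintype S] (x : S → ℝ) : ℝ := ∑ s, |x s|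

section Chains

variable {S : Type} [Fintype S]

theorem l1_nonneg (x : S → ℝ) : 0 ≤ l1 x := Finset.sum_nonneg fun _ _ => abs_nonneg _

theorem l1_smul (c : ℝ) (x : S → ℝ) : l1 (c • x) = |c| * l1 x := by
  simp [l1, abs_mul, Finset.mul_sum]

theorem l1_sub_le (x y : S → ℝ) : l1 (x - y) ≤ l1 x + l1 y := by
  rw [l1, l1, l1, ← Finset.sum_add_distrib]
  exact Finset.sum_le_sum fun s _ => abs_sub _ _

theorem l1_of_mem_stdSimplex {q : S → ℝ} (hq : q ∈ stdSimplex ℝ S) : l1 q = 1 := by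
  rw [l1, ← hq.2]
  exact Finset.sum_congr rfl fun s _ => abs_of_nonneg (hq.1 s)

theorem abs_dotProduct_le_l1 (x f : S → ℝ) {F : ℝ} (hf : ∀ s, |f s| ≤ F) :
    |x ⬝ᵥ f| ≤ l1 x * F := by
  rw [dotProduct, l1, Finset.sum_mul]
  refine (Finset.abs_sum_le_sum_abs _ _).trans (Finset.sum_le_sum fun s _ => ?_)
  rw [abs_mul]
  exact mul_le_mul_of_nonneg_left (hf s) (abs_nonneg _)

theorem sum_sub_eq_zero_of_mem_stdSimplex {q ν : S → ℝ} (hq : q ∈ stdSimplex ℝ S)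
    (hν : ν ∈ stdSimplex ℝ S) : ∑ s, (q - ν) s = 0 := by
  simp [Finset.sum_sub_distrib, hq.2, hν.2]

open Matrix in
/-- A chain that is within `1/2` of its stationary distribution at time `t` halves vectors of zero
sum in `t` steps. -/
theorem l1_vecMul_le_half {Q : Matrix S S ℝ} {ν : S → ℝ}
    (h : ∀ q ∈ stdSimplex ℝ S, l1 (q ᵥ* Q - ν) ≤ 1 / 2) {x : S → ℝ} (hx : ∑ s, x s = 0) :
    l1 (x ᵥ* Q) ≤ 1 / 2 * l1 x := by
  rcases (l1_nonneg x).eq_or_lt with h0 | h0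
  · have : x = 0 := by
      funext s
      have := (Finset.sum_eq_zero_iff_of_nonneg fun s _ => abs_nonneg (x s)).1 h0.symm s
        (Finset.mem_univ s)
      simpa using this
    subst this
    simp [l1]
  -- Since x has zero sum, its positive and negative parts both have mass c, so x = c (q₁ - q₂) with
  -- q₁, q₂ in the simplex, and ν cancels in the difference.
  set c := l1 x / 2 with hc
  have hcpos : 0 < c := by positivity
  have hsum1 : ∑ s, max (x s) 0 = c := by
    have : ∑ s, max (x s) 0 = ∑ s, (|x s| + x s) / 2 :=
      Finset.sum_congr rfl fun s _ => by
        rcases le_total (x s) 0 with h | h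
        · rw [max_eq_right h, abs_of_nonpos h]; ring
        · rw [max_eq_left h, abs_of_nonneg h]; ring
    rw [this, ← Finset.sum_div, Finset.sum_add_distrib, hx, add_zero, hc, l1]
  have hsum2 : ∑ s, max (-x s) 0 = c := by
    have : ∑ s, max (-x s) 0 = ∑ s, (|x s| - x s) / 2 :=
      Finset.sum_congr rfl fun s _ => by
        rcases le_total (x s) 0 with h | h
        · rw [max_eq_left (by linarith), abs_of_nonpos h]; ring
        · rw [max_eq_right (by linarith), abs_of_nonneg h]; ring
    rw [this, ← Finset.sum_div, Finset.sum_sub_distrib, hx, sub_zero, hc, l1]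
  have hq1 : (fun s => c⁻¹ * max (x s) 0) ∈ stdSimplex ℝ S :=
    ⟨fun s => by positivity, by
      rw [← Finset.mul_sum, hsum1, inv_mul_cancel₀ hcpos.ne']⟩
  have hq2 : (fun s => c⁻¹ * max (-x s) 0) ∈ stdSimplex ℝ S :=
    ⟨fun s => by positivity, by
      rw [← Finset.mul_sum, hsum2, inv_mul_cancel₀ hcpos.ne']⟩
  have e : x ᵥ* Q = c • (((fun s => c⁻¹ * max (x s) 0) ᵥ* Q - ν) -
      ((fun s => c⁻¹ * max (-x s) 0) ᵥ* Q - ν)) := by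
    rw [sub_sub_sub_cancel_right, ← sub_vecMul, ← smul_vecMul]
    congr 1
    funext s
    simp only [Pi.smul_apply, Pi.sub_apply, smul_eq_mul]
    rw [← mul_sub, mul_inv_cancel_left₀ hcpos.ne', max_zero_sub_eq_self]
  rw [e, l1_smul, abs_of_pos hcpos]
  have h1 := (l1_sub_le ((fun s => c⁻¹ * max (x s) 0) ᵥ* Q - ν)
    ((fun s => c⁻¹ * max (-x s) 0) ᵥ* Q - ν)).trans (add_le_add (h _ hq1) (h _ hq2))
  calc _ ≤ c * (1 / 2 + 1 / 2) := by gcongr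
    _ = _ := by rw [hc]; ring

variable [DecidableEq S] {P : Matrix S S ℝ}

open Matrix in
theorem l1_vecMul_le (hP : P ∈ rowStochastic ℝ S) (x : S → ℝ) : l1 (x ᵥ* P) ≤ l1 x := by
  have h1 : ∀ j, |(x ᵥ* P) j| ≤ ∑ i, |x i| * P i j := fun j => by
    refine (Finset.abs_sum_le_sum_abs _ _).trans (Finset.sum_le_sum fun i _ => ?_)
    rw [abs_mul, abs_of_nonneg (hP.1 i j)]
  refine (Finset.sum_le_sum fun j _ => h1 j).trans (le_of_eq ?_)
  rw [Finset.sum_comm, l1]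
  refine Finset.sum_congr rfl fun i _ => ?_
  rw [← Finset.mul_sum, sum_row_of_mem_rowStochastic hP, mul_one]

open Matrix in
theorem sum_vecMul (hP : P ∈ rowStochastic ℝ S) (x : S → ℝ) :
    ∑ s, (x ᵥ* P) s = ∑ s, x s := by
  simp only [vecMul, dotProduct]
  rw [Finset.sum_comm]
  refine Finset.sum_congr rfl fun i _ => ?_
  rw [← Finset.mul_sum, sum_row_of_mem_rowStochastic hP, mul_one]

/-- A stochastic matrix has a stationary distribution. -/
theorem exists_stationary [Nonempty S] (hP : P ∈ Matrix.rowStochastic ℝ S) :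
    ∃ ν ∈ stdSimplex ℝ S, ν ᵥ* P = ν := by
  have hdet : (P - 1).det = 0 := by
    apply Matrix.exists_mulVec_eq_zero_iff.1
    refine ⟨1, one_ne_zero, ?_⟩
    rw [Matrix.sub_mulVec, hP.2, Matrix.one_mulVec, sub_self]
  obtain ⟨x, hx0, hx⟩ := Matrix.exists_vecMul_eq_zero_iff.2 hdet
  rw [Matrix.vecMul_sub, Matrix.vecMul_one, sub_eq_zero] at hx
  set y : S → ℝ := fun s => |x s| with hy
  -- For a left fixed vector x, |x| ≤ |x|P entrywise. As P preserves the total mass, equality holds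
  -- everywhere and |x| can be normalized.
  have h1 : ∀ j ∈ Finset.univ, y j ≤ (y ᵥ* P) j := fun j _ => by
    calc y j = |(x ᵥ* P) j| := by rw [hx]
      _ ≤ ∑ i, |x i * P i j| := Finset.abs_sum_le_sum_abs _ _
      _ = (y ᵥ* P) j := Finset.sum_congr rfl fun i _ => by
          rw [abs_mul, abs_of_nonneg (hP.1 i j)]
  have h2 : ∀ j ∈ Finset.univ, y j = (y ᵥ* P) j :=
    (Finset.sum_eq_sum_iff_of_le h1).1 (sum_vecMul hP y).symm
  have hpos : 0 < ∑ s, y s := by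
    refine lt_of_le_of_ne (Finset.sum_nonneg fun s _ => abs_nonneg _) fun h => hx0 ?_
    funext s
    have := (Finset.sum_eq_zero_iff_of_nonneg fun s _ => abs_nonneg (x s)).1 h.symm s
      (Finset.mem_univ s)
    simpa using this
  refine ⟨(∑ s, y s)⁻¹ • y, ⟨fun s => ?_, ?_⟩, ?_⟩
  · exact mul_nonneg (inv_nonneg.2 hpos.le) (abs_nonneg _)
  · simp only [Pi.smul_apply, smul_eq_mul, ← Finset.mul_sum]
    exact inv_mul_cancel₀ hpos.ne'
  · rw [Matrix.smul_vecMul]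
    congr 1
    funext j
    exact (h2 j (Finset.mem_univ j)).symm

open Matrix in
theorem pow_apply_mul_le (hP : P ∈ rowStochastic ℝ S) (a b : ℕ) (i j k : S) :
    (P ^ a) i j * (P ^ b) j k ≤ (P ^ (a + b)) i k := by
  rw [pow_add, mul_apply]
  exact Finset.single_le_sum
    (f := fun j => (P ^ a) i j * (P ^ b) j k)
    (fun l _ => mul_nonneg ((pow_mem hP a).1 i l) ((pow_mem hP b).1 l k)) (Finset.mem_univ j)

/-- An irreducible aperiodic stochastic matrix has a positive power. -/
theorem exists_pow_pos [Nonempty S] (hP : P ∈ Matrix.rowStochastic ℝ S)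
    (hirr : ∀ s s', ∃ t : ℕ, 0 < (P ^ t) s s')
    (haper : ∀ (s : S) (k : ℕ), (∀ t : ℕ, 1 ≤ t → 0 < (P ^ t) s s → k ∣ t) → k = 1) :
    ∃ t : ℕ, ∀ s s', 0 < (P ^ t) s s' := by
  let s₀ : S := Classical.arbitrary S
  let R : Set ℕ := {t | 1 ≤ t ∧ 0 < (P ^ t) s₀ s₀}
  -- By aperiodicity the return times to s₀ have gcd 1, so the additive monoid they generate
  -- contains all large integers.
  have hgcd : Nat.setGcd R = 1 :=
    haper s₀ _ fun t h1 h2 => Nat.setGcd_dvd_of_mem (s := R) ⟨h1, h2⟩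
  obtain ⟨n, hn⟩ := Nat.exists_mem_closure_of_ge R
  have hmem : ∀ m ∈ AddSubmonoid.closure R, 0 < (P ^ m) s₀ s₀ := by
    intro m hm
    induction hm using AddSubmonoid.closure_induction with
    | mem x hx => exact hx.2
    | zero => simp
    | add x y _ _ hx hy => exact (mul_pos hx hy).trans_le (pow_apply_mul_le hP x y s₀ s₀ s₀)
  choose a ha using fun s => hirr s s₀
  choose b hb using fun s => hirr s₀ s
  -- One exponent for all pairs: go to s₀, spend the surplus in loops there, then go to the target.
  refine ⟨n + ∑ s, a s + ∑ s, b s, fun s s' => ?_⟩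
  have h1 : a s ≤ ∑ s, a s := Finset.single_le_sum (fun _ _ => Nat.zero_le _) (Finset.mem_univ s)
  have h2 : b s' ≤ ∑ s, b s := Finset.single_le_sum (fun _ _ => Nat.zero_le _) (Finset.mem_univ s')
  obtain ⟨m, hm⟩ : ∃ m, n + ∑ s, a s + ∑ s, b s = a s + (n + m) + b s' :=
    ⟨∑ s, a s + ∑ s, b s - a s - b s', by omega⟩
  rw [hm]
  have h3 := hmem (n + m) (hn (n + m) (by omega) (by rw [hgcd]; exact one_dvd _))
  exact (mul_pos ((mul_pos (ha s) h3).trans_le (pow_apply_mul_le hP _ _ _ _ _)) (hb s')).trans_le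
    (pow_apply_mul_le hP _ _ _ _ _)

/-- Doeblin's argument: for x of zero sum, subtracting δ from all entries of Q does not change xQ,
but lowers every row sum by at least δ. -/
theorem l1_vecMul_le_of_le {Q : Matrix S S ℝ} (hQ : Q ∈ Matrix.rowStochastic ℝ S) [Nonempty S]
    {δ : ℝ} (hδ0 : 0 ≤ δ) (hδ : ∀ i j, δ ≤ Q i j) {x : S → ℝ} (hx : ∑ s, x s = 0) :
    l1 (x ᵥ* Q) ≤ (1 - δ) * l1 x := by
  have h1 : ∀ j, |(x ᵥ* Q) j| ≤ ∑ i, |x i| * (Q i j - δ) := fun j => by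
    have e : (x ᵥ* Q) j = ∑ i, x i * (Q i j - δ) := by
      simp only [mul_sub, Finset.sum_sub_distrib, ← Finset.sum_mul, hx, zero_mul, sub_zero]
      rfl
    rw [e]
    refine (Finset.abs_sum_le_sum_abs _ _).trans (Finset.sum_le_sum fun i _ => ?_)
    rw [abs_mul, abs_of_nonneg (sub_nonneg.2 (hδ i j))]
  refine (Finset.sum_le_sum fun j _ => h1 j).trans ?_
  rw [Finset.sum_comm, l1, Finset.mul_sum]
  refine Finset.sum_le_sum fun i _ => ?_
  rw [← Finset.mul_sum, Finset.sum_sub_distrib, Matrix.sum_row_of_mem_rowStochastic hQ, mul_comm]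
  refine mul_le_mul_of_nonneg_right ?_ (abs_nonneg _)
  simp only [Finset.sum_const, Finset.card_univ, nsmul_eq_mul]
  have : (1 : ℝ) ≤ Fintype.card S := by exact_mod_cast Fintype.card_pos
  nlinarith

open Matrix in
/-- Iterated contraction of vectors of zero sum. -/
theorem l1_vecMul_pow_le (hP : P ∈ rowStochastic ℝ S) {t : ℕ} {c : ℝ} (hc : 0 ≤ c)
    (h : ∀ x : S → ℝ, ∑ s, x s = 0 → l1 (x ᵥ* P ^ t) ≤ c * l1 x) (j : ℕ) {k : ℕ} (hk : t * j ≤ k)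
    {x : S → ℝ} (hx : ∑ s, x s = 0) : l1 (x ᵥ* P ^ k) ≤ c ^ j * l1 x := by
  have h1 : l1 (x ᵥ* P ^ (t * j)) ≤ c ^ j * l1 x := by
    clear hk
    induction j with
    | zero => simp
    | succ j ih =>
      rw [Nat.mul_succ, pow_add, ← vecMul_vecMul]
      refine (h _ (by rw [sum_vecMul (pow_mem hP _), hx])).trans ?_
      rw [pow_succ, mul_comm _ c, mul_assoc]
      exact mul_le_mul_of_nonneg_left ih hc
  obtain ⟨m, rfl⟩ := Nat.exists_eq_add_of_le hk
  rw [pow_add, ← vecMul_vecMul]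
  exact (l1_vecMul_le (pow_mem hP m) _).trans h1

end Chains

/-! ### Mixing of the state chains of policies. -/

namespace AMDP

variable {S A : Type} [Fintype S] [Fintype A] (M : AMDP S A)

theorem stateMat_mem [DecidableEq S] (π : Policy S A) :
    M.stateMat π ∈ Matrix.rowStochastic ℝ S := by
  rw [Matrix.mem_rowStochastic_iff_sum]
  refine ⟨fun s s' => Finset.sum_nonneg fun a _ => mul_nonneg ((π s).2.1 a) ((M.P s a).2.1 s'),
    fun s => ?_⟩
  simp only [stateMat]
  rw [Finset.sum_comm]
  simp only [← Finset.mul_sum, (M.P s _).2.2, mul_one, (π s).2.2]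

theorem stat_spec [DecidableEq S] [Nonempty S] (π : Policy S A) :
    M.stat π ∈ stdSimplex ℝ S ∧ M.stat π ᵥ* M.stateMat π = M.stat π :=
  Classical.epsilon_spec (p := fun ν => ν ∈ stdSimplex ℝ S ∧ ν ᵥ* M.stateMat π = ν)
    (exists_stationary (M.stateMat_mem π))

theorem stat_vecMul_pow [DecidableEq S] [Nonempty S] (π : Policy S A) (t : ℕ) :
    M.stat π ᵥ* M.stateMat π ^ t = M.stat π := by
  induction t with
  | zero => rw [pow_zero, Matrix.vecMul_one]
  | succ t ih => rw [pow_succ, ← Matrix.vecMul_vecMul, ih, (M.stat_spec π).2]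

/-- Only the existence of a mixing time is at stake, since an infimum over an empty set would be 0.
A positive power of the chain contracts zero-sum vectors, and two distributions are at distance at
most 2, hence the target 1/4; the additional step ensures t ≥ 1. -/
theorem mixTime_spec [DecidableEq S] [Nonempty S] (hM : M.Ergodic) (π : Policy S A) :
    1 ≤ M.mixTime π ∧ ∀ q ∈ stdSimplex ℝ S,
      l1 (q ᵥ* (M.stateMat π ^ M.mixTime π) - M.stat π) ≤ 1 / 2 := by
  have hP := M.stateMat_mem π
  suffices h : {t | 1 ≤ t ∧ ∀ q ∈ stdSimplex ℝ S,
      ∑ s, |(q ᵥ* (M.stateMat π ^ t)) s - M.stat π s| ≤ 1 / 2}.Nonempty from Nat.sInf_mem h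
  obtain ⟨t, ht⟩ := exists_pow_pos hP (hM π).1 (hM π).2
  obtain ⟨⟨i, j⟩, hij⟩ := Finite.exists_min fun z : S × S => (M.stateMat π ^ t) z.1 z.2
  set δ := (M.stateMat π ^ t) i j with hδ
  have hδpos : 0 < δ := ht i j
  have hδ1 : δ ≤ 1 := Matrix.le_one_of_mem_rowStochastic (pow_mem hP t)
  have hcontr : ∀ x : S → ℝ, ∑ s, x s = 0 → l1 (x ᵥ* M.stateMat π ^ t) ≤ (1 - δ) * l1 x :=
    fun x hx => l1_vecMul_le_of_le (pow_mem hP t) hδpos.le (fun i j => hij (i, j)) hx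
  obtain ⟨n, hn⟩ := exists_pow_lt_of_lt_one (by norm_num : (0 : ℝ) < 1 / 4)
    (by linarith : 1 - δ < 1)
  refine ⟨t * n + 1, by omega, fun q hq => ?_⟩
  have hν := (M.stat_spec π).1
  have h1 := l1_vecMul_pow_le hP (by linarith) hcontr n (k := t * n + 1) (by omega)
    (sum_sub_eq_zero_of_mem_stdSimplex hq hν)
  rw [Matrix.sub_vecMul, stat_vecMul_pow] at h1
  have h2 := l1_sub_le q (M.stat π)
  rw [l1_of_mem_stdSimplex hq, l1_of_mem_stdSimplex hν] at h2
  refine le_trans h1 ?_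
  have h3 : 0 ≤ (1 - δ) ^ n := pow_nonneg (by linarith) n
  nlinarith

/-- Every policy mixes by time `tmix`, provided that `tmix` is not the junk value `0`. -/
theorem mixTime_le_tmix [DecidableEq S] (h : M.tmix ≠ 0) (π : Policy S A) :
    M.mixTime π ≤ M.tmix := by
  have hb : BddAbove (Set.range M.mixTime) := by
    by_contra hb
    exact h (Nat.sSup_of_not_bddAbove hb)
  exact le_ciSup hb π

theorem l1_mix [DecidableEq S] [Nonempty S] (hM : M.Ergodic) (h : M.tmix ≠ 0) (π : Policy S A)
    {j k : ℕ} (hk : M.tmix * j ≤ k) {x : S → ℝ} (hx : ∑ s, x s = 0) :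
    l1 (x ᵥ* M.stateMat π ^ k) ≤ (1 / 2) ^ j * l1 x := by
  refine l1_vecMul_pow_le (M.stateMat_mem π) (t := M.mixTime π) (by norm_num) ?_ j ?_ hx
  · exact fun x hx => l1_vecMul_le_half (M.mixTime_spec hM π).2 hx
  · exact (Nat.mul_le_mul_right j (M.mixTime_le_tmix h π)).trans hk

theorem l1_mix_simplex [DecidableEq S] [Nonempty S] (hM : M.Ergodic) (h : M.tmix ≠ 0)
    (π : Policy S A) {j k : ℕ} (hk : M.tmix * j ≤ k) {q : S → ℝ} (hq : q ∈ stdSimplex ℝ S) :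
    l1 (q ᵥ* M.stateMat π ^ k - M.stat π) ≤ 2 * (1 / 2) ^ j := by
  have hν := (M.stat_spec π).1
  have h1 := M.l1_mix hM h π hk (sum_sub_eq_zero_of_mem_stdSimplex hq hν)
  rw [Matrix.sub_vecMul, stat_vecMul_pow] at h1
  have h2 := l1_sub_le q (M.stat π)
  rw [l1_of_mem_stdSimplex hq, l1_of_mem_stdSimplex hν] at h2
  refine h1.trans ?_
  have : (0 : ℝ) ≤ (1 / 2) ^ j := by positivity
  nlinarith

end AMDP

namespace AMDP

/-! ### The differential Q-function -/

section Avg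

variable {S A : Type} [Fintype A]

/-- Average of a function of state-action pairs over the actions of a policy. -/
def avg (π : Policy S A) (f : S × A → ℝ) : S → ℝ := fun s => ∑ a, (π s).1 a * f (s, a)

theorem abs_avg_le (π : Policy S A) {f : S × A → ℝ} {F : ℝ} (hf : ∀ z, |f z| ≤ F) (s : S) :
    |avg π f s| ≤ F := by
  refine (Finset.abs_sum_le_sum_abs _ _).trans ?_
  calc ∑ a, |(π s).1 a * f (s, a)| ≤ ∑ a, (π s).1 a * F := by
        refine Finset.sum_le_sum fun a _ => ?_
        rw [abs_mul, abs_of_nonneg ((π s).2.1 a)]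
        exact mul_le_mul_of_nonneg_left (hf _) ((π s).2.1 a)
    _ = F := by rw [← Finset.sum_mul, (π s).2.2, one_mul]

end Avg

variable {S A : Type} [Fintype S] [Fintype A] (M : AMDP S A)

theorem pairMat_mulVec (π : Policy S A) (f : S × A → ℝ) (z : S × A) :
    (M.pairMat π *ᵥ f) z = (M.P z.1 z.2).1 ⬝ᵥ avg π f := by
  simp only [Matrix.mulVec, dotProduct, pairMat, Fintype.sum_prod_type, avg, Finset.mul_sum,
    mul_assoc]

theorem avg_pairMat_mulVec (π : Policy S A) (f : S × A → ℝ) :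
    avg π (M.pairMat π *ᵥ f) = M.stateMat π *ᵥ avg π f := by
  funext s
  change ∑ a, (π s).1 a * (M.pairMat π *ᵥ f) (s, a) = _
  simp only [pairMat_mulVec]
  simp only [Matrix.mulVec, dotProduct, stateMat, Finset.mul_sum, Finset.sum_mul]
  rw [Finset.sum_comm]
  exact Finset.sum_congr rfl fun s' _ => Finset.sum_congr rfl fun a _ => by ring

variable [DecidableEq S] [DecidableEq A]

theorem avg_pairMat_pow_mulVec (π : Policy S A) (f : S × A → ℝ) (t : ℕ) :
    avg π (M.pairMat π ^ t *ᵥ f) = M.stateMat π ^ t *ᵥ avg π f := by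
  induction t with
  | zero => simp
  | succ t ih =>
    rw [pow_succ', ← Matrix.mulVec_mulVec, avg_pairMat_mulVec, ih, Matrix.mulVec_mulVec, ← pow_succ']

/-- After one transition the action is redrawn by the policy, so only the state matters and the pair
chain reduces to the state chain. This is the origin of the extra step in the skipping lengths. -/
theorem pairMat_pow_succ_mulVec (π : Policy S A) (f : S × A → ℝ) (t : ℕ) (z : S × A) :
    (M.pairMat π ^ (t + 1) *ᵥ f) z =
      ((M.P z.1 z.2).1 ᵥ* M.stateMat π ^ t) ⬝ᵥ avg π f := by
  rw [pow_succ', ← Matrix.mulVec_mulVec, pairMat_mulVec, avg_pairMat_pow_mulVec,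
    Matrix.dotProduct_mulVec]

omit [DecidableEq A] in
theorem stat_dot_avg_cost [Nonempty S] (π : Policy S A) :
    M.stat π ⬝ᵥ avg π (fun y => M.cost π y - M.rho π) = 0 := by
  have h := (M.stat_spec π).1.2
  have e : ∀ s, avg π (fun y => M.cost π y - M.rho π) s =
      (∑ a, (π s).1 a * M.c s a + M.h s (π s).1) - M.rho π := by
    intro s
    simp only [avg, cost, mul_sub, mul_add, Finset.sum_sub_distrib, Finset.sum_add_distrib,
      ← Finset.sum_mul, (π s).2.2, one_mul]
  rw [dotProduct]
  simp only [e, mul_sub, Finset.sum_sub_distrib, ← Finset.sum_mul, h, one_mul]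
  exact sub_self _

/-- Geometric bound with the integer part of the exponent. -/
theorem half_pow_div_le {τ : ℕ} (hτ : τ ≠ 0) (t : ℕ) :
    ((1 : ℝ) / 2) ^ (t / τ) ≤ 2 * (1 - 1 / (2 * τ)) ^ t := by
  have hτ0 : (0 : ℝ) < τ := by positivity
  have hτ1 : (1 : ℝ) ≤ τ := by exact_mod_cast Nat.one_le_iff_ne_zero.2 hτ
  set r : ℝ := 1 - 1 / (2 * τ) with hr
  have hx : 1 / (2 * (τ : ℝ)) ≤ 1 / 2 := by
    apply one_div_le_one_div_of_le <;> linarith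
  have hx0 : 0 ≤ 1 / (2 * (τ : ℝ)) := by positivity
  have hr0 : 0 ≤ r := by linarith
  have hr1 : r ≤ 1 := by linarith
  have h1 : 1 / 2 ≤ r ^ τ := by
    have := one_add_mul_le_pow (a := -(1 / (2 * (τ : ℝ)))) (by linarith) τ
    have e : 1 + (τ : ℝ) * -(1 / (2 * τ)) = 1 / 2 := by field_simp; ring
    rw [e] at this
    have e2 : 1 + -(1 / (2 * (τ : ℝ))) = r := by rw [hr]; ring
    rwa [e2] at this
  have h2 : ((1 : ℝ) / 2) ^ (t / τ + 1) ≤ r ^ t := by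
    calc ((1 : ℝ) / 2) ^ (t / τ + 1) ≤ (r ^ τ) ^ (t / τ + 1) := by gcongr
      _ = r ^ (τ * (t / τ + 1)) := by rw [pow_mul]
      _ ≤ r ^ t := pow_le_pow_of_le_one hr0 hr1 (Nat.lt_mul_div_succ t (Nat.pos_of_ne_zero hτ)).le
  rw [pow_succ] at h2
  linarith

section Q

variable [Nonempty S] (hM : M.Ergodic) (ht : M.tmix ≠ 0) (π : Policy S A)

include hM ht

/-- The centered cost has stationary mean zero, so only the distance of the chain to ν contributes,
and this decays geometrically. -/
theorem abs_pairMat_pow_le {F : ℝ} (hF : ∀ z, |M.cost π z - M.rho π| ≤ F) (t : ℕ) (z : S × A) :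
    |(M.pairMat π ^ (t + 1) *ᵥ fun y => M.cost π y - M.rho π) z| ≤
      4 * F * (1 - 1 / (2 * M.tmix)) ^ t := by
  have hF0 : 0 ≤ F := (abs_nonneg _).trans (hF z)
  rw [pairMat_pow_succ_mulVec]
  have h0 := M.stat_dot_avg_cost π
  have h1 := abs_dotProduct_le_l1 ((M.P z.1 z.2).1 ᵥ* M.stateMat π ^ t - M.stat π)
    (avg π fun y => M.cost π y - M.rho π) (abs_avg_le π hF)
  rw [sub_dotProduct, h0, sub_zero] at h1
  have h2 := M.l1_mix_simplex hM ht π (Nat.mul_div_le t M.tmix) (M.P z.1 z.2).2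
  have h3 := half_pow_div_le ht t
  refine h1.trans ?_
  calc _ ≤ (2 * (2 * (1 - 1 / (2 * (M.tmix : ℝ))) ^ t)) * F := by
        refine mul_le_mul_of_nonneg_right (h2.trans ?_) hF0
        linarith
    _ = _ := by ring

omit hM [DecidableEq A] [Nonempty S] in
theorem rate_tmix_bounds : 0 ≤ 1 - 1 / (2 * (M.tmix : ℝ)) ∧ 1 - 1 / (2 * (M.tmix : ℝ)) < 1 := by
  have h1 : (1 : ℝ) ≤ M.tmix := by exact_mod_cast Nat.one_le_iff_ne_zero.2 ht
  have hx : 1 / (2 * (M.tmix : ℝ)) ≤ 1 / 2 := by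
    apply one_div_le_one_div_of_le <;> linarith
  have hx0 : 0 < 1 / (2 * (M.tmix : ℝ)) := by positivity
  constructor <;> linarith

theorem summable_basicQ (z : S × A) :
    Summable fun t : ℕ => (M.pairMat π ^ t *ᵥ fun y => M.cost π y - M.rho π) z := by
  rw [← summable_nat_add_iff 1]
  obtain ⟨F, hF⟩ : ∃ F, ∀ z, |M.cost π z - M.rho π| ≤ F :=
    ⟨∑ z, |M.cost π z - M.rho π|, fun z =>
      Finset.single_le_sum (f := fun z => |M.cost π z - M.rho π|) (fun _ _ => abs_nonneg _)
        (Finset.mem_univ z)⟩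
  obtain ⟨h0, h1⟩ := M.rate_tmix_bounds ht
  exact Summable.of_norm_bounded ((summable_geometric_of_lt_one h0 h1).mul_left (4 * F))
    fun t => M.abs_pairMat_pow_le hM ht π hF t z

theorem basicQ_bellman :
    M.basicQ π = (fun z => M.cost π z - M.rho π) + M.pairMat π *ᵥ M.basicQ π := by
  funext z
  have hs := M.summable_basicQ hM ht π
  rw [basicQ, (hs z).tsum_eq_zero_add, Pi.add_apply]
  congr 1
  · simp
  · rw [show (M.pairMat π *ᵥ M.basicQ π) z = ∑ z', M.pairMat π z z' * M.basicQ π z' from rfl]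
    have e : ∀ z', M.basicQ π z' = ∑' t : ℕ, (M.pairMat π ^ t *ᵥ fun y => M.cost π y - M.rho π) z' :=
      fun z' => rfl
    simp only [e, ← tsum_mul_left]
    rw [← Summable.tsum_finsetSum fun z' _ => (hs z').mul_left _]
    refine tsum_congr fun t => ?_
    rw [pow_succ', ← Matrix.mulVec_mulVec]
    rfl

theorem abs_basicQ_le {F : ℝ} (hF : ∀ z, |M.cost π z - M.rho π| ≤ F) (z : S × A) :
    |M.basicQ π z| ≤ F * (1 + 8 * M.tmix) := by
  have hs := M.summable_basicQ hM ht π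
  obtain ⟨h0, h1⟩ := M.rate_tmix_bounds ht
  have ht0 : (0 : ℝ) < M.tmix := by positivity
  rw [basicQ, (hs z).tsum_eq_zero_add]
  have h2 : |∑' t : ℕ, (M.pairMat π ^ (t + 1) *ᵥ fun y => M.cost π y - M.rho π) z| ≤
      4 * F * (2 * M.tmix) := by
    have h3 := tsum_of_norm_bounded
      (f := fun t => (M.pairMat π ^ (t + 1) *ᵥ fun y => M.cost π y - M.rho π) z) ((hasSum_geometric_of_lt_one h0 h1).mul_left (4 * F))
      (fun t => M.abs_pairMat_pow_le hM ht π hF t z)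
    rw [Real.norm_eq_abs] at h3
    refine h3.trans (le_of_eq ?_)
    rw [sub_sub_cancel, one_div, inv_inv]
  have h4 : |(M.pairMat π ^ 0 *ᵥ fun y => M.cost π y - M.rho π) z| ≤ F := by simpa using hF z
  refine (abs_add_le _ _).trans ((add_le_add h4 h2).trans (le_of_eq ?_))
  ring

end Q

/-! ### Occupation measures -/

/-- The performance difference formula. -/
theorem rho_sub_rho [Nonempty S] (hM : M.Ergodic) (ht : M.tmix ≠ 0) (π π' : Policy S A) :
    M.rho π' - M.rho π = ∑ s, M.stat π' s *
      (∑ a, M.basicQ π (s, a) * ((π' s).1 a - (π s).1 a) + (M.h s (π' s).1 - M.h s (π s).1)) := by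
  have hν := (M.stat_spec π').1.2
  set V := avg π (M.basicQ π) with hV
  have hQ : ∀ s a, M.basicQ π (s, a) =
      M.c s a + M.h s (π s).1 - M.rho π + (M.P s a).1 ⬝ᵥ V := by
    intro s a
    have := congrFun (M.basicQ_bellman hM ht π) (s, a)
    rw [Pi.add_apply, pairMat_mulVec] at this
    exact this
  -- Stationarity of the law of π' removes the transition kernel of π' from the average of V.
  have hflow : ∑ s, M.stat π' s * ∑ a, (π' s).1 a * ((M.P s a).1 ⬝ᵥ V) = ∑ s, M.stat π' s * V s := by
    have h2 : M.stat π' ⬝ᵥ (M.stateMat π' *ᵥ V) = M.stat π' ⬝ᵥ V := by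
      rw [Matrix.dotProduct_mulVec, (M.stat_spec π').2]
    have e : ∀ s, ∑ a, (π' s).1 a * ((M.P s a).1 ⬝ᵥ V) = (M.stateMat π' *ᵥ V) s := by
      intro s
      simp only [Matrix.mulVec, dotProduct, stateMat, Finset.mul_sum, Finset.sum_mul]
      rw [Finset.sum_comm]
      exact Finset.sum_congr rfl fun s' _ => Finset.sum_congr rfl fun a _ => by ring
    simp only [e]
    exact h2
  have h1 : ∀ s, ∑ a, M.basicQ π (s, a) * ((π' s).1 a - (π s).1 a) + (M.h s (π' s).1 - M.h s (π s).1) =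
      ((∑ a, (π' s).1 a * M.c s a + M.h s (π' s).1) - M.rho π) +
        (∑ a, (π' s).1 a * ((M.P s a).1 ⬝ᵥ V) - V s) := by
    intro s
    have e1 : ∑ a, M.basicQ π (s, a) * ((π' s).1 a - (π s).1 a) =
        ∑ a, (π' s).1 a * M.basicQ π (s, a) - V s := by
      rw [hV, avg, ← Finset.sum_sub_distrib]
      exact Finset.sum_congr rfl fun a _ => by ring
    have e2 : ∑ a, (π' s).1 a * M.basicQ π (s, a) = ∑ a, (π' s).1 a * M.c s a +
        (M.h s (π s).1 - M.rho π) + ∑ a, (π' s).1 a * ((M.P s a).1 ⬝ᵥ V) := by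
      have : (M.h s (π s).1 - M.rho π) = ∑ a, (π' s).1 a * (M.h s (π s).1 - M.rho π) := by
        rw [← Finset.sum_mul, (π' s).2.2, one_mul]
      rw [this, ← Finset.sum_add_distrib, ← Finset.sum_add_distrib]
      exact Finset.sum_congr rfl fun a _ => by rw [hQ]; ring
    rw [e1, e2]
    ring
  have h2 : ∀ s ∈ Finset.univ, M.stat π' s * (∑ a, M.basicQ π (s, a) * ((π' s).1 a - (π s).1 a) +
        (M.h s (π' s).1 - M.h s (π s).1)) =
      M.stat π' s * (∑ a, (π' s).1 a * M.c s a + M.h s (π' s).1) - M.stat π' s * M.rho π +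
        (M.stat π' s * ∑ a, (π' s).1 a * ((M.P s a).1 ⬝ᵥ V) - M.stat π' s * V s) := by
    intro s _
    rw [h1]
    ring
  rw [Finset.sum_congr rfl h2, Finset.sum_add_distrib, Finset.sum_sub_distrib,
    Finset.sum_sub_distrib, hflow, ← Finset.sum_mul, hν, sub_self, add_zero, one_mul]
  rfl

end AMDP

/-! ### Smallest eigenvalues -/

/-- The spectrum is finite, so its infimum is a lower bound, and B minus this multiple of the
identity has nonnegative eigenvalues. -/
theorem lambdaMin_mul_le {ι : Type} [Fintype ι] [DecidableEq ι] {B : Matrix ι ι ℝ}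
    (hB : B.IsHermitian) (x : ι → ℝ) : lambdaMin B * (x ⬝ᵥ x) ≤ x ⬝ᵥ (B *ᵥ x) := by
  have hC : (B - lambdaMin B • (1 : Matrix ι ι ℝ)).IsHermitian := by
    refine hB.sub ?_
    rw [Matrix.IsHermitian, Matrix.conjTranspose_smul, Matrix.conjTranspose_one]
    simp
  have hpos : (B - lambdaMin B • (1 : Matrix ι ι ℝ)).PosSemidef := by
    rw [hC.posSemidef_iff_eigenvalues_nonneg]
    intro i
    have h1 := hC.eigenvalues_mem_spectrum_real i
    have h2 : hC.eigenvalues i + lambdaMin B ∈ spectrum ℝ B := by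
      rw [spectrum.mem_iff] at h1 ⊢
      rw [Algebra.algebraMap_eq_smul_one] at h1 ⊢
      convert h1 using 2
      rw [add_smul]
      abel
    have h3 : lambdaMin B ≤ hC.eigenvalues i + lambdaMin B :=
      csInf_le (Matrix.finite_real_spectrum (A := B)).bddBelow h2
    simpa using h3
  have h := hpos.dotProduct_mulVec_nonneg x
  rw [Matrix.sub_mulVec, dotProduct_sub, Matrix.smul_mulVec, Matrix.one_mulVec,
    dotProduct_smul] at h
  simp only [star_trivial, smul_eq_mul] at h
  linarith

namespace AMDP

variable {S A : Type} [Fintype S] [Fintype A] (M : AMDP S A)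

/-! ### Quadratic forms in the stationary weights. -/

section Weights

variable [DecidableEq S] [DecidableEq A]

theorem dot_weightMat_mulVec (π π' : Policy S A) (f g : S × A → ℝ) :
    f ⬝ᵥ (M.weightMat π π' *ᵥ g) =
      ∑ s, M.stat π s * ∑ a, (π' s).1 a * (f (s, a) * g (s, a)) := by
  simp only [dotProduct, weightMat, Matrix.mulVec_diagonal, Fintype.sum_prod_type, Finset.mul_sum]
  exact Finset.sum_congr rfl fun s _ => Finset.sum_congr rfl fun a _ => by ring

theorem isHermitian_gram {d : ℕ} (Ψ : Matrix (S × A) (Fin d) ℝ) (π π' : Policy S A) :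
    (Ψᵀ * M.weightMat π π' * Ψ).IsHermitian := by
  rw [Matrix.IsHermitian, Matrix.conjTranspose_eq_transpose_of_trivial, Matrix.transpose_mul,
    Matrix.transpose_mul, Matrix.transpose_transpose, weightMat, Matrix.diagonal_transpose,
    Matrix.mul_assoc]

omit [DecidableEq S] [DecidableEq A] in
theorem dot_transpose_mul_mulVec {d : ℕ} (Ψ : Matrix (S × A) (Fin d) ℝ)
    (B : Matrix (S × A) (S × A) ℝ) (x y : Fin d → ℝ) :
    x ⬝ᵥ ((Ψᵀ * B * Ψ) *ᵥ y) = (Ψ *ᵥ x) ⬝ᵥ (B *ᵥ (Ψ *ᵥ y)) := by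
  rw [Matrix.mul_assoc, ← Matrix.mulVec_mulVec, Matrix.dotProduct_mulVec, Matrix.vecMul_transpose,
    Matrix.mulVec_mulVec]

theorem lamD_le (π : Policy S A) (u : ℝ) (s : S) (a : A) :
    M.lamD π u ≤ M.stat π s * (perturb u π s).1 a := by
  have hB : (M.weightMat π (perturb u π)).IsHermitian := by
    rw [weightMat]
    exact Matrix.isHermitian_diagonal _
  have h := lambdaMin_mul_le hB (Pi.single (s, a) 1)
  simpa [weightMat, lamD, Matrix.mulVec_diagonal, single_dotProduct] using h

end Weights

/-! ### The perturbed policy. -/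

section Perturb

variable {M} {π : Policy S A} {u : ℝ}

theorem card_bigActions_ge (π : Policy S A) (u : ℝ) (s : S) :
    (Fintype.card A : ℝ) - (bigActions u (π s)).card ≤ numMissing u π := by
  have := ciInf_le (Set.finite_range fun s => ((bigActions u (π s)).card : ℝ)).bddBelow s
  unfold numMissing
  linarith

theorem numMissing_nonneg [Nonempty S] (π : Policy S A) (u : ℝ) : 0 ≤ numMissing u π := by
  refine le_trans ?_ (card_bigActions_ge π u (Classical.arbitrary S))
  have : ((bigActions u (π (Classical.arbitrary S))).card : ℝ) ≤ Fintype.card A := by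
    exact_mod_cast Finset.card_le_univ _
  linarith

theorem sum_not_bigActions_le (u : ℝ) (p : stdSimplex ℝ A) :
    1 - ((Fintype.card A : ℝ) - (bigActions u p).card) * u / 2 ≤ ∑ a ∈ bigActions u p, p.1 a := by
  classical
  have h1 := Finset.sum_add_sum_compl (bigActions u p) p.1
  rw [p.2.2] at h1
  have h2 : ∑ a ∈ (bigActions u p)ᶜ, p.1 a ≤ ∑ _a ∈ (bigActions u p)ᶜ, u / 2 := by
    refine Finset.sum_le_sum fun a ha => ?_
    simp only [bigActions, Finset.mem_compl, Finset.mem_filter, Finset.mem_univ, true_and,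
      not_lt] at ha
    exact ha
  rw [Finset.sum_const, nsmul_eq_mul, Finset.card_compl,
    Nat.cast_sub (Finset.card_le_univ _)] at h2
  linarith

/-- Properties of the perturbed policy when the exploration level is small. -/
theorem perturb_spec (hu : 0 < u) (hmu : numMissing u π * u < 1) (s : S) :
    (perturb u π s).1 = perturbWeights u (π s) ∧
      ∀ a, (1 - numMissing u π * u) * (π s).1 a ≤ (perturb u π s).1 a := by
  classical
  set p := π s with hp
  set k : ℝ := (Fintype.card A : ℝ) - (bigActions u p).card with hk
  have hk0 : 0 ≤ k := by
    have : ((bigActions u p).card : ℝ) ≤ Fintype.card A := by exact_mod_cast Finset.card_le_univ _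
    linarith
  have hkm : k * u ≤ numMissing u π * u :=
    mul_le_mul_of_nonneg_right (card_bigActions_ge π u s) hu.le
  set σ := ∑ a ∈ bigActions u p, p.1 a with hσ
  have hσ1 : 1 - k * u / 2 ≤ σ := sum_not_bigActions_le u p
  have hku : 0 ≤ k * u := by positivity
  have hσ0 : 0 < σ := by linarith
  have hσle : σ ≤ 1 := by
    rw [← p.2.2]
    exact Finset.sum_le_sum_of_subset_of_nonneg (Finset.subset_univ _) fun a _ _ => p.2.1 a
  have hw : perturbWeights u p ∈ stdSimplex ℝ A := by
    refine ⟨fun a => ?_, ?_⟩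
    · simp only [perturbWeights]
      split_ifs with ha
      · exact mul_nonneg (p.2.1 a) (div_nonneg (by linarith) hσ0.le)
      · exact hu.le
    · rw [← Finset.sum_add_sum_compl (bigActions u p)]
      have e1 : ∑ a ∈ bigActions u p, perturbWeights u p a = 1 - k * u := by
        have : ∀ a ∈ bigActions u p, perturbWeights u p a = p.1 a * ((1 - k * u) / σ) :=
          fun a ha => by simp only [perturbWeights, if_pos ha]; rfl
        rw [Finset.sum_congr rfl this, ← Finset.sum_mul, ← hσ]
        field_simp
      have e2 : ∑ a ∈ (bigActions u p)ᶜ, perturbWeights u p a = k * u := by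
        have : ∀ a ∈ (bigActions u p)ᶜ, perturbWeights u p a = u := fun a ha => by
          simp only [perturbWeights, if_neg (Finset.mem_compl.1 ha)]
        rw [Finset.sum_congr rfl this, Finset.sum_const, nsmul_eq_mul, Finset.card_compl,
          Nat.cast_sub (Finset.card_le_univ _)]
      rw [e1, e2]
      ring
  have e : (perturb u π s).1 = perturbWeights u p := by
    simp only [perturb, ← hp, dif_pos hw]
  refine ⟨e, fun a => ?_⟩
  rw [e]
  have hpa := p.2.1 a
  simp only [perturbWeights]
  -- On retained actions the rescaling factor is at least 1 - mu, because their total mass σ is at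
  -- most 1; on the others π(a|s) ≤ u/2, which is below u.
  split_ifs with ha
  · rw [mul_comm]
    refine mul_le_mul_of_nonneg_left ?_ hpa
    rw [le_div_iff₀ hσ0]
    have : (1 - numMissing u π * u) * σ ≤ (1 - numMissing u π * u) * 1 :=
      mul_le_mul_of_nonneg_left hσle (by linarith)
    linarith
  · have h1 : p.1 a ≤ u / 2 := by
      simpa only [bigActions, Finset.mem_filter, Finset.mem_univ, true_and, not_lt] using ha
    have h2 : 0 ≤ numMissing u π * u := hku.trans hkm
    nlinarith

end Perturb

/-! ### The monotonicity constant and its stability under exploration. -/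

section BetaGap

variable [DecidableEq S] [DecidableEq A] {d : ℕ} (Ψ : Matrix (S × A) (Fin d) ℝ) (π : Policy S A)

theorem dot_weightMat_sub (π' : Policy S A) (f : S × A → ℝ) :
    f ⬝ᵥ ((M.weightMat π π' * (1 - M.pairMat π)) *ᵥ f) =
      ∑ s, M.stat π s * ∑ a, (π' s).1 a * (f (s, a) * (f (s, a) - (M.pairMat π *ᵥ f) (s, a))) := by
  rw [← Matrix.mulVec_mulVec, dot_weightMat_mulVec, Matrix.sub_mulVec, Matrix.one_mulVec]
  rfl

/-- A nonzero value shows that the set of admissible constants is nonempty. Its supremum is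
admissible too, because each constraint is linear in the constant. -/
theorem betaGap_spec [Nonempty S] (h0 : M.betaGap Ψ π ≠ 0) :
    M.betaGap Ψ π ≤ 1 / 2 ∧ ∀ θ : Fin d → ℝ,
      M.betaGap Ψ π * ∑ s, M.stat π s * ∑ a, (π s).1 a * (Ψ *ᵥ θ) (s, a) ^ 2 ≤
        ∑ s, M.stat π s * ∑ a, (π s).1 a *
          ((Ψ *ᵥ θ) (s, a) * ((Ψ *ᵥ θ) (s, a) - (M.pairMat π *ᵥ (Ψ *ᵥ θ)) (s, a))) := by
  have hdef : M.betaGap Ψ π = sSup {b | b ≤ 1 / 2 ∧ ∀ θ : Fin d → ℝ,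
    b * ((Ψ *ᵥ θ) ⬝ᵥ (M.weightMat π π *ᵥ (Ψ *ᵥ θ))) ≤
      (Ψ *ᵥ θ) ⬝ᵥ ((M.weightMat π π * (1 - M.pairMat π)) *ᵥ (Ψ *ᵥ θ))} := rfl
  have hne : {b | b ≤ 1 / 2 ∧ ∀ θ : Fin d → ℝ,
    b * ((Ψ *ᵥ θ) ⬝ᵥ (M.weightMat π π *ᵥ (Ψ *ᵥ θ))) ≤
      (Ψ *ᵥ θ) ⬝ᵥ ((M.weightMat π π * (1 - M.pairMat π)) *ᵥ (Ψ *ᵥ θ))}.Nonempty := by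
    by_contra h
    rw [Set.not_nonempty_iff_eq_empty] at h
    rw [h, Real.sSup_empty] at hdef
    exact h0 hdef
  refine ⟨hdef ▸ csSup_le hne fun b hb => hb.1, fun θ => ?_⟩
  simp only [dot_weightMat_sub, dot_weightMat_mulVec] at hdef hne
  have e : ∑ s, M.stat π s * ∑ a, (π s).1 a * (Ψ *ᵥ θ) (s, a) ^ 2 =
      ∑ s, M.stat π s * ∑ a, (π s).1 a * ((Ψ *ᵥ θ) (s, a) * (Ψ *ᵥ θ) (s, a)) := by
    simp only [sq]
  rw [e]
  set n := ∑ s, M.stat π s * ∑ a, (π s).1 a * ((Ψ *ᵥ θ) (s, a) * (Ψ *ᵥ θ) (s, a)) with hn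
  have hn0 : 0 ≤ n := Finset.sum_nonneg fun s _ => mul_nonneg ((M.stat_spec π).1.1 s)
    (Finset.sum_nonneg fun a _ => mul_nonneg ((π s).2.1 a) (mul_self_nonneg _))
  rcases hn0.eq_or_lt with h | h
  · obtain ⟨b, hb⟩ := hne
    have := hb.2 θ
    rw [← hn, ← h] at this
    rw [← h]
    simpa using this
  · rw [← le_div_iff₀ h, hdef]
    refine csSup_le hne fun b hb => ?_
    rw [le_div_iff₀ h]
    exact hb.2 θ

end BetaGap

/-- Monotonicity of the projected Bellman operator in the perturbed weights. -/
theorem perturbed_monotone [Nonempty S] {π : Policy S A} {u b νmin : ℝ} (hu : 0 < u)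
    (hb0 : 0 < b) (hb1 : b ≤ 1 / 2) (hν0 : 0 < νmin) (hν : ∀ s, νmin ≤ M.stat π s)
    (hlevel : u * (numMissing u π * (8 + b * νmin)) ≤ b * νmin) {f : S × A → ℝ}
    (hf : b * ∑ s, M.stat π s * ∑ a, (π s).1 a * f (s, a) ^ 2 ≤
      ∑ s, M.stat π s * ∑ a, (π s).1 a * (f (s, a) * (f (s, a) - (M.pairMat π *ᵥ f) (s, a)))) :
    b / 2 * ∑ s, M.stat π s * ∑ a, (perturb u π s).1 a * f (s, a) ^ 2 ≤
      ∑ s, M.stat π s * ∑ a, (perturb u π s).1 a *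
        (f (s, a) * (f (s, a) - (M.pairMat π *ᵥ f) (s, a))) := by
  classical
  set m := numMissing u π * u with hm
  have hm0 : 0 ≤ m := mul_nonneg (numMissing_nonneg π u) hu.le
  have hbν : 0 < b * νmin := by positivity
  have hlev : m * (8 + b * νmin) ≤ b * νmin := by
    calc m * (8 + b * νmin) = u * (numMissing u π * (8 + b * νmin)) := by rw [hm]; ring
      _ ≤ _ := hlevel
  have hm1 : m < 1 := by nlinarith
  -- The excess of the perturbed weights over (1 - m)π: nonnegative, of total mass m in every state.
  set Δ : S → A → ℝ := fun s a => (perturb u π s).1 a - (1 - m) * (π s).1 a with hΔ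
  have hΔ0 : ∀ s a, 0 ≤ Δ s a := fun s a => sub_nonneg.2 ((perturb_spec hu hm1 s).2 a)
  have hΔsum : ∀ s, ∑ a, Δ s a = m := fun s => by
    simp only [hΔ, Finset.sum_sub_distrib, ← Finset.mul_sum, (perturb u π s).2.2, (π s).2.2]
    ring
  have hstat := M.stat_spec π
  have hstat0 := hstat.1.1
  have hsplit : ∀ g : S × A → ℝ, ∑ s, M.stat π s * ∑ a, (perturb u π s).1 a * g (s, a) =
      (1 - m) * (∑ s, M.stat π s * ∑ a, (π s).1 a * g (s, a)) +
        ∑ s, M.stat π s * ∑ a, Δ s a * g (s, a) := by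
    intro g
    have e : ∀ s, ∑ a, (perturb u π s).1 a * g (s, a) =
        (1 - m) * (∑ a, (π s).1 a * g (s, a)) + ∑ a, Δ s a * g (s, a) := fun s => by
      rw [Finset.mul_sum, ← Finset.sum_add_distrib]
      refine Finset.sum_congr rfl fun a _ => ?_
      simp only [hΔ]
      ring
    rw [Finset.mul_sum (a := 1 - m), ← Finset.sum_add_distrib]
    refine Finset.sum_congr rfl fun s _ => ?_
    rw [e s]
    ring
  have hs1 := hsplit fun z => f z ^ 2
  have hs2 := hsplit fun z => f z * (f z - (M.pairMat π *ᵥ f) z)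
  rw [hs1, hs2]
  set X := ∑ s, M.stat π s * ∑ a, (π s).1 a * f (s, a) ^ 2 with hX
  set Y := ∑ s, M.stat π s * ∑ a, Δ s a * f (s, a) ^ 2 with hY
  set Y' := ∑ s, M.stat π s * ∑ a, Δ s a * (M.pairMat π *ᵥ f) (s, a) ^ 2 with hY'
  have hX0 : 0 ≤ X := Finset.sum_nonneg fun s _ => mul_nonneg (hstat0 s)
    (Finset.sum_nonneg fun a _ => mul_nonneg ((π s).2.1 a) (sq_nonneg _))
  have hY0 : 0 ≤ Y := Finset.sum_nonneg fun s _ => mul_nonneg (hstat0 s)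
    (Finset.sum_nonneg fun a _ => mul_nonneg (hΔ0 s a) (sq_nonneg _))
  -- On the excess part, f·Pf ≤ (f² + (Pf)²)/2.
  have hcross : Y - (Y + Y') / 2 ≤ ∑ s, M.stat π s * ∑ a, Δ s a *
      (f (s, a) * (f (s, a) - (M.pairMat π *ᵥ f) (s, a))) := by
    have e : Y - (Y + Y') / 2 = ∑ s, M.stat π s * ∑ a, Δ s a *
        (f (s, a) ^ 2 - (f (s, a) ^ 2 + (M.pairMat π *ᵥ f) (s, a) ^ 2) / 2) := by
      rw [hY, hY', ← Finset.sum_add_distrib, Finset.sum_div, ← Finset.sum_sub_distrib]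
      refine Finset.sum_congr rfl fun s _ => ?_
      rw [← mul_add, mul_div_assoc, ← mul_sub, ← Finset.sum_add_distrib, Finset.sum_div,
        ← Finset.sum_sub_distrib]
      congr 1
      exact Finset.sum_congr rfl fun a _ => by ring
    rw [e]
    refine Finset.sum_le_sum fun s _ => mul_le_mul_of_nonneg_left
      (Finset.sum_le_sum fun a _ => mul_le_mul_of_nonneg_left ?_ (hΔ0 s a)) (hstat0 s)
    nlinarith [sq_nonneg (f (s, a) - (M.pairMat π *ᵥ f) (s, a))]
  -- Two applications of Jensen bound (Pf)² by an average of f² over the next pair, and dividing by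
  -- the smallest stationary weight compares this with the stationary average X.
  have hYY : νmin * Y' ≤ m * X := by
    have h1 : ∀ z : S × A, νmin * (M.pairMat π *ᵥ f) z ^ 2 ≤ X := by
      intro z
      rw [pairMat_mulVec]
      have h2 : ((M.P z.1 z.2).1 ⬝ᵥ avg π f) ^ 2 ≤ ∑ s', (M.P z.1 z.2).1 s' * (avg π f s') ^ 2 :=
        inner_sq_le (M.P z.1 z.2) _
      have h3 : ∀ s', (avg π f s') ^ 2 ≤ ∑ a, (π s').1 a * f (s', a) ^ 2 := fun s' =>
        inner_sq_le (π s') _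
      have h4 : ∀ s', (M.P z.1 z.2).1 s' ≤ 1 := fun s' => by
        rw [← (M.P z.1 z.2).2.2]
        exact Finset.single_le_sum (fun s _ => (M.P z.1 z.2).2.1 s) (Finset.mem_univ s')
      calc νmin * ((M.P z.1 z.2).1 ⬝ᵥ avg π f) ^ 2
          ≤ νmin * ∑ s', (M.P z.1 z.2).1 s' * (avg π f s') ^ 2 := by gcongr
        _ = ∑ s', νmin * ((M.P z.1 z.2).1 s' * (avg π f s') ^ 2) := by rw [Finset.mul_sum]
        _ ≤ X := by
          refine Finset.sum_le_sum fun s' _ => ?_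
          have h5 := h3 s'
          have h6 := sq_nonneg (avg π f s')
          calc νmin * ((M.P z.1 z.2).1 s' * (avg π f s') ^ 2)
              ≤ νmin * (1 * (avg π f s') ^ 2) := by gcongr; exact h4 s'
            _ = νmin * (avg π f s') ^ 2 := by ring
            _ ≤ M.stat π s' * (avg π f s') ^ 2 := by gcongr; exact hν s'
            _ ≤ _ := by
              refine mul_le_mul_of_nonneg_left h5 (hstat0 s')
    rw [hY', Finset.mul_sum]
    calc ∑ s, νmin * (M.stat π s * ∑ a, Δ s a * (M.pairMat π *ᵥ f) (s, a) ^ 2)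
        = ∑ s, M.stat π s * ∑ a, Δ s a * (νmin * (M.pairMat π *ᵥ f) (s, a) ^ 2) := by
          refine Finset.sum_congr rfl fun s _ => ?_
          rw [mul_left_comm, Finset.mul_sum]
          congr 1
          exact Finset.sum_congr rfl fun a _ => by ring
      _ ≤ ∑ s, M.stat π s * ∑ a, Δ s a * X :=
          Finset.sum_le_sum fun s _ => mul_le_mul_of_nonneg_left
            (Finset.sum_le_sum fun a _ => mul_le_mul_of_nonneg_left (h1 _) (hΔ0 s a)) (hstat0 s)
      _ = m * X := by
          simp only [← Finset.sum_mul, hΔsum]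
          rw [hstat.1.2, one_mul]
  -- The condition on the exploration level says exactly 8m ≤ (1 - m) b ν_min, so the loss Y' is an
  -- eighth of the available (1 - m) b X.
  have hY8 : 8 * Y' ≤ (1 - m) * b * X := by
    have h1 : 8 * m ≤ (1 - m) * (b * νmin) := by nlinarith
    have h2 : νmin * (8 * Y') ≤ νmin * ((1 - m) * b * X) := by nlinarith
    exact le_of_mul_le_mul_left h2 hν0
  have h9 := mul_le_mul_of_nonneg_left hf (by linarith : 0 ≤ 1 - m)
  have h10 : 0 ≤ (1 - m) * b * X := mul_nonneg (mul_nonneg (by linarith) hb0.le) hX0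
  nlinarith
where
  inner_sq_le {ι : Type} [Fintype ι] (p : stdSimplex ℝ ι) (g : ι → ℝ) :
      (∑ i, p.1 i * g i) ^ 2 ≤ ∑ i, p.1 i * g i ^ 2 := by
    have h := (Ex.ofSimplex p).nonneg (f := fun i => (g i - Ex.ofSimplex p g) ^ 2)
      fun _ => sq_nonneg _
    have e : (fun i => (g i - Ex.ofSimplex p g) ^ 2) = fun i =>
        (g i ^ 2 - (2 * Ex.ofSimplex p g) * g i) + Ex.ofSimplex p g ^ 2 := by
      funext i; ring
    rw [e, Ex.add, Ex.sub, Ex.smul, Ex.const] at h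
    rw [← Ex.ofSimplex_apply, ← Ex.ofSimplex_apply]
    nlinarith

end AMDP

/-! ### The temporal difference problem of a policy -/

namespace AMDP

variable {S A : Type} [Fintype S] [Fintype A] (M : AMDP S A)

/-- One transition of the state-action chain. -/
def transEx (π : Policy S A) (z : S × A) : Ex (S × A) :=
  (Ex.ofSimplex (M.P z.1 z.2)).bind fun s' => (Ex.ofSimplex (π s')).map fun a' => (s', a')

theorem transEx_apply (π : Policy S A) (z : S × A) (f : S × A → ℝ) :
    M.transEx π z f = (M.pairMat π *ᵥ f) z := by
  rw [pairMat_mulVec, transEx, Ex.bind_apply, Ex.ofSimplex_apply]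
  simp only [Ex.map_apply, Ex.ofSimplex_apply]
  rfl

variable [DecidableEq S]

/-- The stationary distribution as a point of the simplex. -/
def statPt [Nonempty S] (π : Policy S A) : stdSimplex ℝ S := ⟨M.stat π, (M.stat_spec π).1⟩

variable [Nonempty S]

/-- The stationary law of the state-action pairs under `π`. -/
def pairEx (π : Policy S A) : Ex (S × A) :=
  (Ex.ofSimplex (M.statPt π)).bind fun s => (Ex.ofSimplex (π s)).map fun a => (s, a)

/-- The stationary law of the samples of the critic. -/
def tupleEx (π π' : Policy S A) : Ex ((S × A) × (S × A)) :=
  (Ex.ofSimplex (M.statPt π)).bind fun s => (Ex.ofSimplex (π' s)).bind fun a =>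
    (M.transEx π (s, a)).map fun z => ((s, a), z)

theorem pairEx_apply (π : Policy S A) (f : S × A → ℝ) :
    M.pairEx π f = M.stat π ⬝ᵥ avg π f := by
  rw [pairEx, Ex.bind_apply, Ex.ofSimplex_apply]
  simp only [Ex.map_apply, Ex.ofSimplex_apply]
  rfl

theorem tupleEx_apply (π π' : Policy S A) (f : (S × A) × (S × A) → ℝ) :
    M.tupleEx π π' f = ∑ s, M.stat π s * ∑ a, (π' s).1 a *
      (M.pairMat π *ᵥ fun z => f ((s, a), z)) (s, a) := by
  rw [tupleEx, Ex.bind_apply, Ex.ofSimplex_apply]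
  simp only [Ex.bind_apply, Ex.map_apply, Ex.ofSimplex_apply, transEx_apply]
  rfl

theorem tupleEx_mul_sub (π π' : Policy S A) (f g k : S × A → ℝ) :
    M.tupleEx π π' (fun ξ => f ξ.1 * (g ξ.1 - k ξ.2)) =
      ∑ s, M.stat π s * ∑ a, (π' s).1 a * (f (s, a) * (g (s, a) - (M.pairMat π *ᵥ k) (s, a))) := by
  rw [tupleEx_apply]
  refine Finset.sum_congr rfl fun s _ => ?_
  congr 1
  refine Finset.sum_congr rfl fun a _ => ?_
  rw [← transEx_apply, ← transEx_apply]
  congr 1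
  change M.transEx π (s, a) (fun z => f (s, a) * (g (s, a) - k z)) = _
  rw [Ex.smul, Ex.sub, Ex.const]

theorem tupleEx_fst (π π' : Policy S A) (f : S × A → ℝ) :
    M.tupleEx π π' (fun ξ => f ξ.1) = ∑ s, M.stat π s * ∑ a, (π' s).1 a * f (s, a) := by
  rw [tupleEx_apply]
  refine Finset.sum_congr rfl fun s _ => ?_
  congr 1
  refine Finset.sum_congr rfl fun a _ => ?_
  rw [← transEx_apply]
  congr 1
  exact Ex.const (M.transEx π (s, a)) (f (s, a))

variable [DecidableEq A]

/-- The standing assumptions on the decision process, the features and the exploration levels. -/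
structure Setting {d : ℕ} (M : AMDP S A) (Ψ : Matrix (S × A) (Fin d) ℝ) (u : Policy S A → ℝ)
    (Cβ ω Γ cbar mubar dmin : ℝ) : Prop where
  Cβ_pos : 0 < Cβ
  card : 2 ≤ Fintype.card S
  d_pos : 1 ≤ d
  erg : M.Ergodic
  ω_pos : 0 < ω
  convex : ∀ s, IsKLStronglyConvex ω (M.h s)
  abs_cost : ∀ (π : Policy S A) (z : S × A), |M.cost π z| ≤ cbar
  Γ_pos : 0 < Γ
  Γ_lt : Γ < 1
  stat_ge : ∀ (π : Policy S A) (s : S), 1 - Γ ≤ M.stat π s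
  norm_le : ∀ z : S × A, Ψ z ⬝ᵥ Ψ z ≤ 1
  gap : ∀ π : Policy S A, 1 ≤ Cβ * M.tmix * M.betaGap Ψ π
  level : ∀ π : Policy S A, M.GoodLevel Ψ π (u π)
  mubar_pos : 0 < mubar
  mu_ge : ∀ π : Policy S A, mubar ≤ M.mu Ψ π (u π)
  dmin_pos : 0 < dmin
  lamD_ge : ∀ π : Policy S A, dmin ≤ M.lamD π (u π)

/-- The weighted square of the features. -/
theorem lambdaMin_mul_le_tupleEx {d : ℕ} (Ψ : Matrix (S × A) (Fin d) ℝ) (π : Policy S A) (u : ℝ)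
    (x : Fin d → ℝ) :
    M.mu Ψ π u * (x ⬝ᵥ x) ≤ M.tupleEx π (perturb u π) fun ξ => (Ψ ξ.1 ⬝ᵥ x) ^ 2 := by
  refine (lambdaMin_mul_le (M.isHermitian_gram Ψ π (perturb u π)) x).trans (le_of_eq ?_)
  rw [dot_transpose_mul_mulVec, dot_weightMat_mulVec, M.tupleEx_fst π _ fun z => (Ψ z ⬝ᵥ x) ^ 2]
  simp only [sq]
  rfl

namespace Setting

variable {M} {d : ℕ} {Ψ : Matrix (S × A) (Fin d) ℝ} {u : Policy S A → ℝ}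
  {Cβ ω Γ cbar mubar dmin : ℝ} (H : M.Setting Ψ u Cβ ω Γ cbar mubar dmin)
include H

-- If the mixing times of the policies were unbounded, the supremum of naturals would be 0; the
-- hypothesis on the gap excludes this.
omit [Nonempty S] in
theorem tmix_ne [Nonempty A] : M.tmix ≠ 0 := by
  intro h
  have h1 := H.gap (uniformPolicy S A)
  rw [h] at h1
  norm_num at h1

omit [Nonempty S] in
theorem tmix_ge [Nonempty A] : (1 : ℝ) ≤ M.tmix := by
  exact_mod_cast Nat.one_le_iff_ne_zero.2 H.tmix_ne

omit [Nonempty S] in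
theorem betaGap_ge [Nonempty A] (π : Policy S A) : 1 / (Cβ * M.tmix) ≤ M.betaGap Ψ π := by
  have h1 := H.tmix_ge
  have h2 := H.Cβ_pos
  rw [div_le_iff₀ (by positivity), mul_comm]
  exact H.gap π

theorem betaGap_pos [Nonempty A] (π : Policy S A) : 0 < M.betaGap Ψ π := by
  have h1 := H.tmix_ge
  have h2 := H.Cβ_pos
  exact lt_of_lt_of_le (by positivity) (H.betaGap_ge π)

theorem betaGap_le [Nonempty A] (π : Policy S A) : M.betaGap Ψ π ≤ 1 / 2 :=
  (M.betaGap_spec Ψ π (H.betaGap_pos π).ne').1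

theorem Cβ_tmix [Nonempty A] : 2 ≤ Cβ * M.tmix := by
  have h1 := H.gap (uniformPolicy S A)
  have h2 := H.betaGap_le (uniformPolicy S A)
  have h3 : 0 ≤ Cβ * M.tmix := mul_nonneg H.Cβ_pos.le (Nat.cast_nonneg _)
  nlinarith

theorem stat_iInf (π : Policy S A) :
    0 < (⨅ s, M.stat π s) ∧ (⨅ s, M.stat π s) ≤ 1 ∧ ∀ s, (⨅ s, M.stat π s) ≤ M.stat π s := by
  have hb : ∀ s, (⨅ s, M.stat π s) ≤ M.stat π s :=
    fun s => ciInf_le (Set.finite_range (M.stat π)).bddBelow s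
  have hΓ := H.Γ_lt
  have hg : 1 - Γ ≤ ⨅ s, M.stat π s := le_ciInf (H.stat_ge π)
  refine ⟨by linarith, (hb (Classical.arbitrary S)).trans ?_, hb⟩
  have hν := (M.stat_spec π).1
  rw [← hν.2]
  exact Finset.single_le_sum (fun s _ => hν.1 s) (Finset.mem_univ _)

theorem numMissing_mul_le [Nonempty A] (π : Policy S A) : numMissing (u π) π * u π ≤ 1 / 16 := by
  obtain ⟨hu, -, hl⟩ := H.level π
  obtain ⟨h1, h2, -⟩ := H.stat_iInf π
  have h3 := H.betaGap_pos π
  have h4 := H.betaGap_le π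
  set ν := ⨅ s, M.stat π s
  have h5 : M.betaGap Ψ π * ν ≤ 1 / 2 * 1 := mul_le_mul h4 h2 h1.le (by norm_num)
  have h6 : 0 < M.betaGap Ψ π * ν := by positivity
  have h7 := numMissing_nonneg π (u π)
  have h8 : 0 ≤ numMissing (u π) π * u π := by positivity
  nlinarith

theorem le_betaGapPert [Nonempty A] (π : Policy S A) :
    M.betaGap Ψ π / 8 ≤ M.betaGapPert Ψ π (u π) := by
  have h1 := H.numMissing_mul_le π
  have h2 := mul_nonneg (numMissing_nonneg π (u π)) (H.level π).1.le
  have h3 := H.betaGap_pos π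
  have h4 := H.betaGap_le π
  refine le_min ?_ ?_ <;> nlinarith

/-- The lower bound `1 / (2 Cβ tmix)` of the monotonicity constant. -/
theorem monotone [Nonempty A] (π : Policy S A) (x : Fin d → ℝ) :
    1 / (2 * Cβ * M.tmix) * M.tupleEx π (perturb (u π) π) (fun ξ => (Ψ ξ.1 ⬝ᵥ x) ^ 2) ≤
      M.tupleEx π (perturb (u π) π) fun ξ => (Ψ ξ.1 ⬝ᵥ x) * ((Ψ ξ.1 - Ψ ξ.2) ⬝ᵥ x) := by
  obtain ⟨hν0, -, hν⟩ := H.stat_iInf π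
  have h1 := M.perturbed_monotone (H.level π).1 (H.betaGap_pos π) (H.betaGap_le π) hν0 hν
    (H.level π).2.2 ((M.betaGap_spec Ψ π (H.betaGap_pos π).ne').2 x)
  have e1 := M.tupleEx_fst π (perturb (u π) π) fun z => (Ψ *ᵥ x) z ^ 2
  have e2 := M.tupleEx_mul_sub π (perturb (u π) π) (Ψ *ᵥ x) (Ψ *ᵥ x) (Ψ *ᵥ x)
  rw [← e1, ← e2] at h1
  have h3 : 1 / (2 * Cβ * M.tmix) ≤ M.betaGap Ψ π / 2 := by
    have h := H.betaGap_ge π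
    calc 1 / (2 * Cβ * M.tmix) = 1 / (Cβ * M.tmix) / 2 := by
          rw [div_div]; congr 1; ring
      _ ≤ _ := by linarith
  simp only [sub_dotProduct]
  refine le_trans (mul_le_mul_of_nonneg_right h3 ?_) h1
  exact Ex.nonneg _ fun _ => sq_nonneg _

theorem tupleEx_sq_le (π : Policy S A) (π' : Policy S A) (x : Fin d → ℝ) :
    M.tupleEx π π' (fun ξ => (Ψ ξ.1 ⬝ᵥ x) ^ 2) ≤ x ⬝ᵥ x := by
  refine ((M.tupleEx π π').mono (g := fun _ => x ⬝ᵥ x) fun ξ => ?_).trans (le_of_eq (Ex.const _ _))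
  refine (dotProduct_sq_le _ _).trans ?_
  exact mul_le_of_le_one_left (dotProduct_self_nonneg_real x) (H.norm_le _)

theorem mu_le_one (π : Policy S A) : M.mu Ψ π (u π) ≤ 1 := by
  have h1 := M.lambdaMin_mul_le_tupleEx Ψ π (u π) (Pi.single ⟨0, H.d_pos⟩ 1)
  have h2 := H.tupleEx_sq_le π (perturb (u π) π) (Pi.single ⟨0, H.d_pos⟩ 1)
  simpa using h1.trans h2

theorem mubar_le_one [Nonempty A] : mubar ≤ 1 :=
  (H.mu_ge (uniformPolicy S A)).trans (H.mu_le_one _)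

theorem cbar_nonneg [Nonempty A] : 0 ≤ cbar :=
  (abs_nonneg _).trans (H.abs_cost (uniformPolicy S A) (Classical.arbitrary _))

omit H [DecidableEq A] in
theorem _root_.AMDP.rho_eq (π : Policy S A) : M.rho π = M.pairEx π (M.cost π) := by
  rw [pairEx_apply]
  have h := M.stat_dot_avg_cost π
  rw [← pairEx_apply, Ex.sub, Ex.const] at h
  rw [← pairEx_apply]
  linarith

theorem abs_rho_le [Nonempty A] (π : Policy S A) : |M.rho π| ≤ cbar := by
  rw [rho_eq]
  refine (Ex.abs_apply_le _ _).trans ?_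
  exact ((M.pairEx π).mono fun z => H.abs_cost π z).trans (le_of_eq (Ex.const _ _))

theorem abs_cost_sub_le [Nonempty A] (π : Policy S A) (z : S × A) :
    |M.cost π z - M.rho π| ≤ 2 * cbar := by
  refine (abs_sub _ _).trans ?_
  linarith [H.abs_cost π z, H.abs_rho_le π]

/-- The weights of all pairs sum to 1. The second bound absorbs the number of state-action pairs,
hence the moment order q, into the logarithm of 1/`dmin`. -/
theorem perturb_nonneg_sum (π : Policy S A) : M.lamD π (u π) ≤ 1 ∧
    (Fintype.card (S × A) : ℝ) * dmin ≤ 1 := by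
  have h1 : ∑ z : S × A, M.stat π z.1 * (perturb (u π) π z.1).1 z.2 = 1 := by
    rw [Fintype.sum_prod_type]
    simp only [← Finset.mul_sum, (perturb (u π) π _).2.2, mul_one, (M.stat_spec π).1.2]
  have h0 : ∀ z : S × A, 0 ≤ M.stat π z.1 * (perturb (u π) π z.1).1 z.2 := fun z =>
    mul_nonneg ((M.stat_spec π).1.1 _) ((perturb (u π) π _).2.1 _)
  constructor
  · obtain ⟨a, ha⟩ : ∃ a, 0 < (perturb (u π) π (Classical.arbitrary S)).1 a := by
      by_contra hne
      push Not at hne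
      have := Finset.sum_nonpos fun a (_ : a ∈ Finset.univ) => hne a
      rw [(perturb (u π) π _).2.2] at this
      linarith
    refine (M.lamD_le π (u π) (Classical.arbitrary S) a).trans ?_
    rw [← h1]
    exact Finset.single_le_sum (f := fun z : S × A => M.stat π z.1 * (perturb (u π) π z.1).1 z.2)
      (fun z _ => h0 z) (Finset.mem_univ (Classical.arbitrary S, a))
  · rw [← h1, ← nsmul_eq_mul, ← Finset.card_univ]
    exact Finset.card_nsmul_le_sum _ _ _ fun z _ =>
      (H.lamD_ge π).trans (M.lamD_le π (u π) z.1 z.2)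

end Setting

/-! ### The fixed point -/

section Fixed

variable {d : ℕ} (Ψ : Matrix (S × A) (Fin d) ℝ) (π : Policy S A)

/-- Pairing the matrix equation with x turns it into the stationary mean of the stochastic operator,
the form in which the martingale arguments use it. -/
theorem isFixed_iff (π' : Policy S A) (θ : Fin d → ℝ) :
    (Ψᵀ * M.weightMat π π' * Ψ) *ᵥ θ = (Ψᵀ * M.weightMat π π' * M.pairMat π * Ψ) *ᵥ θ +
        (Ψᵀ * M.weightMat π π') *ᵥ (fun z => M.cost π z - M.rho π) ↔
      ∀ x, M.tupleEx π π' (fun ξ => (Ψ ξ.1 ⬝ᵥ x) *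
        ((Ψ ξ.1 - Ψ ξ.2) ⬝ᵥ θ - M.cost π ξ.1 + M.rho π)) = 0 := by
  set R : S × A → ℝ := Ψ *ᵥ θ - M.pairMat π *ᵥ (Ψ *ᵥ θ) - fun z => M.cost π z - M.rho π with hR
  have e1 : ∀ x, M.tupleEx π π' (fun ξ => (Ψ ξ.1 ⬝ᵥ x) *
        ((Ψ ξ.1 - Ψ ξ.2) ⬝ᵥ θ - M.cost π ξ.1 + M.rho π)) =
      x ⬝ᵥ ((Ψᵀ * M.weightMat π π') *ᵥ R) := by
    intro x
    have h1 := M.tupleEx_mul_sub π π' (Ψ *ᵥ x)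
      (fun z => (Ψ *ᵥ θ) z - (M.cost π z - M.rho π)) (Ψ *ᵥ θ)
    have h2 : x ⬝ᵥ ((Ψᵀ * M.weightMat π π') *ᵥ R) = (Ψ *ᵥ x) ⬝ᵥ (M.weightMat π π' *ᵥ R) := by
      rw [← Matrix.mulVec_mulVec, Matrix.dotProduct_mulVec, Matrix.vecMul_transpose]
    rw [h2, dot_weightMat_mulVec]
    refine Eq.trans ?_ (h1.trans ?_)
    · congr 1
      funext ξ
      rw [sub_dotProduct]
      change (Ψ *ᵥ x) ξ.1 * ((Ψ *ᵥ θ) ξ.1 - (Ψ *ᵥ θ) ξ.2 - M.cost π ξ.1 + M.rho π) = _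
      ring
    · refine Finset.sum_congr rfl fun s _ => ?_
      congr 1
      refine Finset.sum_congr rfl fun a _ => ?_
      simp only [hR, Pi.sub_apply]
      ring
  have e2 : (Ψᵀ * M.weightMat π π') *ᵥ R = (Ψᵀ * M.weightMat π π' * Ψ) *ᵥ θ -
      ((Ψᵀ * M.weightMat π π' * M.pairMat π * Ψ) *ᵥ θ +
        (Ψᵀ * M.weightMat π π') *ᵥ (fun z => M.cost π z - M.rho π)) := by
    simp only [hR, Matrix.mulVec_sub, Matrix.mulVec_mulVec, Matrix.mul_assoc]
    abel
  simp only [e1]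
  rw [← sub_eq_zero, ← e2]
  exact ⟨fun h x => by rw [h, dotProduct_zero], fun h => dotProduct_self_eq_zero.1 (h _)⟩

end Fixed

namespace Setting

variable {M} {d : ℕ} {Ψ : Matrix (S × A) (Fin d) ℝ} {u : Policy S A → ℝ}
  {Cβ ω Γ cbar mubar dmin : ℝ} (H : M.Setting Ψ u Cβ ω Γ cbar mubar dmin) [Nonempty A]

theorem rate_bounds (H : M.Setting Ψ u Cβ ω Γ cbar mubar dmin) :
    0 < 1 / (2 * Cβ * M.tmix) ∧ 1 / (2 * Cβ * M.tmix) ≤ 1 / 4 := by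
  have h := H.Cβ_tmix
  constructor
  · exact one_div_pos.2 (by linarith)
  · exact one_div_le_one_div_of_le (by norm_num) (by linarith)

omit [Nonempty A] in
theorem posdef (H : M.Setting Ψ u Cβ ω Γ cbar mubar dmin) (π : Policy S A) (x : Fin d → ℝ) :
    mubar * (x ⬝ᵥ x) ≤ M.tupleEx π (perturb (u π) π) fun ξ => (Ψ ξ.1 ⬝ᵥ x) ^ 2 :=
  (mul_le_mul_of_nonneg_right (H.mu_ge π) (dotProduct_self_nonneg_real x)).trans
    (M.lambdaMin_mul_le_tupleEx Ψ π (u π) x)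

-- The vector is chosen by `epsilon`, so existence must be shown: the expected operator A is
-- invertible, and the equation is linear with matrix A.
include H in
theorem thetaStar_spec (π : Policy S A) (x : Fin d → ℝ) :
    M.tupleEx π (perturb (u π) π) (fun ξ => (Ψ ξ.1 ⬝ᵥ x) *
      ((Ψ ξ.1 - Ψ ξ.2) ⬝ᵥ M.thetaStar Ψ π (u π) - M.cost π ξ.1 + M.rho π)) = 0 := by
  -- An auxiliary problem with zero costs and zero solution; only its matrix A is needed, and A does
  -- not depend on the costs.
  let D : TDProblem (S × A) d :=
    { Ψ := Ψ, cost := fun _ => 0, wp := M.tupleEx π (perturb (u π) π), wc := M.pairEx π, ρ := 0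
      θs := 0, G := 0, β := 1 / (2 * Cβ * M.tmix), μ := mubar
      β_pos := H.rate_bounds.1
      μ_pos := H.mubar_pos
      β_le := H.rate_bounds.2.trans (by norm_num)
      μ_le := H.mubar_le_one
      norm_le := H.norm_le
      monotone := H.monotone π
      posdef := H.posdef π
      fixed := fun x => by simpa using Ex.const _ _
      residual := fun ξ => by simp
      cost_mean := Ex.const _ _
      cost_le := fun z => by simp }
  refine (M.isFixed_iff Ψ π (perturb (u π) π) _).1 ?_ x
  refine Classical.epsilon_spec (p := fun θ =>
    (Ψᵀ * M.weightMat π (perturb (u π) π) * Ψ) *ᵥ θ =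
      (Ψᵀ * M.weightMat π (perturb (u π) π) * M.pairMat π * Ψ) *ᵥ θ +
        (Ψᵀ * M.weightMat π (perturb (u π) π)) *ᵥ (fun z => M.cost π z - M.rho π)) ?_
  refine ⟨D.A⁻¹ *ᵥ (fun i => D.wp fun ξ => Ψ ξ.1 i * (M.cost π ξ.1 - M.rho π)), ?_⟩
  rw [isFixed_iff]
  intro x
  set θ := D.A⁻¹ *ᵥ (fun i => D.wp fun ξ => Ψ ξ.1 i * (M.cost π ξ.1 - M.rho π)) with hθ
  have h1 : x ⬝ᵥ (D.A *ᵥ θ) = D.wp fun ξ => (Ψ ξ.1 ⬝ᵥ x) * (M.cost π ξ.1 - M.rho π) := by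
    rw [hθ, D.A_mulVec_inv, dotProduct]
    simp only [dotProduct, Finset.sum_mul]
    rw [Ex.sum]
    refine Finset.sum_congr rfl fun i _ => ?_
    rw [← Ex.smul]
    congr 1
    funext ξ
    ring
  rw [D.dot_A] at h1
  have e : ∀ ξ : (S × A) × (S × A), (Ψ ξ.1 ⬝ᵥ x) *
      ((Ψ ξ.1 - Ψ ξ.2) ⬝ᵥ θ - M.cost π ξ.1 + M.rho π) =
      (D.Ψ ξ.1 ⬝ᵥ x) * ((D.Ψ ξ.1 - D.Ψ ξ.2) ⬝ᵥ θ) - (Ψ ξ.1 ⬝ᵥ x) * (M.cost π ξ.1 - M.rho π) :=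
    fun ξ => by ring
  simp only [e]
  rw [Ex.sub]
  exact sub_eq_zero.2 h1

/-- The temporal difference problem of the policy `π`. -/
def tdProblem (H : M.Setting Ψ u Cβ ω Γ cbar mubar dmin) (π : Policy S A) (G : ℝ)
    (hres : ∀ ξ : (S × A) × (S × A),
      |(Ψ ξ.1 - Ψ ξ.2) ⬝ᵥ M.thetaStar Ψ π (u π) - M.cost π ξ.1 + M.rho π| ≤ G)
    (hcost : ∀ z, |M.cost π z - M.rho π| ≤ G) : TDProblem (S × A) d where
  Ψ := Ψ
  cost := M.cost π
  wp := M.tupleEx π (perturb (u π) π)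
  wc := M.pairEx π
  ρ := M.rho π
  θs := M.thetaStar Ψ π (u π)
  G := G
  β := 1 / (2 * Cβ * M.tmix)
  μ := mubar
  β_pos := H.rate_bounds.1
  μ_pos := H.mubar_pos
  β_le := H.rate_bounds.2.trans (by norm_num)
  μ_le := H.mubar_le_one
  norm_le := H.norm_le
  monotone := H.monotone π
  posdef := H.posdef π
  fixed := H.thetaStar_spec π
  residual := hres
  cost_mean := (M.rho_eq π).symm
  cost_le := hcost

include H

theorem norm_mulVec_le (x : Fin d → ℝ) : ‖Ψ *ᵥ x‖ ≤ √(x ⬝ᵥ x) := by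
  obtain ⟨z, hz⟩ := exists_norm_le_abs (Ψ *ᵥ x)
  refine hz.trans (Real.abs_le_sqrt ?_)
  exact (dotProduct_sq_le (Ψ z) x).trans
    (mul_le_of_le_one_left (dotProduct_self_nonneg_real x) (H.norm_le z))

/-- Test the fixed point equation with its solution: βμ|θ|² ≤ 2 cbar |θ|. This crude bound is used
for the bias, where it is beaten by exponentially small factors, and for boundedness of suprema. -/
theorem thetaStar_le (π : Policy S A) :
    √(M.thetaStar Ψ π (u π) ⬝ᵥ M.thetaStar Ψ π (u π)) ≤
      2 * cbar / (1 / (2 * Cβ * M.tmix) * mubar) := by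
  set θ := M.thetaStar Ψ π (u π) with hθ
  obtain ⟨hβ, -⟩ := H.rate_bounds
  have hμ := H.mubar_pos
  set β := 1 / (2 * Cβ * (M.tmix : ℝ))
  set E := M.tupleEx π (perturb (u π) π)
  have h1 := H.thetaStar_spec π θ
  have h2 := H.monotone π θ
  have h3 := H.posdef π θ
  have hn := dotProduct_self_nonneg_real θ
  have e : ∀ ξ : (S × A) × (S × A), (Ψ ξ.1 ⬝ᵥ θ) *
      ((Ψ ξ.1 - Ψ ξ.2) ⬝ᵥ θ - M.cost π ξ.1 + M.rho π) =
      (Ψ ξ.1 ⬝ᵥ θ) * ((Ψ ξ.1 - Ψ ξ.2) ⬝ᵥ θ) - (Ψ ξ.1 ⬝ᵥ θ) * (M.cost π ξ.1 - M.rho π) :=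
    fun ξ => by ring
  rw [show (fun ξ : (S × A) × (S × A) => (Ψ ξ.1 ⬝ᵥ θ) *
      ((Ψ ξ.1 - Ψ ξ.2) ⬝ᵥ θ - M.cost π ξ.1 + M.rho π)) = _ from funext e, Ex.sub] at h1
  have h4 : E (fun ξ => (Ψ ξ.1 ⬝ᵥ θ) * (M.cost π ξ.1 - M.rho π)) ≤ √(θ ⬝ᵥ θ) * (2 * cbar) := by
    refine (E.mono (g := fun _ => √(θ ⬝ᵥ θ) * (2 * cbar)) fun ξ => ?_).trans
      (le_of_eq (Ex.const _ _))
    refine (le_abs_self _).trans ?_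
    rw [abs_mul]
    exact mul_le_mul ((norm_le_pi_norm (Ψ *ᵥ θ) ξ.1).trans (H.norm_mulVec_le θ))
      (H.abs_cost_sub_le π _) (abs_nonneg _) (Real.sqrt_nonneg _)
  rw [le_div_iff₀ (by positivity)]
  have h5 : β * (mubar * (θ ⬝ᵥ θ)) ≤ √(θ ⬝ᵥ θ) * (2 * cbar) := by
    have := mul_le_mul_of_nonneg_left h3 hβ.le
    linarith
  have hs := Real.mul_self_sqrt hn
  have hs0 := Real.sqrt_nonneg (θ ⬝ᵥ θ)
  rcases hs0.eq_or_lt with h0 | h0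
  · rw [← h0, zero_mul]; linarith [H.cbar_nonneg]
  · refine le_of_mul_le_mul_left ?_ h0
    calc √(θ ⬝ᵥ θ) * (√(θ ⬝ᵥ θ) * (β * mubar)) = β * (mubar * (√(θ ⬝ᵥ θ) * √(θ ⬝ᵥ θ))) := by ring
      _ ≤ _ := by rw [hs]; exact h5

end Setting

/-! ### The approximation error -/

section SupNorm

variable {ι : Type} [Fintype ι]

theorem supNormModConst_le (x : ι → ℝ) (b : ℝ) : supNormModConst x ≤ ‖fun i => x i + b‖ :=
  ciInf_le ⟨0, by rintro _ ⟨b, rfl⟩; exact norm_nonneg _⟩ b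

theorem supNormModConst_nonneg (x : ι → ℝ) : 0 ≤ supNormModConst x :=
  Real.iInf_nonneg fun _ => norm_nonneg _

theorem supNormModConst_add_le (x y : ι → ℝ) :
    supNormModConst (x + y) ≤ supNormModConst x + ‖y‖ := by
  rw [← sub_le_iff_le_add]
  refine le_ciInf fun b => ?_
  rw [sub_le_iff_le_add]
  refine (supNormModConst_le _ b).trans ?_
  have : (fun i => (x + y) i + b) = (fun i => x i + b) + y := by
    funext i; simp only [Pi.add_apply]; ring
  rw [this]
  exact norm_add_le _ _

theorem supNormModConst_le_norm (x : ι → ℝ) : supNormModConst x ≤ ‖x‖ := by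
  simpa using supNormModConst_le x 0

end SupNorm

namespace Setting

variable {M} {d : ℕ} {Ψ : Matrix (S × A) (Fin d) ℝ} {u : Policy S A → ℝ}
  {Cβ ω Γ cbar mubar dmin : ℝ} (H : M.Setting Ψ u Cβ ω Γ cbar mubar dmin) [Nonempty A]
include H

theorem norm_basicQ_le (π : Policy S A) : ‖M.basicQ π‖ ≤ 2 * cbar * (1 + 8 * M.tmix) := by
  have h1 := M.abs_basicQ_le H.erg H.tmix_ne π (H.abs_cost_sub_le π)
  refine (pi_norm_le_iff_of_nonneg ?_).2 h1
  have := H.cbar_nonneg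
  positivity

theorem approx_le_bound (π : Policy S A) :
    supNormModConst (Ψ *ᵥ M.thetaStar Ψ π (u π) - M.basicQ π) ≤
      2 * cbar / (1 / (2 * Cβ * M.tmix) * mubar) + 2 * cbar * (1 + 8 * M.tmix) := by
  refine (supNormModConst_le_norm _).trans ((norm_sub_le _ _).trans ?_)
  exact add_le_add ((H.norm_mulVec_le _).trans (H.thetaStar_le π)) (H.norm_basicQ_le π)

theorem approx_le (π : Policy S A) :
    supNormModConst (Ψ *ᵥ M.thetaStar Ψ π (u π) - M.basicQ π) ≤ M.epsApprox Ψ u :=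
  le_ciSup (f := fun π : Policy S A => supNormModConst (Ψ *ᵥ M.thetaStar Ψ π (u π) - M.basicQ π))
    ⟨_, by rintro _ ⟨π, rfl⟩; exact H.approx_le_bound π⟩ π

theorem epsApprox_le : M.epsApprox Ψ u ≤
      2 * cbar / (1 / (2 * Cβ * M.tmix) * mubar) + 2 * cbar * (1 + 8 * M.tmix) :=
  have : Nonempty (Policy S A) := ⟨uniformPolicy S A⟩
  ciSup_le fun π => H.approx_le_bound π

theorem epsApprox_nonneg : 0 ≤ M.epsApprox Ψ u :=
  (supNormModConst_nonneg _).trans (H.approx_le (uniformPolicy S A))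

/-- By the Bellman equation c - ρ = Q - PQ, which is insensitive to constants added to Q. Modulo a
constant, Q is within ε_approx of Ψθ*, whose sup norm is at most |θ*|. So the noise level of the
critic involves neither the mixing time nor the bound on the costs. -/
theorem abs_cost_sub_le_approx (π : Policy S A) (z : S × A) :
    |M.cost π z - M.rho π| ≤ 2 * (M.epsApprox Ψ u +
      √(M.thetaStar Ψ π (u π) ⬝ᵥ M.thetaStar Ψ π (u π))) := by
  set θ := M.thetaStar Ψ π (u π) with hθ
  have hb : ∀ b : ℝ, |M.cost π z - M.rho π| / 2 - √(θ ⬝ᵥ θ) ≤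
      ‖fun i => (Ψ *ᵥ θ - M.basicQ π) i + b‖ := by
    intro b
    set n := ‖fun i => (Ψ *ᵥ θ - M.basicQ π) i + b‖ with hn
    have hQ : ∀ y, |M.basicQ π y - b| ≤ n + √(θ ⬝ᵥ θ) := by
      intro y
      have h1 : |(Ψ *ᵥ θ - M.basicQ π) y + b| ≤ n :=
        norm_le_pi_norm (fun i => (Ψ *ᵥ θ - M.basicQ π) i + b) y
      have h2 : |(Ψ *ᵥ θ) y| ≤ √(θ ⬝ᵥ θ) :=
        (norm_le_pi_norm (Ψ *ᵥ θ) y).trans (H.norm_mulVec_le θ)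
      have e : M.basicQ π y - b = (Ψ *ᵥ θ) y - ((Ψ *ᵥ θ - M.basicQ π) y + b) := by
        simp only [Pi.sub_apply]; ring
      rw [e]
      exact (abs_sub _ _).trans (by linarith)
    have hB := congrFun (M.basicQ_bellman H.erg H.tmix_ne π) z
    rw [Pi.add_apply, ← transEx_apply] at hB
    have e : M.cost π z - M.rho π = (M.basicQ π z - b) -
        M.transEx π z (fun y => M.basicQ π y - b) := by
      rw [Ex.sub, Ex.const]
      change M.basicQ π z = (M.cost π z - M.rho π) + _ at hB
      linarith
    have h3 : |M.transEx π z (fun y => M.basicQ π y - b)| ≤ n + √(θ ⬝ᵥ θ) :=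
      (Ex.abs_apply_le _ _).trans (((M.transEx π z).mono hQ).trans (le_of_eq (Ex.const _ _)))
    have h4 : |M.cost π z - M.rho π| ≤ 2 * (n + √(θ ⬝ᵥ θ)) := by
      rw [e]
      exact (abs_sub _ _).trans (by linarith [hQ z])
    linarith
  have h1 : |M.cost π z - M.rho π| / 2 - √(θ ⬝ᵥ θ) ≤ M.epsApprox Ψ u :=
    (le_ciInf hb).trans (H.approx_le π)
  linarith

theorem abs_residual_le (π : Policy S A) (ξ : (S × A) × (S × A)) :
    |(Ψ ξ.1 - Ψ ξ.2) ⬝ᵥ M.thetaStar Ψ π (u π) - M.cost π ξ.1 + M.rho π| ≤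
      2 * M.epsApprox Ψ u + 4 * √(M.thetaStar Ψ π (u π) ⬝ᵥ M.thetaStar Ψ π (u π)) := by
  set θ := M.thetaStar Ψ π (u π) with hθ
  have h : ∀ y, |Ψ y ⬝ᵥ θ| ≤ √(θ ⬝ᵥ θ) := fun y =>
    (norm_le_pi_norm (Ψ *ᵥ θ) y).trans (H.norm_mulVec_le θ)
  have e : (Ψ ξ.1 - Ψ ξ.2) ⬝ᵥ θ - M.cost π ξ.1 + M.rho π =
      (Ψ ξ.1 ⬝ᵥ θ - Ψ ξ.2 ⬝ᵥ θ) - (M.cost π ξ.1 - M.rho π) := by rw [sub_dotProduct]; ring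
  rw [e]
  refine (abs_sub _ _).trans ?_
  have := abs_sub (Ψ ξ.1 ⬝ᵥ θ) (Ψ ξ.2 ⬝ᵥ θ)
  linarith [H.abs_cost_sub_le_approx π ξ.1, h ξ.1, h ξ.2]

/-- The temporal difference problem of the policy `π` with its natural noise level. -/
def td (π : Policy S A) : TDProblem (S × A) d :=
  H.tdProblem π (2 * M.epsApprox Ψ u + 4 * √(M.thetaStar Ψ π (u π) ⬝ᵥ M.thetaStar Ψ π (u π)))
    (H.abs_residual_le π) fun z => (H.abs_cost_sub_le_approx π z).trans (by
      linarith [Real.sqrt_nonneg (M.thetaStar Ψ π (u π) ⬝ᵥ M.thetaStar Ψ π (u π))])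

end Setting
end AMDP

/-! ### Comparison of the trajectory with independent samples -/

theorem Dom.mono {X R : Type} {lo hi lo' hi' : ℝ} {p : PMF (X × R)} {E : Ex X}
    (h : Dom lo hi p E) (hlo : lo' ≤ lo) (hhi : hi ≤ hi') : Dom lo' hi' p E where
  fin := h.fin
  le f hf := (h.le f hf).trans (mul_le_mul_of_nonneg_right hhi (E.nonneg hf))
  ge f hf := (mul_le_mul_of_nonneg_right hlo (E.nonneg hf)).trans (h.ge f hf)

/-- From (1+δ)^m (1-δ)^m ≤ 1 and Bernoulli's lower bound 1 - mδ of the second factor. -/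
theorem one_add_pow_le {δ : ℝ} (hδ : 0 ≤ δ) {m : ℕ} (h : m * δ ≤ 1 / 2) :
    (1 + δ) ^ m ≤ 1 + 2 * (m * δ) := by
  rcases Nat.eq_zero_or_pos m with rfl | hm
  · simp
  have hm1 : (1 : ℝ) ≤ m := by exact_mod_cast hm
  have hδ1 : δ ≤ 1 / 2 := by nlinarith
  have h1 : 1 - m * δ ≤ (1 - δ) ^ m := by
    have := one_add_mul_le_pow (a := -δ) (by linarith) m
    rw [← sub_eq_add_neg] at this
    linarith
  have h2 : (1 + δ) ^ m * (1 - δ) ^ m ≤ 1 := by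
    rw [← mul_pow]
    exact pow_le_one₀ (by nlinarith) (by nlinarith)
  have h3 : (1 + δ) ^ m * (1 - m * δ) ≤ 1 :=
    (mul_le_mul_of_nonneg_left h1 (by positivity)).trans h2
  have h4 : 0 ≤ m * δ := by positivity
  by_contra hcon
  push Not at hcon
  nlinarith

theorem Dom.of_pow {X R : Type} {δ : ℝ} {m : ℕ} {p : PMF (X × R)} {E : Ex X} (hδ : 0 ≤ δ)
    (hm : m * δ ≤ 1 / 2) (h : Dom ((1 - δ) ^ m) ((1 + δ) ^ m) p E) :
    Dom (1 - 2 * (m * δ)) (1 + 2 * (m * δ)) p E := by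
  refine h.mono ?_ (one_add_pow_le hδ hm)
  have h4 : 0 ≤ m * δ := by positivity
  rcases Nat.eq_zero_or_pos m with rfl | hm0
  · simp
  have hm1 : (1 : ℝ) ≤ m := by exact_mod_cast hm0
  have hδ1 : δ ≤ 1 / 2 := by nlinarith
  have := one_add_mul_le_pow (a := -δ) (by linarith) m
  rw [← sub_eq_add_neg] at this
  linarith

namespace AMDP

variable {S A : Type} [Fintype S] [Fintype A] (M : AMDP S A)

theorem finite_support_transition (π : Policy S A) (z : S × A) :
    (M.transition π z).support.Finite := finite_support_of_finite _

theorem pmfE_transition (π : Policy S A) (z : S × A) (f : S × A → ℝ) :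
    pmfE (M.transition π z) f = M.transEx π z f := by
  rw [transition, pmfE_bind (finite_support_of_finite _) fun _ => finite_support_of_finite _,
    pmfE_pmfOf, transEx, Ex.bind_apply, Ex.ofSimplex_apply]
  refine Finset.sum_congr rfl fun s _ => ?_
  rw [pmfE_map _ (finite_support_of_finite _), pmfE_pmfOf, Ex.map_apply, Ex.ofSimplex_apply]

theorem finite_support_run (π : Policy S A) (k : ℕ) (x : Traj S A) :
    (M.run π k x).support.Finite := by
  induction k generalizing x with
  | zero => exact finite_support_pure x
  | succ k ih => exact finite_support_bind (M.finite_support_transition π x.1) fun z => ih _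

theorem pmfE_run [DecidableEq S] [DecidableEq A] (π : Policy S A) (k : ℕ) (x : Traj S A)
    (f : S × A → ℝ) :
    pmfE (M.run π k x) (fun y => f y.1) = (M.pairMat π ^ k *ᵥ f) x.1 := by
  induction k generalizing x with
  | zero => rw [run, pmfE_pure, pow_zero, Matrix.one_mulVec]
  | succ k ih =>
    rw [run, pmfE_bind (M.finite_support_transition π x.1) fun z => M.finite_support_run π k _]
    simp only [ih]
    rw [pmfE_transition, transEx_apply, pow_succ', ← Matrix.mulVec_mulVec]

/-! ### The trajectory after a mixing period. -/

section Mixing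

variable [DecidableEq S] [DecidableEq A] [Nonempty S] (hM : M.Ergodic) (ht : M.tmix ≠ 0)
  {Γ : ℝ} (hΓ : Γ < 1) {π : Policy S A} (hν : ∀ s, 1 - Γ ≤ M.stat π s)
include hM ht hΓ hν

-- The lower bound 1 - Γ of the stationary weights converts the ℓ₁ error into an error relative to
-- each weight.
omit [DecidableEq A] in
theorem ratio_bounds {j k : ℕ} (hk : M.tmix * j ≤ k) {q : S → ℝ} (hq : q ∈ stdSimplex ℝ S)
    (s : S) : (1 - 2 * (1 / 2) ^ j / (1 - Γ)) * M.stat π s ≤ (q ᵥ* M.stateMat π ^ k) s ∧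
      (q ᵥ* M.stateMat π ^ k) s ≤ (1 + 2 * (1 / 2) ^ j / (1 - Γ)) * M.stat π s := by
  have h1 := M.l1_mix_simplex hM ht π hk hq
  have h2 : |(q ᵥ* M.stateMat π ^ k) s - M.stat π s| ≤ l1 (q ᵥ* M.stateMat π ^ k - M.stat π) :=
    Finset.single_le_sum (f := fun s => |(q ᵥ* M.stateMat π ^ k - M.stat π) s|)
      (fun _ _ => abs_nonneg _) (Finset.mem_univ s)
  have h3 : (2 : ℝ) * (1 / 2) ^ j ≤ 2 * (1 / 2) ^ j / (1 - Γ) * M.stat π s := by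
    have h4 : 0 < 1 - Γ := by linarith
    rw [div_mul_eq_mul_div, le_div_iff₀ h4]
    exact mul_le_mul_of_nonneg_left (hν s) (by positivity)
  have h5 := abs_le.1 (h2.trans (h1.trans h3))
  constructor <;> linarith [h5.1, h5.2]

theorem run_apply_bounds {j k : ℕ} (hk : M.tmix * j + 1 ≤ k) (x : Traj S A) {f : S × A → ℝ}
    (hf : ∀ s, 0 ≤ avg π f s) :
    (1 - 2 * (1 / 2) ^ j / (1 - Γ)) * (M.stat π ⬝ᵥ avg π f) ≤
        pmfE (M.run π k x) (fun y => f y.1) ∧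
      pmfE (M.run π k x) (fun y => f y.1) ≤
        (1 + 2 * (1 / 2) ^ j / (1 - Γ)) * (M.stat π ⬝ᵥ avg π f) := by
  obtain ⟨k, rfl⟩ : ∃ i, k = i + 1 := ⟨k - 1, by omega⟩
  have h := fun s => M.ratio_bounds hM ht hΓ hν (j := j) (k := k) (by omega)
    (M.P x.1.1 x.1.2).2 s
  rw [pmfE_run, pairMat_pow_succ_mulVec]
  simp only [dotProduct, Finset.mul_sum]
  exact ⟨Finset.sum_le_sum fun s _ => by
      rw [← mul_assoc]; exact mul_le_mul_of_nonneg_right (h s).1 (hf s),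
    Finset.sum_le_sum fun s _ => by
      rw [← mul_assoc]; exact mul_le_mul_of_nonneg_right (h s).2 (hf s)⟩

theorem dom_run {j k : ℕ} (hk : M.tmix * j + 1 ≤ k) (x : Traj S A) :
    Dom (1 - 2 * (1 / 2) ^ j / (1 - Γ)) (1 + 2 * (1 / 2) ^ j / (1 - Γ)) (M.run π k x)
      (M.pairEx π) where
  fin := M.finite_support_run π k x
  le f hf := by
    rw [pairEx_apply]
    exact (M.run_apply_bounds hM ht hΓ hν hk x fun s => avg_nonneg hf s).2
  ge f hf := by
    rw [pairEx_apply]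
    exact (M.run_apply_bounds hM ht hΓ hν hk x fun s => avg_nonneg hf s).1
where
  avg_nonneg {f : S × A → ℝ} (hf : ∀ z, 0 ≤ f z) (s : S) : 0 ≤ avg π f s :=
    Finset.sum_nonneg fun a _ => mul_nonneg ((π s).2.1 a) (hf _)

theorem dom_sampleTuple {j k : ℕ} (hk : M.tmix * j + 1 ≤ k) (π' : Policy S A) (x : Traj S A) :
    Dom (1 - 2 * (1 / 2) ^ j / (1 - Γ)) (1 + 2 * (1 / 2) ^ j / (1 - Γ)) (M.sampleTuple π π' k x)
      (M.tupleEx π π') := by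
  have hfin : ∀ y : Traj S A, ((pmfOf (π' y.1.1)).bind fun a =>
      (M.transition π (y.1.1, a)).map fun z => (((y.1.1, a), z), (z, y.2 + 1))).support.Finite :=
    fun y => finite_support_bind (finite_support_of_finite _) fun a =>
      finite_support_map _ (finite_support_of_finite _)
  -- Given the state, the rest of the sample has the same conditional law on both sides. Integrating
  -- it out leaves a function of the state, and only the law of the state is compared.
  set F : ((S × A) × (S × A) → ℝ) → S × A → ℝ := fun f z =>
    ∑ a, (π' z.1).1 a * M.transEx π (z.1, a) (fun z' => f ((z.1, a), z')) with hF
  have hF0 : ∀ f : (S × A) × (S × A) → ℝ, (∀ ξ, 0 ≤ f ξ) → ∀ s, 0 ≤ avg π (F f) s := fun f hf s =>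
    Finset.sum_nonneg fun a _ => mul_nonneg ((π s).2.1 a) <|
      Finset.sum_nonneg fun a' _ => mul_nonneg ((π' s).2.1 a') (Ex.nonneg _ fun _ => hf _)
  have e1 : ∀ f : (S × A) × (S × A) → ℝ, pmfE (M.sampleTuple π π' k x) (fun y => f y.1) =
      pmfE (M.run π k x) fun y => F f y.1 := by
    intro f
    rw [sampleTuple, pmfE_bind (M.finite_support_run π k x) hfin]
    congr 1
    funext y
    rw [pmfE_bind (finite_support_of_finite _)
      fun a => finite_support_map _ (finite_support_of_finite _), pmfE_pmfOf]
    refine Finset.sum_congr rfl fun a _ => ?_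
    rw [pmfE_map _ (finite_support_of_finite _), pmfE_transition]
  have e2 : ∀ f : (S × A) × (S × A) → ℝ, M.tupleEx π π' f = M.stat π ⬝ᵥ avg π (F f) := by
    intro f
    rw [tupleEx_apply, dotProduct]
    refine Finset.sum_congr rfl fun s _ => ?_
    congr 1
    simp only [avg, hF, ← transEx_apply, ← Finset.sum_mul, (π s).2.2, one_mul]
  refine ⟨finite_support_bind (M.finite_support_run π k x) hfin, fun f hf => ?_, fun f hf => ?_⟩
  · rw [e1, e2]
    exact (M.run_apply_bounds hM ht hΓ hν hk x (hF0 f hf)).2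
  · rw [e1, e2]
    exact (M.run_apply_bounds hM ht hΓ hν hk x (hF0 f hf)).1

end Mixing

/-! ### The critic on the trajectory and on independent samples. -/

section Critic

variable {d : ℕ} (D : TDProblem (S × A) d) {π π' : Policy S A} {lo hi : ℝ} {k : ℕ}

theorem dom_sumCosts (hlo : 0 ≤ lo) (hhi : 0 ≤ hi) (hcost : D.cost = M.cost π)
    (hrun : ∀ x, Dom lo hi (M.run π (k + 1) x) D.wc) (n : ℕ) (acc : ℝ) (x : Traj S A) :
    Dom (lo ^ n) (hi ^ n) (M.sumCosts π k n acc x) (Ex.loop D.wc D.costStep n acc) := by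
  induction n generalizing acc x with
  | zero => rw [pow_zero, pow_zero]; exact Dom.pure acc x
  | succ n ih =>
    rw [pow_succ', pow_succ', sumCosts, Ex.loop]
    exact (hrun x).bind (pow_nonneg hlo n) (pow_nonneg hhi n)
      (K := fun z => Ex.loop D.wc D.costStep n (D.costStep acc z))
      fun y => by
        rw [TDProblem.costStep, hcost]
        exact ih _ _

variable (hlo : 0 ≤ lo) (hhi : 0 ≤ hi) (hcost : D.cost = M.cost π)
  (htuple : ∀ x, Dom lo hi (M.sampleTuple π π' k x) D.wp)
include hlo hhi hcost htuple

theorem dom_sumOps (θ : Fin d → ℝ) (r : ℝ) (n : ℕ) (acc : Fin d → ℝ) (x : Traj S A) :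
    Dom (lo ^ n) (hi ^ n) (M.sumOps D.Ψ π π' k θ r n acc x)
      (Ex.loop D.wp (D.opStep θ r) n acc) := by
  induction n generalizing acc x with
  | zero => rw [pow_zero, pow_zero]; exact Dom.pure acc x
  | succ n ih =>
    rw [pow_succ', pow_succ', sumOps, Ex.loop]
    exact (htuple x).bind (pow_nonneg hlo n) (pow_nonneg hhi n)
      (K := fun ξ => Ex.loop D.wp (D.opStep θ r) n (D.opStep θ r acc ξ))
      fun y => by
        rw [TDProblem.opStep, tdOp, hcost]
        exact ih _ _

theorem dom_innerLoop (η : ℝ) (θc : Fin d → ℝ) (r : ℝ) (gh : Fin d → ℝ) (n : ℕ)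
    (θ acc : Fin d → ℝ) (x : Traj S A) :
    Dom (lo ^ n) (hi ^ n) (M.innerLoop D.Ψ π π' k η θc r gh n θ acc x)
      ((Ex.loop D.wp (D.innerStep η θc r gh) n (θ, acc)).map Prod.snd) := by
  induction n generalizing θ acc x with
  | zero =>
    rw [pow_zero, pow_zero]
    exact Dom.pure acc x
  | succ n ih =>
    rw [pow_succ', pow_succ', innerLoop]
    exact (htuple x).bind (pow_nonneg hlo n) (pow_nonneg hhi n)
      (K := fun ξ => (Ex.loop D.wp (D.innerStep η θc r gh) n
        (D.innerStep η θc r gh (θ, acc) ξ)).map Prod.snd)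
      fun y => by
        rw [TDProblem.innerStep, tdOp, tdOp, hcost]
        exact ih _ _ _

omit htuple in
theorem dom_epoch {prm : CriticParams}
    (hrun : ∀ x, Dom lo hi (M.run π (prm.tau' + 1) x) D.wc)
    (htuple' : ∀ x, Dom lo hi (M.sampleTuple π π' prm.tau' x) D.wp)
    (htuple : ∀ x, Dom lo hi (M.sampleTuple π π' prm.tau x) D.wp)
    (θ : Fin d → ℝ) (x : Traj S A) :
    Dom (lo ^ (prm.N' + prm.N + prm.T)) (hi ^ (prm.N' + prm.N + prm.T))
      (M.epoch D.Ψ π π' prm θ x) (D.epochEx prm.eta prm.N' prm.N prm.T θ) := by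
  have e : ∀ c : ℝ, c ^ (prm.N' + prm.N + prm.T) = c ^ prm.N' * (c ^ prm.N * c ^ prm.T) :=
    fun c => by rw [pow_add, pow_add, mul_assoc]
  rw [e lo, e hi, epoch, TDProblem.epochEx]
  refine (M.dom_sumCosts D hlo hhi hcost hrun prm.N' 0 x).bind
    (mul_nonneg (pow_nonneg hlo _) (pow_nonneg hlo _))
    (mul_nonneg (pow_nonneg hhi _) (pow_nonneg hhi _))
    (K := fun a => (Ex.loop D.wp (D.opStep θ (a / prm.N')) prm.N 0).bind fun g =>
      (Ex.loop D.wp (D.innerStep prm.eta θ (a / prm.N') ((prm.N : ℝ)⁻¹ • g)) prm.T (θ, 0)).map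
        fun v => (prm.T : ℝ)⁻¹ • v.2) fun y => ?_
  refine (M.dom_sumOps D hlo hhi hcost htuple' θ (y.1 / prm.N') prm.N 0 y.2).bind
    (pow_nonneg hlo _) (pow_nonneg hhi _)
    (K := fun g => (Ex.loop D.wp (D.innerStep prm.eta θ (y.1 / prm.N') ((prm.N : ℝ)⁻¹ • g))
      prm.T (θ, 0)).map fun v => (prm.T : ℝ)⁻¹ • v.2) fun w => ?_
  exact (M.dom_innerLoop D hlo hhi hcost htuple prm.eta θ (y.1 / prm.N') ((prm.N : ℝ)⁻¹ • w.1)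
    prm.T θ 0 w.2).map fun v => (prm.T : ℝ)⁻¹ • v

omit htuple in
theorem dom_epochs {prm : CriticParams}
    (hrun : ∀ x, Dom lo hi (M.run π (prm.tau' + 1) x) D.wc)
    (htuple' : ∀ x, Dom lo hi (M.sampleTuple π π' prm.tau' x) D.wp)
    (htuple : ∀ x, Dom lo hi (M.sampleTuple π π' prm.tau x) D.wp)
    (n : ℕ) (θ : Fin d → ℝ) (x : Traj S A) :
    Dom ((lo ^ (prm.N' + prm.N + prm.T)) ^ n) ((hi ^ (prm.N' + prm.N + prm.T)) ^ n)
      (M.epochs D.Ψ π π' prm n θ x) (D.epochsEx prm.eta prm.N' prm.N prm.T n θ) := by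
  induction n generalizing θ x with
  | zero => rw [pow_zero, pow_zero]; exact Dom.pure θ x
  | succ n ih =>
    rw [pow_succ', pow_succ', epochs, TDProblem.epochsEx]
    exact (M.dom_epoch D hlo hhi hcost hrun htuple' htuple θ x).bind
      (pow_nonneg (pow_nonneg hlo _) _) (pow_nonneg (pow_nonneg hhi _) _) (K := D.epochsEx prm.eta prm.N' prm.N prm.T n) fun y => ih _ _

end Critic

/-! ### The number of samples -/

section Count

variable {d : ℕ} (Ψ : Matrix (S × A) (Fin d) ℝ) (π π' : Policy S A)

/-- The counter is deterministic on the support: neither the program nor its lengths depend on the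
random outcomes. So the sample bound holds for every outcome. -/
theorem run_count {k : ℕ} {x y : Traj S A} (hy : y ∈ (M.run π k x).support) : y.2 = x.2 + k := by
  induction k generalizing x with
  | zero =>
    rw [run, PMF.mem_support_pure_iff] at hy
    rw [hy, add_zero]
  | succ k ih =>
    rw [run, PMF.mem_support_bind_iff] at hy
    obtain ⟨z, -, hz⟩ := hy
    rw [ih hz]
    ring

theorem sampleTuple_count {k : ℕ} {x : Traj S A} {y : ((S × A) × (S × A)) × Traj S A}
    (hy : y ∈ (M.sampleTuple π π' k x).support) : y.2.2 = x.2 + (k + 1) := by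
  rw [sampleTuple, PMF.mem_support_bind_iff] at hy
  obtain ⟨w, hw, hy⟩ := hy
  rw [PMF.mem_support_bind_iff] at hy
  obtain ⟨a, -, hy⟩ := hy
  rw [PMF.mem_support_map_iff] at hy
  obtain ⟨z, -, rfl⟩ := hy
  have := M.run_count π hw
  simp only
  omega

theorem sumCosts_count {k n : ℕ} {acc : ℝ} {x : Traj S A} {y : ℝ × Traj S A}
    (hy : y ∈ (M.sumCosts π k n acc x).support) : y.2.2 = x.2 + n * (k + 1) := by
  induction n generalizing acc x with
  | zero =>
    rw [sumCosts, PMF.mem_support_pure_iff] at hy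
    simp [hy]
  | succ n ih =>
    rw [sumCosts, PMF.mem_support_bind_iff] at hy
    obtain ⟨z, hz, hy⟩ := hy
    rw [ih hy, M.run_count π hz]
    ring

theorem sumOps_count {k n : ℕ} {θ acc : Fin d → ℝ} {r : ℝ} {x : Traj S A}
    {y : (Fin d → ℝ) × Traj S A} (hy : y ∈ (M.sumOps Ψ π π' k θ r n acc x).support) :
    y.2.2 = x.2 + n * (k + 1) := by
  induction n generalizing acc x with
  | zero =>
    rw [sumOps, PMF.mem_support_pure_iff] at hy
    simp [hy]
  | succ n ih =>
    rw [sumOps, PMF.mem_support_bind_iff] at hy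
    obtain ⟨z, hz, hy⟩ := hy
    rw [ih hy, M.sampleTuple_count π π' hz]
    ring

theorem innerLoop_count {k n : ℕ} {η r : ℝ} {θc gh θ acc : Fin d → ℝ} {x : Traj S A}
    {y : (Fin d → ℝ) × Traj S A}
    (hy : y ∈ (M.innerLoop Ψ π π' k η θc r gh n θ acc x).support) :
    y.2.2 = x.2 + n * (k + 1) := by
  induction n generalizing θ acc x with
  | zero =>
    rw [innerLoop, PMF.mem_support_pure_iff] at hy
    simp [hy]
  | succ n ih =>
    rw [innerLoop, PMF.mem_support_bind_iff] at hy
    obtain ⟨z, hz, hy⟩ := hy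
    rw [ih hy, M.sampleTuple_count π π' hz]
    ring

/-- The number of transitions in an epoch. -/
def _root_.CriticParams.epochCost (prm : CriticParams) : ℕ :=
  (prm.N' + prm.N) * (prm.tau' + 1) + prm.T * (prm.tau + 1)

theorem epoch_count {prm : CriticParams} {θ : Fin d → ℝ} {x : Traj S A}
    {y : (Fin d → ℝ) × Traj S A} (hy : y ∈ (M.epoch Ψ π π' prm θ x).support) :
    y.2.2 = x.2 + prm.epochCost := by
  rw [epoch, PMF.mem_support_bind_iff] at hy
  obtain ⟨a, ha, hy⟩ := hy
  rw [PMF.mem_support_bind_iff] at hy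
  obtain ⟨g, hg, hy⟩ := hy
  rw [PMF.mem_support_map_iff] at hy
  obtain ⟨v, hv, rfl⟩ := hy
  have h1 := M.sumCosts_count π ha
  have h2 := M.sumOps_count Ψ π π' hg
  have h3 := M.innerLoop_count Ψ π π' hv
  simp only
  rw [h3, h2, h1, CriticParams.epochCost]
  ring

theorem epochs_count {prm : CriticParams} {n : ℕ} {θ : Fin d → ℝ} {x : Traj S A}
    {y : (Fin d → ℝ) × Traj S A} (hy : y ∈ (M.epochs Ψ π π' prm n θ x).support) :
    y.2.2 = x.2 + n * prm.epochCost := by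
  induction n generalizing θ x with
  | zero =>
    rw [epochs, PMF.mem_support_pure_iff] at hy
    simp [hy]
  | succ n ih =>
    rw [epochs, PMF.mem_support_bind_iff] at hy
    obtain ⟨z, hz, hy⟩ := hy
    rw [ih hy, M.epoch_count Ψ π π' hz]
    ring

theorem spmd_count [Nonempty A] {u : Policy S A → ℝ} {prm : CriticParams} {θ0 : Fin d → ℝ}
    {l : ℝ} {z0 : S × A} {k : ℕ} {y : Policy S A × Traj S A}
    (hy : y ∈ (M.spmd Ψ u prm θ0 l z0 k).support) :
    y.2.2 = k * (prm.epochs * prm.epochCost) := by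
  induction k generalizing y with
  | zero =>
    rw [spmd, PMF.mem_support_pure_iff] at hy
    simp [hy]
  | succ k ih =>
    rw [spmd, PMF.mem_support_bind_iff] at hy
    obtain ⟨z, hz, hy⟩ := hy
    rw [PMF.mem_support_map_iff] at hy
    obtain ⟨w, hw, rfl⟩ := hy
    have h1 := M.epochs_count Ψ _ _ hw
    simp only
    rw [h1, ih hz]
    ring

end Count

end AMDP

/-! ### The Kullback-Leibler divergence -/

section KL

variable {ι : Type} [Fintype ι] {p q : ι → ℝ}

/-- Use log t ≤ t - 1 at t = (y/x)^(1/2): x log(x/y) ≥ 2x - 2(xy)^(1/2), which is the left-hand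
side. -/
theorem sub_add_sq_sqrt_le_mul_log {x y : ℝ} (hx : 0 ≤ x) (hy : 0 < y) :
    x - y + (√x - √y) ^ 2 ≤ x * Real.log (x / y) := by
  rcases hx.eq_or_lt with rfl | hx
  · simp [Real.sq_sqrt hy.le]
  have h1 : Real.log (x / y) = -(2 * Real.log (√y / √x)) := by
    rw [← Real.sqrt_div hy.le, Real.log_sqrt (by positivity)]
    have : Real.log (x / y) = -Real.log (y / x) := by rw [← Real.log_inv, inv_div]
    linarith
  have h2 := Real.log_le_sub_one_of_pos (x := √y / √x) (by positivity)
  have hsx : √x * √x = x := Real.mul_self_sqrt hx.le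
  have hsy : √y * √y = y := Real.mul_self_sqrt hy.le
  have h3 : x * (√y / √x) = √x * √y := by
    rw [mul_div_assoc', div_eq_iff (Real.sqrt_pos.2 hx).ne']
    linear_combination -√y * hsx
  rw [h1]
  have h4 := mul_le_mul_of_nonneg_left h2 hx.le
  nlinarith

theorem sum_sq_sqrt_le_kl (hp : p ∈ stdSimplex ℝ ι) (hq : q ∈ stdSimplex ℝ ι)
    (hq0 : ∀ i, 0 < q i) : ∑ i, (√(p i) - √(q i)) ^ 2 ≤ kl p q := by
  have h := Finset.sum_le_sum fun i (_ : i ∈ Finset.univ) =>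
    sub_add_sq_sqrt_le_mul_log (hp.1 i) (hq0 i)
  rw [Finset.sum_add_distrib, Finset.sum_sub_distrib, hp.2, hq.2, sub_self, zero_add] at h
  exact h

theorem kl_nonneg (hp : p ∈ stdSimplex ℝ ι) (hq : q ∈ stdSimplex ℝ ι) (hq0 : ∀ i, 0 < q i) :
    0 ≤ kl p q :=
  (Finset.sum_nonneg fun _ _ => sq_nonneg _).trans (sum_sq_sqrt_le_kl hp hq hq0)

/-- A form of Pinsker's inequality. -/
theorem l1_sub_sq_le_kl (hp : p ∈ stdSimplex ℝ ι) (hq : q ∈ stdSimplex ℝ ι)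
    (hq0 : ∀ i, 0 < q i) : l1 (p - q) ^ 2 ≤ 4 * kl p q := by
  have h1 := sum_sq_sqrt_le_kl hp hq hq0
  -- Factor the difference through square roots and apply Cauchy-Schwarz; the second factor has
  -- square sum at most 4.
  have e : ∀ i, |(p - q) i| = |√(p i) - √(q i)| * (√(p i) + √(q i)) := by
    intro i
    have hs : 0 ≤ √(p i) + √(q i) := by positivity
    rw [← abs_of_nonneg hs, ← abs_mul, Pi.sub_apply]
    congr 1
    have h2 := Real.mul_self_sqrt (hp.1 i)
    have h3 := Real.mul_self_sqrt (hq.1 i)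
    linarith
  have h2 := Finset.sum_mul_sq_le_sq_mul_sq Finset.univ (fun i => |√(p i) - √(q i)|)
    (fun i => √(p i) + √(q i))
  have h3 : ∑ i, (√(p i) + √(q i)) ^ 2 ≤ 4 := by
    calc ∑ i, (√(p i) + √(q i)) ^ 2 ≤ ∑ i, 2 * (p i + q i) := by
          refine Finset.sum_le_sum fun i _ => ?_
          have h2 := Real.sq_sqrt (hp.1 i)
          have h3 := Real.sq_sqrt (hq.1 i)
          nlinarith [sq_nonneg (√(p i) - √(q i))]
      _ = 4 := by
          rw [← Finset.mul_sum, Finset.sum_add_distrib, hp.2, hq.2]; norm_num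
  rw [l1]
  simp only [e]
  refine h2.trans ?_
  simp only [sq_abs]
  have h4 : 0 ≤ ∑ i, (√(p i) - √(q i)) ^ 2 := Finset.sum_nonneg fun _ _ => sq_nonneg _
  nlinarith

theorem mul_log_div (x : ℝ) {y : ℝ} (hy : 0 < y) :
    x * Real.log (x / y) = x * Real.log x - x * Real.log y := by
  rcases eq_or_ne x 0 with rfl | hx
  · simp
  · rw [Real.log_div hx hy.ne']; ring

theorem continuous_kl_left (hq0 : ∀ i, 0 < q i) : Continuous fun p : ι → ℝ => kl p q := by
  have e : (fun p : ι → ℝ => kl p q) = fun p =>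
      ∑ i, (p i * Real.log (p i) - p i * Real.log (q i)) := by
    funext p
    exact Finset.sum_congr rfl fun i _ => mul_log_div _ (hq0 i)
  rw [e]
  refine continuous_finsetSum _ fun i _ => ?_
  exact (Real.continuous_mul_log.comp (continuous_apply i)).sub
    ((continuous_apply i).mul continuous_const)

/-- The compensation identity. -/
theorem kl_compensation {p0 r : ι → ℝ} {t : ℝ} (h0 : ∀ i, 0 < p0 i)
    (hr : ∀ i, r i = t * p i + (1 - t) * q i) (hr0 : ∀ i, 0 < r i) :
    t * kl p p0 + (1 - t) * kl q p0 = kl r p0 + (t * kl p r + (1 - t) * kl q r) := by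
  simp only [kl, Finset.mul_sum, ← Finset.sum_add_distrib]
  refine Finset.sum_congr rfl fun i _ => ?_
  rw [mul_log_div _ (h0 i), mul_log_div _ (h0 i), mul_log_div _ (h0 i), mul_log_div _ (hr0 i),
    mul_log_div _ (hr0 i)]
  linear_combination (Real.log (p0 i) - Real.log (r i)) * hr i

theorem kl_self (h0 : ∀ i, 0 < q i) : kl q q = 0 :=
  Finset.sum_eq_zero fun i _ => by rw [div_self (h0 i).ne', Real.log_one, mul_zero]

end KL

/-! ### The proximal step -/

section Prox

variable {A : Type} [Fintype A]

/-- The objective of the mirror descent update in a state. -/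
def proxObj (l : ℝ) (g : A → ℝ) (f : (A → ℝ) → ℝ) (p0 p : A → ℝ) : ℝ :=
  l * (∑ a, g a * p a + f p) + kl p p0

variable {l ω : ℝ} {g : A → ℝ} {f : (A → ℝ) → ℝ} {p0 : A → ℝ}

theorem exists_proxObj_min (hl : 0 ≤ l) (hf : IsKLStronglyConvex ω f)
    (h0 : p0 ∈ stdSimplex ℝ A) (hpos : ∀ a, 0 < p0 a) :
    ∃ p ∈ stdSimplex ℝ A, ∀ q ∈ stdSimplex ℝ A, proxObj l g f p0 p ≤ proxObj l g f p0 q := by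
  have h1 : LowerSemicontinuousOn (proxObj l g f p0) (stdSimplex ℝ A) := by
    have e : proxObj l g f p0 = fun p => l * f p + (l * ∑ a, g a * p a + kl p p0) := by
      funext p
      simp only [proxObj]
      ring
    rw [e]
    refine LowerSemicontinuousOn.add ?_ (Continuous.continuousOn ?_).lowerSemicontinuousOn
    · exact (continuous_const.mul continuous_id).comp_lowerSemicontinuousOn hf.2.1
        (monotone_mul_left_of_nonneg hl)
    · refine Continuous.add (continuous_const.mul (continuous_finsetSum _ fun a _ => ?_))
        (continuous_kl_left hpos)
      exact continuous_const.mul (continuous_apply a)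
  obtain ⟨p, hp, hmin⟩ := h1.exists_isMinOn ⟨p0, h0⟩ (isCompact_stdSimplex ℝ A)
  exact ⟨p, hp, fun q hq => hmin hq⟩

/-- Suppose p(a) = 0 and move a fraction t of the mass towards p₀. The objective changes by at most
t (B + p₀(a) log t) with B independent of t, which is negative for small t. -/
theorem proxObj_min_pos (hl : 0 ≤ l) (hf : IsKLStronglyConvex ω f)
    (h0 : p0 ∈ stdSimplex ℝ A) (hpos : ∀ a, 0 < p0 a) {p : A → ℝ} (hp : p ∈ stdSimplex ℝ A)
    (hmin : ∀ q ∈ stdSimplex ℝ A, proxObj l g f p0 p ≤ proxObj l g f p0 q) (a : A) :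
    0 < p a := by
  classical
  by_contra hcon
  have ha : p a = 0 := le_antisymm (not_lt.1 hcon) (hp.1 a)
  have key : ∀ t : ℝ, 0 < t → t < 1 →
      0 ≤ l * ((∑ a, g a * p0 a + f p0) - (∑ a, g a * p a + f p)) - kl p p0 +
        p0 a * Real.log t := by
    intro t ht ht1
    set r : A → ℝ := (1 - t) • p + t • p0 with hr
    have hri : ∀ i, r i = (1 - t) * p i + t * p0 i := fun i => rfl
    have hrm : r ∈ stdSimplex ℝ A :=
      convex_stdSimplex ℝ A hp h0 (by linarith) ht.le (by ring)
    have h1 := hmin r hrm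
    have h2 : f r ≤ (1 - t) * f p + t * f p0 :=
      hf.1.2 hp h0 (by linarith) ht.le (by ring)
    have h3 : ∑ a, g a * r a = (1 - t) * ∑ a, g a * p a + t * ∑ a, g a * p0 a := by
      rw [Finset.mul_sum, Finset.mul_sum, ← Finset.sum_add_distrib]
      exact Finset.sum_congr rfl fun i _ => by rw [hri]; ring
    have h4 : kl r p0 ≤ (1 - t) * kl p p0 + t * (p0 a * Real.log t) := by
      have hterm : ∀ i, r i * Real.log (r i / p0 i) ≤ (1 - t) * (p i * Real.log (p i / p0 i)) := by
        intro i
        have hc := Real.convexOn_mul_log.2 (Set.mem_Ici.2 (div_nonneg (hp.1 i) (hpos i).le))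
          (Set.mem_Ici.2 zero_le_one) (by linarith : 0 ≤ 1 - t) ht.le (by ring)
        simp only [smul_eq_mul, mul_one, Real.log_one, mul_zero, add_zero] at hc
        have e : r i / p0 i = (1 - t) * (p i / p0 i) + t := by
          rw [hri]
          field_simp [(hpos i).ne']
        rw [← e] at hc
        have := mul_le_mul_of_nonneg_left hc (hpos i).le
        calc r i * Real.log (r i / p0 i) = p0 i * (r i / p0 i * Real.log (r i / p0 i)) := by
              rw [← mul_assoc, mul_div_cancel₀ _ (hpos i).ne']
          _ ≤ _ := this
          _ = (1 - t) * ((p0 i * (p i / p0 i)) * Real.log (p i / p0 i)) := by ring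
          _ = _ := by rw [mul_div_cancel₀ _ (hpos i).ne']
      rw [kl, kl, ← Finset.add_sum_erase _ _ (Finset.mem_univ a)]
      have h5 : ∑ i ∈ Finset.univ.erase a, r i * Real.log (r i / p0 i) ≤
          (1 - t) * ∑ i, p i * Real.log (p i / p0 i) := by
        rw [← Finset.add_sum_erase Finset.univ _ (Finset.mem_univ a), ha, zero_mul, zero_add,
          Finset.mul_sum]
        exact Finset.sum_le_sum fun i _ => hterm i
      have h6 : r a * Real.log (r a / p0 a) = t * (p0 a * Real.log t) := by
        rw [hri, ha, mul_zero, zero_add, mul_div_cancel_right₀ _ (hpos a).ne']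
        ring
      rw [h6]
      linarith
    simp only [proxObj] at h1
    rw [h3] at h1
    have h7 := mul_le_mul_of_nonneg_left h2 hl
    have h8 : 0 ≤ t * (l * ((∑ a, g a * p0 a + f p0) - (∑ a, g a * p a + f p)) - kl p p0 +
        p0 a * Real.log t) := by nlinarith
    exact nonneg_of_mul_nonneg_right h8 ht
  set B := l * ((∑ a, g a * p0 a + f p0) - (∑ a, g a * p a + f p)) - kl p p0
  -- This t makes p₀(a) log t = -(|B| + 1).
  have h1 := key (Real.exp (-(|B| + 1) / p0 a)) (Real.exp_pos _) (by
    rw [Real.exp_lt_one_iff]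
    exact div_neg_of_neg_of_pos (by linarith [abs_nonneg B]) (hpos a))
  rw [Real.log_exp, mul_div_cancel₀ _ (hpos a).ne'] at h1
  linarith [le_abs_self B]

/-- The three-point inequality. -/
theorem proxObj_three_point (hl : 0 ≤ l) (hω : 0 ≤ ω) (hf : IsKLStronglyConvex ω f)
    (hpos : ∀ a, 0 < p0 a) {p : A → ℝ} (hp : p ∈ stdSimplex ℝ A) (hp0 : ∀ a, 0 < p a)
    (hmin : ∀ q ∈ stdSimplex ℝ A, proxObj l g f p0 p ≤ proxObj l g f p0 q) {q : A → ℝ}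
    (hq : q ∈ stdSimplex ℝ A) :
    proxObj l g f p0 p + (1 + l * ω) * kl q p ≤ proxObj l g f p0 q := by
  -- No optimality condition with a subgradient at p is needed. Minimality is tested at r = tq +
  -- (1-t)p, strong convexity is used at r for both p and q, and the compensation identity does the
  -- same for the divergence from p₀; dividing by t, then t → 0.
  have key : ∀ t : ℝ, 0 < t → t < 1 →
      proxObj l g f p0 p + (1 + l * ω) * kl q (t • q + (1 - t) • p) ≤ proxObj l g f p0 q := by
    intro t ht ht1
    set r : A → ℝ := t • q + (1 - t) • p with hr
    have hri : ∀ i, r i = t * q i + (1 - t) * p i := fun i => rfl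
    have hrm : r ∈ stdSimplex ℝ A := convex_stdSimplex ℝ A hq hp ht.le (by linarith) (by ring)
    have hr0 : ∀ i, 0 < r i := fun i => by
      rw [hri]
      have := mul_pos (by linarith : 0 < 1 - t) (hp0 i)
      have := mul_nonneg ht.le (hq.1 i)
      linarith
    obtain ⟨w, hw⟩ := hf.2.2 r hrm hr0
    have h1 := hw q hq
    have h2 := hw p hp
    have h3 := kl_compensation hpos hri hr0
    have h4 := hmin r hrm
    have h5 : ∑ a, g a * r a = t * ∑ a, g a * q a + (1 - t) * ∑ a, g a * p a := by
      rw [Finset.mul_sum, Finset.mul_sum, ← Finset.sum_add_distrib]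
      exact Finset.sum_congr rfl fun i _ => by rw [hri]; ring
    have h6 : t * (w ⬝ᵥ (q - r)) + (1 - t) * (w ⬝ᵥ (p - r)) = 0 := by
      simp only [dotProduct, Finset.mul_sum, ← Finset.sum_add_distrib]
      refine Finset.sum_eq_zero fun i _ => ?_
      simp only [Pi.sub_apply]
      rw [hri]
      ring
    have h7 := kl_nonneg hp hrm hr0
    have h8 : f r + ω * (t * kl q r + (1 - t) * kl p r) ≤ t * f q + (1 - t) * f p := by
      have a1 := mul_le_mul_of_nonneg_left h1 ht.le
      have a2 := mul_le_mul_of_nonneg_left h2 (by linarith : 0 ≤ 1 - t)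
      nlinarith
    have h9 := mul_le_mul_of_nonneg_left h8 hl
    simp only [proxObj] at h4 ⊢
    rw [h5] at h4
    have h10 : 0 ≤ (1 + l * ω) * ((1 - t) * kl p r) := by
      have : 0 ≤ l * ω := by positivity
      exact mul_nonneg (by linarith) (mul_nonneg (by linarith) h7)
    have h11 : t * (l * (∑ a, g a * p a + f p) + kl p p0 + (1 + l * ω) * kl q r) ≤
        t * (l * (∑ a, g a * q a + f q) + kl q p0) := by nlinarith
    exact le_of_mul_le_mul_left h11 ht
  have hlim : Filter.Tendsto (fun t : ℝ => proxObj l g f p0 p +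
      (1 + l * ω) * kl q (t • q + (1 - t) • p)) (nhdsWithin 0 (Set.Ioo 0 1))
      (nhds (proxObj l g f p0 p + (1 + l * ω) * kl q p)) := by
    refine Filter.Tendsto.mono_left ?_ nhdsWithin_le_nhds
    have hc : ContinuousAt (fun t : ℝ => proxObj l g f p0 p +
        (1 + l * ω) * kl q (t • q + (1 - t) • p)) 0 := by
      refine continuousAt_const.add (continuousAt_const.mul ?_)
      unfold kl
      refine tendsto_finsetSum _ fun i _ => ?_
      change ContinuousAt (fun t : ℝ => q i * Real.log (q i / (t * q i + (1 - t) * p i))) 0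
      -- Where q vanishes the summand is identically zero, otherwise the quotient stays positive
      -- near t = 0.
      rcases (hq.1 i).eq_or_lt with h | h
      · simp only [← h, zero_mul]
        exact continuousAt_const
      · refine continuousAt_const.mul (ContinuousAt.log (continuousAt_const.div ?_ ?_) ?_)
        · fun_prop
        · simpa using (hp0 i).ne'
        · simpa using ⟨h.ne', (hp0 i).ne'⟩
    have := hc.tendsto
    simpa using this
  have hne : (nhdsWithin (0 : ℝ) (Set.Ioo 0 1)).NeBot := by
    rw [← mem_closure_iff_nhdsWithin_neBot, closure_Ioo (by norm_num)]
    exact ⟨le_refl _, zero_le_one⟩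
  refine le_of_tendsto hlim ?_
  filter_upwards [self_mem_nhdsWithin] with t ht
  exact key t ht.1 ht.2

end Prox

/-! ### The mirror descent update as a proximal step in each state. -/

namespace AMDP

variable {S A : Type} [Fintype S] [Fintype A] (M : AMDP S A)

/-- All actions have positive probability. -/
def _root_.Policy.Positive (π : Policy S A) : Prop := ∀ s a, 0 < (π s).1 a

variable {M} {l ω : ℝ} (hl : 0 ≤ l) (hω : 0 ≤ ω) (hconv : ∀ s, IsKLStronglyConvex ω (M.h s))
  {π : Policy S A} (hπ : Policy.Positive π) (Q : S × A → ℝ)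
include hl hconv hπ

theorem mirrorStep_spec (s : S) (q : stdSimplex ℝ A) :
    proxObj l (fun a => Q (s, a)) (M.h s) (π s).1 (M.mirrorStep l Q π s).1 ≤
      proxObj l (fun a => Q (s, a)) (M.h s) (π s).1 q.1 := by
  obtain ⟨p, hp, hmin⟩ := exists_proxObj_min (g := fun a => Q (s, a)) hl (hconv s) (π s).2 (hπ s)
  have h := Classical.epsilon_spec (p := fun p : stdSimplex ℝ A => ∀ q : stdSimplex ℝ A,
    proxObj l (fun a => Q (s, a)) (M.h s) (π s).1 p.1 ≤
      proxObj l (fun a => Q (s, a)) (M.h s) (π s).1 q.1) ⟨⟨p, hp⟩, fun q => hmin q.1 q.2⟩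
  exact h q

theorem mirrorStep_positive : Policy.Positive (M.mirrorStep l Q π) := fun s =>
  proxObj_min_pos hl (hconv s) (π s).2 (hπ s) (M.mirrorStep l Q π s).2
    fun q hq => mirrorStep_spec hl hconv hπ Q s ⟨q, hq⟩

include hω in
theorem mirrorStep_three_point (s : S) (q : stdSimplex ℝ A) :
    proxObj l (fun a => Q (s, a)) (M.h s) (π s).1 (M.mirrorStep l Q π s).1 +
        (1 + l * ω) * kl q.1 (M.mirrorStep l Q π s).1 ≤
      proxObj l (fun a => Q (s, a)) (M.h s) (π s).1 q.1 :=
  proxObj_three_point hl hω (hconv s) (hπ s) (M.mirrorStep l Q π s).2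
    (mirrorStep_positive hl hconv hπ Q s)
    (fun q hq => mirrorStep_spec hl hconv hπ Q s ⟨q, hq⟩) q.2

end AMDP

/-! ### Guarantees for the critic -/

/-- Sufficient conditions on the parameters of the critic for a problem with monotonicity constant
`β`, conditioning `μ` and mixing time `t`; the trajectory differs from independent samples by a
relative error of at most `κ`. -/
structure CriticParams.Good (prm : CriticParams) (β μ Γ κ : ℝ) (q t j c : ℕ) : Prop where
  q_pos : 1 ≤ q
  card_le : (c : ℝ) ≤ 9 ^ q
  eta_pos : 0 < prm.eta
  eta_le : 4 * prm.eta ≤ β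
  eta_q : 81 * (64 * q ^ 2 * prm.eta ^ 2 + 24 * q * prm.eta / β) ≤ (1 / 800) ^ 2
  N'_ge : 200000000 * q / (β ^ 2 * μ) ≤ prm.N'
  N_ge : 200000000 * q / (β ^ 2 * μ) ≤ prm.N
  T_ge : 1600 / (prm.eta * β * μ) ≤ prm.T
  tau_ge : t * j + 1 ≤ prm.tau
  tau'_ge : t * j + 1 ≤ prm.tau'
  κ_ge : 2 * ((((prm.N' + prm.N + prm.T) * prm.epochs : ℕ) : ℝ) * (2 * (1 / 2) ^ j / (1 - Γ))) ≤ κ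
  κ_le : κ ≤ 1 / 100

namespace AMDP

variable {S A : Type} [Fintype S] [Fintype A]

variable [DecidableEq S] [DecidableEq A] [Nonempty S] [Nonempty A]

namespace Setting

variable {M : AMDP S A} {d : ℕ} {Ψ : Matrix (S × A) (Fin d) ℝ} {u : Policy S A → ℝ}
  {Cβ ω Γ cbar mubar dmin κ : ℝ} (H : M.Setting Ψ u Cβ ω Γ cbar mubar dmin)
  {prm : CriticParams} {q j : ℕ}
  (hp : prm.Good (1 / (2 * Cβ * M.tmix)) mubar Γ κ q M.tmix j (Fintype.card (S × A)))
include H hp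

/-- Each of the m samples of the critic contributes a factor 1 ± δ, and κ dominates 2mδ. -/
theorem critic_dom (θ0 : Fin d → ℝ) (π : Policy S A) (x : Traj S A) :
    Dom (1 - κ) (1 + κ) (M.critic Ψ (u π) prm θ0 π x)
      ((H.td π).epochsEx prm.eta prm.N' prm.N prm.T prm.epochs θ0) := by
  have hΓ := H.Γ_lt
  set δ := 2 * (1 / 2) ^ j / (1 - Γ) with hδ
  have hδ0 : 0 ≤ δ := div_nonneg (by positivity) (by linarith)
  set m := (prm.N' + prm.N + prm.T) * prm.epochs with hm
  have hκ := hp.κ_ge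
  have hκ1 := hp.κ_le
  rw [← hm] at hκ
  have hmδ : (m : ℝ) * δ ≤ 1 / 2 := by linarith
  -- Without any sample there is no epoch, because N is positive; then both laws are point masses.
  rcases Nat.eq_zero_or_pos m with h0 | h0
  · have hκ0 : 0 ≤ κ := by
      rw [h0] at hκ; simpa using hκ
    have hcase : prm.epochs = 0 := by
      rcases Nat.mul_eq_zero.1 h0 with h | h
      · exfalso
        have h2 := hp.N_ge
        have h3 : prm.N = 0 := by omega
        have hμ := H.mubar_pos
        have hβ := H.rate_bounds.1
        have hq : (1 : ℝ) ≤ q := by exact_mod_cast hp.q_pos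
        rw [h3] at h2
        have : (0 : ℝ) < 200000000 * q / ((1 / (2 * Cβ * M.tmix)) ^ 2 * mubar) := by positivity
        push_cast at h2
        linarith
      · exact h
    rw [critic, hcase]
    exact (Dom.pure θ0 x).mono (by linarith) (by linarith)
  have hδ1 : δ ≤ 1 / 2 := by
    have h1 : (1 : ℝ) ≤ m := by exact_mod_cast h0
    nlinarith
  have h1 := M.dom_epochs (H.td π) (π := π) (π' := perturb (u π) π) (lo := 1 - δ) (hi := 1 + δ)
    (by linarith) (by linarith) rfl (prm := prm)
    (fun x => M.dom_run H.erg H.tmix_ne hΓ (H.stat_ge π) (hp.tau'_ge.trans (Nat.le_succ _)) x)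
    (fun x => M.dom_sampleTuple H.erg H.tmix_ne hΓ (H.stat_ge π) hp.tau'_ge _ x)
    (fun x => M.dom_sampleTuple H.erg H.tmix_ne hΓ (H.stat_ge π) hp.tau_ge _ x)
    prm.epochs θ0 x
  rw [← pow_mul, ← pow_mul, ← hm] at h1
  exact (Dom.of_pow hδ0 hmδ h1).mono (by linarith) (by linarith)

omit hp [Nonempty A] [Nonempty S] H in
theorem dot_sub_le (θ0 : Fin d → ℝ) (π : Policy S A) :
    (θ0 - M.thetaStar Ψ π (u π)) ⬝ᵥ (θ0 - M.thetaStar Ψ π (u π)) ≤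
      √(2 * (θ0 ⬝ᵥ θ0) + 2 * (M.thetaStar Ψ π (u π) ⬝ᵥ M.thetaStar Ψ π (u π))) ^ 2 := by
  set θ := M.thetaStar Ψ π (u π)
  have h1 := dotProduct_self_nonneg_real θ0
  have h2 := dotProduct_self_nonneg_real θ
  have h3 := dotProduct_self_nonneg_real (θ0 + θ)
  rw [Real.sq_sqrt (by positivity)]
  simp only [sub_dotProduct, dotProduct_sub, add_dotProduct, dotProduct_add] at h3 ⊢
  linarith

theorem critic_wbd (θ0 : Fin d → ℝ) (π : Policy S A) :
    ((H.td π).epochsEx prm.eta prm.N' prm.N prm.T prm.epochs θ0).WBd q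
      (fun θ => θ - M.thetaStar Ψ π (u π))
      ((1 / 100) ^ prm.epochs *
        √(2 * (θ0 ⬝ᵥ θ0) + 2 * (M.thetaStar Ψ π (u π) ⬝ᵥ M.thetaStar Ψ π (u π))) +
        (2 * M.epsApprox Ψ u +
          4 * √(M.thetaStar Ψ π (u π) ⬝ᵥ M.thetaStar Ψ π (u π))) / 99) :=
  (H.td π).epochsEx_bd hp.q_pos hp.card_le hp.eta_pos hp.eta_le hp.eta_q hp.N'_ge hp.N_ge hp.T_ge
    prm.epochs (Real.sqrt_nonneg _) (dot_sub_le (Ψ := Ψ) (u := u) θ0 π)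

/-- The squared error of the critic. -/
theorem criticError_le (θ0 : Fin d → ℝ) (π : Policy S A) (x : Traj S A) :
    M.criticError Ψ (u π) prm θ0 π x ≤ 2 * M.epsApprox Ψ u ^ 2 +
      112 * (M.thetaStar Ψ π (u π) ⬝ᵥ M.thetaStar Ψ π (u π) +
        (1 / 2) ^ prm.epochs * (θ0 ⬝ᵥ θ0)) := by
  set θ := M.thetaStar Ψ π (u π) with hθ
  set ε := M.epsApprox Ψ u with hε
  set E := (H.td π).epochsEx prm.eta prm.N' prm.N prm.T prm.epochs θ0 with hE
  have hdom := H.critic_dom hp θ0 π x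
  have hw := (H.critic_wbd hp θ0 π).norm_mulVec H.norm_le hp.card_le
  have hsq := hw.sq_le hp.q_pos
  rw [← hE, ← hθ] at hsq
  have hε0 := H.epsApprox_nonneg
  have ht0 := dotProduct_self_nonneg_real θ
  have hn0 := dotProduct_self_nonneg_real θ0
  -- The weights 3/2 and 3 leave room, below the final coefficient 2 of ε_approx², for the factor 1
  -- + κ and for the share of ε_approx in the noise level G.
  have hpt : ∀ y : Fin d → ℝ, supNormModConst (Ψ *ᵥ y - M.basicQ π) ^ 2 ≤
      3 / 2 * ε ^ 2 + 3 * ‖Ψ *ᵥ (y - θ)‖ ^ 2 := by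
    intro y
    have e : Ψ *ᵥ y - M.basicQ π = (Ψ *ᵥ θ - M.basicQ π) + Ψ *ᵥ (y - θ) := by
      rw [Matrix.mulVec_sub]; abel
    have h1 := supNormModConst_add_le (Ψ *ᵥ θ - M.basicQ π) (Ψ *ᵥ (y - θ))
    rw [← e] at h1
    have h2 := H.approx_le π
    have h3 := supNormModConst_nonneg (Ψ *ᵥ y - M.basicQ π)
    have h4 := norm_nonneg (Ψ *ᵥ (y - θ))
    have h5 : supNormModConst (Ψ *ᵥ y - M.basicQ π) ^ 2 ≤ (ε + ‖Ψ *ᵥ (y - θ)‖) ^ 2 :=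
      pow_le_pow_left₀ h3 (by linarith) 2
    nlinarith [sq_nonneg (ε - 2 * ‖Ψ *ᵥ (y - θ)‖)]
  have h1 : M.criticError Ψ (u π) prm θ0 π x ≤ (1 + κ) * E fun y =>
      supNormModConst (Ψ *ᵥ y - M.basicQ π) ^ 2 :=
    hdom.le (fun y => supNormModConst (Ψ *ᵥ y - M.basicQ π) ^ 2) fun _ => sq_nonneg _
  have h2 : E (fun y => supNormModConst (Ψ *ᵥ y - M.basicQ π) ^ 2) ≤
      3 / 2 * ε ^ 2 + 3 * E fun y => ‖Ψ *ᵥ (y - θ)‖ ^ 2 := by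
    have := E.mono hpt
    rwa [Ex.add, Ex.const, Ex.smul] at this
  set s := √(θ ⬝ᵥ θ) with hs
  set w := √(2 * (θ0 ⬝ᵥ θ0) + 2 * (θ ⬝ᵥ θ)) with hwdef
  have hss : s ^ 2 = θ ⬝ᵥ θ := Real.sq_sqrt ht0
  have hww : w ^ 2 = 2 * (θ0 ⬝ᵥ θ0) + 2 * (θ ⬝ᵥ θ) := Real.sq_sqrt (by positivity)
  have hs0 : 0 ≤ s := Real.sqrt_nonneg _
  have hw0 : 0 ≤ w := Real.sqrt_nonneg _
  set r : ℝ := (1 / 100) ^ prm.epochs with hr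
  have hr0 : 0 ≤ r := by positivity
  have hr1 : r ≤ 1 := pow_le_one₀ (by norm_num) (by norm_num)
  have hr2 : r ≤ (1 / 2) ^ prm.epochs := pow_le_pow_left₀ (by norm_num) (by norm_num) _
  have h3 : (3 * (r * w + (2 * ε + 4 * s) / 99)) ^ 2 ≤
      18 * (r ^ 2 * w ^ 2) + 18 * (8 * ε ^ 2 + 32 * s ^ 2) / 9801 := by
    have a1 : (2 * ε + 4 * s) ^ 2 ≤ 8 * ε ^ 2 + 32 * s ^ 2 := by
      nlinarith [sq_nonneg (2 * ε - 4 * s)]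
    nlinarith [sq_nonneg (r * w - (2 * ε + 4 * s) / 99)]
  have h4 : r ^ 2 * w ^ 2 ≤ 2 * ((1 / 2) ^ prm.epochs * (θ0 ⬝ᵥ θ0)) + 2 * (θ ⬝ᵥ θ) := by
    rw [hww]
    have b1 : r ^ 2 ≤ r := by nlinarith
    have b2 : r ^ 2 * (θ0 ⬝ᵥ θ0) ≤ (1 / 2) ^ prm.epochs * (θ0 ⬝ᵥ θ0) :=
      mul_le_mul_of_nonneg_right (b1.trans hr2) hn0
    have b3 : r ^ 2 * (θ ⬝ᵥ θ) ≤ 1 * (θ ⬝ᵥ θ) :=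
      mul_le_mul_of_nonneg_right (b1.trans hr1) ht0
    linarith
  have hκ := hp.κ_le
  have h5 : 0 ≤ E fun y => supNormModConst (Ψ *ᵥ y - M.basicQ π) ^ 2 :=
    E.nonneg fun _ => sq_nonneg _
  have h6 : M.criticError Ψ (u π) prm θ0 π x ≤ 101 / 100 * E fun y =>
      supNormModConst (Ψ *ᵥ y - M.basicQ π) ^ 2 :=
    h1.trans (mul_le_mul_of_nonneg_right (by linarith) h5)
  have h7 : 0 ≤ (1 / 2 : ℝ) ^ prm.epochs * (θ0 ⬝ᵥ θ0) := by positivity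
  rw [hss] at h3
  nlinarith [sq_nonneg ε]

/-- The bias of the critic. -/
theorem critic_bias_le (θ0 : Fin d → ℝ) (π : Policy S A) (x : Traj S A) {v : Fin d → ℝ}
    (hv : v ⬝ᵥ v ≤ 2 ^ 2) {W G : ℝ}
    (hW : √(2 * (θ0 ⬝ᵥ θ0) + 2 * (M.thetaStar Ψ π (u π) ⬝ᵥ M.thetaStar Ψ π (u π))) ≤ W)
    (hG : 2 * M.epsApprox Ψ u + 4 * √(M.thetaStar Ψ π (u π) ⬝ᵥ M.thetaStar Ψ π (u π)) ≤ G) :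
    pmfE (M.critic Ψ (u π) prm θ0 π x) (fun y => v ⬝ᵥ (y.1 - M.thetaStar Ψ π (u π))) ≤
      2 * ((1 / 100) ^ prm.epochs * W + κ * (W + G)) := by
  set θ := M.thetaStar Ψ π (u π) with hθ
  set E := (H.td π).epochsEx prm.eta prm.N' prm.N prm.T prm.epochs θ0 with hE
  have hΓ := H.Γ_lt
  have hκ0 : 0 ≤ κ := le_trans (mul_nonneg (by norm_num) (mul_nonneg (Nat.cast_nonneg _)
    (div_nonneg (by positivity) (by linarith)))) hp.κ_ge
  -- The bias is that of independent samples, exponentially small in the number of epochs, plus κ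
  -- times the mean absolute value, for which a moment bound suffices.
  have h1 := (H.critic_dom hp θ0 π x).abs_sub_le fun y => v ⬝ᵥ (y - θ)
  have h2 := ((H.critic_wbd hp θ0 π) v 2 (by norm_num) hv).abs_expect_le hp.q_pos
  have hμ := H.mubar_pos
  have hβ := H.rate_bounds.1
  have hq : (1 : ℝ) ≤ q := by exact_mod_cast hp.q_pos
  have hNpos : (0 : ℝ) < 200000000 * q / ((1 / (2 * Cβ * M.tmix)) ^ 2 * mubar) := by positivity
  have hTpos : (0 : ℝ) < 1600 / (prm.eta * (1 / (2 * Cβ * M.tmix)) * mubar) := by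
    have := hp.eta_pos
    positivity
  have n1 : prm.N' ≠ 0 := fun h => by
    have := hp.N'_ge; rw [h, Nat.cast_zero] at this; linarith
  have n2 : prm.N ≠ 0 := fun h => by
    have := hp.N_ge; rw [h, Nat.cast_zero] at this; linarith
  have n3 : prm.T ≠ 0 := fun h => by
    have := hp.T_ge; rw [h, Nat.cast_zero] at this; linarith
  have h3 := ((H.td π).epochsEx_bias hp.eta_pos hp.eta_le n1 n2 n3 hp.T_ge prm.epochs
    (Real.sqrt_nonneg _) (dot_sub_le (Ψ := Ψ) (u := u) θ0 π)) v 2 (by norm_num) hv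
  change |E fun y => v ⬝ᵥ (y - θ)| ≤ _ at h3
  change E (fun y => |v ⬝ᵥ (y - θ)|) ≤ _ at h2
  set w := √(2 * (θ0 ⬝ᵥ θ0) + 2 * (θ ⬝ᵥ θ)) with hwdef
  have hw0 : 0 ≤ w := Real.sqrt_nonneg _
  set r : ℝ := (1 / 100) ^ prm.epochs with hr
  have hr0 : 0 ≤ r := by positivity
  have hr1 : r ≤ 1 := pow_le_one₀ (by norm_num) (by norm_num)
  have hG0 : 0 ≤ G := le_trans (by
    have := H.epsApprox_nonneg
    positivity) hG
  have h4 : E (fun y => |v ⬝ᵥ (y - θ)|) ≤ 2 * (W + G) := by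
    refine h2.trans (mul_le_mul_of_nonneg_left (add_le_add ?_ ?_) (by norm_num))
    · exact (mul_le_of_le_one_left hw0 hr1).trans hW
    · exact (div_le_div_of_nonneg_right hG (by norm_num)).trans (by linarith)
  have h5 := (abs_le.1 h1).2
  have h6 := (abs_le.1 h3).2
  have h7 := mul_le_mul_of_nonneg_left h4 hκ0
  have h8 := mul_le_mul_of_nonneg_left hW hr0
  linarith

end Setting

end AMDP

/-! ### Policy mirror descent -/

section Aux

variable {S A : Type} [Fintype S] [Fintype A]

/-- A constant added to e does not change the sum, because x has zero sum. This is why the critic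
need only be accurate modulo constants. -/
theorem sum_mul_le_supNormModConst (e : S × A → ℝ) (s : S) {x : A → ℝ} (hx : ∑ a, x a = 0) :
    ∑ a, e (s, a) * x a ≤ supNormModConst e * l1 x := by
  rw [supNormModConst, Real.iInf_mul_of_nonneg (l1_nonneg x)]
  refine le_ciInf fun b => ?_
  have h1 : ∑ a, e (s, a) * x a = x ⬝ᵥ fun a => e (s, a) + b := by
    simp only [dotProduct, mul_add, Finset.sum_add_distrib, ← Finset.sum_mul, hx, zero_mul,
      add_zero]
    exact Finset.sum_congr rfl fun a _ => mul_comm _ _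
  rw [h1, mul_comm]
  exact (le_abs_self _).trans (abs_dotProduct_le_l1 x _ fun a =>
    norm_le_pi_norm (fun z => e z + b) (s, a))

theorem l1_sub_le_two (p q : stdSimplex ℝ A) : l1 (p.1 - q.1) ≤ 2 := by
  refine (l1_sub_le _ _).trans ?_
  rw [l1_of_mem_stdSimplex p.2, l1_of_mem_stdSimplex q.2]
  norm_num

theorem sum_sub_simplex (p q : stdSimplex ℝ A) : ∑ a, (p.1 - q.1) a = 0 := by
  simp only [Pi.sub_apply, Finset.sum_sub_distrib, p.2.2, q.2.2, sub_self]

end Aux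

namespace AMDP

variable {S A : Type} [Fintype S] [Fintype A] [DecidableEq S]
  [DecidableEq A] [Nonempty S] [Nonempty A] (M : AMDP S A)

omit [DecidableEq A] [Nonempty A] in
theorem dist_nonneg {π : Policy S A} (hπ : Policy.Positive π) (πs : Policy S A) :
    0 ≤ M.dist π πs :=
  Finset.sum_nonneg fun s _ => mul_nonneg ((M.stat_spec πs).1.1 s)
    (kl_nonneg (πs s).2 (π s).2 (hπ s))

omit [Fintype S] [DecidableEq S] [DecidableEq A] [Nonempty S] in
theorem uniformPolicy_positive : Policy.Positive (uniformPolicy S A) := fun s a => by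
  simp only [uniformPolicy]
  positivity

namespace Setting

variable {M} {d : ℕ} {Ψ : Matrix (S × A) (Fin d) ℝ} {u : Policy S A → ℝ}
  {Cβ ω Γ cbar mubar dmin κ : ℝ} (H : M.Setting Ψ u Cβ ω Γ cbar mubar dmin)
include H

-- A second state already takes mass 1 - Γ; this is where at least two states are required.
omit [Nonempty A] in
theorem stat_le (π : Policy S A) (s : S) : M.stat π s ≤ Γ := by
  obtain ⟨s', hs'⟩ := Fintype.exists_ne_of_one_lt_card (by have := H.card; omega) s
  have h1 := (M.stat_spec π).1
  have h2 : M.stat π s + M.stat π s' ≤ 1 := by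
    rw [← h1.2, ← Finset.sum_pair hs'.symm]
    exact Finset.sum_le_sum_of_subset_of_nonneg (Finset.subset_univ _) fun a _ _ => h1.1 a
  linarith [H.stat_ge π s']

theorem half_le : 1 / 2 ≤ Γ := by
  have h1 := H.stat_ge (uniformPolicy S A) (Classical.arbitrary S)
  have h2 := H.stat_le (uniformPolicy S A) (Classical.arbitrary S)
  linarith

/-- One step of policy mirror descent with inexact value functions. -/
theorem mirror_step {l : ℝ} (hl : 0 ≤ l) {π : Policy S A} (hπ : Policy.Positive π)
    (πs : Policy S A) (Q : S × A → ℝ) :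
    (1 + l * ω) * M.dist (M.mirrorStep l Q π) πs +
        Γ / (1 - Γ) * l * (M.rho (M.mirrorStep l Q π) - M.rho πs) ≤
      M.dist π πs + (Γ / (1 - Γ) - 1) * l * (M.rho π - M.rho πs) +
        Γ / (1 - Γ) * l ^ 2 * supNormModConst (Q - M.basicQ π) ^ 2 +
        l * ∑ s, M.stat πs s * ∑ a, (Q - M.basicQ π) (s, a) * ((πs s).1 - (π s).1) a := by
  have hω := H.ω_pos
  have hΓ1 := H.Γ_lt
  have hΓ0 := H.Γ_pos
  set π' := M.mirrorStep l Q π with hπ'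
  set e := Q - M.basicQ π with he
  set m := supNormModConst e with hm
  set c := Γ / (1 - Γ) with hc
  have hc0 : 0 ≤ c := div_nonneg hΓ0.le (by linarith)
  have hpos' : Policy.Positive π' := mirrorStep_positive hl H.convex hπ Q
  have h3 := fun s q => mirrorStep_three_point hl hω.le H.convex hπ Q s q
  simp only [proxObj, ← hπ'] at h3
  have hlω : 0 ≤ l * ω := by positivity
  -- The decrease of the proximal objective from π to π' in a state; it is nonnegative since π is a
  -- competitor of the minimizer.
  set B : S → ℝ := fun s => l * (∑ a, Q (s, a) * ((π s).1 a - (π' s).1 a) +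
    (M.h s (π s).1 - M.h s (π' s).1)) - kl (π' s).1 (π s).1 with hB
  have hsub : ∀ (s : S) (p q : stdSimplex ℝ A), ∑ a, Q (s, a) * (p.1 a - q.1 a) =
      ∑ a, Q (s, a) * p.1 a - ∑ a, Q (s, a) * q.1 a := fun s p q => by
    rw [← Finset.sum_sub_distrib]
    exact Finset.sum_congr rfl fun a _ => by ring
  have hB0 : ∀ s, 0 ≤ B s := by
    intro s
    have h1 := h3 s (π s)
    rw [kl_self (hπ s)] at h1
    have h2 := mul_nonneg (by linarith : 0 ≤ 1 + l * ω)
      (kl_nonneg (π s).2 (π' s).2 (hpos' s))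
    simp only [hB, hsub]
    linarith
  have hstar : ∀ s, (1 + l * ω) * kl (πs s).1 (π' s).1 ≤ kl (πs s).1 (π s).1 +
      l * (∑ a, Q (s, a) * ((πs s).1 a - (π s).1 a) + (M.h s (πs s).1 - M.h s (π s).1)) + B s := by
    intro s
    have h1 := h3 s (πs s)
    simp only [hB, hsub]
    linarith
  have hQe : ∀ (s : S) (x : A → ℝ), ∑ a, Q (s, a) * x a =
      ∑ a, M.basicQ π (s, a) * x a + ∑ a, e (s, a) * x a := fun s x => by
    rw [← Finset.sum_add_distrib]
    exact Finset.sum_congr rfl fun a _ => by rw [he, Pi.sub_apply]; ring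
  have hsum1 : (1 + l * ω) * M.dist π' πs ≤ M.dist π πs + l * ((M.rho πs - M.rho π) +
      ∑ s, M.stat πs s * ∑ a, e (s, a) * ((πs s).1 - (π s).1) a) + ∑ s, M.stat πs s * B s := by
    rw [M.rho_sub_rho H.erg H.tmix_ne π πs, dist, dist, Finset.mul_sum,
      ← Finset.sum_add_distrib, Finset.mul_sum, ← Finset.sum_add_distrib, ← Finset.sum_add_distrib]
    refine Finset.sum_le_sum fun s _ => ?_
    have h1 := mul_le_mul_of_nonneg_left (hstar s) ((M.stat_spec πs).1.1 s)
    rw [hQe s fun a => (πs s).1 a - (π s).1 a] at h1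
    simp only [Pi.sub_apply]
    linarith
  -- Change of measure, legitimate because B ≥ 0: the optimal weights are at most Γ = c (1 - Γ),
  -- hence at most c times those of π'.
  have hsum2 : ∑ s, M.stat πs s * B s ≤ c * ∑ s, M.stat π' s * B s := by
    rw [Finset.mul_sum]
    refine Finset.sum_le_sum fun s _ => ?_
    rw [← mul_assoc]
    refine mul_le_mul_of_nonneg_right ((H.stat_le πs s).trans ?_) (hB0 s)
    calc Γ = c * (1 - Γ) := by rw [hc, div_mul_cancel₀]; linarith
      _ ≤ c * M.stat π' s := mul_le_mul_of_nonneg_left (H.stat_ge π' s) hc0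
  have hsum3 : ∑ s, M.stat π' s * B s ≤ l * (M.rho π - M.rho π') + l ^ 2 * m ^ 2 := by
    have e1 : l ^ 2 * m ^ 2 = ∑ s, M.stat π' s * (l ^ 2 * m ^ 2) := by
      rw [← Finset.sum_mul, (M.stat_spec π').1.2, one_mul]
    have e2 : l * (M.rho π - M.rho π') = -l * (M.rho π' - M.rho π) := by ring
    rw [e2, M.rho_sub_rho H.erg H.tmix_ne π π', e1, Finset.mul_sum, ← Finset.sum_add_distrib]
    refine Finset.sum_le_sum fun s _ => ?_
    -- With y the ℓ₁ distance of π and π', Pinsker gives l m y - y²/4 ≤ l²m². The error of the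
    -- critic thus enters this term only at second order in the stepsize.
    have h1 : l * (∑ a, e (s, a) * ((π s).1 - (π' s).1) a) - kl (π' s).1 (π s).1 ≤
        l ^ 2 * m ^ 2 := by
      have a1 := mul_le_mul_of_nonneg_left (sum_mul_le_supNormModConst e s
        (sum_sub_simplex (π s) (π' s))) hl
      have a2 := l1_sub_sq_le_kl (π' s).2 (π s).2 (hπ s)
      have a3 : l1 ((π' s).1 - (π s).1) = l1 ((π s).1 - (π' s).1) := by
        simp only [l1, Pi.sub_apply]
        exact Finset.sum_congr rfl fun a _ => abs_sub_comm _ _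
      rw [a3] at a2
      rw [← hm] at a1
      nlinarith [sq_nonneg (l * m - l1 ((π s).1 - (π' s).1) / 2)]
    have h2 : B s ≤ -l * (∑ a, M.basicQ π (s, a) * ((π' s).1 a - (π s).1 a) +
        (M.h s (π' s).1 - M.h s (π s).1)) + l ^ 2 * m ^ 2 := by
      have e3 : ∑ a, M.basicQ π (s, a) * ((π' s).1 a - (π s).1 a) =
          -∑ a, M.basicQ π (s, a) * ((π s).1 a - (π' s).1 a) := by
        rw [← Finset.sum_neg_distrib]
        exact Finset.sum_congr rfl fun a _ => by ring
      simp only [hB]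
      rw [hQe s fun a => (π s).1 a - (π' s).1 a, e3]
      simp only [Pi.sub_apply] at h1
      linarith
    have h3 := mul_le_mul_of_nonneg_left h2 ((M.stat_spec π').1.1 s)
    linarith
  have h4 := mul_le_mul_of_nonneg_left hsum3 hc0
  linarith

omit [DecidableEq A] [Nonempty A] H in
/-- The linear functional of the parameter that appears in the performance difference. -/
theorem exists_dual_feature (hΨ : ∀ z : S × A, Ψ z ⬝ᵥ Ψ z ≤ 1) (π πs : Policy S A) :
    ∃ v : Fin d → ℝ, v ⬝ᵥ v ≤ 2 ^ 2 ∧ ∀ x : Fin d → ℝ,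
      v ⬝ᵥ x = ∑ s, M.stat πs s * ∑ a, (Ψ *ᵥ x) (s, a) * ((πs s).1 - (π s).1) a := by
  set w : S × A → ℝ := fun z => M.stat πs z.1 * ((πs z.1).1 - (π z.1).1) z.2 with hw
  have hx : ∀ x : Fin d → ℝ, (w ᵥ* Ψ) ⬝ᵥ x =
      ∑ s, M.stat πs s * ∑ a, (Ψ *ᵥ x) (s, a) * ((πs s).1 - (π s).1) a := by
    intro x
    rw [← Matrix.dotProduct_mulVec, dotProduct, Fintype.sum_prod_type]
    refine Finset.sum_congr rfl fun s _ => ?_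
    rw [Finset.mul_sum]
    exact Finset.sum_congr rfl fun a _ => by simp only [hw]; ring
  refine ⟨w ᵥ* Ψ, ?_, hx⟩
  set v := w ᵥ* Ψ
  have hv0 := dotProduct_self_nonneg_real v
  -- Testing v against itself: the features have norm at most 1 and two policies are at ℓ₁ distance
  -- at most 2, so |v|² ≤ 2|v|.
  have h1 : v ⬝ᵥ v ≤ √(v ⬝ᵥ v) * 2 := by
    calc v ⬝ᵥ v = ∑ s, M.stat πs s * ∑ a, (Ψ *ᵥ v) (s, a) * ((πs s).1 - (π s).1) a := hx v
      _ ≤ ∑ s, M.stat πs s * (√(v ⬝ᵥ v) * 2) := by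
          refine Finset.sum_le_sum fun s _ => mul_le_mul_of_nonneg_left ?_
            ((M.stat_spec πs).1.1 s)
          have h2 := abs_dotProduct_le_l1 ((πs s).1 - (π s).1) (fun a => (Ψ *ᵥ v) (s, a))
            (F := √(v ⬝ᵥ v)) fun a => Real.abs_le_sqrt ((dotProduct_sq_le (Ψ (s, a)) v).trans
              (mul_le_of_le_one_left hv0 (hΨ _)))
          have h3 := mul_le_mul_of_nonneg_right (l1_sub_le_two (πs s) (π s))
            (Real.sqrt_nonneg (v ⬝ᵥ v))
          have e : ∑ a, (Ψ *ᵥ v) (s, a) * ((πs s).1 - (π s).1) a =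
              ((πs s).1 - (π s).1) ⬝ᵥ fun a => (Ψ *ᵥ v) (s, a) :=
            Finset.sum_congr rfl fun a _ => mul_comm _ _
          rw [e]
          linarith [le_abs_self (((πs s).1 - (π s).1) ⬝ᵥ fun a => (Ψ *ᵥ v) (s, a))]
      _ = √(v ⬝ᵥ v) * 2 := by rw [← Finset.sum_mul, (M.stat_spec πs).1.2, one_mul]
  have h2 := Real.mul_self_sqrt hv0
  have h3 := Real.sqrt_nonneg (v ⬝ᵥ v)
  have h4 : √(v ⬝ᵥ v) ≤ 2 := by
    by_contra h
    push Not at h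
    nlinarith
  nlinarith

/-- The potential function of policy mirror descent. -/
def potential (M : AMDP S A) (Γ ω l : ℝ) (πs π : Policy S A) : ℝ :=
  (1 + l * ω) * M.dist π πs + Γ / (1 - Γ) * l * (M.rho π - M.rho πs)

/-- Expected decrease of the potential in an iteration. -/
theorem potential_step {l σ b : ℝ} (hl : 0 < l) (hlω : l ≤ (1 - Γ) / (ω * Γ))
    {πs : Policy S A} (hopt : M.IsOptimal πs) {prm : CriticParams} {θ0 : Fin d → ℝ}
    {π : Policy S A} (hπ : Policy.Positive π) {x : Traj S A}
    (hfin : (M.critic Ψ (u π) prm θ0 π x).support.Finite)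
    (hbias : ∀ v : Fin d → ℝ, v ⬝ᵥ v ≤ 2 ^ 2 →
      pmfE (M.critic Ψ (u π) prm θ0 π x) (fun y => v ⬝ᵥ (y.1 - M.thetaStar Ψ π (u π))) ≤ 2 * b)
    (herr : M.criticError Ψ (u π) prm θ0 π x ≤ σ ^ 2) :
    pmfE (M.critic Ψ (u π) prm θ0 π x)
        (fun y => potential M Γ ω l πs (M.mirrorStep l (Ψ *ᵥ y.1) π)) ≤
      potential M Γ ω l πs π / (1 + l * ω) +
        (Γ / (1 - Γ) * l ^ 2 * σ ^ 2 + 2 * l * (M.epsApprox Ψ u + b)) := by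
  have hω := H.ω_pos
  have hΓ1 := H.Γ_lt
  have hΓ0 := H.Γ_pos
  have hlω0 : 0 < l * ω := by positivity
  set c := Γ / (1 - Γ) with hc
  have hc0 : 0 ≤ c := div_nonneg hΓ0.le (by linarith)
  have hclω : c * (l * ω) ≤ 1 := by
    have h1 : l * (ω * Γ) ≤ 1 - Γ := by rwa [← le_div_iff₀ (by positivity)]
    rw [hc, div_mul_eq_mul_div, div_le_one (by linarith)]
    linarith
  set E := Ex.ofPMF _ hfin with hE
  have hEapp : ∀ f : (Fin d → ℝ) × Traj S A → ℝ,
      pmfE (M.critic Ψ (u π) prm θ0 π x) f = E f := fun f => rfl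
  obtain ⟨v, hv, hvx⟩ := exists_dual_feature (M := M) H.norm_le π πs
  set θ := M.thetaStar Ψ π (u π) with hθ
  have hr := hopt π
  rw [hEapp]
  have hb := hbias v hv
  rw [hEapp] at hb
  rw [criticError, hEapp] at herr
  have happrox : ∑ s, M.stat πs s * ∑ a, (Ψ *ᵥ θ - M.basicQ π) (s, a) * ((πs s).1 - (π s).1) a ≤
      2 * M.epsApprox Ψ u := by
    calc _ ≤ ∑ s, M.stat πs s * (M.epsApprox Ψ u * 2) := by
          refine Finset.sum_le_sum fun s _ => mul_le_mul_of_nonneg_left ?_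
            ((M.stat_spec πs).1.1 s)
          refine (sum_mul_le_supNormModConst _ s (sum_sub_simplex _ _)).trans ?_
          exact mul_le_mul (H.approx_le π) (l1_sub_le_two _ _) (l1_nonneg _) H.epsApprox_nonneg
      _ = _ := by rw [← Finset.sum_mul, (M.stat_spec πs).1.2, one_mul, mul_comm]
  have hpt : ∀ y : (Fin d → ℝ) × Traj S A,
      potential M Γ ω l πs (M.mirrorStep l (Ψ *ᵥ y.1) π) ≤
        (potential M Γ ω l πs π / (1 + l * ω) + l * (2 * M.epsApprox Ψ u)) +
          (c * l ^ 2 * supNormModConst (Ψ *ᵥ y.1 - M.basicQ π) ^ 2 +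
            l * (v ⬝ᵥ (y.1 - θ))) := by
    intro y
    have h1 := H.mirror_step hl.le hπ πs (Ψ *ᵥ y.1)
    -- The first order error splits into a part that is linear in θ - θ*, of which only the mean
    -- counts, and the approximation error of Ψθ*.
    have h2 : ∑ s, M.stat πs s * ∑ a, (Ψ *ᵥ y.1 - M.basicQ π) (s, a) * ((πs s).1 - (π s).1) a =
        v ⬝ᵥ (y.1 - θ) + ∑ s, M.stat πs s *
          ∑ a, (Ψ *ᵥ θ - M.basicQ π) (s, a) * ((πs s).1 - (π s).1) a := by
      rw [hvx, ← Finset.sum_add_distrib]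
      refine Finset.sum_congr rfl fun s _ => ?_
      rw [← mul_add, ← Finset.sum_add_distrib]
      congr 1
      refine Finset.sum_congr rfl fun a _ => ?_
      rw [Matrix.mulVec_sub]
      simp only [Pi.sub_apply]
      ring
    rw [h2, ← hc] at h1
    have h3 : M.dist π πs + (c - 1) * l * (M.rho π - M.rho πs) ≤
        potential M Γ ω l πs π / (1 + l * ω) := by
      rw [le_div_iff₀ (by linarith), potential, ← hc]
      -- Equivalent to c l ω ≤ 1 + l ω, and implied by the first bound on the stepsize. It lets the
      -- cost term contract at the rate of the distance term.
      have a1 : (c - 1) * (1 + l * ω) ≤ c := by nlinarith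
      have a2 := mul_le_mul_of_nonneg_right a1 (mul_nonneg hl.le (sub_nonneg.2 hr))
      nlinarith
    have h4 := mul_le_mul_of_nonneg_left happrox hl.le
    rw [potential, ← hc]
    linarith
  have h5 := E.mono hpt
  rw [Ex.add, Ex.const, Ex.add, Ex.smul, Ex.smul] at h5
  have h6 := mul_le_mul_of_nonneg_left herr (by positivity : 0 ≤ c * l ^ 2)
  have h7 := mul_le_mul_of_nonneg_left hb hl.le
  linarith

/-- Expected distance to the optimal policy after `K + 1` iterations. -/
theorem expected_dist_le {l σ b : ℝ} (hl : 0 < l) (hlω : l ≤ (1 - Γ) / (ω * Γ)) (hb : 0 ≤ b)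
    {πs : Policy S A} (hopt : M.IsOptimal πs) {prm : CriticParams} {θ0 : Fin d → ℝ} {z0 : S × A}
    (hfin : ∀ (π : Policy S A) (x : Traj S A), (M.critic Ψ (u π) prm θ0 π x).support.Finite)
    (hbias : ∀ (π : Policy S A) (x : Traj S A) (v : Fin d → ℝ), v ⬝ᵥ v ≤ 2 ^ 2 →
      pmfE (M.critic Ψ (u π) prm θ0 π x) (fun y => v ⬝ᵥ (y.1 - M.thetaStar Ψ π (u π))) ≤ 2 * b)
    {K : ℕ} (herr : ∀ k ≤ K, ∀ y ∈ (M.spmd Ψ u prm θ0 l z0 k).support,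
      M.criticError Ψ (u y.1) prm θ0 y.1 y.2 ≤ σ ^ 2) :
    pmfE (M.spmd Ψ u prm θ0 l z0 (K + 1)) (fun y => M.dist y.1 πs) ≤
      potential M Γ ω l πs (uniformPolicy S A) / (1 + l * ω) ^ K +
        (Γ / (1 - Γ) * l * σ ^ 2 + 2 * (M.epsApprox Ψ u + b)) / ω := by
  have hω := H.ω_pos
  have hΓ1 := H.Γ_lt
  have hΓ0 := H.Γ_pos
  have hlω0 : 0 < l * ω := by positivity
  have hc0 : 0 ≤ Γ / (1 - Γ) := div_nonneg hΓ0.le (by linarith)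
  have hε := H.epsApprox_nonneg
  set R := Γ / (1 - Γ) * l ^ 2 * σ ^ 2 + 2 * l * (M.epsApprox Ψ u + b) with hR
  have hR0 : 0 ≤ R := by positivity
  set a := 1 + l * ω with ha
  have ha1 : 1 ≤ a := by linarith
  -- Every reachable policy has full support, so the divergences from it are genuine; finite
  -- supports make the expectations finite sums.
  have hsupp : ∀ k, (M.spmd Ψ u prm θ0 l z0 k).support.Finite ∧
      ∀ y ∈ (M.spmd Ψ u prm θ0 l z0 k).support, Policy.Positive y.1 := by
    intro k
    induction k with
    | zero =>
      refine ⟨finite_support_pure _, fun y hy => ?_⟩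
      rw [spmd, PMF.mem_support_pure_iff] at hy
      rw [hy]
      exact uniformPolicy_positive
    | succ k ih =>
      refine ⟨finite_support_bind ih.1 fun y => finite_support_map _ (hfin _ _), fun y hy => ?_⟩
      rw [spmd, PMF.mem_support_bind_iff] at hy
      obtain ⟨z, hz, hy⟩ := hy
      rw [PMF.mem_support_map_iff] at hy
      obtain ⟨w, -, rfl⟩ := hy
      exact mirrorStep_positive hl.le H.convex (ih.2 z hz) _
  set Φ := potential M Γ ω l πs with hΦ
  -- R a/(lω) is the fixed point of the recursion x ↦ x/a + R with a = 1 + lω.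
  have hrec : ∀ k ≤ K + 1, pmfE (M.spmd Ψ u prm θ0 l z0 k) (fun y => Φ y.1) ≤
      Φ (uniformPolicy S A) / a ^ k + R * (a / (l * ω)) := by
    intro k
    induction k with
    | zero =>
      intro _
      rw [spmd, pmfE_pure, pow_zero, div_one]
      have : 0 ≤ R * (a / (l * ω)) := by positivity
      linarith
    | succ k ih =>
      intro hk
      have h1 := ih (by omega)
      rw [spmd, pmfE_bind (hsupp k).1 fun y => finite_support_map _ (hfin _ _)]
      have h2 : pmfE (M.spmd Ψ u prm θ0 l z0 k) (fun y =>
          pmfE ((M.critic Ψ (u y.1) prm θ0 y.1 y.2).map fun w =>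
            (M.mirrorStep l (Ψ *ᵥ w.1) y.1, w.2)) fun y => Φ y.1) ≤
          pmfE (M.spmd Ψ u prm θ0 l z0 k) (fun y => a⁻¹ * Φ y.1 + R) := by
        refine pmfE_mono_support _ (hsupp k).1 fun y hy => ?_
        rw [pmfE_map _ (hfin _ _)]
        have h3 := H.potential_step hl hlω hopt ((hsupp k).2 y hy) (hfin y.1 y.2) (hbias y.1 y.2)
          (herr k (by omega) y hy)
        rw [← ha, div_eq_inv_mul] at h3
        exact h3
      have h4 : pmfE (M.spmd Ψ u prm θ0 l z0 k) (fun y => a⁻¹ * Φ y.1 + R) =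
          a⁻¹ * pmfE (M.spmd Ψ u prm θ0 l z0 k) (fun y => Φ y.1) + R := by
        set E := Ex.ofPMF _ (hsupp k).1
        have h5 := E.add (fun y => a⁻¹ * Φ y.1) fun _ => R
        rw [E.smul, E.const] at h5
        exact h5
      rw [h4] at h2
      refine h2.trans ?_
      have h6 := mul_le_mul_of_nonneg_left h1 (by positivity : 0 ≤ a⁻¹)
      have e1 : a⁻¹ * (Φ (uniformPolicy S A) / a ^ k + R * (a / (l * ω))) + R =
          Φ (uniformPolicy S A) / a ^ (k + 1) + R * (a / (l * ω)) := by
        have ha0 : a ≠ 0 := by positivity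
        have hl0 : l * ω ≠ 0 := hlω0.ne'
        have e2 : a⁻¹ * (R * (a / (l * ω))) + R = R * (a / (l * ω)) := by
          rw [show a⁻¹ * (R * (a / (l * ω))) = R * (a⁻¹ * a) / (l * ω) by ring,
            inv_mul_cancel₀ ha0]
          rw [mul_one, div_add' _ _ _ hl0, ← mul_div_assoc]
          congr 1
          rw [ha]; ring
        rw [mul_add, add_assoc, e2, pow_succ, div_mul_eq_div_div]
        ring_nf
      linarith
  have h1 := hrec (K + 1) le_rfl
  have h2 : pmfE (M.spmd Ψ u prm θ0 l z0 (K + 1)) (fun y => a * M.dist y.1 πs) ≤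
      pmfE (M.spmd Ψ u prm θ0 l z0 (K + 1)) (fun y => Φ y.1) := by
    refine pmfE_mono_support _ (hsupp (K + 1)).1 fun y _ => ?_
    have h3 := mul_nonneg (mul_nonneg hc0 hl.le) (sub_nonneg.2 (hopt y.1))
    simp only [hΦ, potential, ← ha]
    linarith
  have h3 : pmfE (M.spmd Ψ u prm θ0 l z0 (K + 1)) (fun y => a * M.dist y.1 πs) =
      a * pmfE (M.spmd Ψ u prm θ0 l z0 (K + 1)) (fun y => M.dist y.1 πs) :=
    (Ex.ofPMF _ (hsupp (K + 1)).1).smul a fun y => M.dist y.1 πs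
  rw [h3] at h2
  have h4 := h2.trans h1
  have ha0 : 0 < a := by linarith
  have e3 : Φ (uniformPolicy S A) / a ^ (K + 1) + R * (a / (l * ω)) =
      a * (Φ (uniformPolicy S A) / a ^ (K + 1) / a + R / (l * ω)) := by
    field_simp
  rw [e3] at h4
  have h5 := le_of_mul_le_mul_left h4 ha0
  refine h5.trans (add_le_add ?_ (le_of_eq ?_))
  · have hΦ0 : 0 ≤ Φ (uniformPolicy S A) :=
      add_nonneg (mul_nonneg (by linarith) (M.dist_nonneg uniformPolicy_positive πs))
        (mul_nonneg (mul_nonneg hc0 hl.le) (sub_nonneg.2 (hopt _)))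
    rw [div_div]
    refine div_le_div_of_nonneg_left hΦ0 (by positivity) ?_
    calc a ^ K = a ^ K * 1 * 1 := by ring
      _ ≤ a ^ K * a * a := by gcongr
      _ = a ^ (K + 1) * a := by ring
  · rw [hR]
    field_simp

end Setting

end AMDP

/-! ### Choice of the parameters -/

section Size

variable {ε ω Γ cbar tm mubar dmin n0 : ℝ}

theorem le_problemSize (hε : 0 < ε) (hω : 0 < ω) (hΓ : Γ < 1) (hc : 0 ≤ cbar) (ht : 0 ≤ tm)
    (hm : 0 < mubar) (hd : 0 < dmin) (hn : 0 ≤ n0) :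
    3 ≤ problemSize ε ω Γ cbar tm mubar dmin n0 ∧
    1 / ε ≤ problemSize ε ω Γ cbar tm mubar dmin n0 ∧
    ω ≤ problemSize ε ω Γ cbar tm mubar dmin n0 ∧
    1 / ω ≤ problemSize ε ω Γ cbar tm mubar dmin n0 ∧
    cbar ≤ problemSize ε ω Γ cbar tm mubar dmin n0 ∧
    1 / (1 - Γ) ≤ problemSize ε ω Γ cbar tm mubar dmin n0 ∧
    tm ≤ problemSize ε ω Γ cbar tm mubar dmin n0 ∧
    1 / mubar ≤ problemSize ε ω Γ cbar tm mubar dmin n0 ∧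
    1 / dmin ≤ problemSize ε ω Γ cbar tm mubar dmin n0 ∧
    n0 ≤ problemSize ε ω Γ cbar tm mubar dmin n0 := by
  have h1 : 0 < 1 / ε := by positivity
  have h2 : 0 < 1 / ω := by positivity
  have h3 : 0 < 1 / (1 - Γ) := one_div_pos.2 (by linarith)
  have h4 : 0 < 1 / mubar := by positivity
  have h5 : 0 < 1 / dmin := by positivity
  unfold problemSize
  refine ⟨?_, ?_, ?_, ?_, ?_, ?_, ?_, ?_, ?_, ?_⟩ <;> linarith

theorem one_le_log {x : ℝ} (hx : 3 ≤ x) : 1 ≤ Real.log x := by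
  rw [Real.le_log_iff_exp_le (by linarith)]
  linarith [Real.exp_one_lt_d9]

theorem ceil_log_bounds {x : ℝ} (hx : 3 ≤ x) :
    1 ≤ ⌈Real.log x⌉₊ ∧ Real.log x ≤ ⌈Real.log x⌉₊ ∧ (⌈Real.log x⌉₊ : ℝ) ≤ 2 * Real.log x ∧
      x ≤ 3 ^ ⌈Real.log x⌉₊ := by
  have h1 := one_le_log hx
  have h2 := Nat.le_ceil (Real.log x)
  have h3 := (Nat.ceil_lt_add_one (by linarith : 0 ≤ Real.log x)).le
  refine ⟨?_, h2, by linarith, ?_⟩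
  · exact_mod_cast h1.trans h2
  · calc x = Real.exp (Real.log x) := (Real.exp_log (by linarith)).symm
      _ ≤ Real.exp (⌈Real.log x⌉₊ : ℝ) := Real.exp_le_exp.2 h2
      _ = Real.exp 1 ^ ⌈Real.log x⌉₊ := by rw [← Real.exp_nat_mul, mul_one]
      _ ≤ _ := pow_le_pow_left₀ (Real.exp_pos 1).le (by linarith [Real.exp_one_lt_d9]) _

theorem pow_mul_le_inv_pow {x r : ℝ} (hx : 0 < x) (hr : 0 < r) {q k : ℕ} (h : x ≤ (r⁻¹) ^ q) (i : ℕ)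
    (hk : k = i * q) : r ^ k ≤ (x ^ i)⁻¹ := by
  rw [hk, mul_comm, pow_mul, ← inv_pow]
  refine pow_le_pow_left₀ (by positivity) ?_ i
  rw [inv_pow] at h
  exact (le_inv_comm₀ hx (by positivity)).1 h

theorem polynomial_bound {x z Tb n0 cbar t : ℝ} (x3 : 3 ≤ x) (hz1 : 1 ≤ z) (hTb0 : 0 ≤ Tb)
    (hTb : Tb ≤ 2 * (z * x ^ 3)) (xn : n0 ≤ x) (xc : cbar ≤ x) (ht : 1 ≤ t)
    (xt : t ≤ x) : 4 * (2 * (1 + 2 * n0 + 2 * Tb ^ 2) + (6 * Tb + 4 * cbar * (1 + 8 * t))) ≤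
      z ^ 2 * x ^ 14 := by
  have hx1 : 1 ≤ x := by linarith
  have hz2 : 1 ≤ z ^ 2 := one_le_pow₀ hz1
  have p6 : 1 ≤ x ^ 6 := one_le_pow₀ hx1
  have b1 : Tb ^ 2 ≤ 4 * (z ^ 2 * x ^ 6) := by
    calc Tb ^ 2 ≤ (2 * (z * x ^ 3)) ^ 2 := pow_le_pow_left₀ hTb0 hTb 2
      _ = _ := by ring
  have b0 : 1 ≤ z ^ 2 * x ^ 6 := one_le_mul_of_one_le_of_one_le hz2 p6
  have b2 : Tb ≤ 2 * (z ^ 2 * x ^ 6) := by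
    have : z * x ^ 3 ≤ z ^ 2 * x ^ 6 := by
      have h1 : 1 ≤ z * x ^ 3 := one_le_mul_of_one_le_of_one_le hz1 (one_le_pow₀ hx1)
      calc z * x ^ 3 = z * x ^ 3 * 1 := by ring
        _ ≤ (z * x ^ 3) * (z * x ^ 3) := by gcongr
        _ = _ := by ring
    linarith
  have b3 : x ^ 2 ≤ z ^ 2 * x ^ 6 := by
    calc x ^ 2 ≤ x ^ 6 := pow_le_pow_right₀ hx1 (by norm_num)
      _ = 1 * x ^ 6 := by ring
      _ ≤ _ := by gcongr
  have b4 : x ≤ x ^ 2 := by nlinarith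
  have b5 : cbar * (1 + 8 * t) ≤ 9 * x ^ 2 := by
    have : cbar * (1 + 8 * t) ≤ x * (9 * x) := by gcongr; linarith
    linarith
  have b6 : (280 : ℝ) * (z ^ 2 * x ^ 6) ≤ z ^ 2 * x ^ 14 := by
    have : (280 : ℝ) ≤ x ^ 8 := by
      calc (280 : ℝ) ≤ 3 ^ 8 := by norm_num
        _ ≤ _ := pow_le_pow_left₀ (by norm_num) x3 8
    calc (280 : ℝ) * (z ^ 2 * x ^ 6) ≤ x ^ 8 * (z ^ 2 * x ^ 6) := by gcongr
      _ = _ := by ring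
  linarith

/-- Both small parameters beat the polynomial size z²x¹⁴ of the error bounds by a further x⁻², which
is at most εω. -/
theorem bias_parameter_bound {x z r κ W G : ℝ} (hx0 : 0 < x) (hz0 : 0 < z) (hε : 0 < ε)
    (hω : 0 < ω) (xε : 1 / ε ≤ x) (xω : 1 / ω ≤ x) (hr : r ≤ (z ^ 2 * x ^ 14 * x ^ 2)⁻¹)
    (hκ : κ ≤ (z ^ 2 * x ^ 14 * x ^ 2)⁻¹) (hW0 : 0 ≤ W) (hG0 : 0 ≤ G)
    (hWG : 4 * (2 * W + G) ≤ z ^ 2 * x ^ 14) : r * W + κ * (W + G) ≤ ε * ω / 4 := by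
  have a1 := mul_le_mul_of_nonneg_right hr hW0
  have a2 := mul_le_mul_of_nonneg_right hκ (by linarith : 0 ≤ W + G)
  have h2 : (z ^ 2 * x ^ 14 * x ^ 2)⁻¹ * (2 * W + G) ≤ (x ^ 2)⁻¹ / 4 := by
    rw [mul_inv, mul_comm (z ^ 2 * x ^ 14)⁻¹, mul_assoc, div_eq_mul_inv]
    refine mul_le_mul_of_nonneg_left ?_ (by positivity)
    rw [inv_mul_le_iff₀ (by positivity)]
    linarith
  have h3 : (x ^ 2)⁻¹ ≤ ε * ω := by
    rw [inv_le_comm₀ (by positivity) (by positivity), mul_inv, ← one_div, ← one_div, sq]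
    gcongr
  linarith

end Size

-- All data of the problem are at most x, and x ≤ 3^q for q = ⌈log x⌉, so any exponent proportional
-- to q yields an inverse power of x. The same q is the moment order; the number of epochs and the
-- number of mixing times between samples are multiples of q.
set_option maxHeartbeats 1000000 in
theorem exists_criticParams {Cβ : ℝ} (hC : 0 < Cβ) : ∃ C : ℝ, 0 < C ∧
    ∀ (ε ω Γ cbar mubar dmin n0 : ℝ) (t c : ℕ), 0 < ε → 0 < ω → Γ < 1 → 0 ≤ cbar →
    0 < mubar → mubar ≤ 1 → 0 < dmin → 0 ≤ n0 → 1 ≤ t → 2 ≤ Cβ * t → c * dmin ≤ 1 →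
    ∃ (prm : CriticParams) (κ : ℝ) (q j : ℕ),
      prm.Good (1 / (2 * Cβ * t)) mubar Γ κ q t j c ∧
      prm.eta ≤ 1 / (2 * Cβ * t) / 4 / 845 ∧
      t * Real.log (problemSize ε ω Γ cbar t mubar dmin n0) ≤ prm.tau ∧
      t * Real.log (problemSize ε ω Γ cbar t mubar dmin n0) ≤ prm.tau' ∧
      Real.log (problemSize ε ω Γ cbar t mubar dmin n0) ≤ prm.epochs ∧
      prm.epochs ≤ C * Real.log (problemSize ε ω Γ cbar t mubar dmin n0) ∧
      prm.epochs * prm.epochCost ≤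
        C * (t ^ 3 / mubar) * Real.log (problemSize ε ω Γ cbar t mubar dmin n0) ^ 3 ∧
      (1 / 100) ^ prm.epochs * (1 + 2 * n0 + 2 * (2 * cbar / (1 / (2 * Cβ * t) * mubar)) ^ 2) +
        κ * ((1 + 2 * n0 + 2 * (2 * cbar / (1 / (2 * Cβ * t) * mubar)) ^ 2) +
          (6 * (2 * cbar / (1 / (2 * Cβ * t) * mubar)) + 4 * cbar * (1 + 8 * t))) ≤
        ε * ω / 4 := by
  -- The constant 2Cβ is at most 3^J ≤ x^J, which turns it into a power of x. The multiples a and i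
  -- then depend on Cβ alone.
  obtain ⟨J, hJ⟩ := pow_unbounded_of_one_lt (2 * Cβ) (by norm_num : (1 : ℝ) < 3)
  set a : ℕ := 2 * J + 16 with ha
  obtain ⟨J', hJ'⟩ := pow_unbounded_of_one_lt (200000000000000 * (a : ℝ))
    (by norm_num : (1 : ℝ) < 3)
  set i : ℕ := J' + 2 * J + 6 + a with hi
  refine ⟨2 * a + 8 * (a * (12000000000000 * (4 * Cβ ^ 2) * (3 * (2 * i)))), by positivity, ?_⟩
  intro ε ω Γ cbar mubar dmin n0 t c hε hω hΓ hc hm hm1 hd hn ht htC hcd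
  have ht1 : (1 : ℝ) ≤ t := by exact_mod_cast ht
  obtain ⟨x3, xε, xω', xω, xc, xΓ, xt, xm, xd, xn⟩ :=
    le_problemSize hε hω hΓ hc (by linarith : (0 : ℝ) ≤ t) hm hd hn
  set x := problemSize ε ω Γ cbar t mubar dmin n0 with hx
  set L := Real.log x with hL
  obtain ⟨q1, qL, qL2, xq⟩ := ceil_log_bounds x3
  set q := ⌈L⌉₊ with hq
  have hL1 : 1 ≤ L := one_le_log x3
  have hLx : L ≤ x := Real.log_le_self (by linarith)
  have hq1 : (1 : ℝ) ≤ q := by exact_mod_cast q1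
  have hx0 : 0 < x := by linarith
  have hqx : (q : ℝ) ≤ 2 * x := by linarith
  set β := 1 / (2 * Cβ * (t : ℝ)) with hβ
  have hβ0 : 0 < β := by positivity
  have hβ1 : β ≤ 1 / 4 := one_div_le_one_div_of_le (by norm_num) (by linarith)
  have hβinv : 1 / β = 2 * Cβ * t := by rw [hβ, one_div_one_div]
  set z := x ^ J with hz
  have hz1 : 1 ≤ z := one_le_pow₀ (by linarith)
  have hCz : 2 * Cβ ≤ z := hJ.le.trans (pow_le_pow_left₀ (by norm_num) x3 J)
  have hβz : 1 / β ≤ z * x := by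
    rw [hβinv]
    exact mul_le_mul hCz xt (by linarith) (by linarith)
  -- The common scale q/(β²μ̄) of N and T: with η proportional to β/q, the inner length 1/(ηβμ̄) has
  -- the order of the batch size.
  set y : ℝ := q * ((1 / β) ^ 2 * (1 / mubar)) with hy
  have hm1' : 1 ≤ 1 / mubar := by rw [le_div_iff₀ hm]; linarith
  have hβ1' : 1 ≤ 1 / β := by rw [le_div_iff₀ hβ0]; linarith
  have hy1 : 1 ≤ y := by
    have h1 : 1 ≤ (1 / β) ^ 2 * (1 / mubar) :=
      one_le_mul_of_one_le_of_one_le (one_le_pow₀ hβ1') hm1'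
    exact one_le_mul_of_one_le_of_one_le hq1 h1
  have hyx : y ≤ 2 * x * ((z * x) ^ 2 * x) := by
    refine mul_le_mul hqx (mul_le_mul (pow_le_pow_left₀ (by positivity) hβz 2) xm (by positivity)
      (by positivity)) (by positivity) (by positivity)
  set η := β / (2000000000 * q) with hη
  have hη0 : 0 < η := by positivity
  have hηβ : η ≤ β / 2000000000 := by
    rw [hη]
    exact div_le_div_of_nonneg_left hβ0.le (by norm_num) (by linarith)
  set N := ⌈200000000 * q / (β ^ 2 * mubar)⌉₊ with hN
  set T := ⌈1600 / (η * β * mubar)⌉₊ with hT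
  have hN1 : 200000000 * q / (β ^ 2 * mubar) ≤ N := Nat.le_ceil _
  have hT1 : 1600 / (η * β * mubar) ≤ T := Nat.le_ceil _
  have hN2 := (Nat.ceil_lt_add_one (a := 200000000 * q / (β ^ 2 * mubar)) (by positivity)).le
  have hT2 := (Nat.ceil_lt_add_one (a := 1600 / (η * β * mubar)) (by positivity)).le
  rw [← hN] at hN2
  rw [← hT] at hT2
  clear_value N T
  have eN : 200000000 * q / (β ^ 2 * mubar) = 200000000 * y := by rw [hy]; field_simp
  have eT : 1600 / (η * β * mubar) = 3200000000000 * y := by rw [hη, hy]; field_simp; norm_num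
  have hNle : (N : ℝ) ≤ 4000000000000 * y := by
    rw [eN] at hN2
    linarith
  have hTle : (T : ℝ) ≤ 4000000000000 * y := by
    rw [eT] at hT2
    linarith
  -- Then 2^(-j) = 4^(-iq) ≤ x^(-i), and i is large enough to outweigh the number of samples and
  -- 1/(1-Γ).
  set j := 2 * i * q with hj
  set n := a * q with hn'
  set κ : ℝ := 2 * ((((N + N + T) * n : ℕ) : ℝ) * (2 * (1 / 2) ^ j / (1 - Γ))) with hκ
  have hhalf : (1 / 2 : ℝ) ^ j ≤ (x ^ i)⁻¹ := by
    have h4 : x ≤ ((1 / 4 : ℝ)⁻¹) ^ q := xq.trans (pow_le_pow_left₀ (by norm_num) (by norm_num) q)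
    have := pow_mul_le_inv_pow hx0 (by norm_num) h4 i rfl
    rw [hj, mul_assoc, pow_mul]
    norm_num at this ⊢
    exact this
  have hhund : (1 / 100 : ℝ) ^ n ≤ (x ^ a)⁻¹ :=
    pow_mul_le_inv_pow hx0 (by norm_num)
      (xq.trans (pow_le_pow_left₀ (by norm_num) (by norm_num) q)) a rfl
  have hκle : κ ≤ (x ^ a)⁻¹ := by
    have h1 : (((N + N + T) * n : ℕ) : ℝ) ≤ (12000000000000 * y) * (a * (2 * x)) := by
      push_cast
      rw [hn']
      push_cast
      refine mul_le_mul (by linarith) ?_ (by positivity) (by positivity)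
      gcongr
    have h2 : 2 * (1 / 2) ^ j / (1 - Γ) ≤ 2 * (x ^ i)⁻¹ * x := by
      rw [div_eq_mul_one_div]
      exact mul_le_mul (by linarith) xΓ (one_div_pos.2 (by linarith)).le (by positivity)
    have h3 : κ ≤ 2 * ((12000000000000 * (2 * x * ((z * x) ^ 2 * x))) * (a * (2 * x)) *
        (2 * (x ^ i)⁻¹ * x)) := by
      refine mul_le_mul_of_nonneg_left (mul_le_mul (h1.trans ?_) h2 (div_nonneg (by positivity)
        (by linarith)) (by positivity)) (by norm_num)
      gcongr
    refine h3.trans ?_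
    have h4 : x ^ i = x ^ J' * (z ^ 2 * x ^ 6 * x ^ a) := by
      rw [hi, hz]; ring
    have h5 : 200000000000000 * (a : ℝ) ≤ x ^ J' :=
      hJ'.le.trans (pow_le_pow_left₀ (by norm_num) x3 J')
    rw [h4]
    have hxJ : 0 < x ^ J' := by positivity
    have hz0 : 0 < z := by linarith
    have e : 2 * ((12000000000000 * (2 * x * ((z * x) ^ 2 * x))) * (a * (2 * x)) *
        (2 * (x ^ J' * (z ^ 2 * x ^ 6 * x ^ a))⁻¹ * x)) =
        192000000000000 * a / x ^ J' * (x ^ a)⁻¹ := by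
      field_simp
      ring
    rw [e]
    refine mul_le_of_le_one_left (by positivity) ?_
    rw [div_le_one hxJ]
    have : (0 : ℝ) ≤ a := Nat.cast_nonneg a
    linarith
  have hκ100 : κ ≤ 1 / 100 := by
    refine hκle.trans ?_
    rw [← one_div]
    refine one_div_le_one_div_of_le (by norm_num) ?_
    calc (100 : ℝ) ≤ 3 ^ 16 := by norm_num
      _ ≤ x ^ 16 := pow_le_pow_left₀ (by norm_num) x3 16
      _ ≤ x ^ a := pow_le_pow_right₀ (by linarith) (by omega)
  have hκ0 : 0 ≤ κ := mul_nonneg (by norm_num) (mul_nonneg (Nat.cast_nonneg _)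
    (div_nonneg (by positivity) (by linarith)))
  have hTb : 2 * cbar / (β * mubar) ≤ 2 * (z * x ^ 3) := by
    have e : 2 * cbar / (β * mubar) = 2 * (cbar * ((1 / β) * (1 / mubar))) := by field_simp
    rw [e]
    have h1 : cbar * ((1 / β) * (1 / mubar)) ≤ x * ((z * x) * x) := by gcongr
    linarith
  have hTb0 : 0 ≤ 2 * cbar / (β * mubar) := by positivity
  have hxa : x ^ a = z ^ 2 * x ^ 14 * x ^ 2 := by rw [ha, hz]; ring
  rw [hxa] at hhund hκle
  have hbias := bias_parameter_bound hx0 (by linarith) hε hω xε xω hhund hκle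
    (by positivity : 0 ≤ 1 + 2 * n0 + 2 * (2 * cbar / (β * mubar)) ^ 2)
    (by positivity : 0 ≤ 6 * (2 * cbar / (β * mubar)) + 4 * cbar * (1 + 8 * (t : ℝ)))
    (polynomial_bound x3 hz1 hTb0 hTb xn xc ht1 xt)
  refine ⟨⟨η, n, T, N, N, t * j + 1, t * j + 1⟩, κ, q, j, ?_, ?_, ?_, ?_, ?_, ?_, ?_, ?_⟩
  · refine ⟨q1, ?_, hη0, ?_, ?_, hN1, hN1, hT1, le_rfl, le_rfl,
      le_rfl, hκ100⟩
    · calc (c : ℝ) ≤ 1 / dmin := by rw [le_div_iff₀ hd]; exact hcd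
        _ ≤ x := xd
        _ ≤ 3 ^ q := xq
        _ ≤ 9 ^ q := pow_le_pow_left₀ (by norm_num) (by norm_num) q
    · change 4 * η ≤ β
      linarith
    · have e : 81 * (64 * (q : ℝ) ^ 2 * η ^ 2 + 24 * q * η / β) =
          81 * (64 * β ^ 2 / 2000000000 ^ 2 + 24 / 2000000000) := by
        rw [hη]; field_simp
      change 81 * (64 * (q : ℝ) ^ 2 * η ^ 2 + 24 * q * η / β) ≤ _
      rw [e]
      have : β ^ 2 ≤ 1 := pow_le_one₀ hβ0.le (by linarith)
      norm_num
      linarith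
  · change η ≤ β / 4 / 845
    linarith
  · have h1 : (t : ℝ) * L ≤ t * j := by
      refine mul_le_mul_of_nonneg_left (qL.trans ?_) (by linarith)
      rw [hj]
      exact_mod_cast Nat.le_mul_of_pos_left q (by omega)
    push_cast
    linarith
  · have h1 : (t : ℝ) * L ≤ t * j := by
      refine mul_le_mul_of_nonneg_left (qL.trans ?_) (by linarith)
      rw [hj]
      exact_mod_cast Nat.le_mul_of_pos_left q (by omega)
    push_cast
    linarith
  · refine qL.trans ?_
    change (q : ℝ) ≤ (n : ℕ)
    rw [hn']
    exact_mod_cast Nat.le_mul_of_pos_left q (by omega)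
  · change ((n : ℕ) : ℝ) ≤ _
    rw [hn']
    push_cast
    have h1 : (a : ℝ) * q ≤ a * (2 * L) := by gcongr
    have h2 : 0 ≤ 8 * ((a : ℝ) * (12000000000000 * (4 * Cβ ^ 2) * (3 * (2 * i)))) * L := by
      positivity
    refine (h1.trans (le_add_of_nonneg_right h2)).trans (le_of_eq ?_)
    ring
  -- Tally: a q epochs, of order q t²/μ̄ samples in each, at distance of order t q. The product is
  -- t³/μ̄ times q³.
  · have h1 : ((t * j + 1 + 1 : ℕ) : ℝ) ≤ 3 * (2 * i) * (t * q) := by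
      have h2 : 1 ≤ t * j := Nat.one_le_iff_ne_zero.2 (by
        have : 0 < j := by rw [hj]; positivity
        positivity)
      have h3 : t * j + 1 + 1 ≤ 3 * (t * j) := by omega
      calc ((t * j + 1 + 1 : ℕ) : ℝ) ≤ ((3 * (t * j) : ℕ) : ℝ) := by exact_mod_cast h3
        _ = _ := by rw [hj]; push_cast; ring
    have h2 : ((((N + N) * (t * j + 1 + 1) + T * (t * j + 1 + 1) : ℕ)) : ℝ) ≤
        12000000000000 * y * (3 * (2 * i) * (t * q)) := by
      rw [← add_mul, Nat.cast_mul]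
      refine mul_le_mul ?_ h1 (Nat.cast_nonneg _) (by positivity)
      push_cast
      linarith
    have hL0 : 0 ≤ L := by linarith
    change ((n : ℕ) : ℝ) * (((N + N) * (t * j + 1 + 1) + T * (t * j + 1 + 1) : ℕ) : ℝ) ≤ _
    calc ((n : ℕ) : ℝ) * (((N + N) * (t * j + 1 + 1) + T * (t * j + 1 + 1) : ℕ) : ℝ)
        ≤ (a * q) * (12000000000000 * y * (3 * (2 * i) * (t * q))) := by
          rw [hn']; push_cast at h2 ⊢
          exact mul_le_mul_of_nonneg_left h2 (by positivity)
      _ = (a * (12000000000000 * (4 * Cβ ^ 2) * (3 * (2 * i)))) * (t ^ 3 / mubar) * (q : ℝ) ^ 3 := by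
          rw [hy, hβinv]; ring
      _ ≤ (a * (12000000000000 * (4 * Cβ ^ 2) * (3 * (2 * i)))) * (t ^ 3 / mubar) *
          (2 * L) ^ 3 := by gcongr
      _ = 8 * (a * (12000000000000 * (4 * Cβ ^ 2) * (3 * (2 * i)))) * (t ^ 3 / mubar) *
          L ^ 3 := by ring
      _ ≤ _ := by
          have h0 : (0 : ℝ) ≤ 2 * a := by positivity
          gcongr
          linarith
  · exact hbias

/-! ### Number of iterations -/

/-- log t/t decreases beyond e, whence the requirement K₀ ≥ 3. -/
theorem log_div_le_of_le {K₀ K : ℕ} (h3 : 3 ≤ K₀) (h : K₀ ≤ K) :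
    Real.log K / K ≤ Real.log K₀ / K₀ := by
  have h3' : (3 : ℝ) ≤ K₀ := by exact_mod_cast h3
  have hK : (K₀ : ℝ) ≤ K := by exact_mod_cast h
  have he := Real.exp_one_lt_d9
  exact Real.log_div_self_antitoneOn (Set.mem_ofPred.2 (by linarith))
    (Set.mem_ofPred.2 (by linarith)) hK

set_option maxHeartbeats 1000000 in
/-- The number of iterations. -/
theorem exists_iterations {x σ ω ε Γ : ℝ} (hx : 3 ≤ x) (hσ : 0 < σ) (hω : 0 < ω) (hε : 0 < ε)
    (hΓ0 : 0 ≤ Γ) (hΓ : Γ < 1) (xε : 1 / ε ≤ x) (xω : 1 / ω ≤ x) (xΓ : 1 / (1 - Γ) ≤ x) :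
    ∃ K₀ : ℕ, 3 ≤ K₀ ∧
      (K₀ + 1 : ℝ) ≤ 2002 * ((1 + σ ^ 2 / (ω ^ 2 * ε)) / (1 - Γ)) *
        Real.log (x + σ + 1 / σ) ^ 2 ∧
      ∀ K : ℕ, K₀ ≤ K →
        14 * Real.log (x + σ + 1 / σ) * ((1 + σ ^ 2 / (ω ^ 2 * ε)) / (1 - Γ)) *
          (Real.log K / K) ≤ 1 / 4 ∧ 6 * Real.log x ≤ (1 - Γ) * K := by
  have hσ' : 0 < 1 / σ := by positivity
  have hΓ1 : 0 < 1 - Γ := by linarith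
  set s := x + σ + 1 / σ with hs
  set ρ := (1 + σ ^ 2 / (ω ^ 2 * ε)) / (1 - Γ) with hρ
  set L := Real.log s with hL
  have hxs : x ≤ s := by linarith
  have hσs : σ ≤ s := by linarith
  have hs3 : 3 ≤ s := by linarith
  have hs0 : 0 < s := by linarith
  have hL1 : 1 ≤ L := one_le_log hs3
  have hLs : L ≤ s := Real.log_le_self hs0.le
  have hfrac : 0 ≤ σ ^ 2 / (ω ^ 2 * ε) := by positivity
  have hρ1 : 1 / (1 - Γ) ≤ ρ := div_le_div_of_nonneg_right (by linarith) hΓ1.le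
  have hρ1' : 1 ≤ ρ := le_trans (by rw [le_div_iff₀ hΓ1]; linarith) hρ1
  -- Polynomial growth is all that is needed: it gives log K₀ ≤ 16 L.
  have hρs : ρ ≤ s ^ 7 := by
    have h1 : σ ^ 2 / (ω ^ 2 * ε) ≤ s ^ 5 := by
      have e : σ ^ 2 / (ω ^ 2 * ε) = σ ^ 2 * ((1 / ω) ^ 2 * (1 / ε)) := by field_simp
      have a1 : (1 / ω) ^ 2 ≤ s ^ 2 := pow_le_pow_left₀ (by positivity) (by linarith) 2
      have a2 : σ ^ 2 ≤ s ^ 2 := pow_le_pow_left₀ hσ.le hσs 2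
      rw [e]
      calc σ ^ 2 * ((1 / ω) ^ 2 * (1 / ε)) ≤ s ^ 2 * (s ^ 2 * s) := by
            gcongr; linarith
        _ = s ^ 5 := by ring
    have h2 : ρ = (1 + σ ^ 2 / (ω ^ 2 * ε)) * (1 / (1 - Γ)) := by rw [hρ]; ring
    have h3 : 1 + s ^ 5 ≤ s ^ 6 := by
      have h4 : 1 ≤ s ^ 5 := one_le_pow₀ (by linarith)
      have h5 : s ^ 6 = s ^ 5 * s := by ring
      nlinarith
    rw [h2]
    calc (1 + σ ^ 2 / (ω ^ 2 * ε)) * (1 / (1 - Γ)) ≤ s ^ 6 * s :=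
          mul_le_mul (by linarith) (by linarith) (one_div_pos.2 hΓ1).le (by positivity)
      _ = s ^ 7 := by ring
  have hP1 : 1 ≤ ρ * L ^ 2 := one_le_mul_of_one_le_of_one_le hρ1' (one_le_pow₀ hL1)
  -- One factor L pays for the logarithm in the stepsize and one for log K₀; the result 14·16/2000
  -- is below 1/4.
  set K₀ := ⌈2000 * (ρ * L ^ 2)⌉₊ with hK₀
  have hK1 : 2000 * (ρ * L ^ 2) ≤ K₀ := Nat.le_ceil _
  have hK2 : (K₀ : ℝ) ≤ 2000 * (ρ * L ^ 2) + 1 := (Nat.ceil_lt_add_one (by positivity)).le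
  clear_value K₀
  have hK3 : (3 : ℝ) ≤ K₀ := by linarith
  have hK3' : 3 ≤ K₀ := by exact_mod_cast hK3
  have hK0 : (0 : ℝ) < K₀ := by linarith
  have hlogK : Real.log K₀ ≤ 16 * L := by
    have h1 : (K₀ : ℝ) ≤ s ^ 16 := by
      calc (K₀ : ℝ) ≤ 2001 * (ρ * L ^ 2) := by linarith
        _ ≤ s ^ 7 * (s ^ 7 * s ^ 2) := by
          have : (2001 : ℝ) ≤ s ^ 7 := by
            calc (2001 : ℝ) ≤ 3 ^ 7 := by norm_num
              _ ≤ _ := pow_le_pow_left₀ (by norm_num) hs3 7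
          gcongr
        _ = s ^ 16 := by ring
    calc Real.log K₀ ≤ Real.log (s ^ 16) := Real.log_le_log hK0 h1
      _ = 16 * L := by rw [Real.log_pow, hL]; norm_num
  refine ⟨K₀, hK3', by linarith, fun K hK => ⟨?_, ?_⟩⟩
  · have h1 := log_div_le_of_le hK3' hK
    have h2 : Real.log K₀ / K₀ ≤ 16 * L / (2000 * (ρ * L ^ 2)) :=
      div_le_div₀ (by positivity) hlogK (by positivity) hK1
    calc 14 * L * ρ * (Real.log K / K) ≤ 14 * L * ρ * (16 * L / (2000 * (ρ * L ^ 2))) :=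
          mul_le_mul_of_nonneg_left (h1.trans h2) (by positivity)
      _ = 224 / 2000 := by
          have : ρ ≠ 0 := by linarith
          have : L ≠ 0 := by linarith
          field_simp
          norm_num
      _ ≤ 1 / 4 := by norm_num
  · have h1 : (K₀ : ℝ) ≤ K := by exact_mod_cast hK
    have h2 : Real.log x ≤ L := Real.log_le_log (by linarith) hxs
    have h3 : 1 ≤ (1 - Γ) * ρ := by
      rw [div_le_iff₀ hΓ1] at hρ1; linarith
    calc 6 * Real.log x ≤ 6 * L := by linarith
      _ ≤ 2000 * L ^ 2 := by
        have : L ≤ L ^ 2 := by rw [sq]; exact le_mul_of_one_le_left (by linarith) hL1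
        linarith
      _ = 1 * (2000 * L ^ 2) := by ring
      _ ≤ ((1 - Γ) * ρ) * (2000 * L ^ 2) := by gcongr
      _ = (1 - Γ) * (2000 * (ρ * L ^ 2)) := by ring
      _ ≤ (1 - Γ) * K := by gcongr; linarith

/-- It bounds (1 + lω)^K from below by exp(lωK/2); the factor 2 in the definition of the stepsize
compensates for the 1/2. -/
theorem exp_half_le {y : ℝ} (hy0 : 0 ≤ y) (hy1 : y ≤ 1) : Real.exp (y / 2) ≤ 1 + y := by
  have h1 := Real.add_one_le_exp (-(y / 2))
  have h2 : Real.exp (y / 2) * Real.exp (-(y / 2)) = 1 := by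
    rw [← Real.exp_add]; simp
  have h3 := Real.exp_pos (y / 2)
  have h4 : Real.exp (y / 2) * (1 - y / 2) ≤ 1 := by nlinarith
  by_contra h
  push Not at h
  nlinarith

set_option maxHeartbeats 1000000 in
/-- The effect of the stepsize on the two error terms. -/
theorem stepsize_bounds {x σ ω ε Γ cbar D r l : ℝ} {K : ℕ} (hx : 3 ≤ x) (hσ : 0 < σ)
    (hω : 0 < ω) (hε : 0 < ε) (hΓ0 : 1 / 2 ≤ Γ) (hΓ : Γ < 1) (xε : 1 / ε ≤ x) (xω' : ω ≤ x)
    (xω : 1 / ω ≤ x) (xc : cbar ≤ x) (hD0 : 0 ≤ D) (hD : D ≤ x) (hr0 : 0 ≤ r)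
    (hr : r ≤ 2 * cbar) (hK3 : 3 ≤ K)
    (hK : 14 * Real.log (x + σ + 1 / σ) * ((1 + σ ^ 2 / (ω ^ 2 * ε)) / (1 - Γ)) *
      (Real.log K / K) ≤ 1 / 4) (hK' : 6 * Real.log x ≤ (1 - Γ) * K)
    (hl : l = min ((1 - Γ) / (ω * Γ)) (2 * (1 + Real.log (max 1
      ((2 * Γ * (1 - Γ) * ω ^ 2 * D + 2 * Γ * (1 - Γ) * ω * r) / σ ^ 2))) *
      Real.log K / (ω * K))) :
    0 < l ∧ Γ / (1 - Γ) * l * σ ^ 2 / ω ≤ ε / 4 ∧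
      ((1 + l * ω) * D + Γ / (1 - Γ) * l * r) / (1 + l * ω) ^ K ≤ ε / 4 := by
  have hΓ1 : 0 < 1 - Γ := by linarith
  have hΓp : 0 < Γ := by linarith
  have hσ' : 0 < 1 / σ := by positivity
  have hK3' : (3 : ℝ) ≤ K := by exact_mod_cast hK3
  have hKp : (0 : ℝ) < K := by linarith
  have hlogK : 1 ≤ Real.log K := one_le_log hK3'
  set s := x + σ + 1 / σ with hs
  set L := Real.log s with hL
  have hL1 : 1 ≤ L := one_le_log (by linarith)
  set ρ := (1 + σ ^ 2 / (ω ^ 2 * ε)) / (1 - Γ) with hρ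
  set X := 2 * Γ * (1 - Γ) * ω ^ 2 * D + 2 * Γ * (1 - Γ) * ω * r with hX
  have hX0 : 0 ≤ X := by positivity
  set m := max 1 (X / σ ^ 2) with hm
  have hm1 : 1 ≤ m := le_max_left _ _
  have hlogm : 0 ≤ Real.log m := Real.log_nonneg hm1
  set Q := 2 * (1 + Real.log m) with hQ
  have hσρ : σ ^ 2 / (ω ^ 2 * (1 - Γ)) ≤ ε * ρ := by
    have e : ε * ρ = ε / (1 - Γ) + σ ^ 2 / (ω ^ 2 * (1 - Γ)) := by
      rw [hρ]; field_simp
    have : 0 ≤ ε / (1 - Γ) := by positivity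
    linarith
  have hQL : Q ≤ 14 * L := by
    have h1 : X ≤ x ^ 3 := by
      have a0 : 2 * Γ * (1 - Γ) ≤ 1 / 2 := by nlinarith [sq_nonneg (2 * Γ - 1)]
      have a1 : ω ^ 2 * D ≤ x ^ 2 * x := by gcongr
      have a2 : ω * r ≤ x * (2 * x) := by gcongr; linarith
      have a3 : 0 ≤ ω ^ 2 * D + ω * r := by positivity
      have a4 : X = 2 * Γ * (1 - Γ) * (ω ^ 2 * D + ω * r) := by rw [hX]; ring
      rw [a4]
      calc 2 * Γ * (1 - Γ) * (ω ^ 2 * D + ω * r) ≤ 1 / 2 * (ω ^ 2 * D + ω * r) := by gcongr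
        _ ≤ 1 / 2 * (x ^ 2 * x + x * (2 * x)) := by gcongr
        _ ≤ x ^ 3 := by nlinarith [sq_nonneg x]
    have h2 : X / σ ^ 2 ≤ s ^ 5 := by
      have e : X / σ ^ 2 = X * (1 / σ) ^ 2 := by field_simp
      rw [e]
      calc X * (1 / σ) ^ 2 ≤ s ^ 3 * s ^ 2 := by
            have b1 : x ^ 3 ≤ s ^ 3 := pow_le_pow_left₀ (by linarith) (by linarith) 3
            have b2 : (1 / σ) ^ 2 ≤ s ^ 2 := pow_le_pow_left₀ hσ'.le (by linarith) 2
            exact mul_le_mul (h1.trans b1) b2 (by positivity)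
              (pow_nonneg (by linarith) 3)
        _ = s ^ 5 := by ring
    have h3 : m ≤ s ^ 5 := max_le (one_le_pow₀ (by linarith)) h2
    have h4 : Real.log m ≤ 5 * L := by
      calc Real.log m ≤ Real.log (s ^ 5) := Real.log_le_log (by linarith) h3
        _ = 5 * L := by rw [Real.log_pow, hL]; norm_num
    linarith
  have hQ0 : 0 < Q := by linarith
  have hl1 : l ≤ (1 - Γ) / (ω * Γ) := hl ▸ min_le_left _ _
  have hl2 : l ≤ Q * Real.log K / (ω * K) := hl ▸ min_le_right _ _
  have hl0 : 0 < l := by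
    rw [hl]
    exact lt_min (by positivity) (by positivity)
  have hlω : l * ω ≤ (1 - Γ) / Γ := by
    calc l * ω ≤ (1 - Γ) / (ω * Γ) * ω := by gcongr
      _ = _ := by field_simp
  have hcl : Γ / (1 - Γ) * l ≤ 1 / ω := by
    calc Γ / (1 - Γ) * l ≤ Γ / (1 - Γ) * ((1 - Γ) / (ω * Γ)) := by gcongr
      _ = _ := by field_simp
  have hlω1 : l * ω ≤ 1 := hlω.trans (by rw [div_le_one hΓp]; linarith)
  set Φ := (1 + l * ω) * D + Γ / (1 - Γ) * l * r with hΦ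
  have hlω0 : 0 < l * ω := by positivity
  have hΦ1 : Φ ≤ 2 * (D + r / ω) := by
    have a1 : (1 + l * ω) * D ≤ 2 * D := by gcongr; linarith
    have a2 : Γ / (1 - Γ) * l * r ≤ 1 / ω * r := by gcongr
    have a3 : 1 / ω * r = r / ω := by ring
    have a4 : 0 ≤ r / ω := by positivity
    linarith
  have hΦ0 : 0 ≤ Φ := by positivity
  refine ⟨hl0, ?_, ?_⟩
  · have h1 : Γ / (1 - Γ) * l * σ ^ 2 / ω ≤
        1 / (1 - Γ) * (14 * L * Real.log K / (ω * K)) * σ ^ 2 / ω := by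
      have : l ≤ 14 * L * Real.log K / (ω * K) := hl2.trans (by gcongr)
      gcongr
    have h2 : 1 / (1 - Γ) * (14 * L * Real.log K / (ω * K)) * σ ^ 2 / ω =
        14 * L * (Real.log K / K) * (σ ^ 2 / (ω ^ 2 * (1 - Γ))) := by
      field_simp
    have h3 : 14 * L * (Real.log K / K) * (σ ^ 2 / (ω ^ 2 * (1 - Γ))) ≤
        14 * L * (Real.log K / K) * (ε * ρ) := by
      have : 0 ≤ 14 * L * (Real.log K / K) := by positivity
      gcongr
    have h4 := mul_le_mul_of_nonneg_left hK hε.le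
    rw [h2] at h1
    linarith
  -- In the first case 1 + lω = 1/Γ, and Γ^K is a negative power of x. In the second case the
  -- logarithm in the stepsize is designed to cancel the initial potential.
  · rcases min_choice ((1 - Γ) / (ω * Γ)) (Q * Real.log K / (ω * K)) with h | h
    · have hl3 : l = (1 - Γ) / (ω * Γ) := hl.trans h
      have e : 1 + l * ω = Γ⁻¹ := by rw [hl3]; field_simp; ring
      rw [e, inv_pow, div_inv_eq_mul]
      have h1 : Γ ^ K ≤ (x ^ 6)⁻¹ := by
        have a1 : Γ ≤ Real.exp (-(1 - Γ)) := by linarith [Real.add_one_le_exp (-(1 - Γ))]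
        calc Γ ^ K ≤ Real.exp (-(1 - Γ)) ^ K := pow_le_pow_left₀ hΓp.le a1 K
          _ = Real.exp (-((1 - Γ) * K)) := by rw [← Real.exp_nat_mul]; congr 1; ring
          _ ≤ Real.exp (-(6 * Real.log x)) := Real.exp_le_exp.2 (by linarith)
          _ = (x ^ 6)⁻¹ := by
            rw [Real.exp_neg, show 6 * Real.log x = Real.log (x ^ 6) by
              rw [Real.log_pow]; norm_num, Real.exp_log (by positivity)]
      have h2 : Φ ≤ 6 * x ^ 2 := by
        have a1 : r / ω ≤ 2 * x ^ 2 := by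
          rw [div_eq_mul_one_div]
          calc r * (1 / ω) ≤ (2 * x) * x := by gcongr; linarith
            _ = _ := by ring
        have a2 : D ≤ x ^ 2 := hD.trans (le_self_pow₀ (by linarith) (by norm_num))
        linarith
      have h3 : 1 / x ≤ ε := by
        rw [div_le_iff₀ (by linarith)]
        rw [div_le_iff₀ hε] at xε
        linarith
      calc Φ * Γ ^ K ≤ 6 * x ^ 2 * (x ^ 6)⁻¹ := by gcongr
        _ = 6 / x ^ 3 * (1 / x) := by field_simp
        _ ≤ 1 / 4 * ε := by
          have : 6 / x ^ 3 ≤ 1 / 4 := by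
            rw [div_le_iff₀ (by positivity)]
            have : (3 : ℝ) ^ 3 ≤ x ^ 3 := pow_le_pow_left₀ (by norm_num) hx 3
            linarith
          gcongr
        _ = ε / 4 := by ring
    · have hl3 : l = Q * Real.log K / (ω * K) := hl.trans h
      -- Since log K ≥ 1, the exponent (1 + log m) log K is at least log K + log m.
      have h1 : K * m ≤ (1 + l * ω) ^ K := by
        have e : (K : ℝ) * (l * ω / 2) = (1 + Real.log m) * Real.log K := by
          rw [hl3, hQ]; field_simp
        have hexp : Real.log K + Real.log m ≤ (1 + Real.log m) * Real.log K := by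
          have := le_mul_of_one_le_right hlogm hlogK
          linarith
        calc (K : ℝ) * m = Real.exp (Real.log K + Real.log m) := by
              rw [Real.exp_add, Real.exp_log hKp, Real.exp_log (by linarith)]
          _ ≤ Real.exp ((1 + Real.log m) * Real.log K) := Real.exp_le_exp.2 hexp
          _ = Real.exp (l * ω / 2) ^ K := by rw [← Real.exp_nat_mul, e]
          _ ≤ _ := pow_le_pow_left₀ (Real.exp_pos _).le (exp_half_le hlω0.le hlω1) K
      -- X is ω²(1-Γ)Γ times the bound 2(D + r/ω) of the initial potential, and X ≤ mσ², so that m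
      -- cancels against the previous estimate.
      have h2 : Φ ≤ 2 * (σ ^ 2 / (ω ^ 2 * (1 - Γ))) * m := by
        have a1 : X ≤ m * σ ^ 2 := by
          rw [← div_le_iff₀ (by positivity)]
          exact le_max_right _ _
        have a2 : 2 * (D + r / ω) = X / (ω ^ 2 * (1 - Γ)) / Γ := by
          rw [hX]; field_simp
        have a3 : X / (ω ^ 2 * (1 - Γ)) / Γ ≤ m * σ ^ 2 / (ω ^ 2 * (1 - Γ)) / (1 / 2) := by
          gcongr
        have a4 : m * σ ^ 2 / (ω ^ 2 * (1 - Γ)) / (1 / 2) =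
            2 * (σ ^ 2 / (ω ^ 2 * (1 - Γ))) * m := by ring
        linarith
      have h3 : Φ / (1 + l * ω) ^ K ≤ 2 * (ε * ρ) * m / (K * m) := by
        refine div_le_div₀ (by positivity) (h2.trans ?_) (by positivity) h1
        gcongr
      refine h3.trans ?_
      have hρ0 : 0 < ρ := by positivity
      have h4 : 2 * (ε * ρ) * m / (K * m) = ε * (2 * ρ * (1 / K)) := by
        have : m ≠ 0 := by linarith
        field_simp
      have h5 : 2 * ρ * (1 / K) ≤ 14 * L * ρ * (Real.log K / K) := by
        calc 2 * ρ * (1 / K) ≤ 14 * 1 * ρ * (1 / K) := by gcongr; norm_num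
          _ ≤ _ := by gcongr
      rw [h4]
      have := mul_le_mul_of_nonneg_left (h5.trans hK) hε.le
      linarith

/-! ### The main result -/

/-- The crude inequality log t ≤ t suffices, as this bound matters only inside logarithms. -/
theorem kl_uniform_le {A : Type} [Fintype A] [Nonempty A] (p : stdSimplex ℝ A) :
    kl p.1 (fun _ => (Fintype.card A : ℝ)⁻¹) ≤ Fintype.card A := by
  have hA : (1 : ℝ) ≤ Fintype.card A := by exact_mod_cast Fintype.card_pos
  have h : ∀ a, p.1 a * Real.log (p.1 a / (Fintype.card A : ℝ)⁻¹) ≤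
      p.1 a * (Fintype.card A : ℝ) := by
    intro a
    have hp := p.2.1 a
    have hp1 : p.1 a ≤ 1 := by
      rw [← p.2.2]
      exact Finset.single_le_sum (fun a _ => p.2.1 a) (Finset.mem_univ a)
    refine mul_le_mul_of_nonneg_left ?_ hp
    refine (Real.log_le_self (by positivity)).trans ?_
    rw [div_inv_eq_mul]
    exact mul_le_of_le_one_left (by linarith) hp1
  calc kl p.1 (fun _ => (Fintype.card A : ℝ)⁻¹) ≤ ∑ a, p.1 a * (Fintype.card A : ℝ) :=
        Finset.sum_le_sum fun a _ => h a
    _ = _ := by rw [← Finset.sum_mul, p.2.2, one_mul]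

namespace AMDP

theorem dist_uniform_le {S A : Type} [Fintype S] [DecidableEq S] [Nonempty S] [Fintype A]
    [Nonempty A] (M : AMDP S A) (πs : Policy S A) :
    M.dist (uniformPolicy S A) πs ≤ Fintype.card (S × A) := by
  have hS : (1 : ℝ) ≤ Fintype.card S := by exact_mod_cast Fintype.card_pos
  calc M.dist (uniformPolicy S A) πs ≤ ∑ s, M.stat πs s * (Fintype.card A : ℝ) :=
        Finset.sum_le_sum fun s _ => mul_le_mul_of_nonneg_left (kl_uniform_le (πs s))
          ((M.stat_spec πs).1.1 s)
    _ = Fintype.card A := by rw [← Finset.sum_mul, (M.stat_spec πs).1.2, one_mul]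
    _ ≤ Fintype.card S * Fintype.card A := le_mul_of_one_le_left (Nat.cast_nonneg _) hS
    _ = _ := by rw [Fintype.card_prod, Nat.cast_mul]

namespace Setting

variable {S A : Type} [Fintype S] [Fintype A] [DecidableEq S] [DecidableEq A] [Nonempty S]
  [Nonempty A] {M : AMDP S A} {d : ℕ} {Ψ : Matrix (S × A) (Fin d) ℝ} {u : Policy S A → ℝ}
  {Cβ ω Γ cbar mubar dmin : ℝ} (H : M.Setting Ψ u Cβ ω Γ cbar mubar dmin)
include H

/-- The requirements on the parameters of the critic. -/
theorem params_requirements {prm : CriticParams} {κ : ℝ} {q j : ℕ}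
    (hp : prm.Good (1 / (2 * Cβ * M.tmix)) mubar Γ κ q M.tmix j (Fintype.card (S × A)))
    (hη : prm.eta ≤ 1 / (2 * Cβ * M.tmix) / 4 / 845) :
    0 < prm.eta ∧ 1 ≤ prm.T ∧ 1 ≤ prm.N ∧ 1 ≤ prm.N' ∧
      ∀ π : Policy S A,
        prm.eta ≤ M.betaGapPert Ψ π (u π) / 845 ∧
        64 / (M.mu Ψ π (u π) * M.betaGapPert Ψ π (u π) * prm.eta) ≤ prm.T ∧
        1160 / (M.mu Ψ π (u π) * M.betaGapPert Ψ π (u π) ^ 2) ≤ prm.N ∧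
        1 / (M.mu Ψ π (u π) * M.betaGapPert Ψ π (u π) ^ 2) ≤ prm.N' := by
  have hβ0 := H.rate_bounds.1
  have hμ := H.mubar_pos
  have hη0 := hp.eta_pos
  have hq : (1 : ℝ) ≤ q := by exact_mod_cast hp.q_pos
  have hN := hp.N_ge
  have hN' := hp.N'_ge
  have hT := hp.T_ge
  have hgap : ∀ π, 1 / (2 * Cβ * M.tmix) / 4 ≤ M.betaGapPert Ψ π (u π) := fun π => by
    have h1 := H.betaGap_ge π
    have h2 := H.le_betaGapPert π
    have e : 1 / (2 * Cβ * M.tmix) = 1 / (Cβ * M.tmix) / 2 := by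
      rw [div_div]; congr 1; ring
    rw [e]
    linarith
  set β := 1 / (2 * Cβ * (M.tmix : ℝ)) with hβ
  clear_value β
  have hNpos : 200000000 / (β ^ 2 * mubar) ≤ 200000000 * q / (β ^ 2 * mubar) := by
    gcongr
    linarith
  have p1 : 0 < 200000000 / (β ^ 2 * mubar) := by positivity
  have p2 : 0 < 1600 / (prm.eta * β * mubar) := by positivity
  refine ⟨hη0, ?_, ?_, ?_, fun π => ⟨?_, ?_, ?_, ?_⟩⟩
  · exact_mod_cast Nat.one_le_iff_ne_zero.2 fun h => by rw [h, Nat.cast_zero] at hT; linarith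
  · exact_mod_cast Nat.one_le_iff_ne_zero.2 fun h => by rw [h, Nat.cast_zero] at hN; linarith
  · exact_mod_cast Nat.one_le_iff_ne_zero.2 fun h => by rw [h, Nat.cast_zero] at hN'; linarith
  · linarith [hgap π]
  · have h1 : 64 / (M.mu Ψ π (u π) * M.betaGapPert Ψ π (u π) * prm.eta) ≤
        64 / (mubar * (β / 4) * prm.eta) := by
      have := hgap π
      have := H.mu_ge π
      gcongr
      exact hμ.le.trans this
    refine (h1.trans ?_).trans hT
    have e : 64 / (mubar * (β / 4) * prm.eta) = 256 / (prm.eta * β * mubar) := by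
      field_simp; norm_num
    rw [e]
    gcongr
    norm_num
  all_goals
    have h1 : M.mu Ψ π (u π) * M.betaGapPert Ψ π (u π) ^ 2 ≥ mubar * (β / 4) ^ 2 := by
      have := hgap π
      have := H.mu_ge π
      gcongr
      exact hμ.le.trans this
  · have h2 : 1160 / (M.mu Ψ π (u π) * M.betaGapPert Ψ π (u π) ^ 2) ≤
        1160 / (mubar * (β / 4) ^ 2) := div_le_div_of_nonneg_left (by norm_num) (by positivity) h1
    have e : 1160 / (mubar * (β / 4) ^ 2) = 18560 / (β ^ 2 * mubar) := by
      field_simp; norm_num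
    have h3 : 18560 / (β ^ 2 * mubar) ≤ 200000000 / (β ^ 2 * mubar) := by gcongr; norm_num
    linarith
  · have h2 : 1 / (M.mu Ψ π (u π) * M.betaGapPert Ψ π (u π) ^ 2) ≤
        1 / (mubar * (β / 4) ^ 2) := div_le_div_of_nonneg_left (by norm_num) (by positivity) h1
    have e : 1 / (mubar * (β / 4) ^ 2) = 16 / (β ^ 2 * mubar) := by
      field_simp
      norm_num
    have h3 : 16 / (β ^ 2 * mubar) ≤ 200000000 / (β ^ 2 * mubar) := by gcongr; norm_num
    linarith

/-- Dividing by the smallest weight, at most 1, only enlarges. The family must be shown bounded, as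
the real supremum of an unbounded family would be 0. -/
theorem le_iSup_div_lamD (θ0 : Fin d → ℝ) (n : ℕ) (π : Policy S A) :
    M.thetaStar Ψ π (u π) ⬝ᵥ M.thetaStar Ψ π (u π) + (1 / 2) ^ n * (θ0 ⬝ᵥ θ0) ≤
      ⨆ π' : Policy S A, (M.thetaStar Ψ π' (u π') ⬝ᵥ M.thetaStar Ψ π' (u π') +
        (1 / 2) ^ n * (θ0 ⬝ᵥ θ0)) / M.lamD π' (u π') := by
  have h0 : ∀ π', 0 ≤ M.thetaStar Ψ π' (u π') ⬝ᵥ M.thetaStar Ψ π' (u π') +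
      (1 / 2) ^ n * (θ0 ⬝ᵥ θ0) := fun π' =>
    add_nonneg (dotProduct_self_nonneg_real _)
      (mul_nonneg (by positivity) (dotProduct_self_nonneg_real _))
  have hd := H.dmin_pos
  have hlam : ∀ π', 0 < M.lamD π' (u π') := fun π' => hd.trans_le (H.lamD_ge π')
  have hb : BddAbove (Set.range fun π' : Policy S A =>
      (M.thetaStar Ψ π' (u π') ⬝ᵥ M.thetaStar Ψ π' (u π') +
        (1 / 2) ^ n * (θ0 ⬝ᵥ θ0)) / M.lamD π' (u π')) := by
    refine ⟨((2 * cbar / (1 / (2 * Cβ * M.tmix) * mubar)) ^ 2 +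
      (1 / 2) ^ n * (θ0 ⬝ᵥ θ0)) / dmin, ?_⟩
    rintro _ ⟨π', rfl⟩
    refine div_le_div₀ ?_ ?_ hd (H.lamD_ge π')
    · exact add_nonneg (sq_nonneg _)
        (mul_nonneg (by positivity) (dotProduct_self_nonneg_real _))
    · have h1 := pow_le_pow_left₀ (Real.sqrt_nonneg _) (H.thetaStar_le π') 2
      rw [Real.sq_sqrt (dotProduct_self_nonneg_real _)] at h1
      linarith
  refine le_trans ?_ (le_ciSup hb π)
  rw [le_div_iff₀ (hlam π)]
  exact mul_le_of_le_one_right (h0 π) (H.perturb_nonneg_sum π).1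

/-- The bias of the critic under the choice of the parameters. -/
theorem critic_bias_le_of_good {prm : CriticParams} {κ ε : ℝ} {q j : ℕ}
    (hp : prm.Good (1 / (2 * Cβ * M.tmix)) mubar Γ κ q M.tmix j (Fintype.card (S × A)))
    (θ0 : Fin d → ℝ)
    (hε : (1 / 100) ^ prm.epochs *
        (1 + 2 * (θ0 ⬝ᵥ θ0) + 2 * (2 * cbar / (1 / (2 * Cβ * M.tmix) * mubar)) ^ 2) +
      κ * ((1 + 2 * (θ0 ⬝ᵥ θ0) + 2 * (2 * cbar / (1 / (2 * Cβ * M.tmix) * mubar)) ^ 2) +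
        (6 * (2 * cbar / (1 / (2 * Cβ * M.tmix) * mubar)) + 4 * cbar * (1 + 8 * M.tmix))) ≤
      ε * ω / 4) (π : Policy S A) (x : Traj S A) (v : Fin d → ℝ) (hv : v ⬝ᵥ v ≤ 2 ^ 2) :
    pmfE (M.critic Ψ (u π) prm θ0 π x) (fun y => v ⬝ᵥ (y.1 - M.thetaStar Ψ π (u π))) ≤
      2 * (ε * ω / 4) := by
  have h1 := H.thetaStar_le π
  have h2 := H.epsApprox_le
  have h3 := pow_le_pow_left₀ (Real.sqrt_nonneg _) h1 2
  rw [Real.sq_sqrt (dotProduct_self_nonneg_real _)] at h3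
  have h4 := dotProduct_self_nonneg_real θ0
  have h5 := dotProduct_self_nonneg_real (M.thetaStar Ψ π (u π))
  refine (H.critic_bias_le hp θ0 π x hv (W := 1 + 2 * (θ0 ⬝ᵥ θ0) +
    2 * (2 * cbar / (1 / (2 * Cβ * M.tmix) * mubar)) ^ 2)
    (G := 6 * (2 * cbar / (1 / (2 * Cβ * M.tmix) * mubar)) + 4 * cbar * (1 + 8 * M.tmix))
    ?_ ?_).trans ?_
  · refine (Real.sqrt_le_iff.2 ⟨by positivity, ?_⟩ : _ ≤ 1 + 2 * (θ0 ⬝ᵥ θ0) +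
      2 * (M.thetaStar Ψ π (u π) ⬝ᵥ M.thetaStar Ψ π (u π))).trans (by linarith)
    nlinarith
  · linarith
  · linarith

end Setting

end AMDP

end

theorem corollary3 :
    -- `Cβ`: the constant in the convention `1/(1-β) = O(t_mix)`; `C`, `p`: constants of the bounds
    ∀ Cβ : ℝ, 0 < Cβ → ∃ (C : ℝ) (p : ℕ), 0 < C ∧
    ∀ (S A : Type) [Fintype S] [DecidableEq S] [Fintype A] [DecidableEq A] [Nonempty A]
      (d : ℕ) (M : AMDP S A) (Ψ : Matrix (S × A) (Fin d) ℝ) (u : Policy S A → ℝ)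
      (ω Γ cbar mubar dmin ε : ℝ) (πs : Policy S A) (θ0 : Fin d → ℝ) (z0 : S × A),
    2 ≤ Fintype.card S → 1 ≤ d → M.Ergodic →
    0 < ω → (∀ s, IsKLStronglyConvex ω (M.h s)) →
    (∀ (π : Policy S A) (z : S × A), |M.cost π z| ≤ cbar) →
    0 < Γ → Γ < 1 → (∀ (π : Policy S A) (s : S), 1 - Γ ≤ M.stat π s) →
    (∀ z : S × A, Ψ z ⬝ᵥ Ψ z ≤ 1) →
    (∀ π : Policy S A, 1 ≤ Cβ * M.tmix * M.betaGap Ψ π) →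
    (∀ π : Policy S A, M.GoodLevel Ψ π (u π)) →
    0 < mubar → (∀ π : Policy S A, mubar ≤ M.mu Ψ π (u π)) →
    0 < dmin → (∀ π : Policy S A, dmin ≤ M.lamD π (u π)) →
    0 < ε → M.IsOptimal πs →
    ∃ prm : CriticParams,
      -- the parameter selection of the critic
      (0 < prm.eta ∧ 1 ≤ prm.T ∧ 1 ≤ prm.N ∧ 1 ≤ prm.N' ∧
        ∀ π : Policy S A,
          prm.eta ≤ M.betaGapPert Ψ π (u π) / 845 ∧
          64 / (M.mu Ψ π (u π) * M.betaGapPert Ψ π (u π) * prm.eta) ≤ prm.T ∧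
          1160 / (M.mu Ψ π (u π) * M.betaGapPert Ψ π (u π) ^ 2) ≤ prm.N ∧
          1 / (M.mu Ψ π (u π) * M.betaGapPert Ψ π (u π) ^ 2) ≤ prm.N') ∧
      (M.tmix * Real.log (1 / ε) ≤ prm.tau ∧ M.tmix * Real.log (1 / ε) ≤ prm.tau' ∧
        Real.log (1 / ε) ≤ prm.epochs ∧
        (prm.epochs : ℝ) ≤
          C * Real.log (problemSize ε ω Γ cbar M.tmix mubar dmin (θ0 ⬝ᵥ θ0)) ^ p) ∧
      -- the bound on the variance of the critic
      (∀ (π : Policy S A) (x : Traj S A),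
        M.criticError Ψ (u π) prm θ0 π x ≤ 2 * M.epsApprox Ψ u ^ 2 +
          C * ⨆ π' : Policy S A,
            (M.thetaStar Ψ π' (u π') ⬝ᵥ M.thetaStar Ψ π' (u π') +
              (1 / 2) ^ prm.epochs * (θ0 ⬝ᵥ θ0)) / M.lamD π' (u π')) ∧
      -- the number of iterations, the number of samples and the accuracy
      ∀ σ : ℝ, 0 < σ → ∃ K₀ : ℕ, 2 ≤ K₀ ∧
        (K₀ + 1 : ℝ) ≤ C * ((1 + σ ^ 2 / (ω ^ 2 * ε)) / (1 - Γ)) *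
          Real.log (problemSize ε ω Γ cbar M.tmix mubar dmin (θ0 ⬝ᵥ θ0) + σ + 1 / σ) ^ p ∧
        (∀ y ∈ (M.spmd Ψ u prm θ0 (M.stepsize Γ ω σ πs K₀) z0 (K₀ + 1)).support,
          (y.2.2 : ℝ) ≤ C * ((1 + σ ^ 2 / (ω ^ 2 * ε)) * M.tmix ^ 3 / ((1 - Γ) * mubar)) *
            Real.log (problemSize ε ω Γ cbar M.tmix mubar dmin (θ0 ⬝ᵥ θ0) + σ + 1 / σ) ^ p) ∧
        ∀ K : ℕ, K₀ ≤ K →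
          (∀ k ≤ K, ∀ y ∈ (M.spmd Ψ u prm θ0 (M.stepsize Γ ω σ πs K) z0 k).support,
            M.criticError Ψ (u y.1) prm θ0 y.1 y.2 ≤ σ ^ 2) →
          pmfE (M.spmd Ψ u prm θ0 (M.stepsize Γ ω σ πs K) z0 (K + 1))
            (fun y => M.dist y.1 πs) ≤ C * (M.epsApprox Ψ u / (ω * Γ)) + ε := by
  intro Cβ hC
  obtain ⟨C₁, hC₁, hpar⟩ := exists_criticParams hC
  -- 2002 comes from the number of iterations, 112 from the critic's error, C₁ from the number of
  -- epochs and 2002 C₁ from the samples. The exponent 5 is 2 for the iterations plus 3 for the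
  -- samples of one critic call.
  refine ⟨2114 + 2002 * C₁ + C₁, 5, by positivity, ?_⟩
  intro S A _ _ _ _ _ d M Ψ u ω Γ cbar mubar dmin ε πs θ0 z0 hS hd hM hω hconv hcost hΓ0 hΓ1 hν hΨ
    hgap hlev hμ hmu hδ hlam hε hopt
  have hne : Nonempty S := Fintype.card_pos_iff.1 (by omega)
  have H : M.Setting Ψ u Cβ ω Γ cbar mubar dmin := ⟨hC, hS, hd, hM, hω, hconv, hcost, hΓ0, hΓ1, hν,
    hΨ, hgap, hlev, hμ, hmu, hδ, hlam⟩
  have hc := H.cbar_nonneg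
  have hn0 := dotProduct_self_nonneg_real θ0
  have ht := H.tmix_ge
  have hcard := (H.perturb_nonneg_sum πs).2
  obtain ⟨prm, κ, q, j, hgood, heta, htau, htau', hep, hep', hsamples, hbias⟩ :=
    hpar ε ω Γ cbar mubar dmin (θ0 ⬝ᵥ θ0) M.tmix (Fintype.card (S × A)) hε hω hΓ1 hc hμ
      H.mubar_le_one hδ hn0 (Nat.one_le_iff_ne_zero.2 H.tmix_ne) H.Cβ_tmix hcard
  obtain ⟨x3, xε, xω', xω, xc, xΓ, -, -, xd, -⟩ :=
    le_problemSize hε hω hΓ1 hc (by linarith : (0 : ℝ) ≤ M.tmix) hμ hδ hn0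
  set x := problemSize ε ω Γ cbar M.tmix mubar dmin (θ0 ⬝ᵥ θ0) with hx
  have hL1 := one_le_log x3
  have hlogε : Real.log (1 / ε) ≤ Real.log x := Real.log_le_log (by positivity) xε
  have htlog : M.tmix * Real.log (1 / ε) ≤ M.tmix * Real.log x :=
    mul_le_mul_of_nonneg_left hlogε (by linarith)
  refine ⟨prm, H.params_requirements hgood heta, ⟨htlog.trans htau, htlog.trans htau',
    hlogε.trans hep, hep'.trans ?_⟩, fun π y => ?_, fun σ hσ => ?_⟩
  · exact mul_le_mul (by linarith) (le_self_pow₀ hL1 (by norm_num)) (by linarith) (by positivity)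
  · have h1 := H.le_iSup_div_lamD θ0 prm.epochs π
    have h2 : 0 ≤ M.thetaStar Ψ π (u π) ⬝ᵥ M.thetaStar Ψ π (u π) +
        (1 / 2) ^ prm.epochs * (θ0 ⬝ᵥ θ0) := add_nonneg (dotProduct_self_nonneg_real _)
          (mul_nonneg (by positivity) hn0)
    refine (H.criticError_le hgood θ0 π y).trans (add_le_add le_rfl ?_)
    exact mul_le_mul (by linarith) h1 h2 (by positivity)
  obtain ⟨K₀, hK3, hK₀, hK⟩ := exists_iterations x3 hσ hω hε hΓ0.le hΓ1 xε xω xΓ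
  have hσ' : 0 < 1 / σ := by positivity
  set L := Real.log (x + σ + 1 / σ) with hL
  set R := 1 + σ ^ 2 / (ω ^ 2 * ε) with hR
  have hR0 : 0 < R := by positivity
  have hxL : Real.log x ≤ L := Real.log_le_log (by linarith) (by linarith)
  have hL1' : 1 ≤ L := hL1.trans hxL
  have hΓ : 0 < 1 - Γ := by linarith
  refine ⟨K₀, by omega, hK₀.trans ?_, fun y hy => ?_, fun K hKK herr => ?_⟩
  · have h1 : L ^ 2 ≤ L ^ 5 := pow_le_pow_right₀ hL1' (by norm_num)
    have h2 : 0 ≤ R / (1 - Γ) := by positivity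
    gcongr
    linarith
  · rw [M.spmd_count Ψ hy]
    have h1 : ((prm.epochs * prm.epochCost : ℕ) : ℝ) ≤ C₁ * (M.tmix ^ 3 / mubar) * L ^ 3 := by
      rw [Nat.cast_mul]
      refine hsamples.trans ?_
      gcongr
    rw [Nat.cast_mul]
    push_cast at h1 ⊢
    calc ((K₀ : ℝ) + 1) * (prm.epochs * prm.epochCost)
        ≤ (2002 * (R / (1 - Γ)) * L ^ 2) * (C₁ * (M.tmix ^ 3 / mubar) * L ^ 3) :=
          mul_le_mul hK₀ h1 (by positivity) (by positivity)
      _ = 2002 * C₁ * (R * M.tmix ^ 3 / ((1 - Γ) * mubar)) * L ^ 5 := by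
          field_simp
      _ ≤ _ := by
          gcongr
          linarith
  · obtain ⟨hK1, hK2⟩ := hK K hKK
    have hD : M.dist (uniformPolicy S A) πs ≤ x := by
      refine (M.dist_uniform_le πs).trans (le_trans ?_ xd)
      rw [le_div_iff₀ hδ]
      exact hcard
    have hr : M.rho (uniformPolicy S A) - M.rho πs ≤ 2 * cbar := by
      have h1 := abs_le.1 (H.abs_rho_le (uniformPolicy S A))
      have h2 := abs_le.1 (H.abs_rho_le πs)
      linarith [h1.2, h2.1]
    obtain ⟨hl0, hl1, hl2⟩ := stepsize_bounds x3 hσ hω hε H.half_le hΓ1 xε xω' xω xc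
      (M.dist_nonneg AMDP.uniformPolicy_positive πs) hD (sub_nonneg.2 (hopt _)) hr
      (hK3.trans hKK) hK1 hK2 (l := M.stepsize Γ ω σ πs K) rfl
    -- The bias level εω/4 contributes 2(εω/4)/ω = ε/2, which with the two bounds ε/4 makes up ε.
    have hmain := H.expected_dist_le hl0 (min_le_left _ _) (by positivity : 0 ≤ ε * ω / 4) hopt
      (fun π y => (H.critic_dom hgood θ0 π y).fin) (H.critic_bias_le_of_good hgood θ0 hbias)
      herr
    refine hmain.trans ?_
    have e1 : (Γ / (1 - Γ) * M.stepsize Γ ω σ πs K * σ ^ 2 +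
        2 * (M.epsApprox Ψ u + ε * ω / 4)) / ω =
        Γ / (1 - Γ) * M.stepsize Γ ω σ πs K * σ ^ 2 / ω + 2 * (M.epsApprox Ψ u / ω) + ε / 2 := by
      field_simp
      ring
    have h3 : M.epsApprox Ψ u / ω ≤ M.epsApprox Ψ u / (ω * Γ) :=
      div_le_div_of_nonneg_left H.epsApprox_nonneg (by positivity)
        (mul_le_of_le_one_right hω.le hΓ1.le)
    have h4 : 0 ≤ M.epsApprox Ψ u / (ω * Γ) := div_nonneg H.epsApprox_nonneg (by positivity)
    have h5 : 2 * (M.epsApprox Ψ u / ω) ≤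
        (2114 + 2002 * C₁ + C₁) * (M.epsApprox Ψ u / (ω * Γ)) :=
      mul_le_mul (by linarith) h3 (div_nonneg H.epsApprox_nonneg hω.le) (by positivity)
    rw [e1]
    have h6 : AMDP.Setting.potential M Γ ω (M.stepsize Γ ω σ πs K) πs (uniformPolicy S A) /
        (1 + M.stepsize Γ ω σ πs K * ω) ^ K ≤ ε / 4 := hl2
    linarith
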